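/- **Setting.** Let the horizon topology be $\mathcal B=L(p,q)$ with $0\le q<p$, $\gcd(p,q)=1$ (so $L(1,0)=S^3$), and put $s=0$; or $\mathcal B=S^1\times S^2$, and put $s=1,\ p=1,\ q=0$. Let $\Lambda\ge 0$, $A>0$, and let $\xi=f(\cos\theta)$ with $f$ a positive smooth function on $[-1,1]$. Let $Z=\begin{pmatrix}1&q\\0&p\end{pmatrix}$, $h_1=\tfrac12\log\sin\theta$, $h_2=\log\tan\tfrac\theta2$. For functions $\zeta=(\zeta^1,\zeta^2),\ \chi,\ \psi=(\psi^1,\psi^2)$ let $$\Upsilon=d\chi+\tfrac1{\sqrt3}(\psi^1d\psi^2-\psi^2d\psi^1),\qquad \Theta^i=d\zeta^i+\psi^i\Big(d\chi+\tfrac1{3\sqrt3}(\psi^1d\psi^2-\psi^2d\psi^1)\Big),$$ and $\bar\Theta=Z^T\Theta,\ \bar\psi=Z^T\psi,\ \bar\zeta=Z^T\zeta$. The symmetric space $G_{2(2)}/SO(4)$ is $\mathbb R^8$ with coordinates $(u,v,w,\zeta^1,\zeta^2,\chi,\psi^1,\psi^2)$ and the Riemannian metric $$\begin{aligned}G={}&12du^2+\cosh^2\!w\,dv^2+dw^2+p^2\frac{e^{-6u-v}}{\cosh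 w}(\bar\Theta^1)^2+p^2e^{-6u+v}\cosh w\,(e^{-v}\tanh w\,\bar\Theta^1-\bar\Theta^2)^2\\&+\frac{e^{-2u-v}}{\cosh w}(d\bar\psi^1)^2+e^{-2u+v}\cosh w\,(e^{-v}\tanh w\,d\bar\psi^1-d\bar\psi^2)^2+p^2e^{-4u}\Upsilon^2,\end{aligned}$$ with Riemannian distance $\operatorname{dist}$. On $S^3$ use Hopf coordinates $(\theta,\phi^1,\phi^2)\in(0,\pi)\times(0,2\pi)^2$ with $d\mathcal V=\frac{\sin\theta}{4}d\theta\,d\phi^1d\phi^2$; let $\Gamma$ be the union of the circles $\theta=0,\pi$. To $\Psi=(U,V,W,\zeta^1,\zeta^2,\chi,\psi^1,\psi^2)$, a function of $\theta\in(0,\pi)$, associate $\tilde\Psi=(U+h_1,V+h_2,W,\zeta^1,\zeta^2,\chi,\psi^1,\psi^2)$ and $V_s=V+2sh_1+sh_2$. With $\kappa=3p^2\Lambda\big(\tfrac{A}{2\sqrt2\pi^2}\big)^2$ and a subscript $\theta$ denoting the $\partial_\theta$-component, the renormalized area functional is $$\begin{aligned}\mathcal I_{\mathcal B}(\Psi)={}&\frac14\int_0^\pi\xi\Big\{12(\partial_\theta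 U)^2+(\partial_\theta V_s)^2+(\partial_\theta W)^2+\sinh^2\!W(\partial_\theta V+\partial_\theta h_2)^2\\ &+p^2\tfrac{e^{-6h_1-h_2-6U-V}}{\cosh W}(\bar\Theta^1_\theta)^2+p^2e^{-6h_1+h_2-6U+V}\cosh W\,(e^{-h_2-V}\tanh W\,\bar\Theta^1_\theta-\bar\Theta^2_\theta)^2\\ &+\tfrac{e^{-2h_1-h_2-2U-V}}{\cosh W}(\partial_\theta\bar\psi^1)^2+e^{-2h_1+h_2-2U+V}\cosh W\,(e^{-h_2-V}\tanh W\,\partial_\theta\bar\psi^1-\partial_\theta\bar\psi^2)^2\\ &+p^2e^{-4h_1-4U}\Upsilon_\theta^2+\kappa e^{-4U}-\xi^{-1}\big[2V_s\,\partial_\theta([1-2s\cos^2\tfrac\theta2]\xi)+12U\,\partial_\theta(\xi\cos\theta)\big]\partial_\theta h_2\Big\}\sin\theta\,d\theta .\end{aligned}$$ The quasi-harmonic energy of a map $\Phi=(u,v,w,\dots):(0,\pi)\to G_{2(2)}/SO(4)$ on $\Omega=\{a<\theta<b\}$ is $E_\Omega(\Phi)=\frac1{\pi^2}\int_\Omega\xi\{G(\partial_\theta\Phi,\partial_\theta\Phi)+\kappa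 e^{-4u}\sin^2\theta\}\,d\mathcal V$; $\Phi$ is *quasi-harmonic* if $\frac{d}{dt}\big|_{t=0}E_\Omega(\Phi+t\eta)=0$ for all $0<a<b<\pi$ and all smooth $\eta$ with compact support in $(a,b)$. **Asymptotics.** All $O(\cdot)$ are for $\theta\to0$ and $\theta\to\pi$. Consider: (i) $U,\bar\zeta^1,\bar\zeta^2,\chi=O(1)$, $W=O(\sin\theta)$, $\partial_\theta W=O(1)$, $\partial_\theta U,\partial_\theta\chi=O(\sin\theta)$; if $s=0$: $V=O(1)$, $\partial_\theta V=O(\sin\theta)$; if $s=1$: $V=-2\log\sin\frac\theta2+O(1)$, $\partial_\theta V=-\cot\frac\theta2+O(\sin\theta)$, $\bar\psi^i=O(1)$, $\partial_\theta\bar\psi^i,\partial_\theta\bar\zeta^i=O(\sin\theta)$, $\bar\Theta^2_\theta=O(\sin^2\theta)$. (ii) if $s=0$: $\bar\psi^1=O(\sqrt{\sin\frac\theta2})$, $\bar\psi^2=O(\sqrt{\cos\frac\theta2})$, $\partial_\theta\bar\psi^i=O(\sqrt{\sin\theta})$, $\partial_\theta\bar\zeta^1=O(\sqrt{\sin\frac\theta2}\,\sin\theta)$,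 $\partial_\theta\bar\zeta^2=O(\sqrt{\cos\frac\theta2}\,\sin\theta)$. (ii$_0$) if $s=0$: $\bar\psi^1=O(\sin^2\frac\theta2)$, $\bar\psi^2=O(\cos^2\frac\theta2)$, $\partial_\theta\bar\psi^i=O(\sin\theta)$, $\partial_\theta\bar\zeta^1=O(\sin^2\frac\theta2\,\sin\theta)$, $\partial_\theta\bar\zeta^2=O(\cos^2\frac\theta2\,\sin\theta)$. A *renormalized quasi-harmonic map* is a smooth $\Psi_0$ on $(0,\pi)$ satisfying (i) and (ii$_0$) such that $\tilde\Psi_0$ is quasi-harmonic. **Theorem.** For given $\mathcal B,\Lambda,A,\xi$ there is a constant $C>0$ such that the following holds. Let $\Psi_0$ be a renormalized quasi-harmonic map, and let $\Psi$ be smooth on $(0,\pi)$ and satisfy (i) and (ii), with $\chi|_\Gamma=\chi_0|_\Gamma$, $\zeta^i|_\Gamma=\zeta^i_0|_\Gamma$, $\psi^i|_\Gamma=\psi^i_0|_\Gamma$ for $i=1,2$ (the differences tend to $0$ as $\theta\to0,\pi$). Then the integrals defining $\mathcal I_{\mathcal B}(\Psi)$ and $\mathcal I_{\mathcal B}(\Psi_0)$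 converge absolutely, $\operatorname{dist}(\tilde\Psi,\tilde\Psi_0)$ is square integrable on $S^3$, and $$\mathcal I_{\mathcal B}(\Psi)-\mathcal I_{\mathcal B}(\Psi_0)\ \ge\ C\int_{S^3}\big(\operatorname{dist}(\tilde\Psi,\tilde\Psi_0)-D\big)^2\,d\mathcal V,$$ where $D$ is the average of $\operatorname{dist}(\tilde\Psi,\tilde\Psi_0)$ over $S^3$. In particular $\mathcal I_{\mathcal B}(\Psi)\ge\mathcal I_{\mathcal B}(\Psi_0)$. -/

import Mathlib

open Filter Topology Asymptotics MeasureTheory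
open scoped ContDiff

namespace MinSugra

noncomputable section

/-- Horizon topologies: `lens p q` is the lens space `L(p,q)`, with `lens 1 0` the sphere `S³`,
and `ring` is `S¹ × S²`. -/
inductive Horizon where
  | lens (p q : ℕ) : Horizon
  | ring : Horizon

/-- The integer `p` of the topology (`1` for the ring). -/
def Horizon.p : Horizon → ℝ
  | .lens p _ => p
  | .ring => 1

/-- The integer `q` of the topology (`0` for the ring). -/
def Horizon.q : Horizon → ℝ
  | .lens _ q => q
  | .ring => 0

/-- The switch `s`: `0` for the sphere and the lens spaces, `1` for the ring. -/
def Horizon.s : Horizon → ℕ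
  | .lens _ _ => 0
  | .ring => 1

/-- `0 ≤ q < p` and `gcd (p,q) = 1`; thus `p = 1` forces `q = 0`, which is the sphere, and
`p ≥ 2` forces `1 ≤ q ≤ p - 1`. -/
def Horizon.Admissible : Horizon → Prop
  | .lens p q => q < p ∧ Nat.Coprime p q
  | .ring => True

/-- Points (and tangent vectors) of the target `G₂₍₂₎/SO(4) ≅ ℝ⁸`, with coordinates
`(u, v, w, ζ¹, ζ², χ, ψ¹, ψ²)` numbered `0, …, 7`. -/
abbrev Target : Type := Fin 8 → ℝ

/-! ### One-forms on the target: `X` is the base point, `Y` the tangent vector.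
Bars denote the action of `Zᵀ`, where `Z` is the matrix with rows `(1, q)` and `(0, p)`. -/

/-- `Υ = dχ + (ψ¹ dψ² - ψ² dψ¹) / √3`. -/
def Upsilon (X Y : Target) : ℝ := Y 5 + (X 6 * Y 7 - X 7 * Y 6) / √3

/-- `dχ + (ψ¹ dψ² - ψ² dψ¹) / (3√3)`. -/
def auxForm (X Y : Target) : ℝ := Y 5 + (X 6 * Y 7 - X 7 * Y 6) / (3 * √3)

/-- `Θ¹ = dζ¹ + ψ¹ (dχ + (ψ¹ dψ² - ψ² dψ¹) / (3√3))`. -/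
def Theta1 (X Y : Target) : ℝ := Y 3 + X 6 * auxForm X Y

/-- `Θ² = dζ² + ψ² (dχ + (ψ¹ dψ² - ψ² dψ¹) / (3√3))`. -/
def Theta2 (X Y : Target) : ℝ := Y 4 + X 7 * auxForm X Y

/-- First component of `Θ̄ = Zᵀ Θ`. -/
def ThetaBar1 (X Y : Target) : ℝ := Theta1 X Y

/-- Second component of `Θ̄ = Zᵀ Θ`. -/
def ThetaBar2 (B : Horizon) (X Y : Target) : ℝ := B.q * Theta1 X Y + B.p * Theta2 X Y

/-- First component of `ζ̄ = Zᵀ ζ`. -/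
def zetaBar1 (X : Target) : ℝ := X 3

/-- Second component of `ζ̄ = Zᵀ ζ`. -/
def zetaBar2 (B : Horizon) (X : Target) : ℝ := B.q * X 3 + B.p * X 4

/-- First component of `ψ̄ = Zᵀ ψ`; being linear, it also gives `dψ̄¹` on tangent vectors. -/
def psiBar1 (X : Target) : ℝ := X 6

/-- Second component of `ψ̄ = Zᵀ ψ`; being linear, it also gives `dψ̄²` on tangent vectors. -/
def psiBar2 (B : Horizon) (X : Target) : ℝ := B.q * X 6 + B.p * X 7

/-! ### The symmetric space `G₂₍₂₎/SO(4)` -/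

/-- The metric of `G₂₍₂₎/SO(4)` at `X`, evaluated on the pair `(Y, Y)`. -/
def G (B : Horizon) (X Y : Target) : ℝ :=
  12 * Y 0 ^ 2 + Real.cosh (X 2) ^ 2 * Y 1 ^ 2 + Y 2 ^ 2
  + B.p ^ 2 * (Real.exp (-6 * X 0 - X 1) / Real.cosh (X 2)) * ThetaBar1 X Y ^ 2
  + B.p ^ 2 * (Real.exp (-6 * X 0 + X 1) * Real.cosh (X 2)) *
      (Real.exp (-X 1) * Real.tanh (X 2) * ThetaBar1 X Y - ThetaBar2 B X Y) ^ 2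
  + Real.exp (-2 * X 0 - X 1) / Real.cosh (X 2) * psiBar1 Y ^ 2
  + Real.exp (-2 * X 0 + X 1) * Real.cosh (X 2) *
      (Real.exp (-X 1) * Real.tanh (X 2) * psiBar1 Y - psiBar2 B Y) ^ 2
  + B.p ^ 2 * Real.exp (-4 * X 0) * Upsilon X Y ^ 2

/-- Length of the curve `γ` on `[0,1]`. -/
def curveLength (B : Horizon) (γ : ℝ → Target) : ℝ :=
  ∫ t in (0 : ℝ)..1, √(G B (γ t) (deriv γ t))

/-- Riemannian distance of `G₂₍₂₎/SO(4)`: the infimum of the lengths of `C¹` curves. -/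
def targetDist (B : Horizon) (X Y : Target) : ℝ :=
  sInf {l : ℝ | ∃ γ : ℝ → Target, ContDiff ℝ 1 γ ∧ γ 0 = X ∧ γ 1 = Y ∧ l = curveLength B γ}

/-! ### The three-sphere in Hopf coordinates `(θ, φ¹, φ²)` -/

/-- The volume `(sin θ / 4) dθ dφ¹ dφ²` of the round `S³` (the omitted circles and the
omitted meridians have measure zero). -/
def volS3 : Measure (ℝ × ℝ × ℝ) :=
  (volume.restrict (Set.Ioo 0 Real.pi ×ˢ Set.Ioo 0 (2 * Real.pi) ×ˢ Set.Ioo 0 (2 * Real.pi))).withDensity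
    (fun x => ENNReal.ofReal (Real.sin x.1 / 4))

/-- `h₁ = (1/2) log sin θ`. -/
def h1 (θ : ℝ) : ℝ := Real.log (Real.sin θ) / 2

/-- `h₂ = log tan (θ/2)`. -/
def h2 (θ : ℝ) : ℝ := Real.log (Real.tan (θ / 2))

/-- Passage from `Ψ = (U, V, W, ζ, χ, ψ)` to the singular map `Ψ̃ = (u, v, w, ζ, χ, ψ)` with
`u = U + h₁`, `v = V + h₂` and `w = W`. -/
def tilde (Ψ : ℝ → Target) (θ : ℝ) : Target := Ψ θ + ![h1 θ, h2 θ, 0, 0, 0, 0, 0, 0]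

/-- `V_s = V + 2 s h₁ + s h₂`. -/
def Vs (B : Horizon) (Ψ : ℝ → Target) (θ : ℝ) : ℝ :=
  Ψ θ 1 + 2 * (B.s : ℝ) * h1 θ + (B.s : ℝ) * h2 θ

/-- `3 p² Λ (A / (2√2 π²))²`. -/
def lambdaCoeff (B : Horizon) (Λ A : ℝ) : ℝ :=
  3 * B.p ^ 2 * Λ * (A / (2 * √2 * Real.pi ^ 2)) ^ 2

/-! ### The renormalized area functional and the quasi-harmonic energy.
The weight `ξ` is a function of `θ`. -/

/-- Integrand of the renormalized area functional. -/
def areaIntegrand (B : Horizon) (Λ A : ℝ) (ξ : ℝ → ℝ) (Ψ : ℝ → Target) (θ : ℝ) : ℝ :=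
  let U : ℝ := Ψ θ 0
  let V : ℝ := Ψ θ 1
  let W : ℝ := Ψ θ 2
  let dΨ : Target := deriv Ψ θ
  ξ θ * (12 * dΨ 0 ^ 2 + deriv (Vs B Ψ) θ ^ 2 + dΨ 2 ^ 2
    + Real.sinh W ^ 2 * (dΨ 1 + deriv h2 θ) ^ 2
    + B.p ^ 2 * (Real.exp (-6 * h1 θ - h2 θ - 6 * U - V) / Real.cosh W) *
        ThetaBar1 (Ψ θ) dΨ ^ 2
    + B.p ^ 2 * (Real.exp (-6 * h1 θ + h2 θ - 6 * U + V) * Real.cosh W) *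
        (Real.exp (-h2 θ - V) * Real.tanh W * ThetaBar1 (Ψ θ) dΨ - ThetaBar2 B (Ψ θ) dΨ) ^ 2
    + Real.exp (-2 * h1 θ - h2 θ - 2 * U - V) / Real.cosh W * psiBar1 dΨ ^ 2
    + Real.exp (-2 * h1 θ + h2 θ - 2 * U + V) * Real.cosh W *
        (Real.exp (-h2 θ - V) * Real.tanh W * psiBar1 dΨ - psiBar2 B dΨ) ^ 2
    + B.p ^ 2 * Real.exp (-4 * h1 θ - 4 * U) * Upsilon (Ψ θ) dΨ ^ 2
    + lambdaCoeff B Λ A * Real.exp (-4 * U)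
    - (ξ θ)⁻¹ *
        (2 * Vs B Ψ θ * deriv (fun τ => (1 - 2 * (B.s : ℝ) * Real.cos (τ / 2) ^ 2) * ξ τ) θ
          + 12 * U * deriv (fun τ => Real.cos τ * ξ τ) θ) * deriv h2 θ) * Real.sin θ

/-- The renormalized area functional `I_B`. -/
def areaFunctional (B : Horizon) (Λ A : ℝ) (ξ : ℝ → ℝ) (Ψ : ℝ → Target) : ℝ :=
  1 / 4 * ∫ θ in (0 : ℝ)..Real.pi, areaIntegrand B Λ A ξ Ψ θ

/-- The quasi-harmonic energy `E_Ω` of a map `Φ` from the domain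
`Ω = {a < θ < b} ⊆ S³` into the target. -/
def quasiEnergy (B : Horizon) (Λ A : ℝ) (ξ : ℝ → ℝ) (a b : ℝ) (Φ : ℝ → Target) : ℝ :=
  1 / Real.pi ^ 2 * ∫ x in {x : ℝ × ℝ × ℝ | x.1 ∈ Set.Ioo a b},
    ξ x.1 * (G B (Φ x.1) (deriv Φ x.1)
      + lambdaCoeff B Λ A * Real.exp (-4 * Φ x.1 0) * Real.sin x.1 ^ 2) ∂volS3

/-- `Φ` is quasi-harmonic on `0 < θ < π`: it is a critical point of the quasi-harmonic energy
with respect to smooth variations supported away from the poles. -/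
def IsQuasiHarmonic (B : Horizon) (Λ A : ℝ) (ξ : ℝ → ℝ) (Φ : ℝ → Target) : Prop :=
  ∀ a b : ℝ, 0 < a → a < b → b < Real.pi →
    ∀ η : ℝ → Target, ContDiff ℝ ∞ η → HasCompactSupport η → tsupport η ⊆ Set.Ioo a b →
      HasDerivAt (fun t : ℝ => quasiEnergy B Λ A ξ a b (fun θ => Φ θ + t • η θ)) 0 0

/-! ### Asymptotics at the poles -/

/-- The filter `θ → 0⁺` or `θ → π⁻`. -/
def poles : Filter ℝ := 𝓝[>] (0 : ℝ) ⊔ 𝓝[<] Real.pi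

/-- The asymptotics common to the given map and to the model map. -/
structure CommonAsymptotics (B : Horizon) (Ψ : ℝ → Target) : Prop where
  U_bdd : (fun θ => Ψ θ 0) =O[poles] (fun _ => (1 : ℝ))
  zeta1_bdd : (fun θ => zetaBar1 (Ψ θ)) =O[poles] (fun _ => (1 : ℝ))
  zeta2_bdd : (fun θ => zetaBar2 B (Ψ θ)) =O[poles] (fun _ => (1 : ℝ))
  chi_bdd : (fun θ => Ψ θ 5) =O[poles] (fun _ => (1 : ℝ))
  W_asymp : (fun θ => Ψ θ 2) =O[poles] Real.sin
  dU_asymp : (fun θ => deriv Ψ θ 0) =O[poles] Real.sin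
  dchi_asymp : (fun θ => deriv Ψ θ 5) =O[poles] Real.sin
  dW_bdd : (fun θ => deriv Ψ θ 2) =O[poles] (fun _ => (1 : ℝ))
  V_bdd : B.s = 0 → (fun θ => Ψ θ 1) =O[poles] (fun _ => (1 : ℝ))
  V_ring : B.s = 1 →
    (fun θ => Ψ θ 1 + 2 * Real.log (Real.sin (θ / 2))) =O[poles] (fun _ => (1 : ℝ))
  dV_asymp : B.s = 0 → (fun θ => deriv Ψ θ 1) =O[poles] Real.sin
  dV_ring : B.s = 1 → (fun θ => deriv Ψ θ 1 + Real.cot (θ / 2)) =O[poles] Real.sin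
  psi1_ring : B.s = 1 → (fun θ => psiBar1 (Ψ θ)) =O[poles] (fun _ => (1 : ℝ))
  psi2_ring : B.s = 1 → (fun θ => psiBar2 B (Ψ θ)) =O[poles] (fun _ => (1 : ℝ))
  dpsi1_ring : B.s = 1 → (fun θ => psiBar1 (deriv Ψ θ)) =O[poles] Real.sin
  dpsi2_ring : B.s = 1 → (fun θ => psiBar2 B (deriv Ψ θ)) =O[poles] Real.sin
  dzeta1_ring : B.s = 1 → (fun θ => zetaBar1 (deriv Ψ θ)) =O[poles] Real.sin
  dzeta2_ring : B.s = 1 → (fun θ => zetaBar2 B (deriv Ψ θ)) =O[poles] Real.sin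
  Theta2_ring : B.s = 1 →
    (fun θ => ThetaBar2 B (Ψ θ) (deriv Ψ θ)) =O[poles] (fun θ => Real.sin θ ^ 2)

/-- The asymptotics required of the given map `Ψ`. -/
structure MapAsymptotics (B : Horizon) (Ψ : ℝ → Target) : Prop
    extends CommonAsymptotics B Ψ where
  psi1_asymp : B.s = 0 → (fun θ => psiBar1 (Ψ θ)) =O[poles] (fun θ => √(Real.sin (θ / 2)))
  psi2_asymp : B.s = 0 → (fun θ => psiBar2 B (Ψ θ)) =O[poles] (fun θ => √(Real.cos (θ / 2)))
  dpsi1_asymp : B.s = 0 → (fun θ => psiBar1 (deriv Ψ θ)) =O[poles] (fun θ => √(Real.sin θ))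
  dpsi2_asymp : B.s = 0 → (fun θ => psiBar2 B (deriv Ψ θ)) =O[poles] (fun θ => √(Real.sin θ))
  dzeta1_asymp : B.s = 0 →
    (fun θ => zetaBar1 (deriv Ψ θ)) =O[poles] (fun θ => √(Real.sin (θ / 2)) * Real.sin θ)
  dzeta2_asymp : B.s = 0 →
    (fun θ => zetaBar2 B (deriv Ψ θ)) =O[poles] (fun θ => √(Real.cos (θ / 2)) * Real.sin θ)

/-- The asymptotics of the model map `Ψ₀`. -/
structure ModelAsymptotics (B : Horizon) (Ψ : ℝ → Target) : Prop
    extends CommonAsymptotics B Ψ where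
  psi1_asymp : B.s = 0 → (fun θ => psiBar1 (Ψ θ)) =O[poles] (fun θ => Real.sin (θ / 2) ^ 2)
  psi2_asymp : B.s = 0 → (fun θ => psiBar2 B (Ψ θ)) =O[poles] (fun θ => Real.cos (θ / 2) ^ 2)
  dpsi1_asymp : B.s = 0 → (fun θ => psiBar1 (deriv Ψ θ)) =O[poles] Real.sin
  dpsi2_asymp : B.s = 0 → (fun θ => psiBar2 B (deriv Ψ θ)) =O[poles] Real.sin
  dzeta1_asymp : B.s = 0 →
    (fun θ => zetaBar1 (deriv Ψ θ)) =O[poles] (fun θ => Real.sin (θ / 2) ^ 2 * Real.sin θ)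
  dzeta2_asymp : B.s = 0 →
    (fun θ => zetaBar2 B (deriv Ψ θ)) =O[poles] (fun θ => Real.cos (θ / 2) ^ 2 * Real.sin θ)

/-- `Ψ₀` is a renormalized quasi-harmonic map: it is smooth on `0 < θ < π`, the associated map
`Ψ̃₀` is quasi-harmonic, and it has the regular behaviour of an extreme near-horizon geometry at
the poles. -/
structure IsRenormalizedQuasiHarmonic (B : Horizon) (Λ A : ℝ) (ξ : ℝ → ℝ)
    (Ψ₀ : ℝ → Target) : Prop where
  smooth : ContDiffOn ℝ ∞ Ψ₀ (Set.Ioo 0 Real.pi)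
  quasiHarmonic : IsQuasiHarmonic B Λ A ξ (tilde Ψ₀)
  asymptotics : ModelAsymptotics B Ψ₀

/-- The potentials `ζ¹, ζ², χ, ψ¹, ψ²` (coordinates `3, …, 7`) of the two maps agree on
`Γ = {θ = 0} ∪ {θ = π}`. -/
def PotentialsAgree (Ψ Ψ₀ : ℝ → Target) : Prop :=
  ∀ i : Fin 8, 3 ≤ i → Tendsto (fun θ => Ψ θ i - Ψ₀ θ i) poles (𝓝 0)

/-- The distance between `Ψ̃` and `Ψ̃₀` as a function on `S³` in Hopf coordinates. -/
def mapDist (B : Horizon) (Ψ Ψ₀ : ℝ → Target) (x : ℝ × ℝ × ℝ) : ℝ :=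
  targetDist B (tilde Ψ x.1) (tilde Ψ₀ x.1)

end

end MinSugra

/-! The target is a symmetric space of noncompact type, so energy is convex along the geodesics
joining two maps pointwise, and a critical map minimizes with a quantitative gain. The proof carries
this out with explicit 7 × 7 matrices and needs neither curvature nor a homotopy of geodesics.

Model. `ghat` sends a point to an upper triangular element of G₂₍₂₎ ⊂ GL₇. Its logarithmic
derivative M along a curve is linear in the orthogonal coframe of the metric (`hasDerivAt_ghat`),
and the metric is tr((M + Mᵀ)²)/4 (`trace_frameMat_coframe`). For two points put k = `relMat` and A
= `relLog` = log(kᵀk). Since G₂₍₂₎ is cut out by invariant forms, A is the symmetrization of a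
tangent direction at the first point (`relLog_eq_frameMat`), the curves gᵀ exp(tA) g are Gram
matrices of points of the target (`gram_fromGram`), and the Riemannian distance is √(tr A²)/2
(`targetDist_eq`).

Convexity. `excess` is four times the energy density of the second map, minus that of the first,
minus the first variation of the latter in the direction A. In an eigenbasis of A it splits into
scalar inequalities (`convexity_scalar`), and `excess_bound` gives (tr AA')² ≤ tr A² · `excess`, so
that `excess` controls the square of the derivative of the distance. The potential e^{-4u} is the
squared length of the first column of `ghat`, so its convexity is exp A ≥ 1 + A tested on one vector
(`exp_potential_ge`).

Criticality. For a quasi-harmonic map the linear term is an exact derivative, that of `momentum`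
(`euler_lagrange`); this uses no boundary condition on the direction. The renormalized density is
the energy density minus a term independent of the map and minus the derivative of `boundaryTerm`
(`hasDerivAt_boundaryTerm`). Thus the difference of the area densities dominates the derivative of
momentum minus boundary terms, plus a positive multiple of the convexity defect
(`integral_sin_defect_le`).

Poles. The asymptotics are turned into orders of vanishing in powers of √(sin θ). Equality of the
potentials on the axis forces the position of one singular map relative to the other to approach the
flat of diagonal matrices, where A is explicit (`tendsto_relCoord`). Hence the momentum and the
difference of the boundary terms cancel in the limit (`tendsto_momentum_sub_boundaryTerm`).

Variance. Integrating the defect from θ to the equator bounds (d(θ) − d(π/2))² sin θ by the area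
difference (`relDist_pointwise_bound`). Integration over the sphere, together with minimality of the
variance at the mean, gives the theorem. -/

namespace MinSugra

noncomputable section

open Matrix
open scoped Matrix.Norms.Frobenius

/-! ### Matrix exponential and smooth symmetric logarithm. -/

section MatrixAnalysis

set_option linter.unusedSectionVars false

variable {n : Type*} [Fintype n] [DecidableEq n]

theorem hasDerivAt_matrix {f : ℝ → Matrix n n ℝ} {f' : Matrix n n ℝ} {x : ℝ} :
    HasDerivAt f f' x ↔ ∀ i j, HasDerivAt (fun t => f t i j) (f' i j) x :=
  hasDerivAt_pi.trans (forall_congr' fun _ => hasDerivAt_pi)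

theorem contDiff_entry (i j : n) {m : WithTop ℕ∞} :
    ContDiff ℝ m (fun A : Matrix n n ℝ => A i j) :=
  (LinearMap.toContinuousLinearMap (Matrix.entryLinearMap ℝ ℝ i j)).contDiff

theorem contDiffAt_matrix {E : Type*} [NormedAddCommGroup E] [NormedSpace ℝ E]
    {f : E → Matrix n n ℝ} {x : E} {m : WithTop ℕ∞}
    (h : ∀ i j, ContDiffAt ℝ m (fun t => f t i j) x) : ContDiffAt ℝ m f x := by
  have : f = fun t => ∑ i, ∑ j, f t i j • Matrix.single i j (1 : ℝ) := by
    ext1 t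
    conv_lhs => rw [Matrix.matrix_eq_sum_single (f t)]
    simp [Matrix.smul_single]
  rw [this]
  exact ContDiffAt.sum fun i _ => ContDiffAt.sum fun j _ => (h i j).smul contDiffAt_const

theorem contDiffAt_transpose {E : Type*} [NormedAddCommGroup E] [NormedSpace ℝ E]
    {f : E → Matrix n n ℝ} {x : E} {m : WithTop ℕ∞} (h : ContDiffAt ℝ m f x) :
    ContDiffAt ℝ m (fun y => (f y)ᵀ) x :=
  contDiffAt_matrix fun i j => (contDiff_entry j i).contDiffAt.comp x h

theorem hasDerivAt_transpose {f : ℝ → Matrix n n ℝ} {f' : Matrix n n ℝ} {x : ℝ}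
    (h : HasDerivAt f f' x) : HasDerivAt (fun t => (f t)ᵀ) f'ᵀ x :=
  hasDerivAt_matrix.2 fun i j => hasDerivAt_matrix.1 h j i

theorem hasDerivAt_trace {f : ℝ → Matrix n n ℝ} {f' : Matrix n n ℝ} {x : ℝ}
    (h : HasDerivAt f f' x) : HasDerivAt (fun t => (f t).trace) f'.trace x := by
  simp only [Matrix.trace]
  exact HasDerivAt.fun_sum fun i _ => hasDerivAt_matrix.1 h i i

/-! ### Symmetric matrices and the exponential -/

theorem exists_spectral {A : Matrix n n ℝ} (hA : A.IsSymm) :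
    ∃ (O : Matrix n n ℝ) (l : n → ℝ), Oᵀ * O = 1 ∧ O * Oᵀ = 1 ∧ A = O * diagonal l * Oᵀ := by
  have hH : A.IsHermitian := by
    rw [Matrix.IsHermitian, Matrix.conjTranspose_eq_transpose_of_trivial]; exact hA
  have h1 : (hH.eigenvectorUnitary : Matrix n n ℝ)ᵀ * hH.eigenvectorUnitary = 1 := by
    have := Unitary.coe_star_mul_self hH.eigenvectorUnitary
    rwa [Matrix.star_eq_conjTranspose, Matrix.conjTranspose_eq_transpose_of_trivial] at this
  refine ⟨hH.eigenvectorUnitary, hH.eigenvalues, h1, mul_eq_one_comm.1 h1, ?_⟩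
  have := hH.spectral_theorem
  rw [Unitary.conjStarAlgAut_apply, Matrix.star_eq_conjTranspose,
    Matrix.conjTranspose_eq_transpose_of_trivial] at this
  exact this

theorem exp_diagonal_real (l : n → ℝ) :
    NormedSpace.exp (diagonal l) = diagonal (fun i => Real.exp (l i)) := by
  rw [Matrix.exp_diagonal]
  congr 1
  ext i
  rw [Pi.coe_exp, Real.exp_eq_exp_ℝ]

theorem exp_orthogonal_conj {O : Matrix n n ℝ} (h : O * Oᵀ = 1) (A : Matrix n n ℝ) :
    NormedSpace.exp (O * A * Oᵀ) = O * NormedSpace.exp A * Oᵀ := by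
  have h1 : O⁻¹ = Oᵀ := Matrix.inv_eq_right_inv h
  have hu : IsUnit O := by
    rw [Matrix.isUnit_iff_isUnit_det]; exact Matrix.isUnit_det_of_right_inverse h
  rw [← h1, Matrix.exp_conj _ _ hu]

theorem exp_spectral {O : Matrix n n ℝ} {l : n → ℝ} (h : O * Oᵀ = 1) :
    NormedSpace.exp (O * diagonal l * Oᵀ) = O * diagonal (fun i => Real.exp (l i)) * Oᵀ := by
  rw [exp_orthogonal_conj h, exp_diagonal_real]

theorem quadForm_spectral (O : Matrix n n ℝ) (l : n → ℝ) (x : n → ℝ) :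
    x ⬝ᵥ ((O * diagonal l * Oᵀ) *ᵥ x) = ∑ i, l i * (Oᵀ *ᵥ x) i ^ 2 := by
  rw [← Matrix.mulVec_mulVec, ← Matrix.mulVec_mulVec, Matrix.dotProduct_mulVec,
    ← Matrix.mulVec_transpose]
  simp only [dotProduct, Matrix.mulVec_diagonal]
  exact Finset.sum_congr rfl fun i _ => by ring

theorem quadForm_orthogonal {O : Matrix n n ℝ} (h : O * Oᵀ = 1) (x : n → ℝ) :
    x ⬝ᵥ x = ∑ i, (Oᵀ *ᵥ x) i ^ 2 := by
  have := quadForm_spectral O (fun _ => 1) x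
  rw [show diagonal (fun _ : n => (1 : ℝ)) = 1 from diagonal_one, mul_one, h, one_mulVec] at this
  simpa using this

/-- `exp A ≥ 1 + A` for symmetric `A`, as quadratic forms. -/
theorem quadForm_exp_ge {A : Matrix n n ℝ} (hA : A.IsSymm) (x : n → ℝ) :
    x ⬝ᵥ x + x ⬝ᵥ (A *ᵥ x) ≤ x ⬝ᵥ (NormedSpace.exp A *ᵥ x) := by
  obtain ⟨O, l, -, h2, rfl⟩ := exists_spectral hA
  rw [exp_spectral h2, quadForm_spectral, quadForm_spectral, quadForm_orthogonal h2,
    ← Finset.sum_add_distrib]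
  refine Finset.sum_le_sum fun i _ => ?_
  nlinarith [Real.add_one_le_exp (l i), sq_nonneg ((Oᵀ *ᵥ x) i)]

/-- A real symmetric matrix whose quadratic form is bounded below by `m`. -/
def FormGe (m : ℝ) (Q : Matrix n n ℝ) : Prop := ∀ x : n → ℝ, m * (x ⬝ᵥ x) ≤ x ⬝ᵥ (Q *ᵥ x)

theorem FormGe.spectral_le {m : ℝ} {O : Matrix n n ℝ} {l : n → ℝ} (h : Oᵀ * O = 1)
    (hQ : FormGe m (O * diagonal l * Oᵀ)) (i : n) : m ≤ l i := by
  have := hQ (O *ᵥ Pi.single i 1)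
  have h2 : O * Oᵀ = 1 := mul_eq_one_comm.1 h
  rw [quadForm_spectral, quadForm_orthogonal h2, mulVec_mulVec, h, one_mulVec] at this
  have e : ∀ f : n → ℝ, ∑ j, f j * (Pi.single i (1 : ℝ) : n → ℝ) j ^ 2 = f i := by
    intro f
    rw [Finset.sum_eq_single i] <;> simp +contextual
  have e1 := e (fun _ => 1)
  simp only [one_mul] at e1
  rw [e, e1] at this
  linarith

theorem trace_mul_transpose_eq (X : Matrix n n ℝ) : (X * Xᵀ).trace = ∑ i, ∑ j, X i j ^ 2 := by
  simp [Matrix.trace, Matrix.mul_apply, sq]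

/-- Follows from e^a ≥ e^b (1 + a − b) for the larger exponent a. It is the scalar seed of the
Lipschitz bound for the matrix logarithm. -/
theorem sq_log_sub_le {m a b : ℝ} (hm : 0 ≤ m) (ha : m ≤ Real.exp a) (hb : m ≤ Real.exp b) :
    m ^ 2 * (a - b) ^ 2 ≤ (Real.exp a - Real.exp b) ^ 2 := by
  have key : ∀ {a b : ℝ}, m ≤ Real.exp b → b ≤ a → m * (a - b) ≤ Real.exp a - Real.exp b := by
    intro a b hb hab
    have h1 : Real.exp a = Real.exp b * Real.exp (a - b) := by rw [← Real.exp_add]; ring_nf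
    nlinarith [Real.add_one_le_exp (a - b), Real.exp_pos b,
      mul_le_mul_of_nonneg_right hb (sub_nonneg.2 hab)]
  rcases le_total b a with h | h
  · have := key hb h
    rw [← mul_pow]
    exact pow_le_pow_left₀ (mul_nonneg hm (sub_nonneg.2 h)) this 2
  · have := key ha h
    have h3 := pow_le_pow_left₀ (mul_nonneg hm (sub_nonneg.2 h)) this 2
    nlinarith

/-- The logarithm is Lipschitz on matrices bounded below. -/
theorem trace_sq_sub_le_exp {m : ℝ} (hm : 0 ≤ m) {A B : Matrix n n ℝ} (hA : A.IsSymm)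
    (hB : B.IsSymm) (hA' : FormGe m (NormedSpace.exp A)) (hB' : FormGe m (NormedSpace.exp B)) :
    m ^ 2 * ((A - B) * (A - B)).trace ≤
      ((NormedSpace.exp A - NormedSpace.exp B) *
        (NormedSpace.exp A - NormedSpace.exp B)).trace := by
  obtain ⟨O, l, h1, h2, rfl⟩ := exists_spectral hA
  obtain ⟨R, k, h3, h4, rfl⟩ := exists_spectral hB
  rw [exp_spectral h2] at hA' ⊢
  rw [exp_spectral h4] at hB' ⊢
  have la := fun i => FormGe.spectral_le h1 hA' i
  have lb := fun i => FormGe.spectral_le h3 hB' i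
  -- The two matrices need not commute. Using the eigenbasis of one on the left and of the other on
  -- the right, their difference has entries `(a i - b j) * (Oᵀ * R) i j`, so the traces for the
  -- logarithms and for the exponentials carry the same weights and are compared term by term.
  have key : ∀ a b : n → ℝ, ((O * diagonal a * Oᵀ - R * diagonal b * Rᵀ) *
      (O * diagonal a * Oᵀ - R * diagonal b * Rᵀ)).trace =
      ∑ i, ∑ j, (a i - b j) ^ 2 * (Oᵀ * R) i j ^ 2 := by
    intro a b
    set X := diagonal a * (Oᵀ * R) - (Oᵀ * R) * diagonal b with hX
    have e1 : O * diagonal a * Oᵀ - R * diagonal b * Rᵀ = O * X * Rᵀ := by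
      rw [hX, mul_sub, sub_mul]
      congr 1
      · calc _ = O * diagonal a * Oᵀ * (R * Rᵀ) := by rw [h4, mul_one]
          _ = _ := by simp only [mul_assoc]
      · calc _ = O * Oᵀ * (R * diagonal b * Rᵀ) := by rw [h2, one_mul]
          _ = _ := by simp only [mul_assoc]
    have e2 : (O * diagonal a * Oᵀ - R * diagonal b * Rᵀ) = (O * X * Rᵀ)ᵀ := by
      rw [← e1]; simp [Matrix.transpose_mul, mul_assoc]
    have e3 : (O * X * Rᵀ) * (O * X * Rᵀ)ᵀ = O * (X * Xᵀ) * Oᵀ := by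
      rw [transpose_mul, transpose_mul, transpose_transpose]
      calc _ = O * X * (Rᵀ * R) * Xᵀ * Oᵀ := by simp only [mul_assoc]
        _ = _ := by rw [h3]; simp only [mul_assoc, mul_one]
    nth_rw 1 [e1]
    rw [e2, e3, Matrix.trace_mul_cycle, h1, one_mul, trace_mul_transpose_eq]
    refine Finset.sum_congr rfl fun i _ => Finset.sum_congr rfl fun j _ => ?_
    rw [hX, Matrix.sub_apply, Matrix.diagonal_mul, Matrix.mul_diagonal]
    ring
  rw [key, key, Finset.mul_sum]
  refine Finset.sum_le_sum fun i _ => ?_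
  rw [Finset.mul_sum]
  refine Finset.sum_le_sum fun j _ => ?_
  rw [← mul_assoc]
  exact mul_le_mul_of_nonneg_right (sq_log_sub_le hm (la i) (lb j)) (sq_nonneg _)

theorem trace_sq_eq {X : Matrix n n ℝ} (hX : X.IsSymm) : (X * X).trace = ∑ i, ∑ j, X i j ^ 2 := by
  rw [← trace_mul_transpose_eq, hX.eq]

theorem trace_sq_nonneg {X : Matrix n n ℝ} (hX : X.IsSymm) : 0 ≤ (X * X).trace := by
  rw [trace_sq_eq hX]; positivity

theorem sq_entry_le_trace_sq {X : Matrix n n ℝ} (hX : X.IsSymm) (i j : n) :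
    X i j ^ 2 ≤ (X * X).trace := by
  rw [trace_sq_eq hX]
  calc X i j ^ 2 ≤ ∑ j, X i j ^ 2 :=
        Finset.single_le_sum (f := fun j => X i j ^ 2) (fun _ _ => sq_nonneg _) (Finset.mem_univ j)
    _ ≤ _ := Finset.single_le_sum (f := fun i => ∑ j, X i j ^ 2)
        (fun _ _ => Finset.sum_nonneg fun _ _ => sq_nonneg _) (Finset.mem_univ i)

/-- Symmetric with form bounded below by a positive constant. -/
def IsSPD (Q : Matrix n n ℝ) : Prop := Q.IsSymm ∧ ∃ m, 0 < m ∧ FormGe m Q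

theorem exists_log {Q : Matrix n n ℝ} (hQ : IsSPD Q) :
    ∃ A : Matrix n n ℝ, A.IsSymm ∧ NormedSpace.exp A = Q := by
  obtain ⟨hs, m, hm, hf⟩ := hQ
  obtain ⟨O, l, h1, h2, rfl⟩ := exists_spectral hs
  refine ⟨O * diagonal (fun i => Real.log (l i)) * Oᵀ, ?_, ?_⟩
  · simp [Matrix.IsSymm, Matrix.transpose_mul, mul_assoc]
  · rw [exp_spectral h2]
    congr 3
    ext i
    exact Real.exp_log (hm.trans_le (FormGe.spectral_le h1 hf i))

/-- The Lipschitz bound with equal exponentials leaves `m ^ 2 * tr ((A - B)²) ≤ 0`, and positive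
definiteness supplies `m > 0`. -/
theorem log_unique {A B : Matrix n n ℝ} (hA : A.IsSymm) (hB : B.IsSymm)
    (hQ : IsSPD (NormedSpace.exp A)) (h : NormedSpace.exp A = NormedSpace.exp B) : A = B := by
  obtain ⟨-, m, hm, hf⟩ := hQ
  have := trace_sq_sub_le_exp hm.le hA hB hf (h ▸ hf)
  rw [h, sub_self, zero_mul, trace_zero] at this
  have hs : (A - B).IsSymm := hA.sub hB
  have h0 : ((A - B) * (A - B)).trace ≤ 0 := by
    by_contra hc
    push Not at hc
    nlinarith [mul_pos (pow_pos hm 2) hc]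
  ext i j
  have := sq_entry_le_trace_sq hs i j
  have h2 : (A - B) i j ^ 2 = 0 := le_antisymm (this.trans h0) (sq_nonneg _)
  have h3 := pow_eq_zero_iff (two_ne_zero) |>.1 h2
  rw [Matrix.sub_apply] at h3
  linarith

open Classical in
/-- The symmetric logarithm of a positive definite symmetric matrix. -/
def symLog (Q : Matrix n n ℝ) : Matrix n n ℝ :=
  if h : IsSPD Q then (exists_log h).choose else 0

theorem symLog_isSymm (Q : Matrix n n ℝ) : (symLog Q).IsSymm := by
  unfold symLog
  split_ifs with h
  · exact (exists_log h).choose_spec.1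
  · exact Matrix.isSymm_zero

theorem exp_symLog {Q : Matrix n n ℝ} (hQ : IsSPD Q) : NormedSpace.exp (symLog Q) = Q := by
  unfold symLog
  rw [dif_pos hQ]
  exact (exists_log hQ).choose_spec.2

/-! ### The differential of the exponential -/

theorem contDiff_matrix_exp :
    ContDiff ℝ ∞ (NormedSpace.exp : Matrix n n ℝ → Matrix n n ℝ) := by
  rw [contDiff_iff_contDiffAt]
  exact fun x => (NormedSpace.exp_analytic (𝕂 := ℝ) x).contDiffAt

theorem hasFDerivAt_matrix_exp (A : Matrix n n ℝ) :
    HasFDerivAt (NormedSpace.exp : Matrix n n ℝ → Matrix n n ℝ)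
      (fderiv ℝ NormedSpace.exp A) A :=
  (contDiff_matrix_exp.differentiable (by simp) A).hasFDerivAt

theorem hasDerivAt_exp_line (Y : Matrix n n ℝ) :
    HasDerivAt (fun s : ℝ => NormedSpace.exp (s • Y)) Y 0 := by
  have := hasDerivAt_exp_smul_const (𝕂 := ℝ) Y (0 : ℝ)
  rw [zero_smul, NormedSpace.exp_zero, one_mul] at this
  exact this

theorem hasDerivAt_line (A H : Matrix n n ℝ) : HasDerivAt (fun s : ℝ => A + s • H) H 0 := by
  have := ((hasDerivAt_id (0 : ℝ)).smul_const H).const_add A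
  rw [one_smul] at this
  exact this

theorem fderiv_exp_commute {A H : Matrix n n ℝ} (h : Commute A H) :
    fderiv ℝ NormedSpace.exp A H = NormedSpace.exp A * H := by
  have h1 : HasDerivAt (fun s : ℝ => NormedSpace.exp (A + s • H))
      (fderiv ℝ NormedSpace.exp A H) 0 := by
    have hA := hasFDerivAt_matrix_exp A
    have : HasFDerivAt (NormedSpace.exp : Matrix n n ℝ → Matrix n n ℝ)
      (fderiv ℝ NormedSpace.exp A) (A + (0 : ℝ) • H) := by simpa using hA
    exact this.comp_hasDerivAt (0 : ℝ) (hasDerivAt_line A H)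
  have h2 : (fun s : ℝ => NormedSpace.exp (A + s • H)) =
      fun s : ℝ => NormedSpace.exp A * NormedSpace.exp (s • H) := by
    ext1 s
    exact Matrix.exp_add_of_commute _ _ (h.smul_right s)
  rw [h2] at h1
  exact h1.unique ((hasDerivAt_exp_line H).const_mul (NormedSpace.exp A))

/-- The exponential intertwines conjugation by exp(sY); differentiate this identity at s = 0.
Together with the commuting case it determines the differential at every diagonal matrix. -/
theorem fderiv_exp_commutator (A Y : Matrix n n ℝ) :
    fderiv ℝ NormedSpace.exp A (A * Y - Y * A) = NormedSpace.exp A * Y - Y * NormedSpace.exp A := by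
  have conj : ∀ X : Matrix n n ℝ, HasDerivAt
      (fun s : ℝ => NormedSpace.exp (s • (-Y)) * X * NormedSpace.exp (s • Y))
      (X * Y - Y * X) 0 := by
    intro X
    have := ((hasDerivAt_exp_line (-Y)).mul_const X).mul (hasDerivAt_exp_line Y)
    refine this.congr_deriv ?_
    simp only [zero_smul, NormedSpace.exp_zero, mul_one, one_mul, neg_mul]
    abel
  have h1 : HasDerivAt (fun s : ℝ => NormedSpace.exp
      (NormedSpace.exp (s • (-Y)) * A * NormedSpace.exp (s • Y)))
      (fderiv ℝ NormedSpace.exp A (A * Y - Y * A)) 0 := by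
    have : HasFDerivAt (NormedSpace.exp : Matrix n n ℝ → Matrix n n ℝ)
        (fderiv ℝ NormedSpace.exp A)
        (NormedSpace.exp ((0 : ℝ) • (-Y)) * A * NormedSpace.exp ((0 : ℝ) • Y)) := by
      simpa using hasFDerivAt_matrix_exp A
    exact this.comp_hasDerivAt (0 : ℝ) (conj A)
  have h2 : (fun s : ℝ => NormedSpace.exp
      (NormedSpace.exp (s • (-Y)) * A * NormedSpace.exp (s • Y))) =
      fun s : ℝ => NormedSpace.exp (s • (-Y)) * NormedSpace.exp A * NormedSpace.exp (s • Y) := by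
    ext1 s
    have e : NormedSpace.exp (s • (-Y)) = (NormedSpace.exp (s • Y))⁻¹ := by
      rw [smul_neg, Matrix.exp_neg]
    rw [e, Matrix.exp_conj' _ _ (Matrix.isUnit_exp _)]
  rw [h2] at h1
  exact h1.unique (conj _)

/-- Divided difference of the exponential. -/
def expSlope (a b : ℝ) : ℝ := if a = b then Real.exp a else (Real.exp a - Real.exp b) / (a - b)

theorem expSlope_pos (a b : ℝ) : 0 < expSlope a b := by
  unfold expSlope
  split_ifs with h
  · exact Real.exp_pos a
  · rcases lt_or_gt_of_ne h with h | h
    · exact div_pos_of_neg_of_neg (sub_neg.2 (Real.exp_lt_exp.2 h)) (sub_neg.2 h)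
    · exact div_pos (sub_pos.2 (Real.exp_lt_exp.2 h)) (sub_pos.2 h)

/-- Split `H` into the part supported on equal eigenvalues, which commutes with the diagonal matrix,
and a commutator with the diagonal matrix. The two preceding formulas then produce the divided
differences of exp. -/
theorem fderiv_exp_diagonal (l : n → ℝ) (H : Matrix n n ℝ) (i j : n) :
    fderiv ℝ NormedSpace.exp (diagonal l) H i j = expSlope (l i) (l j) * H i j := by
  set Hc : Matrix n n ℝ := Matrix.of fun i j => if l i = l j then H i j else 0 with hHc
  set Y : Matrix n n ℝ := Matrix.of fun i j => if l i = l j then 0 else H i j / (l i - l j) with hY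
  have hdec : H = Hc + (diagonal l * Y - Y * diagonal l) := by
    ext i j
    simp only [hHc, hY, Matrix.add_apply, Matrix.sub_apply, Matrix.diagonal_mul,
      Matrix.mul_diagonal, Matrix.of_apply]
    split_ifs with h
    · simp
    · have : l i - l j ≠ 0 := sub_ne_zero.2 h
      field_simp
      ring
  have hcomm : Commute (diagonal l) Hc := by
    change diagonal l * Hc = Hc * diagonal l
    ext i j
    simp only [hHc, Matrix.diagonal_mul, Matrix.mul_diagonal, Matrix.of_apply]
    split_ifs with h
    · rw [h]; ring
    · simp
  conv_lhs => rw [hdec]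
  rw [map_add, fderiv_exp_commute hcomm, fderiv_exp_commutator, exp_diagonal_real]
  simp only [hHc, hY, Matrix.add_apply, Matrix.sub_apply, Matrix.diagonal_mul,
      Matrix.mul_diagonal, Matrix.of_apply, expSlope]
  split_ifs with h
  · simp
  · have : l i - l j ≠ 0 := sub_ne_zero.2 h
    field_simp
    ring

theorem fderiv_exp_conj {O : Matrix n n ℝ} (h : O * Oᵀ = 1) (A H : Matrix n n ℝ) :
    fderiv ℝ NormedSpace.exp (O * A * Oᵀ) (O * H * Oᵀ) =
      O * fderiv ℝ NormedSpace.exp A H * Oᵀ := by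
  have hA : HasFDerivAt (NormedSpace.exp : Matrix n n ℝ → Matrix n n ℝ)
      (fderiv ℝ NormedSpace.exp A) (A + (0 : ℝ) • H) := by simpa using hasFDerivAt_matrix_exp A
  have h1 := ((hA.comp_hasDerivAt (0 : ℝ) (hasDerivAt_line A H)).const_mul O).mul_const Oᵀ
  have hB : HasFDerivAt (NormedSpace.exp : Matrix n n ℝ → Matrix n n ℝ)
      (fderiv ℝ NormedSpace.exp (O * A * Oᵀ)) (O * (A + (0 : ℝ) • H) * Oᵀ) := by
    simpa using hasFDerivAt_matrix_exp (O * A * Oᵀ)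
  have h2 := hB.comp_hasDerivAt (0 : ℝ) (((hasDerivAt_line A H).const_mul O).mul_const Oᵀ)
  have e : (fun s : ℝ => O * (NormedSpace.exp ∘ fun s : ℝ => A + s • H) s * Oᵀ) =
      (NormedSpace.exp ∘ fun s : ℝ => O * (A + s • H) * Oᵀ) := by
    ext1 s
    simp only [Function.comp]
    rw [exp_orthogonal_conj h]
  rw [← e] at h2
  exact h2.unique h1

/-- In an eigenbasis the differential multiplies each entry by a divided difference of exp, which is
positive. This is the hypothesis of the inverse function theorem for the logarithm. -/
theorem fderiv_exp_injective {A : Matrix n n ℝ} (hA : A.IsSymm) :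
    Function.Injective (fderiv ℝ (NormedSpace.exp : Matrix n n ℝ → Matrix n n ℝ) A) := by
  obtain ⟨O, l, h1, h2, rfl⟩ := exists_spectral hA
  rw [injective_iff_map_eq_zero]
  intro H hH
  have e : H = O * (Oᵀ * H * O) * Oᵀ := by
    calc H = (O * Oᵀ) * H * (O * Oᵀ) := by rw [h2, one_mul, mul_one]
      _ = _ := by simp only [mul_assoc]
  rw [e, fderiv_exp_conj h2] at hH
  have h3 : fderiv ℝ NormedSpace.exp (diagonal l) (Oᵀ * H * O) = 0 := by
    calc _ = (Oᵀ * O) * fderiv ℝ NormedSpace.exp (diagonal l) (Oᵀ * H * O) * (Oᵀ * O) := by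
          rw [h1, one_mul, mul_one]
      _ = Oᵀ * (O * fderiv ℝ NormedSpace.exp (diagonal l) (Oᵀ * H * O) * Oᵀ) * O := by
          simp only [mul_assoc]
      _ = 0 := by rw [hH, mul_zero, zero_mul]
  have h4 : Oᵀ * H * O = 0 := by
    ext i j
    have := congrFun (congrFun h3 i) j
    rw [fderiv_exp_diagonal] at this
    exact (mul_eq_zero.1 this).resolve_left (expSlope_pos _ _).ne'
  rw [e, h4, mul_zero, zero_mul]

/-- The symmetric logarithm of a smooth family of positive definite matrices is smooth. -/
theorem contDiffAt_symLog {E : Type*} [NormedAddCommGroup E] [NormedSpace ℝ E]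
    {f : E → Matrix n n ℝ} {x : E} (hf : ContDiffAt ℝ ∞ f x) (hs : ∀ᶠ y in 𝓝 x, IsSPD (f y)) :
    ContDiffAt ℝ ∞ (fun y => symLog (f y)) x := by
  set A := symLog (f x) with hA
  have hx : IsSPD (f x) := hs.self_of_nhds
  have hAs : A.IsSymm := symLog_isSymm _
  let L : Matrix n n ℝ ≃L[ℝ] Matrix n n ℝ :=
    (LinearEquiv.ofInjectiveEndo
      (fderiv ℝ (NormedSpace.exp : Matrix n n ℝ → Matrix n n ℝ) A : Matrix n n ℝ →ₗ[ℝ] Matrix n n ℝ)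
      (fderiv_exp_injective hAs)).toContinuousLinearEquiv
  have hL : HasFDerivAt (NormedSpace.exp : Matrix n n ℝ → Matrix n n ℝ)
      (L : Matrix n n ℝ →L[ℝ] Matrix n n ℝ) A := by
    convert! hasFDerivAt_matrix_exp A using 1
  have hc : ContDiffAt ℝ ∞ (NormedSpace.exp : Matrix n n ℝ → Matrix n n ℝ) A :=
    contDiff_matrix_exp.contDiffAt
  have hn : (∞ : WithTop ℕ∞) ≠ 0 := by simp
  set g := hc.localInverse hL hn with hg
  have hexpA : NormedSpace.exp A = f x := exp_symLog hx
  have hgA : g (f x) = A := by rw [← hexpA]; exact hc.localInverse_apply_image hL hn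
  have hgc : ContDiffAt ℝ ∞ g (f x) := by rw [← hexpA]; exact hc.to_localInverse hL hn
  have hstr : HasStrictFDerivAt (NormedSpace.exp : Matrix n n ℝ → Matrix n n ℝ)
      (L : Matrix n n ℝ →L[ℝ] Matrix n n ℝ) A := hc.hasStrictFDerivAt' hL hn
  have hleft : ∀ᶠ X in 𝓝 A, g (NormedSpace.exp X) = X := hstr.eventually_left_inverse
  have hright : ∀ᶠ Q in 𝓝 (f x), NormedSpace.exp (g Q) = Q := by
    rw [← hexpA]; exact hstr.eventually_right_inverse
  have hgf : Tendsto (fun y => g (f y)) (𝓝 x) (𝓝 A) := by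
    have := hgc.continuousAt.comp hf.continuousAt
    rw [ContinuousAt, Function.comp_apply, hgA] at this
    exact this
  -- The local inverse is taken among all matrices, so its values must be shown symmetric: the
  -- transpose is also close to `A` and has the same exponential, hence coincides with the original
  -- by local injectivity.
  have hgft : Tendsto (fun y => (g (f y))ᵀ) (𝓝 x) (𝓝 A) := by
    have h1 : Continuous (fun X : Matrix n n ℝ => Xᵀ) := continuous_id.matrix_transpose
    have := (h1.tendsto A).comp hgf
    rwa [hAs.eq] at this
  refine (hgc.comp x hf).congr_of_eventuallyEq ?_
  filter_upwards [hs, hgf.eventually hleft, hgft.eventually hleft,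
    hf.continuousAt.eventually hright] with y hy h1 h2 h3
  have h4 : NormedSpace.exp (g (f y))ᵀ = f y := by rw [Matrix.exp_transpose, h3, hy.1.eq]
  have h5 : (g (f y)).IsSymm := by
    change (g (f y))ᵀ = g (f y)
    rw [h4] at h2
    exact h2.symm
  exact log_unique (symLog_isSymm _) h5 (by rw [exp_symLog hy]; exact hy)
    (by rw [exp_symLog hy]; exact h3.symm)

end MatrixAnalysis

/-! ### Convexity of the energy density on positive definite matrices. -/

section Convexity

set_option linter.unusedSectionVars false

variable {n : Type*} [Fintype n] [DecidableEq n]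

theorem expSlope_mul_sub (a b : ℝ) : expSlope a b * (a - b) = Real.exp a - Real.exp b := by
  unfold expSlope
  split_ifs with h
  · simp [h]
  · field_simp [sub_ne_zero.2 h]

theorem expSlope_comm (a b : ℝ) : expSlope a b = expSlope b a := by
  unfold expSlope
  by_cases h : a = b
  · simp [h]
  · rw [if_neg h, if_neg (Ne.symm h), ← neg_sub (Real.exp b), ← neg_sub b a, neg_div_neg_eq]

theorem expSlope_mem_of_le {a b : ℝ} (h : b ≤ a) :
    Real.exp b ≤ expSlope a b ∧ expSlope a b ≤ Real.exp a := by
  rcases h.eq_or_lt with rfl | h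
  · simp [expSlope]
  have hne : a ≠ b := h.ne'
  have hp : 0 < a - b := sub_pos.2 h
  rw [expSlope, if_neg hne, le_div_iff₀ hp, div_le_iff₀ hp]
  have h1 : Real.exp a = Real.exp b * Real.exp (a - b) := by rw [← Real.exp_add]; ring_nf
  have h2 : Real.exp b = Real.exp a * Real.exp (-(a - b)) := by rw [← Real.exp_add]; ring_nf
  constructor
  · nlinarith [Real.add_one_le_exp (a - b), Real.exp_pos b]
  · nlinarith [Real.add_one_le_exp (-(a - b)), Real.exp_pos a]

/-- The scalar inequality behind convexity of the energy along geodesics. -/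
theorem convexity_scalar (a b s d : ℝ) :
    Real.exp a * Real.exp b * (s ^ 2 + 2 * s * d) ≤
      (expSlope a b * d + s * (Real.exp a + Real.exp b) / 2) ^ 2 := by
  have key : ∀ a b : ℝ, b ≤ a → Real.exp a * Real.exp b * (s ^ 2 + 2 * s * d) ≤
      (expSlope a b * d + s * (Real.exp a + Real.exp b) / 2) ^ 2 := by
    intro a b h
    obtain ⟨h1, h2⟩ := expSlope_mem_of_le h
    have hE : 0 < Real.exp b := Real.exp_pos b
    set E := Real.exp a
    set F := Real.exp b
    set c := expSlope a b
    have hc : 0 < c := hE.trans_le h1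
    have hFE : F ≤ E := h1.trans h2
    -- This and the next bound are equivalent to `c ≤ E` and `F ≤ c`. They make the remainder
    -- nonnegative after the claim is multiplied by `c ^ 2` and the square in `d` is completed.
    have hb1 : c * (E + F) - 2 * E * F ≤ (E - F) * c := by nlinarith
    have hb2 : -((E - F) * c) ≤ c * (E + F) - 2 * E * F := by nlinarith
    have hsq : (c * (E + F) - 2 * E * F) ^ 2 ≤ ((E - F) * c) ^ 2 := sq_le_sq' hb2 hb1
    have : 0 ≤ c ^ 2 * ((c * d + s * (E + F) / 2) ^ 2 - E * F * (s ^ 2 + 2 * s * d)) := by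
      have e : c ^ 2 * ((c * d + s * (E + F) / 2) ^ 2 - E * F * (s ^ 2 + 2 * s * d)) =
        (c ^ 2 * d + (c * (E + F) - 2 * E * F) * s / 2) ^ 2 +
          (((E - F) * c) ^ 2 - (c * (E + F) - 2 * E * F) ^ 2) * s ^ 2 / 4 := by ring
      rw [e]
      have : 0 ≤ (((E - F) * c) ^ 2 - (c * (E + F) - 2 * E * F) ^ 2) * s ^ 2 :=
        mul_nonneg (sub_nonneg.2 hsq) (sq_nonneg s)
      positivity
    have := nonneg_of_mul_nonneg_right this (by positivity)
    linarith
  rcases le_total b a with h | h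
  · exact key a b h
  · have := key b a h
    rw [expSlope_comm, add_comm (Real.exp b), mul_comm (Real.exp b)] at this
    exact this

/-- With equal exponents the inequality becomes an identity with the additional term `d ^ 2`. These
diagonal gains are what later controls the derivative of the distance. -/
theorem convexity_scalar_diag (a s d : ℝ) :
    Real.exp a * Real.exp a * (s ^ 2 + 2 * s * d + d ^ 2) =
      (expSlope a a * d + s * (Real.exp a + Real.exp a) / 2) ^ 2 := by
  rw [expSlope, if_pos rfl]; ring

/-- The excess of the energy density of the end point of a geodesic over its linearization at the
starting point. -/
def excess (M₀ M₁ A A' : Matrix n n ℝ) : ℝ :=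
  ((M₁ + M₁ᵀ) * (M₁ + M₁ᵀ)).trace - ((M₀ + M₀ᵀ) * (M₀ + M₀ᵀ)).trace
    - 2 * (((M₀ + M₀ᵀ) * A').trace + (A * (M₀ * M₀ᵀ - M₀ᵀ * M₀)).trace)

/-- Since `k` times diag(e^{-l}) times `kᵀ` is the identity, it can be inserted twice under the
trace; this expresses tr S² through the entries of `kᵀ * S * k`. -/
theorem trace_sq_eq_of_gram {k S : Matrix n n ℝ} {l : n → ℝ}
    (hk : kᵀ * k = diagonal (fun i => Real.exp (l i))) :
    (S * S).trace = ∑ i, ∑ j, Real.exp (-l i) * Real.exp (-l j) *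
      ((kᵀ * S * k) i j * (kᵀ * S * k) j i) := by
  set E : Matrix n n ℝ := diagonal (fun i => Real.exp (-l i)) with hE
  have h1 : (E * kᵀ) * k = 1 := by
    rw [mul_assoc, hk, hE, diagonal_mul_diagonal]
    simp [← Real.exp_add]
  have h2 : k * (E * kᵀ) = 1 := mul_eq_one_comm.1 h1
  have h3 : (S * S).trace = ((E * (kᵀ * S * k)) * (E * (kᵀ * S * k))).trace := by
    calc (S * S).trace = (S * (k * (E * kᵀ)) * S * (k * (E * kᵀ))).trace := by
          rw [h2, mul_one, mul_one]
      _ = ((S * k * E * kᵀ * S * k) * (E * kᵀ)).trace := by simp only [mul_assoc]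
      _ = ((E * kᵀ) * (S * k * E * kᵀ * S * k)).trace := Matrix.trace_mul_comm _ _
      _ = _ := by simp only [mul_assoc]
  rw [h3]
  simp only [Matrix.trace, Matrix.diag_apply]
  refine Finset.sum_congr rfl fun i _ => ?_
  rw [Matrix.mul_apply]
  refine Finset.sum_congr rfl fun j _ => ?_
  rw [hE, Matrix.diagonal_mul, Matrix.diagonal_mul]
  ring

/-- In an eigenbasis of `A` the excess is a sum over index pairs. Off-diagonal pairs are nonnegative
by `convexity_scalar`, and each diagonal pair contributes exactly the square of the corresponding
entry of `A'`. -/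
theorem excess_diagonal {M₀ M₁ k A' : Matrix n n ℝ} {l : n → ℝ} (hA' : A'.IsSymm)
    (hk : kᵀ * k = diagonal (fun i => Real.exp (l i)))
    (hd : ∀ i j, (kᵀ * (M₁ + M₁ᵀ) * k - M₀ᵀ * (kᵀ * k) - kᵀ * k * M₀) i j =
      expSlope (l i) (l j) * A' i j) :
    ∑ i, A' i i ^ 2 ≤ excess M₀ M₁ (diagonal l) A' := by
  -- The antisymmetric part of `M₀` is absorbed into a shift of `A'`, because `l i - l j` times the
  -- divided difference is the difference of the exponentials. What remains has the shape of
  -- `convexity_scalar`, with `s` the entry of `M₀ + M₀ᵀ`.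
  have hT : ∀ i j, (kᵀ * (M₁ + M₁ᵀ) * k) i j =
      expSlope (l i) (l j) * (A' i j + (l i - l j) / 2 * (M₀ i j - M₀ j i)) +
        (M₀ i j + M₀ j i) * (Real.exp (l i) + Real.exp (l j)) / 2 := by
    intro i j
    have h1 := hd i j
    rw [hk, Matrix.sub_apply, Matrix.sub_apply, Matrix.mul_diagonal, Matrix.diagonal_mul,
      Matrix.transpose_apply] at h1
    linear_combination h1 - (M₀ i j - M₀ j i) / 2 * expSlope_mul_sub (l i) (l j)
  have hsym : ∀ i j, (kᵀ * (M₁ + M₁ᵀ) * k) j i = (kᵀ * (M₁ + M₁ᵀ) * k) i j := by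
    intro i j
    rw [hT, hT, expSlope_comm, hA'.apply i j]; ring
  have e1 : ((M₁ + M₁ᵀ) * (M₁ + M₁ᵀ)).trace = ∑ i, ∑ j, Real.exp (-l i) * Real.exp (-l j) *
      ((kᵀ * (M₁ + M₁ᵀ) * k) i j) ^ 2 := by
    rw [trace_sq_eq_of_gram hk]
    refine Finset.sum_congr rfl fun i _ => Finset.sum_congr rfl fun j _ => ?_
    rw [hsym]; ring
  have e2 : ((M₀ + M₀ᵀ) * (M₀ + M₀ᵀ)).trace = ∑ i, ∑ j, (M₀ i j + M₀ j i) ^ 2 := by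
    rw [trace_sq_eq (Matrix.isSymm_add_transpose_self M₀)]
    rfl
  have e3 : ((M₀ + M₀ᵀ) * A').trace = ∑ i, ∑ j, (M₀ i j + M₀ j i) * A' i j := by
    simp only [Matrix.trace, Matrix.diag_apply, Matrix.mul_apply, Matrix.add_apply,
      Matrix.transpose_apply]
    refine Finset.sum_congr rfl fun i _ => Finset.sum_congr rfl fun j _ => ?_
    rw [hA'.apply i j]
  have e4 : (diagonal l * (M₀ * M₀ᵀ - M₀ᵀ * M₀)).trace =
      ∑ i, ∑ j, (M₀ i j + M₀ j i) * ((l i - l j) / 2 * (M₀ i j - M₀ j i)) := by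
    have h1 : (diagonal l * (M₀ * M₀ᵀ - M₀ᵀ * M₀)).trace =
        ∑ i, ∑ j, l i * (M₀ i j ^ 2 - M₀ j i ^ 2) := by
      simp only [Matrix.trace, Matrix.diag_apply, Matrix.diagonal_mul, Matrix.sub_apply]
      refine Finset.sum_congr rfl fun i _ => ?_
      simp only [Matrix.mul_apply, Matrix.transpose_apply]
      rw [← Finset.sum_sub_distrib, Finset.mul_sum]
      exact Finset.sum_congr rfl fun j _ => by ring
    have h2 : (diagonal l * (M₀ * M₀ᵀ - M₀ᵀ * M₀)).trace =
        ∑ i, ∑ j, l j * (M₀ j i ^ 2 - M₀ i j ^ 2) := by rw [h1, Finset.sum_comm]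
    have h3 : (diagonal l * (M₀ * M₀ᵀ - M₀ᵀ * M₀)).trace =
        ((diagonal l * (M₀ * M₀ᵀ - M₀ᵀ * M₀)).trace +
          (diagonal l * (M₀ * M₀ᵀ - M₀ᵀ * M₀)).trace) / 2 := by ring
    rw [h3]
    nth_rw 1 [h1]
    rw [h2, ← Finset.sum_add_distrib, Finset.sum_div]
    refine Finset.sum_congr rfl fun i _ => ?_
    rw [← Finset.sum_add_distrib, Finset.sum_div]
    exact Finset.sum_congr rfl fun j _ => by ring
  have e5 : ∑ i, A' i i ^ 2 = ∑ i, ∑ j, if i = j then A' i j ^ 2 else 0 := by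
    simp
  rw [excess, e1, e2, e3, e4, e5, ← Finset.sum_add_distrib, Finset.mul_sum,
    ← Finset.sum_sub_distrib, ← Finset.sum_sub_distrib]
  refine Finset.sum_le_sum fun i _ => ?_
  rw [← Finset.sum_add_distrib, Finset.mul_sum, ← Finset.sum_sub_distrib,
    ← Finset.sum_sub_distrib]
  refine Finset.sum_le_sum fun j _ => ?_
  rw [hT]
  have hpos : Real.exp (-l i) * Real.exp (-l j) * (Real.exp (l i) * Real.exp (l j)) = 1 := by
    simp only [← Real.exp_add]; ring_nf; simp
  have hp : 0 ≤ Real.exp (-l i) * Real.exp (-l j) := by positivity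
  split_ifs with h
  · subst h
    have := convexity_scalar_diag (l i) (M₀ i i + M₀ i i) (A' i i)
    rw [sub_self, zero_div, zero_mul, add_zero, ← this, ← mul_assoc, hpos]
    apply le_of_eq
    ring
  · have := convexity_scalar (l i) (l j) (M₀ i j + M₀ j i)
      (A' i j + (l i - l j) / 2 * (M₀ i j - M₀ j i))
    have := mul_le_mul_of_nonneg_left this hp
    rw [← mul_assoc, hpos] at this
    linarith

/-- Convexity of the energy density along geodesics of the space of positive definite matrices:
`excess` bounds the square of the derivative of the length `√(tr A²)` of the geodesic. -/
theorem excess_bound {M₀ M₁ k A A' : Matrix n n ℝ} (hA : A.IsSymm) (hA' : A'.IsSymm)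
    (hk : kᵀ * k = NormedSpace.exp A)
    (hd : kᵀ * (M₁ + M₁ᵀ) * k - M₀ᵀ * (kᵀ * k) - kᵀ * k * M₀ = fderiv ℝ NormedSpace.exp A A') :
    0 ≤ excess M₀ M₁ A A' ∧ (A * A').trace ^ 2 ≤ (A * A).trace * excess M₀ M₁ A A' := by
  obtain ⟨O, l, h1, h2, rfl⟩ := exists_spectral hA
  have tr : ∀ X : Matrix n n ℝ, (Oᵀ * X * O).trace = X.trace := fun X => by
    rw [Matrix.trace_mul_cycle, h2, one_mul]
  have mm : ∀ X Y : Matrix n n ℝ, Oᵀ * X * O * (Oᵀ * Y * O) = Oᵀ * (X * Y) * O := fun X Y => by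
    calc _ = Oᵀ * X * (O * Oᵀ) * Y * O := by simp only [mul_assoc]
      _ = _ := by rw [h2, mul_one]; simp only [mul_assoc]
  have tt : ∀ X : Matrix n n ℝ, (Oᵀ * X * O)ᵀ = Oᵀ * Xᵀ * O := fun X => by
    simp [Matrix.transpose_mul, mul_assoc]
  have dd : Oᵀ * (O * diagonal l * Oᵀ) * O = diagonal l := by
    calc _ = (Oᵀ * O) * diagonal l * (Oᵀ * O) := by simp only [mul_assoc]
      _ = _ := by rw [h1, one_mul, mul_one]
  have hB : (Oᵀ * A' * O).IsSymm := by rw [Matrix.IsSymm, tt, hA'.eq]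
  have hex : excess M₀ M₁ (O * diagonal l * Oᵀ) A' =
      excess (Oᵀ * M₀ * O) M₁ (diagonal l) (Oᵀ * A' * O) := by
    have e1 : Oᵀ * M₀ * O + (Oᵀ * M₀ * O)ᵀ = Oᵀ * (M₀ + M₀ᵀ) * O := by
      rw [tt, mul_add, add_mul]
    unfold excess
    rw [e1, mm, mm, tr, tr, tt, mm, mm, ← sub_mul, ← mul_sub]
    nth_rw 2 [← dd]
    rw [mm, tr]
  have key : ∑ i, (Oᵀ * A' * O) i i ^ 2 ≤ excess (Oᵀ * M₀ * O) M₁ (diagonal l) (Oᵀ * A' * O) := by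
    refine excess_diagonal (k := k * O) hB ?_ ?_
    · rw [transpose_mul]
      calc _ = Oᵀ * (kᵀ * k) * O := by simp only [mul_assoc]
        _ = _ := by
          rw [hk, exp_spectral h2]
          calc _ = (Oᵀ * O) * diagonal (fun i => Real.exp (l i)) * (Oᵀ * O) := by
                simp only [mul_assoc]
            _ = _ := by rw [h1, one_mul, mul_one]
    · intro i j
      rw [← fderiv_exp_diagonal]
      have e : A' = O * (Oᵀ * A' * O) * Oᵀ := by
        calc A' = (O * Oᵀ) * A' * (O * Oᵀ) := by rw [h2, one_mul, mul_one]
          _ = _ := by simp only [mul_assoc]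
      rw [e, fderiv_exp_conj h2] at hd
      have hd2 : Oᵀ * (kᵀ * (M₁ + M₁ᵀ) * k - M₀ᵀ * (kᵀ * k) - kᵀ * k * M₀) * O =
          fderiv ℝ NormedSpace.exp (diagonal l) (Oᵀ * A' * O) := by
        rw [hd]
        calc _ = (Oᵀ * O) * fderiv ℝ NormedSpace.exp (diagonal l) (Oᵀ * A' * O) * (Oᵀ * O) := by
              simp only [mul_assoc]
          _ = _ := by rw [h1, one_mul, mul_one]
      rw [← hd2]
      have e2 : (k * O)ᵀ * (k * O) = Oᵀ * (kᵀ * k) * O := by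
        rw [transpose_mul]; simp only [mul_assoc]
      rw [e2, tt, mm, mm, transpose_mul]
      simp only [mul_sub, sub_mul, mul_assoc]
  have hs : 0 ≤ ∑ i, (Oᵀ * A' * O) i i ^ 2 := Finset.sum_nonneg fun i _ => sq_nonneg _
  refine ⟨by rw [hex]; exact hs.trans key, ?_⟩
  -- Only the diagonal entries of `A'` in the eigenbasis of `A` enter tr(AA'), so the diagonal gains
  -- suffice and Cauchy–Schwarz finishes.
  have f1 : (O * diagonal l * Oᵀ * A').trace = ∑ i, l i * (Oᵀ * A' * O) i i := by
    rw [← tr, ← mm, dd]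
    simp [Matrix.trace, Matrix.diagonal_mul]
  have f2 : (O * diagonal l * Oᵀ * (O * diagonal l * Oᵀ)).trace = ∑ i, l i ^ 2 := by
    rw [← tr, ← mm, dd]
    simp [Matrix.trace, sq]
  rw [hex, f1, f2]
  calc _ ≤ (∑ i, l i ^ 2) * ∑ i, (Oᵀ * A' * O) i i ^ 2 := Finset.sum_mul_sq_le_sq_mul_sq _ _ _
    _ ≤ _ := mul_le_mul_of_nonneg_left key (Finset.sum_nonneg fun i _ => sq_nonneg _)

end Convexity

/-! ### The solvable Iwasawa group inside 7 × 7 matrices. -/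

section Model

/-- `1/√3`. -/
def rt3 : ℝ := (√3)⁻¹

theorem rt3_sq : rt3 * rt3 = 1 / 3 := by
  rw [rt3, ← mul_inv, Real.mul_self_sqrt (by norm_num)]; norm_num

theorem sqrt_two_mul_self : √2 * √2 = (2 : ℝ) := Real.mul_self_sqrt (by norm_num)

/-- The general element of the solvable subalgebra of `𝔤₂₍₂₎ ⊂ 𝔤𝔩₇`. -/
def frameMat (o : Fin 8 → ℝ) : Matrix (Fin 7) (Fin 7) ℝ :=
  !![-2 * o 0, rt3 * o 5, rt3 * o 6, rt3 * √2 * o 7, -o 3, o 4, 0;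
     0, -o 0 + o 1 / 2, -o 2, -(rt3 * √2 * o 6), -(rt3 * o 7), 0, -o 4;
     0, 0, -o 0 - o 1 / 2, rt3 * √2 * o 5, 0, rt3 * o 7, o 3;
     0, 0, 0, 0, rt3 * √2 * o 5, -(rt3 * √2 * o 6), rt3 * √2 * o 7;
     0, 0, 0, 0, o 0 + o 1 / 2, o 2, -(rt3 * o 6);
     0, 0, 0, 0, 0, o 0 - o 1 / 2, -(rt3 * o 5);
     0, 0, 0, 0, 0, 0, 2 * o 0]

/-- The block-diagonal factor. -/
def leviMat (P s x : ℝ) : Matrix (Fin 7) (Fin 7) ℝ :=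
  !![P ^ 2, 0, 0, 0, 0, 0, 0;
     0, P * s, -(x * (P * s)), 0, 0, 0, 0;
     0, 0, P * s⁻¹, 0, 0, 0, 0;
     0, 0, 0, 1, 0, 0, 0;
     0, 0, 0, 0, P⁻¹ * s, x * (P⁻¹ * s), 0;
     0, 0, 0, 0, 0, P⁻¹ * s⁻¹, 0;
     0, 0, 0, 0, 0, 0, P⁻¹ ^ 2]

/-- The unipotent factor. -/
def unipMat (a b c z₁ z₂ : ℝ) : Matrix (Fin 7) (Fin 7) ℝ :=
  !![1, rt3 * a, -(rt3 * b), rt3 * √2 * c, -(a * c / 3) - z₁, -(b * c / 3) - z₂,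
       c ^ 2 / 3 - rt3 * b * z₁ + rt3 * a * z₂;
     0, 1, 0, rt3 * √2 * b, a * b / 3 - rt3 * c, b ^ 2 / 3, 2 * b * c / 3 + z₂;
     0, 0, 1, rt3 * √2 * a, a ^ 2 / 3, a * b / 3 + rt3 * c, 2 * a * c / 3 + z₁;
     0, 0, 0, 1, rt3 * √2 * a, rt3 * √2 * b, rt3 * √2 * c;
     0, 0, 0, 0, 1, 0, rt3 * b;
     0, 0, 0, 0, 0, 1, -(rt3 * a);
     0, 0, 0, 0, 0, 0, 1]

/-- The logarithmic derivative stays in the solvable algebra. The term `s t ^ 2 * x'` is the shear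
velocity rescaled by the diagonal part. -/
theorem hasDerivAt_leviMat {P s x : ℝ → ℝ} {u' k x' t : ℝ} (hP : HasDerivAt P (-u' * P t) t)
    (hs : HasDerivAt s (k / 2 * s t) t) (hx : HasDerivAt x x' t) (hP0 : P t ≠ 0) (hs0 : s t ≠ 0) :
    HasDerivAt (fun t => leviMat (P t) (s t) (x t))
      (frameMat ![u', k, s t ^ 2 * x', 0, 0, 0, 0, 0] * leviMat (P t) (s t) (x t)) t := by
  have hPi : HasDerivAt (fun t => (P t)⁻¹) (u' * (P t)⁻¹) t := by
    refine (hP.inv hP0).congr_deriv ?_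
    field_simp
  have hsi : HasDerivAt (fun t => (s t)⁻¹) (-k / 2 * (s t)⁻¹) t := by
    refine (hs.inv hs0).congr_deriv ?_
    field_simp
  have h11 := hP.fun_pow 2
  have h22 := hP.fun_mul hs
  have h23 := (hx.fun_mul h22).fun_neg
  have h33 := hP.fun_mul hsi
  have h55 := hPi.fun_mul hs
  have h56 := hx.fun_mul h55
  have h66 := hPi.fun_mul hsi
  have h77 := hPi.fun_pow 2
  have h0 : HasDerivAt (fun _ : ℝ => (0 : ℝ)) 0 t := hasDerivAt_const t 0
  have h1 : HasDerivAt (fun _ : ℝ => (1 : ℝ)) 0 t := hasDerivAt_const t 1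
  rw [hasDerivAt_matrix]
  intro i j
  fin_cases i <;> fin_cases j
  all_goals first
    | exact h0.congr_deriv (by simp [frameMat, leviMat, Matrix.mul_apply, Fin.sum_univ_seven])
    | exact h1.congr_deriv (by simp [frameMat, leviMat, Matrix.mul_apply, Fin.sum_univ_seven])
    | skip
  · exact h11.congr_deriv (by
      simp [frameMat, leviMat, Matrix.mul_apply, Fin.sum_univ_seven]
      ring)
  · exact h22.congr_deriv (by
      simp [frameMat, leviMat, Matrix.mul_apply, Fin.sum_univ_seven]
      ring)
  · exact h23.congr_deriv (by
      simp [frameMat, leviMat, Matrix.mul_apply, Fin.sum_univ_seven]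
      field_simp)
  · exact h33.congr_deriv (by
      simp [frameMat, leviMat, Matrix.mul_apply, Fin.sum_univ_seven]
      ring)
  · exact h55.congr_deriv (by
      simp [frameMat, leviMat, Matrix.mul_apply, Fin.sum_univ_seven]
      ring)
  · exact h56.congr_deriv (by
      simp [frameMat, leviMat, Matrix.mul_apply, Fin.sum_univ_seven]
      field_simp
      ring)
  · exact h66.congr_deriv (by
      simp [frameMat, leviMat, Matrix.mul_apply, Fin.sum_univ_seven]
      ring)
  · exact h77.congr_deriv (by
      simp [frameMat, leviMat, Matrix.mul_apply, Fin.sum_univ_seven]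
      ring)

/-- This is where the one-forms of the metric originate: up to sign and the factor p, components 3,
4 and 7 of the logarithmic derivative are the forms Θ̄¹, Θ̄² and Υ. -/
theorem hasDerivAt_unipMat {a b c z w : ℝ → ℝ} {a' b' c' z' w' t : ℝ} (ha : HasDerivAt a a' t)
    (hb : HasDerivAt b b' t) (hc : HasDerivAt c c' t) (hz : HasDerivAt z z' t)
    (hw : HasDerivAt w w' t) :
    HasDerivAt (fun t => unipMat (a t) (b t) (c t) (z t) (w t))
      (frameMat ![0, 0, 0, z' + a t * (c' + (a t * b' - b t * a') * (rt3 / 3)),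
        -(w' + b t * (c' + (a t * b' - b t * a') * (rt3 / 3))), a', -b',
        c' + (a t * b' - b t * a') * rt3] * unipMat (a t) (b t) (c t) (z t) (w t)) t := by
  have hr := rt3_sq
  have ht := sqrt_two_mul_self
  have h12 := ha.const_mul rt3
  have h13 := (hb.const_mul rt3).fun_neg
  have h14 := hc.const_mul (rt3 * √2)
  have h15 := (((ha.fun_mul hc).div_const 3).fun_neg).fun_sub hz
  have h16 := (((hb.fun_mul hc).div_const 3).fun_neg).fun_sub hw
  have h17 := (((hc.fun_pow 2).div_const 3).fun_sub ((hb.const_mul rt3).fun_mul hz)).fun_add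
    ((ha.const_mul rt3).fun_mul hw)
  have h24 := hb.const_mul (rt3 * √2)
  have h25 := ((ha.fun_mul hb).div_const 3).fun_sub (hc.const_mul rt3)
  have h26 := (hb.fun_pow 2).div_const 3
  have h27 := (((hb.const_mul 2).fun_mul hc).div_const 3).fun_add hw
  have h34 := ha.const_mul (rt3 * √2)
  have h35 := (ha.fun_pow 2).div_const 3
  have h36 := ((ha.fun_mul hb).div_const 3).fun_add (hc.const_mul rt3)
  have h37 := (((ha.const_mul 2).fun_mul hc).div_const 3).fun_add hz
  have h57 := hb.const_mul rt3
  have h67 := (ha.const_mul rt3).fun_neg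
  have h0 : HasDerivAt (fun _ : ℝ => (0 : ℝ)) 0 t := hasDerivAt_const t 0
  have h1 : HasDerivAt (fun _ : ℝ => (1 : ℝ)) 0 t := hasDerivAt_const t 1
  rw [hasDerivAt_matrix]
  intro i j
  fin_cases i <;> fin_cases j
  all_goals first
    | exact h0.congr_deriv (by simp [frameMat, unipMat, Matrix.mul_apply, Fin.sum_univ_seven])
    | exact h1.congr_deriv (by simp [frameMat, unipMat, Matrix.mul_apply, Fin.sum_univ_seven])
    | skip
  · exact h12.congr_deriv (by simp [frameMat, unipMat, Matrix.mul_apply, Fin.sum_univ_seven])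
  · exact h13.congr_deriv (by simp [frameMat, unipMat, Matrix.mul_apply, Fin.sum_univ_seven])
  · exact h14.congr_deriv (by
      simp [frameMat, unipMat, Matrix.mul_apply, Fin.sum_univ_seven]; ring)
  · exact h15.congr_deriv (by
      simp [frameMat, unipMat, Matrix.mul_apply, Fin.sum_univ_seven]
      grind)
  · exact h16.congr_deriv (by
      simp [frameMat, unipMat, Matrix.mul_apply, Fin.sum_univ_seven]
      grind)
  · exact h17.congr_deriv (by
      simp [frameMat, unipMat, Matrix.mul_apply, Fin.sum_univ_seven]
      grind)
  · exact h24.congr_deriv (by simp [frameMat, unipMat, Matrix.mul_apply, Fin.sum_univ_seven])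
  · exact h25.congr_deriv (by
      simp [frameMat, unipMat, Matrix.mul_apply, Fin.sum_univ_seven]
      grind)
  · exact h26.congr_deriv (by
      simp [frameMat, unipMat, Matrix.mul_apply, Fin.sum_univ_seven]
      grind)
  · exact h27.congr_deriv (by
      simp [frameMat, unipMat, Matrix.mul_apply, Fin.sum_univ_seven]
      grind)
  · exact h34.congr_deriv (by simp [frameMat, unipMat, Matrix.mul_apply, Fin.sum_univ_seven])
  · exact h35.congr_deriv (by
      simp [frameMat, unipMat, Matrix.mul_apply, Fin.sum_univ_seven]
      grind)
  · exact h36.congr_deriv (by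
      simp [frameMat, unipMat, Matrix.mul_apply, Fin.sum_univ_seven]
      grind)
  · exact h37.congr_deriv (by
      simp [frameMat, unipMat, Matrix.mul_apply, Fin.sum_univ_seven]
      grind)
  · exact h34.congr_deriv (by simp [frameMat, unipMat, Matrix.mul_apply, Fin.sum_univ_seven])
  · exact h24.congr_deriv (by simp [frameMat, unipMat, Matrix.mul_apply, Fin.sum_univ_seven])
  · exact h14.congr_deriv (by
      simp [frameMat, unipMat, Matrix.mul_apply, Fin.sum_univ_seven]
      grind)
  · exact h57.congr_deriv (by simp [frameMat, unipMat, Matrix.mul_apply, Fin.sum_univ_seven])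
  · exact h67.congr_deriv (by simp [frameMat, unipMat, Matrix.mul_apply, Fin.sum_univ_seven])

/-- The Levi factor acts on the nilpotent algebra by conjugation. Its weights are the exponential
coefficients of the metric, and its shear produces the combinations with e^{-v} tanh w. -/
theorem leviMat_mul_frameMat {P s x : ℝ} (hP : P ≠ 0) (hs : s ≠ 0) (z w a b c : ℝ) :
    leviMat P s x * frameMat ![0, 0, 0, z, -w, a, -b, c] =
      frameMat ![0, 0, 0, P ^ 3 * s⁻¹ * z, P ^ 3 * s * (x * z - w), P * s⁻¹ * a,
        P * s * (x * a - b), P ^ 2 * c] * leviMat P s x := by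
  ext i j
  fin_cases i <;> fin_cases j
  all_goals simp [frameMat, leviMat, Matrix.mul_apply, Fin.sum_univ_seven]
  all_goals try (field_simp)
  all_goals try ring

theorem frameMat_add (o p : Fin 8 → ℝ) : frameMat o + frameMat p = frameMat (o + p) := by
  ext i j
  fin_cases i <;> fin_cases j
  all_goals simp [frameMat]
  all_goals ring

theorem frameMat_smul (k : ℝ) (o : Fin 8 → ℝ) : frameMat (k • o) = k • frameMat o := by
  ext i j
  fin_cases i <;> fin_cases j
  all_goals simp [frameMat]
  all_goals ring

/-- The factors `rt3` and `√2` in `frameMat` are normalized so that the trace form is diagonal with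
a common factor 4; the coefficient 12 belongs to u. -/
theorem trace_frameMat_sq (o : Fin 8 → ℝ) :
    ((frameMat o + (frameMat o)ᵀ) * (frameMat o + (frameMat o)ᵀ)).trace =
      4 * (12 * o 0 ^ 2 + o 1 ^ 2 + o 2 ^ 2 + o 3 ^ 2 + o 4 ^ 2 + o 5 ^ 2 + o 6 ^ 2 + o 7 ^ 2) := by
  have hr := rt3_sq
  have ht := sqrt_two_mul_self
  rw [trace_sq_eq (Matrix.isSymm_add_transpose_self _)]
  simp [frameMat, Fin.sum_univ_seven]
  grind
end Model

/-! ### The target as a homogeneous space of G₂₍₂₎, and the invariant forms. -/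

section TargetModel

/-- `e^{-u}`. -/
def scaleP (X : Target) : ℝ := Real.exp (-X 0)

/-- `(e^v cosh w)^{1/2}`. -/
def scaleS (X : Target) : ℝ := Real.exp ((X 1 + Real.log (Real.cosh (X 2))) / 2)

/-- `e^{-v} tanh w`. -/
def shear (X : Target) : ℝ := Real.exp (-X 1) * (Real.sinh (X 2) / Real.cosh (X 2))

theorem scaleP_pos (X : Target) : 0 < scaleP X := Real.exp_pos _

theorem scaleS_pos (X : Target) : 0 < scaleS X := Real.exp_pos _

theorem scaleS_sq (X : Target) : scaleS X ^ 2 = Real.exp (X 1) * Real.cosh (X 2) := by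
  rw [scaleS, ← Real.exp_nat_mul, Nat.cast_ofNat, mul_div_cancel₀ _ (two_ne_zero), Real.exp_add,
    Real.exp_log (Real.cosh_pos _)]

/-- The matrix representing a point of `G₂₍₂₎/SO(4)`. -/
def ghat (B : Horizon) (X : Target) : Matrix (Fin 7) (Fin 7) ℝ :=
  leviMat (scaleP X) (scaleS X) (shear X) *
    unipMat (psiBar1 X) (psiBar2 B X) (B.p * X 5) (B.p * zetaBar1 X) (B.p * zetaBar2 B X)

/-- The orthogonal coframe of `G`. -/
def coframe (B : Horizon) (X Y : Target) : Fin 8 → ℝ :=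
  ![Y 0, Y 1 + Real.sinh (X 2) / Real.cosh (X 2) * Y 2,
    -Real.sinh (X 2) * Y 1 + Y 2 / Real.cosh (X 2),
    scaleP X ^ 3 * (scaleS X)⁻¹ * (B.p * ThetaBar1 X Y),
    scaleP X ^ 3 * scaleS X * (shear X * (B.p * ThetaBar1 X Y) - B.p * ThetaBar2 B X Y),
    scaleP X * (scaleS X)⁻¹ * psiBar1 Y,
    scaleP X * scaleS X * (shear X * psiBar1 Y - psiBar2 B Y),
    scaleP X ^ 2 * (B.p * Upsilon X Y)]

/-- Only the (v, w) block requires an argument: a rotation of the orthonormal pair cosh w dv, dw,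
based on cosh² = 1 + sinh², replaces it by the pair that occurs in the upper triangular model. -/
theorem G_eq_coframe (B : Horizon) (X Y : Target) :
    G B X Y = 12 * coframe B X Y 0 ^ 2 + coframe B X Y 1 ^ 2 + coframe B X Y 2 ^ 2
      + coframe B X Y 3 ^ 2 + coframe B X Y 4 ^ 2 + coframe B X Y 5 ^ 2 + coframe B X Y 6 ^ 2
      + coframe B X Y 7 ^ 2 := by
  have hc := Real.cosh_pos (X 2)
  have hcs := Real.cosh_sq (X 2)
  have hs2 := scaleS_sq X
  have hP : ∀ k : ℕ, scaleP X ^ k = Real.exp (-k * X 0) := fun k => by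
    rw [scaleP, ← Real.exp_nat_mul]; ring_nf
  have e1 : ∀ k : ℕ, Real.exp (-k * X 0 - X 1) / Real.cosh (X 2) =
      scaleP X ^ k * ((scaleS X)⁻¹) ^ 2 := fun k => by
    rw [inv_pow, hs2, hP, Real.exp_sub]
    field_simp
  have e2 : ∀ k : ℕ, Real.exp (-k * X 0 + X 1) * Real.cosh (X 2) =
      scaleP X ^ k * (scaleS X) ^ 2 := fun k => by
    rw [hs2, hP, Real.exp_add]
    ring
  have e3 := hP 4
  have e61 := e1 6
  have e62 := e2 6
  have e21 := e1 2
  have e22 := e2 2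
  push_cast at e3 e61 e62 e21 e22
  have hvw : Real.cosh (X 2) ^ 2 * Y 1 ^ 2 + Y 2 ^ 2 =
      (Y 1 + Real.sinh (X 2) / Real.cosh (X 2) * Y 2) ^ 2 +
        (-Real.sinh (X 2) * Y 1 + Y 2 / Real.cosh (X 2)) ^ 2 := by
    field_simp
    linear_combination (Real.cosh (X 2) ^ 2 * Y 1 ^ 2 + Y 2 ^ 2) * hcs
  simp only [G]
  rw [e61, e62, e21, e22, ← e3, Real.tanh_eq_sinh_div_cosh]
  simp only [coframe, shear]
  simp
  linear_combination hvw

/-- The link between metric and matrices: the coframe is the right logarithmic derivative of `ghat`.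
The Levi factor contributes its own derivative and conjugates that of the unipotent factor. -/
theorem hasDerivAt_ghat (B : Horizon) {γ : ℝ → Target} {Y : Target} {t : ℝ}
    (h : HasDerivAt γ Y t) :
    HasDerivAt (fun t => ghat B (γ t)) (frameMat (coframe B (γ t) Y) * ghat B (γ t)) t := by
  have hi := hasDerivAt_pi.1 h
  have hc := Real.cosh_pos (γ t 2)
  have hcs := Real.cosh_sq (γ t 2)
  have hP : HasDerivAt (fun t => scaleP (γ t)) (-(Y 0) * scaleP (γ t)) t := by
    refine ((hi 0).fun_neg.exp).congr_deriv ?_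
    rw [scaleP]; ring
  have hs : HasDerivAt (fun t => scaleS (γ t))
      ((Y 1 + Real.sinh (γ t 2) / Real.cosh (γ t 2) * Y 2) / 2 * scaleS (γ t)) t := by
    refine ((((hi 1).fun_add ((hi 2).cosh.log hc.ne')).div_const 2).exp).congr_deriv ?_
    rw [scaleS]; ring
  have hx : HasDerivAt (fun t => shear (γ t)) (-(Real.exp (-(γ t 1)) * (Real.sinh (γ t 2) /
      Real.cosh (γ t 2))) * Y 1 + Real.exp (-(γ t 1)) * Y 2 / Real.cosh (γ t 2) ^ 2) t := by
    refine (((hi 1).fun_neg.exp).fun_mul ((hi 2).sinh.fun_div (hi 2).cosh hc.ne')).congr_deriv ?_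
    field_simp
    linear_combination (Y 2) * hcs
  have hL := hasDerivAt_leviMat hP hs hx (scaleP_pos _).ne' (scaleS_pos _).ne'
  have hb : HasDerivAt (fun t => psiBar2 B (γ t)) (psiBar2 B Y) t :=
    ((hi 6).const_mul B.q).fun_add ((hi 7).const_mul B.p)
  have hz1 : HasDerivAt (fun t => B.p * zetaBar1 (γ t)) (B.p * zetaBar1 Y) t :=
    (hi 3).const_mul B.p
  have hz2 : HasDerivAt (fun t => B.p * zetaBar2 B (γ t)) (B.p * zetaBar2 B Y) t :=
    (((hi 3).const_mul B.q).fun_add ((hi 4).const_mul B.p)).const_mul B.p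
  have hN := hasDerivAt_unipMat (hi 6) hb ((hi 5).const_mul B.p) hz1 hz2
  refine (hL.mul hN).congr_deriv ?_
  rw [← mul_assoc (leviMat _ _ _), leviMat_mul_frameMat (scaleP_pos _).ne' (scaleS_pos _).ne',
    mul_assoc, mul_assoc, ← add_mul, frameMat_add]
  congr 2
  have hsx : scaleS (γ t) ^ 2 * (-(Real.exp (-(γ t 1)) * (Real.sinh (γ t 2) /
      Real.cosh (γ t 2))) * Y 1 + Real.exp (-(γ t 1)) * Y 2 / Real.cosh (γ t 2) ^ 2) =
      -Real.sinh (γ t 2) * Y 1 + Y 2 / Real.cosh (γ t 2) := by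
    rw [scaleS_sq, Real.exp_neg]
    have := Real.exp_pos (γ t 1)
    field_simp
  have hr3 : (3 * √3)⁻¹ = rt3 / 3 := by rw [rt3, mul_inv]; ring
  have h1 : B.p * zetaBar1 Y + psiBar1 (γ t) * (B.p * Y 5 + (psiBar1 (γ t) * psiBar2 B Y
      - psiBar2 B (γ t) * Y 6) * (rt3 / 3)) = B.p * ThetaBar1 (γ t) Y := by
    simp only [zetaBar1, psiBar1, psiBar2, ThetaBar1, Theta1, auxForm, div_eq_mul_inv _ (3 * √3), hr3]
    ring
  have h2 : B.p * zetaBar2 B Y + psiBar2 B (γ t) * (B.p * Y 5 + (psiBar1 (γ t) * psiBar2 B Y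
      - psiBar2 B (γ t) * Y 6) * (rt3 / 3)) = B.p * ThetaBar2 B (γ t) Y := by
    simp only [zetaBar2, psiBar1, psiBar2, ThetaBar2, Theta1, Theta2, auxForm,
      div_eq_mul_inv _ (3 * √3), hr3]
    ring
  have h3 : B.p * Y 5 + (psiBar1 (γ t) * psiBar2 B Y - psiBar2 B (γ t) * Y 6) * rt3 =
      B.p * Upsilon (γ t) Y := by
    simp only [psiBar1, psiBar2, Upsilon, div_eq_mul_inv _ (√3), rt3]
    ring
  simp only [psiBar1] at h1 h2 h3
  rw [hsx, h1, h2, h3]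
  ext i
  fin_cases i <;> simp [coframe, psiBar1]

/-! ### The invariant forms of `G₂₍₂₎` -/

/-- The invariant quadratic form. -/
def formJ : Matrix (Fin 7) (Fin 7) ℝ :=
  !![0, 0, 0, 0, 0, 0, 1;
     0, 0, 0, 0, 0, 1, 0;
     0, 0, 0, 0, 1, 0, 0;
     0, 0, 0, -1, 0, 0, 0;
     0, 0, 1, 0, 0, 0, 0;
     0, 1, 0, 0, 0, 0, 0;
     1, 0, 0, 0, 0, 0, 0]

/-- The elementary alternating three-form. -/
def alt3 (i j k : Fin 7) (x y z : Fin 7 → ℝ) : ℝ :=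
  x i * (y j * z k - y k * z j) - x j * (y i * z k - y k * z i) + x k * (y i * z j - y j * z i)

/-- The invariant three-form. -/
def form3 (x y z : Fin 7 → ℝ) : ℝ :=
  -alt3 0 3 6 x y z + alt3 1 3 5 x y z + alt3 2 3 4 x y z
    + √2 * (alt3 1 2 6 x y z - alt3 0 4 5 x y z)

theorem formJ_mul_self : formJ * formJ = 1 := by
  ext i j
  fin_cases i <;> fin_cases j <;> simp [formJ, Matrix.mul_apply, Fin.sum_univ_seven]

theorem formJ_transpose : formJᵀ = formJ := by
  ext i j
  fin_cases i <;> fin_cases j <;> simp [formJ]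

theorem frameMat_formJ (o : Fin 8 → ℝ) : (frameMat o)ᵀ * formJ + formJ * frameMat o = 0 := by
  ext i j
  fin_cases i <;> fin_cases j
  all_goals simp [formJ, frameMat, Matrix.mul_apply, Fin.sum_univ_seven]

theorem form3_formJ (x y z : Fin 7 → ℝ) :
    form3 (formJ *ᵥ x) (formJ *ᵥ y) (formJ *ᵥ z) = form3 x y z := by
  simp [form3, alt3, formJ, Matrix.mulVec, dotProduct, Fin.sum_univ_seven]
  ring

/-- `M` acts on `form3` as a derivation. -/
def IsDerivation (M : Matrix (Fin 7) (Fin 7) ℝ) : Prop :=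
  ∀ x y z, form3 (M *ᵥ x) y z + form3 x (M *ᵥ y) z + form3 x y (M *ᵥ z) = 0

theorem form3_add_left (x x' y z : Fin 7 → ℝ) :
    form3 (x + x') y z = form3 x y z + form3 x' y z := by
  simp only [form3, alt3, Pi.add_apply]; ring

theorem form3_add_mid (x y y' z : Fin 7 → ℝ) :
    form3 x (y + y') z = form3 x y z + form3 x y' z := by
  simp only [form3, alt3, Pi.add_apply]; ring

theorem form3_add_right (x y z z' : Fin 7 → ℝ) :
    form3 x y (z + z') = form3 x y z + form3 x y z' := by
  simp only [form3, alt3, Pi.add_apply]; ring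

theorem form3_smul_left (k : ℝ) (x y z : Fin 7 → ℝ) : form3 (k • x) y z = k * form3 x y z := by
  simp only [form3, alt3, Pi.smul_apply, smul_eq_mul]; ring

theorem form3_smul_mid (k : ℝ) (x y z : Fin 7 → ℝ) : form3 x (k • y) z = k * form3 x y z := by
  simp only [form3, alt3, Pi.smul_apply, smul_eq_mul]; ring

theorem form3_smul_right (k : ℝ) (x y z : Fin 7 → ℝ) : form3 x y (k • z) = k * form3 x y z := by
  simp only [form3, alt3, Pi.smul_apply, smul_eq_mul]; ring

theorem isDerivation_frameMat (o : Fin 8 → ℝ) : IsDerivation (frameMat o) := by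
  intro x y z
  have ht := sqrt_two_mul_self
  simp only [form3, alt3, frameMat, Matrix.mulVec, dotProduct, Fin.sum_univ_seven]
  simp
  generalize √2 = q at *
  ring_nf
  have : q ^ 2 = 2 := by rw [sq]; exact ht
  simp only [this]
  ring

theorem IsDerivation.add {M N : Matrix (Fin 7) (Fin 7) ℝ} (hM : IsDerivation M)
    (hN : IsDerivation N) : IsDerivation (M + N) := by
  intro x y z
  simp only [Matrix.add_mulVec, form3_add_left, form3_add_mid, form3_add_right]
  linarith [hM x y z, hN x y z]

/-- On the Lie algebra of the quadratic form, transposition is conjugation by `formJ` up to sign. -/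
theorem frameMat_transpose (o : Fin 8 → ℝ) :
    (frameMat o)ᵀ = -(formJ * frameMat o * formJ) := by
  have h := eq_neg_of_add_eq_zero_left (frameMat_formJ o)
  calc (frameMat o)ᵀ = (frameMat o)ᵀ * formJ * formJ := by
        rw [mul_assoc, formJ_mul_self, mul_one]
    _ = _ := by rw [h, neg_mul]

/-- Because `formJ` itself preserves the three-form, conjugating by it preserves derivations. The
Lie algebra is therefore closed under transposition, and symmetrized elements remain in it. -/
theorem isDerivation_frameMat_transpose (o : Fin 8 → ℝ) : IsDerivation (frameMat o)ᵀ := by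
  intro x y z
  have key := isDerivation_frameMat o (formJ *ᵥ x) (formJ *ᵥ y) (formJ *ᵥ z)
  have hJ : ∀ v : Fin 7 → ℝ, (frameMat o)ᵀ *ᵥ v =
      (-1 : ℝ) • (formJ *ᵥ (frameMat o *ᵥ (formJ *ᵥ v))) := by
    intro v
    rw [frameMat_transpose, Matrix.neg_mulVec, Matrix.mulVec_mulVec, Matrix.mulVec_mulVec, neg_smul,
      one_smul, mul_assoc]
  have hJJ : ∀ v : Fin 7 → ℝ, v = formJ *ᵥ (formJ *ᵥ v) := by
    intro v
    rw [Matrix.mulVec_mulVec, formJ_mul_self, one_mulVec]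
  rw [hJ x, hJ y, hJ z, form3_smul_left, form3_smul_mid, form3_smul_right]
  have e1 := form3_formJ (frameMat o *ᵥ (formJ *ᵥ x)) (formJ *ᵥ y) (formJ *ᵥ z)
  have e2 := form3_formJ (formJ *ᵥ x) (frameMat o *ᵥ (formJ *ᵥ y)) (formJ *ᵥ z)
  have e3 := form3_formJ (formJ *ᵥ x) (formJ *ᵥ y) (frameMat o *ᵥ (formJ *ᵥ z))
  rw [← hJJ y, ← hJJ z] at e1
  rw [← hJJ x, ← hJJ z] at e2
  rw [← hJJ x, ← hJJ y] at e3
  rw [e1, e2, e3]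
  linarith

end TargetModel

/-! ### The group preserving both forms, and logarithms of its symmetric elements. -/

section InvariantForms

/-- Preservation of both invariant forms. -/
def IsG2 (k : Matrix (Fin 7) (Fin 7) ℝ) : Prop :=
  kᵀ * formJ * k = formJ ∧ ∀ x y z, form3 (k *ᵥ x) (k *ᵥ y) (k *ᵥ z) = form3 x y z

theorem IsG2.mul {k l : Matrix (Fin 7) (Fin 7) ℝ} (hk : IsG2 k) (hl : IsG2 l) : IsG2 (k * l) := by
  refine ⟨?_, fun x y z => ?_⟩
  · calc (k * l)ᵀ * formJ * (k * l) = lᵀ * (kᵀ * formJ * k) * l := by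
          rw [transpose_mul]; simp only [mul_assoc]
      _ = formJ := by rw [hk.1, hl.1]
  · simp only [← Matrix.mulVec_mulVec]
    rw [hk.2, hl.2]

/-- The inverse of an element of `G₂₍₂₎`. -/
def jInv (k : Matrix (Fin 7) (Fin 7) ℝ) : Matrix (Fin 7) (Fin 7) ℝ := formJ * kᵀ * formJ

theorem IsG2.jInv_mul {k : Matrix (Fin 7) (Fin 7) ℝ} (hk : IsG2 k) : jInv k * k = 1 := by
  calc jInv k * k = formJ * (kᵀ * formJ * k) := by rw [jInv]; simp only [mul_assoc]
    _ = 1 := by rw [hk.1, formJ_mul_self]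

theorem IsG2.mul_jInv {k : Matrix (Fin 7) (Fin 7) ℝ} (hk : IsG2 k) : k * jInv k = 1 :=
  mul_eq_one_comm.1 hk.jInv_mul

theorem IsG2.inv {k : Matrix (Fin 7) (Fin 7) ℝ} (hk : IsG2 k) : IsG2 (jInv k) := by
  refine ⟨?_, fun x y z => ?_⟩
  · calc (jInv k)ᵀ * formJ * jInv k = (jInv k)ᵀ * (kᵀ * formJ * k) * jInv k := by rw [hk.1]
      _ = (k * jInv k)ᵀ * formJ * (k * jInv k) := by rw [transpose_mul]; simp only [mul_assoc]
      _ = formJ := by rw [hk.mul_jInv]; simp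
  · rw [← hk.2]
    simp only [Matrix.mulVec_mulVec, hk.mul_jInv, one_mulVec]

theorem isG2_formJ : IsG2 formJ :=
  ⟨by rw [formJ_transpose, formJ_mul_self, one_mul], form3_formJ⟩

theorem IsG2.transpose {k : Matrix (Fin 7) (Fin 7) ℝ} (hk : IsG2 k) : IsG2 kᵀ := by
  have : kᵀ = formJ * jInv k * formJ := by
    rw [jInv]
    calc kᵀ = (formJ * formJ) * kᵀ * (formJ * formJ) := by rw [formJ_mul_self]; simp
      _ = _ := by simp only [mul_assoc]
  rw [this]
  exact (isG2_formJ.mul hk.inv).mul isG2_formJ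

theorem form3_hasDerivAt {x y z : ℝ → Fin 7 → ℝ} {x' y' z' : Fin 7 → ℝ} {t : ℝ}
    (hx : HasDerivAt x x' t) (hy : HasDerivAt y y' t) (hz : HasDerivAt z z' t) :
    HasDerivAt (fun s => form3 (x s) (y s) (z s))
      (form3 x' (y t) (z t) + form3 (x t) y' (z t) + form3 (x t) (y t) z') t := by
  have hxi := hasDerivAt_pi.1 hx
  have hyi := hasDerivAt_pi.1 hy
  have hzi := hasDerivAt_pi.1 hz
  have h3 : ∀ i j k, HasDerivAt (fun s => alt3 i j k (x s) (y s) (z s))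
      (alt3 i j k x' (y t) (z t) + alt3 i j k (x t) y' (z t) + alt3 i j k (x t) (y t) z') t := by
    intro i j k
    have m : ∀ a b, HasDerivAt (fun s => y s a * z s b - y s b * z s a)
        (y' a * z t b + y t a * z' b - (y' b * z t a + y t b * z' a)) t := fun a b =>
      ((hyi a).fun_mul (hzi b)).fun_sub ((hyi b).fun_mul (hzi a))
    refine ((((hxi i).fun_mul (m j k)).fun_sub ((hxi j).fun_mul (m i k))).fun_add
      ((hxi k).fun_mul (m i j))).congr_deriv ?_
    simp only [alt3]; ring
  refine (((((h3 0 3 6).fun_neg).fun_add (h3 1 3 5)).fun_add (h3 2 3 4)).fun_add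
    (((h3 1 2 6).fun_sub (h3 0 4 5)).const_mul √2)).congr_deriv ?_
  simp only [form3]; ring

theorem hasDerivAt_mulVec {K : ℝ → Matrix (Fin 7) (Fin 7) ℝ} {K' : Matrix (Fin 7) (Fin 7) ℝ} {t : ℝ}
    (h : HasDerivAt K K' t) (x : Fin 7 → ℝ) : HasDerivAt (fun s => K s *ᵥ x) (K' *ᵥ x) t := by
  rw [hasDerivAt_pi]
  intro i
  simp only [Matrix.mulVec, dotProduct]
  exact HasDerivAt.fun_sum fun j _ => (hasDerivAt_matrix.1 h i j).mul_const _

/-- Along a flow generated by infinitesimal symmetries both forms have zero derivative, so they keep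
their values at the identity. -/
theorem isG2_of_flow {K M : ℝ → Matrix (Fin 7) (Fin 7) ℝ}
    (hK : ∀ t, HasDerivAt K (M t * K t) t) (h0 : K 0 = 1)
    (hJ : ∀ t, (M t)ᵀ * formJ + formJ * M t = 0) (h3 : ∀ t, IsDerivation (M t)) (t : ℝ) :
    IsG2 (K t) := by
  constructor
  · have hd : ∀ s, HasDerivAt (fun s => (K s)ᵀ * formJ * K s) 0 s := by
      intro s
      have h1 : HasDerivAt (fun s => (K s)ᵀ * formJ * K s)
          ((M s * K s)ᵀ * formJ * K s + (K s)ᵀ * formJ * (M s * K s)) s :=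
        ((hasDerivAt_transpose (hK s)).mul_const formJ).mul (hK s)
      refine h1.congr_deriv ?_
      calc _ = (K s)ᵀ * ((M s)ᵀ * formJ + formJ * M s) * K s := by
            rw [transpose_mul, mul_add, add_mul]; simp only [mul_assoc]
        _ = 0 := by rw [hJ, mul_zero, zero_mul]
    have hc := is_const_of_deriv_eq_zero (f := fun s => (K s)ᵀ * formJ * K s)
      (fun s => (hd s).differentiableAt) (fun s => (hd s).deriv) t 0
    simpa [h0] using hc
  · intro x y z
    have hd : ∀ s, HasDerivAt (fun s => form3 (K s *ᵥ x) (K s *ᵥ y) (K s *ᵥ z)) 0 s := by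
      intro s
      refine (form3_hasDerivAt (hasDerivAt_mulVec (hK s) x) (hasDerivAt_mulVec (hK s) y)
        (hasDerivAt_mulVec (hK s) z)).congr_deriv ?_
      simp only [← Matrix.mulVec_mulVec]
      exact h3 s _ _ _
    have hc := is_const_of_deriv_eq_zero
      (fun s => (hd s).differentiableAt) (fun s => (hd s).deriv) t 0
    simpa [h0] using hc

theorem ghat_zero (B : Horizon) : ghat B 0 = 1 := by
  ext i j
  fin_cases i <;> fin_cases j
  all_goals simp [ghat, leviMat, unipMat, scaleP, scaleS, shear, psiBar1, psiBar2, zetaBar1,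
    zetaBar2, Matrix.mul_apply, Fin.sum_univ_seven]

/-- The ray t ↦ tX joins the base point to X, and along it the logarithmic derivative of `ghat` lies
in the solvable subalgebra. -/
theorem isG2_ghat (B : Horizon) (X : Target) : IsG2 (ghat B X) := by
  have hγ : ∀ t : ℝ, HasDerivAt (fun t : ℝ => t • X) X t := fun t => by
    simpa using (hasDerivAt_id t).smul_const X
  have := isG2_of_flow (K := fun t => ghat B (t • X)) (fun t => hasDerivAt_ghat B (hγ t))
    (by simp [ghat_zero]) (fun t => frameMat_formJ _) (fun t => isDerivation_frameMat _) 1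
  simpa using this

theorem isG2_exp {o : Fin 8 → ℝ} (t : ℝ) :
    IsG2 (NormedSpace.exp (t • (frameMat o + (frameMat o)ᵀ))) := by
  refine isG2_of_flow (K := fun t : ℝ => NormedSpace.exp (t • (frameMat o + (frameMat o)ᵀ)))
    (M := fun _ => frameMat o + (frameMat o)ᵀ) (fun t => ?_) (by simp) (fun t => ?_)
    (fun t => (isDerivation_frameMat o).add (isDerivation_frameMat_transpose o)) t
  · exact hasDerivAt_exp_smul_const' (𝕂 := ℝ) _ t
  · have h1 := frameMat_formJ o
    have h2 : frameMat o * formJ + formJ * (frameMat o)ᵀ = 0 := by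
      calc frameMat o * formJ + formJ * (frameMat o)ᵀ
          = (formJ * formJ) * frameMat o * formJ + formJ * (frameMat o)ᵀ * (formJ * formJ) := by
            rw [formJ_mul_self, one_mul, mul_one]
        _ = formJ * ((frameMat o)ᵀ * formJ + formJ * frameMat o) * formJ := by
            rw [mul_add, add_mul, add_comm]; simp only [mul_assoc]
        _ = 0 := by rw [h1, mul_zero, zero_mul]
    rw [transpose_add, transpose_transpose, add_mul, mul_add]
    calc _ = ((frameMat o)ᵀ * formJ + formJ * frameMat o) +
          (frameMat o * formJ + formJ * (frameMat o)ᵀ) := by abel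
      _ = 0 := by rw [h1, h2, add_zero]

theorem isSPD_gram {n : Type*} [Fintype n] [DecidableEq n] {k l : Matrix n n ℝ} (h : l * k = 1) :
    IsSPD (kᵀ * k) := by
  refine ⟨by simp [Matrix.IsSymm, transpose_mul], ?_⟩
  set C := ∑ i, ∑ j, l i j ^ 2
  have hC : 0 ≤ C := Finset.sum_nonneg fun i _ => Finset.sum_nonneg fun j _ => sq_nonneg _
  -- `C` is the squared Frobenius norm of the inverse. Adding 1 keeps the bound meaningful for an
  -- empty index type, where `C` vanishes.
  refine ⟨(C + 1)⁻¹, by positivity, fun x => ?_⟩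
  have e1 : x ⬝ᵥ ((kᵀ * k) *ᵥ x) = (k *ᵥ x) ⬝ᵥ (k *ᵥ x) := by
    rw [← Matrix.mulVec_mulVec, Matrix.dotProduct_mulVec, Matrix.vecMul_transpose]
  have e2 : x ⬝ᵥ x ≤ C * ((k *ᵥ x) ⬝ᵥ (k *ᵥ x)) := by
    have hx : x = l *ᵥ (k *ᵥ x) := by rw [Matrix.mulVec_mulVec, h, one_mulVec]
    set y := k *ᵥ x
    rw [hx]
    calc (l *ᵥ y) ⬝ᵥ (l *ᵥ y) = ∑ i, (∑ j, l i j * y j) ^ 2 := by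
          simp only [dotProduct, Matrix.mulVec, sq]
      _ ≤ ∑ i, (∑ j, l i j ^ 2) * ∑ j, y j ^ 2 :=
          Finset.sum_le_sum fun i _ => Finset.sum_mul_sq_le_sq_mul_sq _ _ _
      _ = C * (y ⬝ᵥ y) := by rw [← Finset.sum_mul]; simp only [dotProduct, sq, C]
  have e3 : 0 ≤ (k *ᵥ x) ⬝ᵥ (k *ᵥ x) := by
    simp only [dotProduct]; exact Finset.sum_nonneg fun i _ => mul_self_nonneg _
  rw [e1, inv_mul_le_iff₀ (by positivity)]
  linarith

/-! ### Logarithms -/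

theorem form3_sum_left {ι : Type*} (s : Finset ι) (f : ι → Fin 7 → ℝ) (y z : Fin 7 → ℝ) :
    form3 (∑ i ∈ s, f i) y z = ∑ i ∈ s, form3 (f i) y z :=
  map_sum (AddMonoidHom.mk' (fun x => form3 x y z) fun _ _ => form3_add_left _ _ _ _) _ _

theorem form3_sum_mid {ι : Type*} (s : Finset ι) (f : ι → Fin 7 → ℝ) (x z : Fin 7 → ℝ) :
    form3 x (∑ i ∈ s, f i) z = ∑ i ∈ s, form3 x (f i) z :=
  map_sum (AddMonoidHom.mk' (fun y => form3 x y z) fun _ _ => form3_add_mid _ _ _ _) _ _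

theorem form3_sum_right {ι : Type*} (s : Finset ι) (f : ι → Fin 7 → ℝ) (x y : Fin 7 → ℝ) :
    form3 x y (∑ i ∈ s, f i) = ∑ i ∈ s, form3 x y (f i) :=
  map_sum (AddMonoidHom.mk' (fun z => form3 x y z) fun _ _ => form3_add_right _ _ _ _) _ _

theorem mulVec_spectral (O : Matrix (Fin 7) (Fin 7) ℝ) (l : Fin 7 → ℝ) (x : Fin 7 → ℝ) :
    (O * diagonal l * Oᵀ) *ᵥ x = ∑ i, (l i * (Oᵀ *ᵥ x) i) • O.col i := by
  have h : ∀ y : Fin 7 → ℝ, O *ᵥ y = ∑ i, y i • O.col i := by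
    intro y
    ext j
    simp [Matrix.mulVec, dotProduct, mul_comm]
  rw [← Matrix.mulVec_mulVec, ← Matrix.mulVec_mulVec, h]
  exact Finset.sum_congr rfl fun i _ => by rw [Matrix.mulVec_diagonal]

theorem expand_spectral {O : Matrix (Fin 7) (Fin 7) ℝ} (h : O * Oᵀ = 1) (x : Fin 7 → ℝ) :
    x = ∑ i, (Oᵀ *ᵥ x) i • O.col i := by
  have := mulVec_spectral O (fun _ => 1) x
  rw [show diagonal (fun _ : Fin 7 => (1 : ℝ)) = 1 from diagonal_one, mul_one, h, one_mulVec] at this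
  simpa using this

/-- In an eigenbasis of `A`, invariance of the three-form under exp A says that every component is
either zero or satisfies exp(l i + l j + l k) = 1. The exponents are real, so their sum vanishes in
the second case; this is infinitesimal invariance. -/
theorem isDerivation_of_exp {A : Matrix (Fin 7) (Fin 7) ℝ} (hA : A.IsSymm)
    (hG : IsG2 (NormedSpace.exp A)) : IsDerivation A := by
  obtain ⟨O, l, h1, h2, rfl⟩ := exists_spectral hA
  rw [exp_spectral h2] at hG
  have hv : ∀ (m : Fin 7 → ℝ) i, (O * diagonal m * Oᵀ) *ᵥ O.col i = m i • O.col i := by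
    intro m i
    rw [mulVec_spectral]
    have : ∀ j, (Oᵀ *ᵥ O.col i) j = if j = i then 1 else 0 := by
      intro j
      have := congrFun (congrFun h1 j) i
      rw [Matrix.one_apply, Matrix.mul_apply] at this
      exact this
    simp [this]
  have key : ∀ i j k, (l i + l j + l k) * form3 (O.col i) (O.col j) (O.col k) = 0 := by
    intro i j k
    have := hG.2 (O.col i) (O.col j) (O.col k)
    rw [hv, hv, hv, form3_smul_left, form3_smul_mid, form3_smul_right, ← mul_assoc, ← mul_assoc,
      ← Real.exp_add, ← Real.exp_add] at this
    by_cases h0 : form3 (O.col i) (O.col j) (O.col k) = 0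
    · rw [h0, mul_zero]
    · have h3 : Real.exp (l i + l j + l k) = 1 := mul_right_cancel₀ h0 (by rw [this, one_mul])
      rw [Real.exp_eq_one_iff] at h3
      rw [h3, zero_mul]
  intro x y z
  have ex := expand_spectral h2 x
  have ey := expand_spectral h2 y
  have ez := expand_spectral h2 z
  rw [mulVec_spectral, mulVec_spectral, mulVec_spectral]
  set xa := fun i => (Oᵀ *ᵥ x) i with hxa
  set ya := fun i => (Oᵀ *ᵥ y) i with hya
  set za := fun i => (Oᵀ *ᵥ z) i with hza
  change x = ∑ i, xa i • O.col i at ex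
  change y = ∑ i, ya i • O.col i at ey
  change z = ∑ i, za i • O.col i at ez
  change form3 (∑ i, (l i * xa i) • O.col i) y z + form3 x (∑ i, (l i * ya i) • O.col i) z
    + form3 x y (∑ i, (l i * za i) • O.col i) = 0
  have full : ∀ a b c : Fin 7 → ℝ, form3 (∑ i, a i • O.col i) (∑ i, b i • O.col i)
      (∑ i, c i • O.col i) = ∑ i, ∑ j, ∑ k, a i * b j * c k *
        form3 (O.col i) (O.col j) (O.col k) := by
    intro a b c
    rw [form3_sum_left]
    refine Finset.sum_congr rfl fun i _ => ?_
    rw [form3_sum_mid]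
    refine Finset.sum_congr rfl fun j _ => ?_
    rw [form3_sum_right]
    refine Finset.sum_congr rfl fun k _ => ?_
    rw [form3_smul_left, form3_smul_mid, form3_smul_right]
    ring
  clear_value xa ya za
  rw [ex, ey, ez, full xa ya, full _ ya za, full xa _ za]
  simp only [← Finset.sum_add_distrib]
  refine Finset.sum_eq_zero fun i _ => Finset.sum_eq_zero fun j _ => Finset.sum_eq_zero fun k _ => ?_
  linear_combination (xa i * ya j * za k) * key i j k

/-- The same argument with two eigenvalues in place of three. -/
theorem formJ_anticomm_of_exp {A : Matrix (Fin 7) (Fin 7) ℝ} (hA : A.IsSymm)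
    (hG : IsG2 (NormedSpace.exp A)) : A * formJ + formJ * A = 0 := by
  have hs : (NormedSpace.exp A)ᵀ = NormedSpace.exp A := hA.exp
  have hJ := hG.1
  rw [hs] at hJ
  obtain ⟨O, l, h1, h2, rfl⟩ := exists_spectral hA
  rw [exp_spectral h2] at hJ
  set R := Oᵀ * formJ * O with hR
  have hRJ : formJ = O * R * Oᵀ := by
    calc formJ = (O * Oᵀ) * formJ * (O * Oᵀ) := by rw [h2]; simp
      _ = _ := by rw [hR]; simp only [mul_assoc]
  have e1 : diagonal (fun i => Real.exp (l i)) * R * diagonal (fun i => Real.exp (l i)) = R := by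
    calc _ = (Oᵀ * O) * diagonal (fun i => Real.exp (l i)) * R *
          diagonal (fun i => Real.exp (l i)) * (Oᵀ * O) := by rw [h1]; simp
      _ = Oᵀ * (O * diagonal (fun i => Real.exp (l i)) * Oᵀ * formJ *
          (O * diagonal (fun i => Real.exp (l i)) * Oᵀ)) * O := by
          rw [hR]; simp only [mul_assoc]
      _ = R := by rw [hJ]
  have e2 : diagonal l * R + R * diagonal l = 0 := by
    ext i j
    have := congrFun (congrFun e1 i) j
    rw [Matrix.mul_diagonal, Matrix.diagonal_mul] at this
    rw [Matrix.add_apply, Matrix.mul_diagonal, Matrix.diagonal_mul, Matrix.zero_apply]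
    by_cases h0 : R i j = 0
    · rw [h0]; ring
    · have h3 : Real.exp (l i + l j) = 1 := mul_right_cancel₀ h0 (by
        rw [Real.exp_add, one_mul]; linarith)
      rw [Real.exp_eq_one_iff] at h3
      linear_combination R i j * h3
  calc _ = O * (diagonal l * R + R * diagonal l) * Oᵀ := by
        rw [hRJ, mul_add, add_mul]
        congr 1
        · calc _ = O * diagonal l * (Oᵀ * O) * R * Oᵀ := by simp only [mul_assoc]
            _ = _ := by rw [h1]; simp only [mul_assoc, one_mul]
        · calc _ = O * R * (Oᵀ * O) * diagonal l * Oᵀ := by simp only [mul_assoc]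
            _ = _ := by rw [h1]; simp only [mul_assoc, one_mul]
    _ = 0 := by rw [e2, mul_zero, zero_mul]

/-- Coordinates of a symmetric element of `𝔤₂₍₂₎`. -/
def frameCoord (A : Matrix (Fin 7) (Fin 7) ℝ) : Fin 8 → ℝ :=
  ![-A 0 0 / 4, A 1 1 - A 0 0 / 2, -A 1 2, -A 0 4, A 0 5, √3 * A 0 1, √3 * A 0 2,
    √3 / 2 * √2 * A 0 3]

/-- A counterpart of the Iwasawa decomposition: the symmetric part of the Lie algebra is exactly the
symmetrization of the eight-dimensional solvable subalgebra. The quadratic form relates entries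
across the antidiagonal, and the three-form supplies the remaining linear relations. -/
theorem eq_frameMat_of_derivation {A : Matrix (Fin 7) (Fin 7) ℝ} (hA : A.IsSymm)
    (hJ : A * formJ + formJ * A = 0) (hD : IsDerivation A) :
    A = frameMat (frameCoord A) + (frameMat (frameCoord A))ᵀ := by
  have ht := sqrt_two_mul_self
  have hr : rt3 * √3 = 1 := by rw [rt3]; exact inv_mul_cancel₀ (by positivity)
  have hs : ∀ i j, A j i = A i j := fun i j => hA.apply i j
  have J : ∀ i j, (A * formJ + formJ * A) i j = 0 := fun i j => by rw [hJ]; rfl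
  -- Four evaluations on basis triples provide all the relations needed from the three-form.
  have d1 := hD (Pi.single 1 1) (Pi.single 2 1) (Pi.single 6 1)
  have d2 := hD (Pi.single 1 1) (Pi.single 3 1) (Pi.single 6 1)
  have d3 := hD (Pi.single 2 1) (Pi.single 3 1) (Pi.single 6 1)
  have d4 := hD (Pi.single 1 1) (Pi.single 2 1) (Pi.single 3 1)
  simp [form3, alt3] at d1 d2 d3 d4
  have j00 := J 0 0
  have j11 := J 1 1
  have j22 := J 2 2
  have j33 := J 3 3
  have j06 := J 0 6
  have j15 := J 1 5
  have j24 := J 2 4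
  have j05 := J 0 5
  have j04 := J 0 4
  have j03 := J 0 3
  have j02 := J 0 2
  have j01 := J 0 1
  have j14 := J 1 4
  have j13 := J 1 3
  have j23 := J 2 3
  have j12 := J 1 2
  simp [formJ, Matrix.mul_apply, Fin.sum_univ_seven, Matrix.vecMul, dotProduct] at j00 j11 j22 j33 j06 j15 j24 j05 j04 j03 j02 j01 j14 j13 j23 j12
  have d1' : A 1 1 + A 2 2 + A 6 6 = 0 := by
    have h0 : √2 * (A 1 1 + A 2 2 + A 6 6) = 0 := by linarith
    exact (mul_eq_zero.1 h0).resolve_left (by positivity)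
  have s60 := hs 0 6
  have s61 := hs 1 6
  have s62 := hs 2 6
  have s54 := hs 4 5
  have s53 := hs 3 5
  have s43 := hs 3 4
  have s51 := hs 1 5
  have s42 := hs 2 4
  have s41 := hs 1 4
  have s52 := hs 2 5
  have s63 := hs 3 6
  have s65 := hs 5 6
  have s64 := hs 4 6
  have hup : ∀ i j, i ≤ j → A i j = (frameMat (frameCoord A) + (frameMat (frameCoord A))ᵀ) i j := by
    intro i j hij
    fin_cases i <;> fin_cases j
    all_goals first
      | exact absurd hij (by decide)
      | skip
    all_goals simp [frameMat, frameCoord]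
    all_goals clear hij hs J hD hJ hA
    all_goals grind
  ext i j
  rcases le_total i j with h | h
  · exact hup i j h
  · rw [hs, hup j i h, Matrix.add_apply, Matrix.add_apply, Matrix.transpose_apply,
      Matrix.transpose_apply, add_comm]

end InvariantForms

/-! ### Recognizing the Levi part of a symmetric group element. -/

section Chart

theorem formJ_apply_gram {A : Matrix (Fin 7) (Fin 7) ℝ} (hA : A.IsSymm) (i j : Fin 7) :
    (Aᵀ * formJ * A) i j = A i 0 * A 6 j + A i 1 * A 5 j + A i 2 * A 4 j - A i 3 * A 3 j
      + A i 4 * A 2 j + A i 5 * A 1 j + A i 6 * A 0 j := by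
  rw [hA.eq]
  simp [Matrix.mul_apply, Fin.sum_univ_seven, formJ]
  ring

/-- A symmetric element of `G₂₍₂₎` with trivial first row lies in the Levi subgroup. -/
theorem eq_gram_leviMat {A : Matrix (Fin 7) (Fin 7) ℝ} (hA : A.IsSymm) (hG : IsG2 A)
    (h00 : A 0 0 = 1) (h01 : A 0 1 = 0) (h02 : A 0 2 = 0) (h03 : A 0 3 = 0) (h04 : A 0 4 = 0)
    (h05 : A 0 5 = 0) {s x : ℝ} (hs : s ≠ 0) (h11 : s ^ 2 = A 1 1) (h12 : x * s ^ 2 = -A 1 2) :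
    A = (leviMat 1 s x)ᵀ * leviMat 1 s x := by
  have hsym : ∀ i j, A j i = A i j := fun i j => hA.apply i j
  have J : ∀ i j, A i 0 * A 6 j + A i 1 * A 5 j + A i 2 * A 4 j - A i 3 * A 3 j
      + A i 4 * A 2 j + A i 5 * A 1 j + A i 6 * A 0 j = formJ i j := fun i j => by
    rw [← formJ_apply_gram hA, hG.1]
  -- The first row is isotropic for the quadratic form, and with the other entries prescribed this
  -- leaves only twice the last entry.
  have h06 : A 0 6 = 0 := by
    have := J 0 0
    rw [hsym 0 6, hsym 0 5, hsym 0 4, hsym 0 3, hsym 0 2, hsym 0 1, h00, h01, h02, h03, h04, h05]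
      at this
    simp [formJ] at this
    linarith
  have h6 : ∀ j, A 6 j = formJ 0 j := fun j => by
    have := J 0 j
    rw [h00, h01, h02, h03, h04, h05, h06] at this
    linarith
  have h61 : A 6 1 = 0 := by rw [h6]; simp [formJ]
  have h62 : A 6 2 = 0 := by rw [h6]; simp [formJ]
  have h63 : A 6 3 = 0 := by rw [h6]; simp [formJ]
  have h64 : A 6 4 = 0 := by rw [h6]; simp [formJ]
  have h65 : A 6 5 = 0 := by rw [h6]; simp [formJ]
  have h66 : A 6 6 = 1 := by rw [h6]; simp [formJ]
  have hcol : ∀ i, A *ᵥ Pi.single i 1 = fun j => A j i := fun i => by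
    ext j; simp
  have hc0 : A *ᵥ Pi.single 0 1 = Pi.single 0 1 := by
    rw [hcol]
    ext j
    rw [hsym 0 j]
    fin_cases j <;> simp [h00, h01, h02, h03, h04, h05, h06]
  have hc6 : A *ᵥ Pi.single 6 1 = Pi.single 6 1 := by
    rw [hcol]
    ext j
    rw [hsym 6 j]
    fin_cases j <;> simp [h61, h62, h63, h64, h65, h66, hsym 0 6, h06]
  -- Both `e₀` and `e₆` are now fixed by `A`, and contracting the three-form with them reads off the
  -- middle coordinate up to sign.
  have h3 : ∀ j, A 3 j = if j = 3 then 1 else 0 := by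
    intro j
    have := hG.2 (Pi.single 0 1) (Pi.single j 1) (Pi.single 6 1)
    rw [hc0, hc6, hcol] at this
    simp [form3, alt3] at this
    rw [this]
    simp [Pi.single_apply, eq_comm]
  have h31 : A 3 1 = 0 := by rw [h3]; simp
  have h32 : A 3 2 = 0 := by rw [h3]; simp
  have h33 : A 3 3 = 1 := by rw [h3]; simp
  have h34 : A 3 4 = 0 := by rw [h3]; simp
  have h35 : A 3 5 = 0 := by rw [h3]; simp
  -- Contraction with `e₀` alone is, after division by √2, the area form of coordinates 4 and 5 plus
  -- a multiple of that of 3 and 6. Hence the 4–5 block is unimodular and its coupling to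
  -- coordinates 1 and 2 vanishes by Cramer's rule.
  have hF : ∀ i j, A 4 i * A 5 j - A 5 i * A 4 j + (√2)⁻¹ * (A 3 i * A 6 j - A 6 i * A 3 j) =
      (√2)⁻¹ * -form3 (Pi.single 0 1) (Pi.single i 1) (Pi.single j 1) := by
    intro i j
    have := hG.2 (Pi.single 0 1) (Pi.single i 1) (Pi.single j 1)
    rw [hc0, hcol, hcol] at this
    rw [← this]
    simp [form3, alt3]
    have : (√2)⁻¹ * √2 = 1 := inv_mul_cancel₀ (by positivity)
    linear_combination (A 5 i * A 4 j - A 4 i * A 5 j) * this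
  have f45 := hF 4 5
  have f14 := hF 1 4
  have f15 := hF 1 5
  have f24 := hF 2 4
  have f25 := hF 2 5
  simp [form3, alt3, h61, h62, h64, h65, h31, h32, h34, h35] at f45 f14 f15 f24 f25
  have hq' : (√2)⁻¹ * √2 = 1 := inv_mul_cancel₀ (by positivity)
  have g45 : A 4 4 * A 5 5 - A 5 4 * A 4 5 = 1 := by linarith
  have h41 : A 4 1 = 0 := by linear_combination (-A 4 1) * g45 - A 4 5 * f14 + A 4 4 * f15
  have h51 : A 5 1 = 0 := by linear_combination (-A 5 1) * g45 - A 5 5 * f14 + A 5 4 * f15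
  have h42 : A 4 2 = 0 := by linear_combination (-A 4 2) * g45 - A 4 5 * f24 + A 4 4 * f25
  have h52 : A 5 2 = 0 := by linear_combination (-A 5 2) * g45 - A 5 5 * f24 + A 5 4 * f25
  -- The quadratic form pairs coordinates 1 and 2 with 5 and 4, so the lower block is determined by
  -- the upper one, and the upper block has determinant one.
  have j15 := J 1 5
  have j14 := J 1 4
  have j25 := J 2 5
  have j24 := J 2 4
  simp [formJ, hsym 0, h01, h02, hsym 1 2, hsym 4 5, hsym 3 1, hsym 3 2, hsym 4 1, hsym 4 2,
    hsym 5 1, hsym 5 2, h31, h32, h41, h42, h51, h52, hsym 6 1, hsym 6 2, h61, h62] at j15 j14 j25 j24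
  rw [hsym 4 5] at g45
  have k44 : A 4 4 = A 1 1 := by linear_combination A 1 1 * g45 - A 4 4 * j15 + A 4 5 * j14
  have k45 : A 4 5 = -A 1 2 := by linear_combination (-A 1 2) * g45 - A 4 5 * j15 + A 5 5 * j14
  have k55 : A 5 5 = A 2 2 := by linear_combination A 2 2 * g45 - A 5 5 * j24 + A 4 5 * j25
  have hd : A 1 1 * A 2 2 - A 1 2 * A 1 2 = 1 := by rw [k55, k45] at j15; linarith
  have k12 : A 1 2 = -(x * s ^ 2) := by linarith
  have k22 : A 2 2 = x ^ 2 * s ^ 2 + (s⁻¹) ^ 2 := by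
    rw [← h11, k12] at hd
    field_simp
    linear_combination hd
  have hup : ∀ i j, i ≤ j → A i j = ((leviMat 1 s x)ᵀ * leviMat 1 s x) i j := by
    intro i j hij
    fin_cases i <;> fin_cases j
    all_goals first
      | exact absurd hij (by decide)
      | skip
    all_goals simp [leviMat, Matrix.mul_apply, Fin.sum_univ_seven, h00, h01, h02, h03, h04, h05,
      h06, ← h11, k12, k22, hsym 3 1, h31, hsym 4 1, h41, hsym 5 1, h51, hsym 6 1, h61, hsym 3 2, h32,
      hsym 4 2, h42, hsym 5 2, h52, hsym 6 2, h62, h33, h34, h35, hsym 6 3, h63, k44, k45, k55,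
      hsym 6 4, h64, hsym 6 5, h65, h66]
    all_goals ring
  ext i j
  rcases le_total i j with h | h
  · exact hup i j h
  · rw [hsym j i, hup j i h, Matrix.mul_apply, Matrix.mul_apply]
    exact Finset.sum_congr rfl fun k _ => by rw [transpose_apply, transpose_apply, mul_comm]

end Chart

/-! ### The target as the set of positive definite symmetric elements of G₂₍₂₎. -/

section FromGram

theorem Horizon.Admissible.p_pos {B : Horizon} (h : B.Admissible) : 0 < B.p := by
  cases B with
  | lens p q => exact Nat.cast_pos.2 (lt_of_le_of_lt (Nat.zero_le _) h.1)
  | ring => exact one_pos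

/-- The point of the target with given Iwasawa coordinates. -/
def iwasawa (B : Horizon) (u S y a b c z₁ z₂ : ℝ) : Target :=
  ![u, Real.log S - Real.log (Real.cosh (Real.arsinh y)), Real.arsinh y, z₁ / B.p,
    (z₂ / B.p - B.q * (z₁ / B.p)) / B.p, c / B.p, a, (b - B.q * a) / B.p]

/-- Here `S` stands for e^v cosh w and `y` for sinh w. In these parameters the inverse chart is
built from rational expressions in a Gram matrix followed by elementary functions. -/
theorem ghat_iwasawa {B : Horizon} (hp : B.p ≠ 0) {u S y a b c z₁ z₂ : ℝ} (hS : 0 < S) :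
    ghat B (iwasawa B u S y a b c z₁ z₂) =
      leviMat (Real.exp (-u)) (√S) (y / S) * unipMat a b c z₁ z₂ := by
  have hc := Real.cosh_pos (Real.arsinh y)
  have h1 : scaleP (iwasawa B u S y a b c z₁ z₂) = Real.exp (-u) := by simp [scaleP, iwasawa]
  have h2 : scaleS (iwasawa B u S y a b c z₁ z₂) = √S := by
    simp [scaleS, iwasawa, Real.exp_half, Real.exp_log hS]
  have h3 : shear (iwasawa B u S y a b c z₁ z₂) = y / S := by
    simp [shear, iwasawa, Real.exp_sub, Real.exp_log hS]
    rw [Real.exp_log (by positivity)]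
    field_simp
  rw [ghat, h1, h2, h3]
  congr 1
  have e5 : B.p * (c / B.p) = c := mul_div_cancel₀ _ hp
  have e4 : B.p * (z₁ / B.p) = z₁ := mul_div_cancel₀ _ hp
  have e7 : B.q * a + B.p * ((b - B.q * a) / B.p) = b := by field_simp; ring
  have e8 : B.p * (B.q * (z₁ / B.p) + B.p * ((z₂ / B.p - B.q * (z₁ / B.p)) / B.p)) = z₂ := by
    field_simp; ring
  simp only [iwasawa, psiBar1, psiBar2, zetaBar1, zetaBar2]
  simp
  rw [e5, e4, e7, e8]

/-- The exponent of the first diagonal entry of a Gram matrix. -/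
def gramU (Q : Matrix (Fin 7) (Fin 7) ℝ) : ℝ := -Real.log (Q 0 0) / 4

/-- The point of the target with a given Gram matrix. -/
def fromGram (B : Horizon) (Q : Matrix (Fin 7) (Fin 7) ℝ) : Target :=
  iwasawa B (gramU Q) ((Q 1 1 - Q 0 1 ^ 2 / Q 0 0) * Real.exp (2 * gramU Q))
    (-(Q 1 2 - Q 0 1 * Q 0 2 / Q 0 0) * Real.exp (2 * gramU Q))
    (√3 * Q 0 1 / Q 0 0) (-√3 * Q 0 2 / Q 0 0) (√3 * √2 / 2 * Q 0 3 / Q 0 0)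
    (-Q 0 4 / Q 0 0 - (√3 * Q 0 1 / Q 0 0) * (√3 * √2 / 2 * Q 0 3 / Q 0 0) / 3)
    (-Q 0 5 / Q 0 0 - (-√3 * Q 0 2 / Q 0 0) * (√3 * √2 / 2 * Q 0 3 / Q 0 0) / 3)

theorem gram_levi_unip (P s x a b c z₁ z₂ : ℝ) :
    let Q := (leviMat P s x * unipMat a b c z₁ z₂)ᵀ * (leviMat P s x * unipMat a b c z₁ z₂)
    Q 0 0 = P ^ 4 ∧ Q 0 1 = P ^ 4 * (rt3 * a) ∧ Q 0 2 = -(P ^ 4 * (rt3 * b)) ∧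
    Q 0 3 = P ^ 4 * (rt3 * √2 * c) ∧ Q 0 4 = P ^ 4 * (-(a * c / 3) - z₁) ∧
    Q 0 5 = P ^ 4 * (-(b * c / 3) - z₂) ∧ Q 1 1 = P ^ 4 * (rt3 * a) ^ 2 + (P * s) ^ 2 ∧
    Q 1 2 = -(P ^ 4 * (rt3 * a) * (rt3 * b)) - x * (P * s) ^ 2 := by
  refine ⟨?_, ?_, ?_, ?_, ?_, ?_, ?_, ?_⟩
  all_goals simp [leviMat, unipMat, Matrix.mul_apply, Fin.sum_univ_seven]
  all_goals ring

/-- A Cholesky-type reading: the first row of the Gram matrix gives u and the potentials, and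
eliminating it from the entries (1,1) and (1,2) gives v and w. -/
theorem fromGram_ghat {B : Horizon} (hp : B.p ≠ 0) (X : Target) :
    fromGram B ((ghat B X)ᵀ * ghat B X) = X := by
  obtain ⟨q00, q01, q02, q03, q04, q05, q11, q12⟩ := gram_levi_unip (scaleP X) (scaleS X) (shear X)
    (psiBar1 X) (psiBar2 B X) (B.p * X 5) (B.p * zetaBar1 X) (B.p * zetaBar2 B X)
  have hP := scaleP_pos X
  have hP4 : scaleP X ^ 4 ≠ 0 := by positivity
  have hr : √3 * rt3 = 1 := by rw [rt3]; exact mul_inv_cancel₀ (by positivity)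
  have ht := sqrt_two_mul_self
  rw [← ghat] at *
  set Q := (ghat B X)ᵀ * ghat B X
  have hu : gramU Q = X 0 := by
    rw [gramU, q00, scaleP, ← Real.exp_nat_mul, Real.log_exp]; push_cast; ring
  have he : Real.exp (2 * gramU Q) = (scaleP X ^ 2)⁻¹ := by
    rw [hu, scaleP, ← Real.exp_nat_mul, ← Real.exp_neg]; push_cast; ring_nf
  have ha : √3 * Q 0 1 / Q 0 0 = psiBar1 X := by
    rw [q01, q00]; field_simp; linear_combination psiBar1 X * hr
  have hb : -√3 * Q 0 2 / Q 0 0 = psiBar2 B X := by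
    rw [q02, q00]; field_simp; linear_combination psiBar2 B X * hr
  have hc : √3 * √2 / 2 * Q 0 3 / Q 0 0 = B.p * X 5 := by
    rw [q03, q00]; field_simp; linear_combination (2 * X 5) * hr + X 5 * √3 * rt3 * ht
  have hS : (Q 1 1 - Q 0 1 ^ 2 / Q 0 0) * Real.exp (2 * gramU Q) = scaleS X ^ 2 := by
    rw [q11, q01, q00, he]; field_simp; ring
  have hy : -(Q 1 2 - Q 0 1 * Q 0 2 / Q 0 0) * Real.exp (2 * gramU Q) = Real.sinh (X 2) := by
    rw [q12, q01, q02, q00, he]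
    have : shear X * scaleS X ^ 2 = Real.sinh (X 2) := by
      rw [scaleS_sq, shear, Real.exp_neg]
      have := Real.cosh_pos (X 2)
      field_simp
    rw [← this]; field_simp; ring
  rw [fromGram, ha, hb, hc, hS, hy, hu, q04, q05, q00, scaleS_sq, iwasawa, Real.arsinh_sinh,
    Real.log_mul (Real.exp_pos _).ne' (Real.cosh_pos _).ne', Real.log_exp]
  ext i
  fin_cases i
  · simp
  · simp
  · simp
  · simp [zetaBar1]; field_simp; ring
  · simp [zetaBar1, zetaBar2]; field_simp; ring
  · simp; field_simp
  · simp [psiBar1]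
  · simp [psiBar1, psiBar2]; field_simp

theorem leviMat_mul_diag (P s x : ℝ) : leviMat 1 s x * leviMat P 1 0 = leviMat P s x := by
  ext i j
  fin_cases i <;> fin_cases j
  all_goals simp [leviMat, Matrix.mul_apply, Fin.sum_univ_seven]
  all_goals ring

theorem IsSPD.pos {Q : Matrix (Fin 7) (Fin 7) ℝ} (hQ : IsSPD Q) {x : Fin 7 → ℝ} (hx : x ≠ 0) :
    0 < x ⬝ᵥ (Q *ᵥ x) := by
  obtain ⟨m, hm, h⟩ := hQ.2
  refine lt_of_lt_of_le (mul_pos hm ?_) (h x)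
  exact lt_of_le_of_ne (by
    simp only [dotProduct]; exact Finset.sum_nonneg fun i _ => mul_self_nonneg _)
    (fun h0 => hx (dotProduct_self_eq_zero.1 h0.symm))

theorem jInv_apply (k : Matrix (Fin 7) (Fin 7) ℝ) (i j : Fin 7) :
    jInv k i j = (if i = 3 then -1 else 1) * (if j = 3 then -1 else 1) * k j.rev i.rev := by
  rw [jInv, Matrix.mul_apply]
  simp only [Matrix.mul_apply, Fin.sum_univ_seven]
  fin_cases i <;> fin_cases j
  all_goals simp [formJ]

/-- Surjectivity of the chart. The first row of `Q` determines a triangular group element `g`;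
undoing it leaves a symmetric element with trivial first row, which `eq_gram_leviMat` identifies.
This brings matrix geodesics back to the target. -/
theorem gram_fromGram {B : Horizon} (hp : B.p ≠ 0) {Q : Matrix (Fin 7) (Fin 7) ℝ} (hQ : IsSPD Q)
    (hG : IsG2 Q) : (ghat B (fromGram B Q))ᵀ * ghat B (fromGram B Q) = Q := by
  have hpos : ∀ x : Fin 7 → ℝ, x ≠ 0 → 0 < x ⬝ᵥ (Q *ᵥ x) := fun x hx => hQ.pos hx
  have hQ0 : 0 < Q 0 0 := by
    have := hpos (Pi.single 0 1) (by simp)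
    simpa using this
  have hsym : ∀ i j, Q j i = Q i j := fun i j => hQ.1.apply i j
  set u := gramU Q with hu
  set S := (Q 1 1 - Q 0 1 ^ 2 / Q 0 0) * Real.exp (2 * u) with hS
  set y := -(Q 1 2 - Q 0 1 * Q 0 2 / Q 0 0) * Real.exp (2 * u) with hy
  set a := √3 * Q 0 1 / Q 0 0 with ha
  set b := -√3 * Q 0 2 / Q 0 0 with hb
  set c := √3 * √2 / 2 * Q 0 3 / Q 0 0 with hc
  set z₁ := -Q 0 4 / Q 0 0 - a * c / 3 with hz₁
  set z₂ := -Q 0 5 / Q 0 0 - b * c / 3 with hz₂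
  have hF : fromGram B Q = iwasawa B u S y a b c z₁ z₂ := rfl
  set P := Real.exp (-u) with hP
  have hP0 : 0 < P := Real.exp_pos _
  have hP4 : P ^ 4 = Q 0 0 := by
    rw [hP, ← Real.exp_nat_mul, hu, gramU]
    push_cast
    rw [show 4 * (-(-Real.log (Q 0 0) / 4)) = Real.log (Q 0 0) by ring, Real.exp_log hQ0]
  have he : Real.exp (2 * u) = (P ^ 2)⁻¹ := by
    rw [hP, ← Real.exp_nat_mul, ← Real.exp_neg]; push_cast; ring_nf
  have hg0 := ghat_iwasawa (B := B) hp (u := u) (S := 1) (y := 0) (a := a) (b := b) (c := c)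
    (z₁ := z₁) (z₂ := z₂) one_pos
  rw [Real.sqrt_one, zero_div] at hg0
  have hG0 := isG2_ghat B (iwasawa B u 1 0 a b c z₁ z₂)
  rw [hg0] at hG0
  set g := leviMat P 1 0 * unipMat a b c z₁ z₂ with hg
  set k := jInv g with hk
  have hgk : g * k = 1 := hG0.mul_jInv
  have hkg : k * g = 1 := hG0.jInv_mul
  set A := kᵀ * Q * k with hA
  have hAs : A.IsSymm := by
    rw [Matrix.IsSymm, hA, transpose_mul, transpose_mul, transpose_transpose, hQ.1.eq, mul_assoc]
  have hAG : IsG2 A := (hG0.inv.transpose.mul hG).mul hG0.inv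
  have hr : √3 * rt3 = 1 := by rw [rt3]; exact mul_inv_cancel₀ (by positivity)
  have ht := sqrt_two_mul_self
  have e1 : Q 0 1 = P ^ 4 * (rt3 * a) := by
    rw [hP4, ha]; field_simp; linear_combination (-Q 0 1) * hr
  have e2 : Q 0 2 = P ^ 4 * -(rt3 * b) := by
    rw [hP4, hb]; field_simp; linear_combination (-Q 0 2) * hr
  have e3 : Q 0 3 = P ^ 4 * (rt3 * √2 * c) := by
    rw [hP4, hc]; field_simp; linear_combination (-2 * Q 0 3) * hr - (Q 0 3 * √3 * rt3) * ht
  have e4 : Q 0 4 = P ^ 4 * (-(a * c / 3) - z₁) := by rw [hP4, hz₁]; field_simp; ring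
  have e5 : Q 0 5 = P ^ 4 * (-(b * c / 3) - z₂) := by rw [hP4, hz₂]; field_simp; ring
  have q0 : ∀ j, j ≠ 6 → Q 0 j = P ^ 2 * g 0 j := by
    intro j hj
    have hP22 : ∀ t, P ^ 2 * (P ^ 2 * t) = P ^ 4 * t := fun t => by ring
    fin_cases j
    · simp [hg, leviMat, unipMat, ← hP4]; ring
    · simp [hg, leviMat, unipMat, hP22, e1]
    · simp [hg, leviMat, unipMat, hP22, e2]
    · simp [hg, leviMat, unipMat, hP22, e3]
    · simp [hg, leviMat, unipMat, hP22, e4]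
    · simp [hg, leviMat, unipMat, hP22, e5]
    · exact absurd rfl hj
  have k0 : ∀ i, k i 0 = if i = 0 then (P ^ 2)⁻¹ else 0 := by
    intro i
    fin_cases i <;>
      simp [hk, jInv_apply, Fin.rev, hg, leviMat, unipMat]
  -- Triangularity of the inverse removes the entry `Q 0 6` from the computation; it is the one
  -- entry of the first row that was not matched by the choice of parameters.
  have k6 : ∀ j, j ≠ 6 → k 6 j = 0 := by
    intro i hi
    fin_cases i <;>
      simp [hk, jInv_apply, Fin.rev, hg, leviMat, unipMat] at hi ⊢
  have k1 : ∀ i, k i 1 = if i = 0 then -(rt3 * a) * P⁻¹ else if i = 1 then P⁻¹ else 0 := by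
    intro i
    fin_cases i <;>
      simp [hk, jInv_apply, Fin.rev, hg, leviMat, unipMat]
    ring
  have k2 : ∀ i, k i 2 = if i = 0 then (rt3 * b) * P⁻¹ else if i = 2 then P⁻¹ else 0 := by
    intro i
    fin_cases i <;>
      simp [hk, jInv_apply, Fin.rev, hg, leviMat, unipMat]
    ring
  have hA0 : ∀ j, j ≠ 6 → A 0 j = if j = 0 then 1 else 0 := by
    intro j hj
    have h1 : A 0 j = (P ^ 2)⁻¹ * ∑ i, Q 0 i * k i j := by
      rw [hA, mul_assoc, Matrix.mul_apply]
      simp [k0, Matrix.mul_apply]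
    have h2 : ∀ i, Q 0 i * k i j = P ^ 2 * (g 0 i * k i j) := by
      intro i
      by_cases hi : i = 6
      · rw [hi, k6 j hj, mul_zero, mul_zero, mul_zero]
      · rw [q0 i hi, mul_assoc]
    have h3 : ∑ i, g 0 i * k i j = if j = 0 then 1 else 0 := by
      rw [← Matrix.mul_apply, hgk, Matrix.one_apply]
      simp [eq_comm]
    rw [h1, Finset.sum_congr rfl fun i _ => h2 i, ← Finset.mul_sum, h3, ← mul_assoc,
      inv_mul_cancel₀ (by positivity), one_mul]
  have hA11 : A 1 1 = S := by
    rw [hA, Matrix.mul_apply]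
    simp only [k1, Matrix.mul_apply, Matrix.transpose_apply, Fin.sum_univ_seven]
    simp
    rw [hS, he, hsym 0 1, e1, ← hP4]
    field_simp
    ring
  have hA12 : A 1 2 = -y := by
    rw [hA, Matrix.mul_apply]
    simp only [k1, k2, Matrix.mul_apply, Matrix.transpose_apply, Fin.sum_univ_seven]
    simp
    rw [hy, he, hsym 0 1, e1, e2, ← hP4]
    field_simp
    ring
  have hSpos : 0 < S := by
    rw [← hA11]
    have h1 := hpos (k *ᵥ Pi.single 1 1) (fun h0 => by
      have := congrFun h0 1
      simp [k1, hP0.ne'] at this)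
    have h2 : (k *ᵥ Pi.single 1 1) ⬝ᵥ (Q *ᵥ (k *ᵥ Pi.single 1 1)) = A 1 1 := by
      nth_rewrite 1 [← Matrix.vecMul_transpose]
      rw [← Matrix.dotProduct_mulVec, Matrix.mulVec_mulVec, Matrix.mulVec_mulVec]
      simp [hA]
    rwa [h2] at h1
  have hsq : √S ^ 2 = S := Real.sq_sqrt hSpos.le
  have hfin := eq_gram_leviMat hAs hAG (s := √S) (x := y / S) (by simpa using hA0 0 (by decide))
    (by simpa using hA0 1 (by decide)) (by simpa using hA0 2 (by decide))
    (by simpa using hA0 3 (by decide)) (by simpa using hA0 4 (by decide))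
    (by simpa using hA0 5 (by decide)) (by positivity) (by rw [hsq, hA11])
    (by rw [hsq, hA12]; field_simp)
  have hQg : Q = gᵀ * A * g := by
    calc Q = (k * g)ᵀ * Q * (k * g) := by rw [hkg]; simp
      _ = _ := by rw [hA, transpose_mul]; simp only [mul_assoc]
  rw [hF, ghat_iwasawa hp hSpos, ← hP, ← leviMat_mul_diag, mul_assoc, ← hg]
  conv_rhs => rw [hQg, hfin]
  rw [transpose_mul]
  simp only [mul_assoc]

theorem contDiff_fromGram (B : Horizon) {Q : ℝ → Matrix (Fin 7) (Fin 7) ℝ} (hQ : ContDiff ℝ ∞ Q)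
    (h : ∀ t, IsSPD (Q t)) : ContDiff ℝ ∞ (fun t => fromGram B (Q t)) := by
  have hq : ∀ i j, ContDiff ℝ ∞ (fun t => Q t i j) := fun i j => (contDiff_entry i j).comp hQ
  have h0 : ∀ t, 0 < Q t 0 0 := fun t => by
    have := (h t).pos (x := Pi.single 0 1) (by simp)
    simpa using this
  have h0' : ∀ t, Q t 0 0 ≠ 0 := fun t => (h0 t).ne'
  -- The Schur complement is the value of the form on `e₁ - (Q₀₁/Q₀₀) e₀`.
  have h1 : ∀ t, 0 < Q t 1 1 - Q t 0 1 ^ 2 / Q t 0 0 := fun t => by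
    have := (h t).pos (x := Pi.single 1 1 - (Q t 0 1 / Q t 0 0) • Pi.single 0 1) (fun h0 => by
      have := congrFun h0 1
      simp at this)
    have e : Q t 1 0 = Q t 0 1 := (h t).1.apply 0 1
    have hne := h0' t
    simp [Matrix.mulVec_sub, Matrix.mulVec_smul, sub_dotProduct, dotProduct_sub, e] at this
    convert this using 1
    · field_simp
      ring
    · ring
  have hu : ContDiff ℝ ∞ (fun t => gramU (Q t)) := ((hq 0 0).log h0').neg.div_const 4
  have he : ContDiff ℝ ∞ (fun t => Real.exp (2 * gramU (Q t))) := (contDiff_const.mul hu).exp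
  have hS : ContDiff ℝ ∞ (fun t => (Q t 1 1 - Q t 0 1 ^ 2 / Q t 0 0) * Real.exp (2 * gramU (Q t))) :=
    ((hq 1 1).sub (((hq 0 1).pow 2).div (hq 0 0) h0')).mul he
  have hS0 : ∀ t, (Q t 1 1 - Q t 0 1 ^ 2 / Q t 0 0) * Real.exp (2 * gramU (Q t)) ≠ 0 := fun t =>
    (mul_pos (h1 t) (Real.exp_pos _)).ne'
  have hy : ContDiff ℝ ∞ (fun t => Real.arsinh
      (-(Q t 1 2 - Q t 0 1 * Q t 0 2 / Q t 0 0) * Real.exp (2 * gramU (Q t)))) :=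
    (((hq 1 2).sub (((hq 0 1).mul (hq 0 2)).div (hq 0 0) h0')).neg.mul he).arsinh
  have ha : ContDiff ℝ ∞ (fun t => √3 * Q t 0 1 / Q t 0 0) :=
    (contDiff_const.mul (hq 0 1)).div (hq 0 0) h0'
  have hb : ContDiff ℝ ∞ (fun t => -√3 * Q t 0 2 / Q t 0 0) :=
    (contDiff_const.mul (hq 0 2)).div (hq 0 0) h0'
  have hc : ContDiff ℝ ∞ (fun t => √3 * √2 / 2 * Q t 0 3 / Q t 0 0) :=
    (contDiff_const.mul (hq 0 3)).div (hq 0 0) h0'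
  have hz1 := ((hq 0 4).neg.div (hq 0 0) h0').sub ((ha.mul hc).div_const 3)
  have hz2 := ((hq 0 5).neg.div (hq 0 0) h0').sub ((hb.mul hc).div_const 3)
  rw [contDiff_pi]
  intro i
  fin_cases i
  · exact hu
  · exact (hS.log hS0).sub (hy.cosh.log fun t => (Real.cosh_pos _).ne')
  · exact hy
  · exact hz1.div_const _
  · exact ((hz2.div_const _).sub (contDiff_const.mul (hz1.div_const _))).div_const _
  · exact hc.div_const _
  · exact ha
  · exact (hb.sub (contDiff_const.mul ha)).div_const _

end FromGram

/-! ### The relative logarithm and the Riemannian distance. -/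

section Distance

theorem contDiff_ghat (B : Horizon) : ContDiff ℝ ∞ (ghat B) := by
  have hX : ∀ i : Fin 8, ContDiff ℝ ∞ (fun X : Target => X i) := fun i => contDiff_apply ℝ ℝ i
  have hP : ContDiff ℝ ∞ scaleP := (hX 0).neg.exp
  have hS : ContDiff ℝ ∞ scaleS :=
    (((hX 1).add ((hX 2).cosh.log fun X => (Real.cosh_pos _).ne')).div_const 2).exp
  have hx : ContDiff ℝ ∞ shear :=
    (hX 1).neg.exp.mul ((hX 2).sinh.div (hX 2).cosh fun X => (Real.cosh_pos _).ne')
  have hPi : ContDiff ℝ ∞ (fun X => (scaleP X)⁻¹) := hP.inv fun X => (scaleP_pos X).ne'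
  have hSi : ContDiff ℝ ∞ (fun X => (scaleS X)⁻¹) := hS.inv fun X => (scaleS_pos X).ne'
  have hb : ContDiff ℝ ∞ (psiBar2 B) :=
    (contDiff_const.mul (hX 6)).add (contDiff_const.mul (hX 7))
  have ha : ContDiff ℝ ∞ psiBar1 := hX 6
  have hz : ContDiff ℝ ∞ zetaBar1 := hX 3
  have hz2 : ContDiff ℝ ∞ (zetaBar2 B) :=
    (contDiff_const.mul (hX 3)).add (contDiff_const.mul (hX 4))
  have hL : ContDiff ℝ ∞ (fun X => leviMat (scaleP X) (scaleS X) (shear X)) := by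
    rw [contDiff_iff_contDiffAt]
    intro X
    refine contDiffAt_matrix fun i j => ContDiff.contDiffAt ?_
    fin_cases i <;> fin_cases j <;> simp [leviMat, -inv_pow] <;> fun_prop
  have hN : ContDiff ℝ ∞ (fun X : Target => unipMat (psiBar1 X) (psiBar2 B X) (B.p * X 5)
      (B.p * zetaBar1 X) (B.p * zetaBar2 B X)) := by
    rw [contDiff_iff_contDiffAt]
    intro X
    refine contDiffAt_matrix fun i j => ContDiff.contDiffAt ?_
    fin_cases i <;> fin_cases j <;> simp [unipMat] <;> fun_prop
  exact hL.mul hN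

/-- The element of `G₂₍₂₎` taking the frame at `X₀` to the frame at `X₁`. -/
def relMat (B : Horizon) (X₀ X₁ : Target) : Matrix (Fin 7) (Fin 7) ℝ :=
  ghat B X₁ * jInv (ghat B X₀)

theorem isG2_relMat (B : Horizon) (X₀ X₁ : Target) : IsG2 (relMat B X₀ X₁) :=
  (isG2_ghat B X₁).mul (isG2_ghat B X₀).inv

theorem isSPD_relMat (B : Horizon) (X₀ X₁ : Target) :
    IsSPD ((relMat B X₀ X₁)ᵀ * relMat B X₀ X₁) := isSPD_gram (isG2_relMat B X₀ X₁).jInv_mul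

/-- The logarithm of the relative Gram matrix. -/
def relLog (B : Horizon) (X₀ X₁ : Target) : Matrix (Fin 7) (Fin 7) ℝ :=
  symLog ((relMat B X₀ X₁)ᵀ * relMat B X₀ X₁)

theorem relLog_isSymm (B : Horizon) (X₀ X₁ : Target) : (relLog B X₀ X₁).IsSymm := symLog_isSymm _

theorem exp_relLog (B : Horizon) (X₀ X₁ : Target) :
    NormedSpace.exp (relLog B X₀ X₁) = (relMat B X₀ X₁)ᵀ * relMat B X₀ X₁ :=
  exp_symLog (isSPD_relMat B X₀ X₁)

theorem relLog_self (B : Horizon) (X : Target) : relLog B X X = 0 := by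
  refine log_unique (relLog_isSymm B X X) Matrix.isSymm_zero ?_ ?_
  · rw [exp_relLog]; exact isSPD_relMat B X X
  · rw [exp_relLog, relMat, (isG2_ghat B X).mul_jInv]; simp

/-- The relative Gram matrix is a symmetric group element, so its logarithm is a symmetrized
solvable element. It can thus serve as a direction of variation, and its exponentials stay in the
group. -/
theorem relLog_eq_frameMat (B : Horizon) (X₀ X₁ : Target) :
    relLog B X₀ X₁ = frameMat (frameCoord (relLog B X₀ X₁)) +
      (frameMat (frameCoord (relLog B X₀ X₁)))ᵀ := by
  have hG : IsG2 (NormedSpace.exp (relLog B X₀ X₁)) := by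
    rw [exp_relLog]
    exact (isG2_relMat B X₀ X₁).transpose.mul (isG2_relMat B X₀ X₁)
  exact eq_frameMat_of_derivation (relLog_isSymm B X₀ X₁)
    (formJ_anticomm_of_exp (relLog_isSymm B X₀ X₁) hG) (isDerivation_of_exp (relLog_isSymm B X₀ X₁) hG)

theorem contDiff_relLog (B : Horizon) :
    ContDiff ℝ ∞ (fun X : Target × Target => relLog B X.1 X.2) := by
  rw [contDiff_iff_contDiffAt]
  intro X
  refine contDiffAt_symLog ?_ (Eventually.of_forall fun Y => isSPD_relMat B Y.1 Y.2)
  have h0 : ContDiffAt ℝ ∞ (fun X : Target × Target => ghat B X.1) X :=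
    ((contDiff_ghat B).comp contDiff_fst).contDiffAt
  have h1 : ContDiffAt ℝ ∞ (fun X : Target × Target => ghat B X.2) X :=
    ((contDiff_ghat B).comp contDiff_snd).contDiffAt
  have hi : ContDiffAt ℝ ∞ (fun X : Target × Target => jInv (ghat B X.1)) X :=
    (contDiffAt_const.mul (contDiffAt_transpose h0)).mul contDiffAt_const
  have hk : ContDiffAt ℝ ∞ (fun X : Target × Target => relMat B X.1 X.2) X := h1.mul hi
  exact (contDiffAt_transpose hk).mul hk

/-- With k = g₁ g₀⁻¹ one has k' = M₁ k − k M₀; the formula is the product rule for kᵀk and supplies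
the hypothesis of `excess_bound`. -/
theorem hasDerivAt_relGram (B : Horizon) {γ₀ γ₁ : ℝ → Target} {Y₀ Y₁ : Target} {t : ℝ}
    (h₀ : HasDerivAt γ₀ Y₀ t) (h₁ : HasDerivAt γ₁ Y₁ t) :
    let k := relMat B (γ₀ t) (γ₁ t)
    let M₀ := frameMat (coframe B (γ₀ t) Y₀)
    let M₁ := frameMat (coframe B (γ₁ t) Y₁)
    HasDerivAt (fun t => (relMat B (γ₀ t) (γ₁ t))ᵀ * relMat B (γ₀ t) (γ₁ t))
      (kᵀ * (M₁ + M₁ᵀ) * k - M₀ᵀ * (kᵀ * k) - kᵀ * k * M₀) t := by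
  intro k M₀ M₁
  have d0 := hasDerivAt_ghat B h₀
  have d1 := hasDerivAt_ghat B h₁
  have di : HasDerivAt (fun t => jInv (ghat B (γ₀ t))) (-(jInv (ghat B (γ₀ t)) * M₀)) t := by
    refine (((hasDerivAt_transpose d0).const_mul formJ).mul_const formJ).congr_deriv ?_
    rw [transpose_mul, frameMat_transpose, jInv]
    calc _ = -(formJ * (ghat B (γ₀ t))ᵀ * (formJ * M₀ * (formJ * formJ))) := by
          simp only [M₀, mul_assoc, mul_neg, neg_mul]
      _ = _ := by rw [formJ_mul_self]; simp only [mul_one, mul_assoc]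
  have dk : HasDerivAt (fun t => relMat B (γ₀ t) (γ₁ t)) (M₁ * k - k * M₀) t := by
    refine (d1.mul di).congr_deriv ?_
    simp only [k, relMat, M₁, mul_assoc, mul_neg, sub_eq_add_neg]
  refine ((hasDerivAt_transpose dk).mul dk).congr_deriv ?_
  rw [transpose_sub, transpose_mul, transpose_mul]
  change (kᵀ * M₁ᵀ - M₀ᵀ * kᵀ) * k + kᵀ * (M₁ * k - k * M₀) = _
  noncomm_ring

/-- The infinitesimal form of the convexity of the distance. -/
theorem relLog_excess_bound (B : Horizon) {γ₀ γ₁ : ℝ → Target} {Y₀ Y₁ : Target}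
    {A' : Matrix (Fin 7) (Fin 7) ℝ} {t : ℝ} (h₀ : HasDerivAt γ₀ Y₀ t) (h₁ : HasDerivAt γ₁ Y₁ t)
    (hA : HasDerivAt (fun t => relLog B (γ₀ t) (γ₁ t)) A' t) :
    let A := relLog B (γ₀ t) (γ₁ t)
    let e := excess (frameMat (coframe B (γ₀ t) Y₀)) (frameMat (coframe B (γ₁ t) Y₁)) A A'
    0 ≤ e ∧ (A * A').trace ^ 2 ≤ (A * A).trace * e := by
  intro A e
  refine excess_bound (relLog_isSymm _ _ _) ?_ (exp_relLog B _ _).symm ?_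
  · have := hasDerivAt_transpose hA
    have h2 : (fun t => (relLog B (γ₀ t) (γ₁ t))ᵀ) = fun t => relLog B (γ₀ t) (γ₁ t) :=
      funext fun t => (relLog_isSymm _ _ _).eq
    rw [h2] at this
    exact this.unique hA
  · have hE := (hasFDerivAt_matrix_exp (relLog B (γ₀ t) (γ₁ t))).comp_hasDerivAt t hA
    refine (hasDerivAt_relGram B h₀ h₁).unique (hE.congr_of_eventuallyEq ?_)
    exact Eventually.of_forall fun s => (exp_relLog B _ _).symm

theorem coframe_zero (B : Horizon) (X : Target) : coframe B X 0 = 0 := by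
  ext i
  fin_cases i <;>
    simp [coframe, ThetaBar1, ThetaBar2, Theta1, Theta2, auxForm, psiBar1, psiBar2, Upsilon]

theorem frameMat_zero : frameMat 0 = 0 := by
  ext i j
  fin_cases i <;> fin_cases j <;> simp [frameMat]

theorem trace_frameMat_coframe (B : Horizon) (X Y : Target) :
    ((frameMat (coframe B X Y) + (frameMat (coframe B X Y))ᵀ) *
      (frameMat (coframe B X Y) + (frameMat (coframe B X Y))ᵀ)).trace = 4 * G B X Y := by
  rw [trace_frameMat_sq, G_eq_coframe]

theorem G_nonneg (B : Horizon) (X Y : Target) : 0 ≤ G B X Y := by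
  rw [G_eq_coframe]; positivity

/-- A bound on the variation of a norm. -/
theorem sqrt_sub_sqrt_le_integral {N N' e : ℝ → ℝ} {a b : ℝ} (hab : a ≤ b)
    (hN : ∀ t ∈ Set.Icc a b, 0 ≤ N t) (hd : ∀ t ∈ Set.Icc a b, HasDerivAt N (2 * N' t) t)
    (he : ∀ t ∈ Set.Icc a b, 0 ≤ e t) (hb : ∀ t ∈ Set.Icc a b, N' t ^ 2 ≤ N t * e t ^ 2)
    (hi : IntegrableOn e (Set.Icc a b)) : |√(N b) - √(N a)| ≤ ∫ t in a..b, e t := by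
  -- The square root is not differentiable where `N` vanishes, that is, where the two points
  -- coincide. The estimate is proved for `N + ε`, and then `ε` tends to zero.
  have key : ∀ ε > 0, |√(N b + ε) - √(N a + ε)| ≤ ∫ t in a..b, e t := by
    intro ε hε
    have hd' : ∀ t ∈ Set.Icc a b, HasDerivAt (fun t => √(N t + ε)) (N' t / √(N t + ε)) t := by
      intro t ht
      have h0 := hN t ht
      refine (((hd t ht).add_const ε).sqrt (by positivity)).congr_deriv ?_
      rw [mul_div_mul_left _ _ two_ne_zero]
    have hbd : ∀ t ∈ Set.Icc a b, |N' t / √(N t + ε)| ≤ e t := by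
      intro t ht
      have h0 := hN t ht
      have hs : 0 < √(N t + ε) := Real.sqrt_pos.2 (by positivity)
      rw [abs_div, abs_of_pos hs, div_le_iff₀ hs]
      refine abs_le_of_sq_le_sq ?_ (mul_nonneg (he t ht) hs.le)
      rw [mul_pow, Real.sq_sqrt (by positivity)]
      nlinarith [hb t ht, mul_nonneg hε.le (sq_nonneg (e t))]
    have hc : ContinuousOn (fun t => √(N t + ε)) (Set.Icc a b) := fun t ht =>
      (hd' t ht).continuousAt.continuousWithinAt
    rw [abs_le]
    constructor
    · have := intervalIntegral.sub_le_integral_of_hasDeriv_right_of_le (φ := e) hab hc.neg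
        (fun t ht => (hd' t (Set.Ioo_subset_Icc_self ht)).neg.hasDerivWithinAt) hi
        (fun t ht => (neg_le_abs _).trans (hbd t (Set.Ioo_subset_Icc_self ht)))
      simp only [Pi.neg_apply] at this
      linarith
    · exact intervalIntegral.sub_le_integral_of_hasDeriv_right_of_le hab hc
        (fun t ht => (hd' t (Set.Ioo_subset_Icc_self ht)).hasDerivWithinAt) hi
        (fun t ht => (le_abs_self _).trans (hbd t (Set.Ioo_subset_Icc_self ht)))
  have hlim : Tendsto (fun ε : ℝ => |√(N b + ε) - √(N a + ε)|) (𝓝[>] 0) (𝓝 |√(N b) - √(N a)|) := by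
    have : Continuous (fun ε : ℝ => |√(N b + ε) - √(N a + ε)|) := by fun_prop
    have h2 := this.tendsto 0
    simp only [add_zero] at h2
    exact h2.mono_left nhdsWithin_le_nhds
  exact le_of_tendsto hlim (eventually_mem_nhdsWithin.mono fun ε hε => key ε hε)

theorem hasDerivAt_trace_sq {A : ℝ → Matrix (Fin 7) (Fin 7) ℝ} {A' : Matrix (Fin 7) (Fin 7) ℝ} {t : ℝ}
    (h : HasDerivAt A A' t) :
    HasDerivAt (fun t => (A t * A t).trace) (2 * (A t * A').trace) t := by
  refine (hasDerivAt_trace (h.mul h)).congr_deriv ?_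
  rw [trace_add, trace_mul_comm A', two_mul]

/-- The distance in matrix form. -/
def relDist (B : Horizon) (X₀ X₁ : Target) : ℝ := √((relLog B X₀ X₁ * relLog B X₀ X₁).trace) / 2

/-- Apply the convexity bound with one end fixed: then `M₀ = 0`, the excess is four times the metric
on the velocity, and the derivative of √(tr A²) is at most twice the speed. -/
theorem relDist_le_curveLength (B : Horizon) {γ : ℝ → Target} (hγ : ContDiff ℝ 1 γ) :
    relDist B (γ 1) (γ 0) ≤ curveLength B γ := by
  have hd : ∀ t, HasDerivAt γ (deriv γ t) t := fun t =>
    (hγ.differentiable one_ne_zero t).hasDerivAt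
  set A : ℝ → Matrix (Fin 7) (Fin 7) ℝ := fun t => relLog B (γ 1) (γ t) with hA
  have hAd : Differentiable ℝ A := by
    have h1 : ContDiff ℝ 1 (fun t => (γ 1, γ t)) := contDiff_const.prodMk hγ
    exact (((contDiff_relLog B).of_le (by simp)).comp h1).differentiable one_ne_zero
  have hcoc : Continuous fun t => G B (γ t) (deriv γ t) := by
    have h1 := hγ.continuous
    have h2 := hγ.continuous_deriv le_rfl
    have e1 : ∀ i, Continuous fun t => γ t i := fun i => (continuous_apply i).comp h1
    have e2 : ∀ i, Continuous fun t => deriv γ t i := fun i => (continuous_apply i).comp h2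
    simp only [G, ThetaBar1, ThetaBar2, Theta1, Theta2, auxForm, psiBar1, psiBar2, Upsilon,
      Real.tanh_eq_sinh_div_cosh]
    have hc : ∀ t, Real.cosh (γ t 2) ≠ 0 := fun t => (Real.cosh_pos _).ne'
    fun_prop (disch := assumption)
  have key := sqrt_sub_sqrt_le_integral (N := fun t => (A t * A t).trace)
    (N' := fun t => (A t * deriv A t).trace) (e := fun t => 2 * √(G B (γ t) (deriv γ t)))
    zero_le_one (fun t _ => trace_sq_nonneg (relLog_isSymm _ _ _))
    (fun t _ => hasDerivAt_trace_sq (hAd t).hasDerivAt) (fun t _ => by positivity) (fun t _ => by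
      have := (relLog_excess_bound B (hasDerivAt_const t (γ 1)) (hd t) (hAd t).hasDerivAt).2
      rw [coframe_zero, frameMat_zero] at this
      simp only [excess, trace_frameMat_coframe] at this
      simp at this
      rw [mul_pow, Real.sq_sqrt (G_nonneg _ _ _)]
      norm_num
      exact this)
    ((continuous_const.mul hcoc.sqrt).continuousOn.integrableOn_Icc)
  simp only [hA, relLog_self, mul_zero, trace_zero, Real.sqrt_zero, zero_sub, abs_neg,
    abs_of_nonneg (Real.sqrt_nonneg _), intervalIntegral.integral_const_mul] at key
  rw [relDist, curveLength]
  linarith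

/-- The hypotheses say that S = m A m⁻¹. It computes the speed of a matrix geodesic. -/
theorem trace_sq_of_conj {n : Type*} [Fintype n] [DecidableEq n] {m l S A E : Matrix n n ℝ}
    (hl : m * l = 1) (hE : mᵀ * m = E) (hS : mᵀ * S * m = E * A) :
    (S * S).trace = (A * A).trace := by
  have hl' : l * m = 1 := mul_eq_one_comm.1 hl
  have h1 : S * m = m * A := by
    have h2 : lᵀ * mᵀ = 1 := by rw [← transpose_mul, hl, transpose_one]
    calc S * m = lᵀ * mᵀ * S * m := by rw [h2, one_mul]
      _ = lᵀ * (mᵀ * S * m) := by simp only [mul_assoc]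
      _ = lᵀ * mᵀ * m * A := by rw [hS, ← hE]; simp only [mul_assoc]
      _ = m * A := by rw [h2, one_mul]
  have h3 : S = m * A * l := by rw [← h1, mul_assoc, hl, mul_one]
  calc (S * S).trace = (m * A * (l * m) * A * l).trace := by rw [h3]; simp only [mul_assoc]
    _ = (l * (m * A * (l * m) * A)).trace := trace_mul_comm _ _
    _ = ((l * m) * A * (l * m) * A).trace := by simp only [mul_assoc]
    _ = _ := by rw [hl']; simp

/-- The infimum is attained by pulling back the curve of Gram matrices gᵀ exp((1 − t)A) g, which has
constant speed √(tr A²)/2; the matching lower bound is `relDist_le_curveLength`. -/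
theorem targetDist_eq {B : Horizon} (hp : B.p ≠ 0) (X₀ X₁ : Target) :
    targetDist B X₁ X₀ = relDist B X₀ X₁ := by
  set A := relLog B X₀ X₁ with hA
  have hG0 := isG2_ghat B X₀
  set g := ghat B X₀ with hg
  set E : ℝ → Matrix (Fin 7) (Fin 7) ℝ := fun t => NormedSpace.exp ((1 - t) • A) with hE
  have hEG : ∀ t, IsG2 (E t) := fun t => by
    have := isG2_exp (o := frameCoord A) (1 - t)
    rwa [← relLog_eq_frameMat] at this
  have hEd : ∀ t, HasDerivAt E (E t * (-A)) t := fun t => by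
    have h1 := hasDerivAt_exp_smul_const (𝕂 := ℝ) A (1 - t)
    have h2 := h1.scomp t ((hasDerivAt_id t).const_sub 1)
    refine h2.congr_deriv ?_
    simp [hE]
    rfl
  have hEc : ContDiff ℝ ∞ E :=
    contDiff_matrix_exp.comp ((contDiff_const.sub contDiff_id).smul contDiff_const)
  set Q : ℝ → Matrix (Fin 7) (Fin 7) ℝ := fun t => gᵀ * E t * g with hQ
  have hQG : ∀ t, IsG2 (Q t) := fun t => (hG0.transpose.mul (hEG t)).mul hG0
  -- Half of the exponent gives a symmetric square root `R` of `E t` inside the group, which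
  -- exhibits `Q t` as the Gram matrix of `R * g`.
  have hQS : ∀ t, IsSPD (Q t) := fun t => by
    set R := NormedSpace.exp (((1 - t) / 2) • A) with hR
    have hRs : Rᵀ = R := by
      have : (((1 - t) / 2) • A).IsSymm := (relLog_isSymm _ _ _).smul _
      exact this.exp
    have hRR : E t = R * R := by
      change NormedSpace.exp ((1 - t) • A) = _
      rw [hR, ← Matrix.exp_add_of_commute _ _ (Commute.refl _), ← add_smul, add_halves]
    have hRG : IsG2 R := by
      have := isG2_exp (o := frameCoord A) ((1 - t) / 2)
      rwa [← relLog_eq_frameMat] at this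
    have := isSPD_gram (hRG.mul hG0).jInv_mul
    rw [transpose_mul, hRs] at this
    rw [hQ]
    simp only [hRR]
    simpa only [mul_assoc] using this
  set γ : ℝ → Target := fun t => fromGram B (Q t) with hγ
  have hγc : ContDiff ℝ ∞ γ :=
    contDiff_fromGram B ((contDiff_const.mul hEc).mul contDiff_const) hQS
  have hgram : ∀ t, (ghat B (γ t))ᵀ * ghat B (γ t) = Q t := fun t => gram_fromGram hp (hQS t) (hQG t)
  have hγ1 : γ 1 = X₀ := by
    have : Q 1 = gᵀ * g := by simp [hQ, hE]
    rw [hγ]; simp only; rw [this]; exact fromGram_ghat hp X₀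
  have hγ0 : γ 0 = X₁ := by
    have : Q 0 = (ghat B X₁)ᵀ * ghat B X₁ := by
      have h1 : relMat B X₀ X₁ * g = ghat B X₁ := by
        rw [relMat, mul_assoc, hG0.jInv_mul, mul_one]
      rw [← h1, transpose_mul]
      simp only [hQ, hE, sub_zero, one_smul, hA, exp_relLog, mul_assoc]
    rw [hγ]; simp only; rw [this]; exact fromGram_ghat hp X₁
  -- Comparing two expressions for the derivative of the Gram matrix shows that the symmetrized
  -- logarithmic derivative is conjugate to `-A` at every time.
  have hspeed : ∀ t, G B (γ t) (deriv γ t) = (A * A).trace / 4 := by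
    intro t
    have hd : HasDerivAt γ (deriv γ t) t := (hγc.differentiable (by simp) t).hasDerivAt
    have h1 := hasDerivAt_ghat B hd
    have h2 := (hasDerivAt_transpose h1).mul h1
    have h3 : HasDerivAt (fun t => (ghat B (γ t))ᵀ * ghat B (γ t)) (gᵀ * (E t * (-A)) * g) t := by
      simp only [hgram]
      exact ((hEd t).const_mul gᵀ).mul_const g
    have h4 := h2.unique h3
    set M := frameMat (coframe B (γ t) (deriv γ t)) with hM
    have hGt := isG2_ghat B (γ t)
    have h5 := trace_sq_of_conj (m := ghat B (γ t) * jInv g) (l := g * jInv (ghat B (γ t)))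
      (S := M + Mᵀ) (A := -A) (E := E t) ?_ ?_ ?_
    · rw [trace_frameMat_coframe] at h5
      simp at h5
      linarith
    · calc _ = ghat B (γ t) * (jInv g * g) * jInv (ghat B (γ t)) := by simp only [mul_assoc]
        _ = 1 := by rw [hG0.jInv_mul, mul_one, hGt.mul_jInv]
    · calc _ = (jInv g)ᵀ * ((ghat B (γ t))ᵀ * ghat B (γ t)) * jInv g := by
            rw [transpose_mul]; simp only [mul_assoc]
        _ = (g * jInv g)ᵀ * E t * (g * jInv g) := by
            rw [hgram, transpose_mul]; simp only [hQ, mul_assoc]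
        _ = E t := by rw [hG0.mul_jInv]; simp
    · calc _ = (jInv g)ᵀ * ((M * ghat B (γ t))ᵀ * ghat B (γ t) + (ghat B (γ t))ᵀ * (M * ghat B (γ t)))
              * jInv g := by
            rw [transpose_mul, transpose_mul]; noncomm_ring
        _ = (g * jInv g)ᵀ * (E t * (-A)) * (g * jInv g) := by
            rw [h4, transpose_mul]; simp only [mul_assoc]
        _ = _ := by rw [hG0.mul_jInv]; simp
  have hlen : curveLength B γ = relDist B X₀ X₁ := by
    rw [curveLength, relDist]
    simp only [hspeed]
    rw [intervalIntegral.integral_const, Real.sqrt_div (trace_sq_nonneg (relLog_isSymm _ _ _)),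
      show (4 : ℝ) = 2 ^ 2 by norm_num, Real.sqrt_sq (by norm_num)]
    simp
  refine IsLeast.csInf_eq ⟨⟨γ, hγc.of_le (by simp), hγ0, hγ1, hlen.symm⟩, ?_⟩
  rintro l ⟨c, hc, rfl, rfl, rfl⟩
  exact relDist_le_curveLength B hc

end Distance

/-! ### Reduction of integrals over the sphere to the polar angle. -/

section Sphere

theorem volS3_eq_prod : volS3 =
    ((volume.restrict (Set.Ioo 0 Real.pi)).withDensity (fun θ => ENNReal.ofReal (Real.sin θ / 4))).prod
      (volume.restrict (Set.Ioo 0 (2 * Real.pi) ×ˢ Set.Ioo 0 (2 * Real.pi))) := by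
  rw [prod_withDensity_left (by fun_prop), Measure.prod_restrict]
  rfl

theorem torus_measure : (volume.restrict
    (Set.Ioo 0 (2 * Real.pi) ×ˢ Set.Ioo 0 (2 * Real.pi)) : Measure (ℝ × ℝ)).real Set.univ =
      4 * Real.pi ^ 2 := by
  have hpi := Real.pi_pos
  rw [measureReal_restrict_apply_univ, Measure.real, Measure.volume_eq_prod, Measure.prod_prod,
    Real.volume_Ioo, ENNReal.toReal_mul, ENNReal.toReal_ofReal (by linarith)]
  ring

theorem sin_ofReal_toReal {θ : ℝ} (h : θ ∈ Set.Ioo 0 Real.pi) :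
    (ENNReal.ofReal (Real.sin θ / 4)).toReal = Real.sin θ / 4 :=
  ENNReal.toReal_ofReal (div_nonneg (Real.sin_pos_of_mem_Ioo h).le (by norm_num))

/-- The factor π² is the area (2π)² of the torus of angles times the density factor 1/4. -/
theorem integral_volS3 (g : ℝ → ℝ) :
    ∫ x, g x.1 ∂volS3 = Real.pi ^ 2 * ∫ θ in Set.Ioo 0 Real.pi, g θ * Real.sin θ := by
  rw [volS3_eq_prod, integral_fun_fst, torus_measure,
    integral_withDensity_eq_integral_toReal_smul (by fun_prop) (by simp)]
  have : ∫ θ in Set.Ioo 0 Real.pi, (ENNReal.ofReal (Real.sin θ / 4)).toReal • g θ =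
      ∫ θ in Set.Ioo 0 Real.pi, (1 / 4) * (g θ * Real.sin θ) := by
    refine setIntegral_congr_fun measurableSet_Ioo fun θ hθ => ?_
    simp only [sin_ofReal_toReal hθ, smul_eq_mul]
    ring
  rw [this, integral_const_mul, smul_eq_mul]
  ring

theorem integrable_volS3 {g : ℝ → ℝ}
    (hg : IntegrableOn (fun θ => g θ * Real.sin θ) (Set.Ioo 0 Real.pi)) :
    Integrable (fun x : ℝ × ℝ × ℝ => g x.1) volS3 := by
  rw [volS3_eq_prod]
  have : IsFiniteMeasure (volume.restrict
      (Set.Ioo 0 (2 * Real.pi) ×ˢ Set.Ioo 0 (2 * Real.pi)) : Measure (ℝ × ℝ)) := by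
    refine ⟨?_⟩
    rw [Measure.restrict_apply_univ, Measure.volume_eq_prod, Measure.prod_prod, Real.volume_Ioo]
    exact ENNReal.mul_lt_top ENNReal.ofReal_lt_top ENNReal.ofReal_lt_top
  refine Integrable.comp_fst ?_ _
  rw [integrable_withDensity_iff_integrable_smul' (by fun_prop) (by simp)]
  refine IntegrableOn.congr_fun (hg.const_mul (1 / 4)) (fun θ hθ => ?_) measurableSet_Ioo
  simp only [sin_ofReal_toReal hθ, smul_eq_mul]
  ring

theorem quasiEnergy_eq (B : Horizon) (Λ A : ℝ) (ξ : ℝ → ℝ) {a b : ℝ} (ha : 0 ≤ a) (hab : a ≤ b)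
    (hb : b ≤ Real.pi) (Φ : ℝ → Target) :
    quasiEnergy B Λ A ξ a b Φ = ∫ θ in a..b, ξ θ * (G B (Φ θ) (deriv Φ θ)
      + lambdaCoeff B Λ A * Real.exp (-4 * Φ θ 0) * Real.sin θ ^ 2) * Real.sin θ := by
  set g : ℝ → ℝ := fun θ => ξ θ * (G B (Φ θ) (deriv Φ θ)
      + lambdaCoeff B Λ A * Real.exp (-4 * Φ θ 0) * Real.sin θ ^ 2) with hg
  have hs : MeasurableSet {x : ℝ × ℝ × ℝ | x.1 ∈ Set.Ioo a b} :=
    measurable_fst measurableSet_Ioo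
  have h1 : ∫ x in {x : ℝ × ℝ × ℝ | x.1 ∈ Set.Ioo a b}, g x.1 ∂volS3 =
      ∫ x, (Set.Ioo a b).indicator g x.1 ∂volS3 := by
    rw [← integral_indicator hs]
    rfl
  have hsub : Set.Ioo a b ⊆ Set.Ioo 0 Real.pi := Set.Ioo_subset_Ioo ha hb
  have h2 : ∫ θ in Set.Ioo 0 Real.pi, (Set.Ioo a b).indicator g θ * Real.sin θ =
      ∫ θ in a..b, g θ * Real.sin θ := by
    have h3 : ∀ θ, (Set.Ioo a b).indicator g θ * Real.sin θ =
        (Set.Ioo a b).indicator (fun θ => g θ * Real.sin θ) θ := fun θ => by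
      by_cases h : θ ∈ Set.Ioo a b <;> simp [h]
    simp only [h3]
    rw [setIntegral_indicator measurableSet_Ioo, Set.inter_eq_self_of_subset_right hsub,
      intervalIntegral.integral_of_le hab, integral_Ioc_eq_integral_Ioo]
  rw [quasiEnergy, h1, integral_volS3, h2]
  rw [← mul_assoc, one_div_mul_cancel (by positivity), one_mul]

end Sphere

/-! ### First variation of the energy through the Maurer–Cartan equation. -/

section FirstVariation

/-- Differentiation under the integral sign along a linear family. -/
theorem hasDerivAt_integral_along {E : Type*} [NormedAddCommGroup E] [NormedSpace ℝ E] {F : E → ℝ}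
    (hF : ContDiff ℝ 1 F) {x v : ℝ → E} {w : ℝ → ℝ} {a b : ℝ} (hab : a ≤ b)
    (hx : ContinuousOn x (Set.Icc a b)) (hv : ContinuousOn v (Set.Icc a b))
    (hw : ContinuousOn w (Set.Icc a b)) :
    HasDerivAt (fun t : ℝ => ∫ θ in a..b, w θ * F (x θ + t • v θ))
      (∫ θ in a..b, w θ * fderiv ℝ F (x θ) (v θ)) 0 := by
  have hcF : Continuous F := hF.continuous
  have hcF' : Continuous (fderiv ℝ F) := hF.continuous_fderiv one_ne_zero
  have hjoint : ContinuousOn (fun p : ℝ × ℝ => w p.2 * fderiv ℝ F (x p.2 + p.1 • v p.2) (v p.2))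
      (Set.Icc (-1) 1 ×ˢ Set.Icc a b) := by
    have m : Set.MapsTo Prod.snd (Set.Icc (-1 : ℝ) 1 ×ˢ Set.Icc a b) (Set.Icc a b) :=
      fun p hp => hp.2
    have hx' := hx.comp continuousOn_snd m
    have hv' := hv.comp continuousOn_snd m
    have hw' := hw.comp continuousOn_snd m
    exact hw'.mul ((hcF'.comp_continuousOn (hx'.add (continuousOn_fst.smul hv'))).clm_apply hv')
  obtain ⟨C, hC⟩ := (isCompact_Icc.prod isCompact_Icc).exists_bound_of_continuousOn hjoint
  have hu : Set.uIoc a b ⊆ Set.Icc a b := by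
    rw [Set.uIoc_of_le hab]; exact Set.Ioc_subset_Icc_self
  have hcont : ∀ t : ℝ, ContinuousOn (fun θ => w θ * F (x θ + t • v θ)) (Set.Icc a b) := fun t =>
    hw.mul (hcF.comp_continuousOn (hx.add (hv.const_smul t)))
  have hcont' : ContinuousOn (fun θ => w θ * fderiv ℝ F (x θ + (0 : ℝ) • v θ) (v θ))
      (Set.Icc a b) :=
    hw.mul ((hcF'.comp_continuousOn (hx.add (hv.const_smul (0 : ℝ)))).clm_apply hv)
  have key := intervalIntegral.hasDerivAt_integral_of_dominated_loc_of_deriv_le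
    (μ := volume) (a := a) (b := b) (bound := fun _ => C) (x₀ := (0 : ℝ)) (s := Set.Icc (-1) 1)
    (F := fun t θ => w θ * F (x θ + t • v θ))
    (F' := fun t θ => w θ * fderiv ℝ F (x θ + t • v θ) (v θ))
    (Icc_mem_nhds (by norm_num) (by norm_num))
    (Eventually.of_forall fun t => ((hcont t).mono hu).aestronglyMeasurable measurableSet_uIoc)
    ((hcont 0).intervalIntegrable_of_Icc hab)
    ((hcont'.mono hu).aestronglyMeasurable measurableSet_uIoc)
    (Eventually.of_forall fun θ hθ t ht => hC (t, θ) ⟨ht, hu hθ⟩)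
    intervalIntegrable_const
    (Eventually.of_forall fun θ hθ t ht => by
      have h1 : HasDerivAt (fun t : ℝ => x θ + t • v θ) (v θ) t := by
        simpa using ((hasDerivAt_id t).smul_const (v θ)).const_add (x θ)
      exact (((hF.differentiable one_ne_zero _).hasFDerivAt).comp_hasDerivAt t h1).const_mul (w θ))
  simpa using key.2

theorem contDiff_coframe (B : Horizon) :
    ContDiff ℝ ∞ (fun p : Target × Target => coframe B p.1 p.2) := by
  have hX : ∀ i : Fin 8, ContDiff ℝ ∞ (fun p : Target × Target => p.1 i) := fun i =>
    (contDiff_apply ℝ ℝ i).comp contDiff_fst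
  have hY : ∀ i : Fin 8, ContDiff ℝ ∞ (fun p : Target × Target => p.2 i) := fun i =>
    (contDiff_apply ℝ ℝ i).comp contDiff_snd
  have hch : ∀ p : Target × Target, Real.cosh (p.1 2) ≠ 0 := fun p => (Real.cosh_pos _).ne'
  have hP : ContDiff ℝ ∞ (fun p : Target × Target => scaleP p.1) := (hX 0).neg.exp
  have hS : ContDiff ℝ ∞ (fun p : Target × Target => scaleS p.1) :=
    (((hX 1).add ((hX 2).cosh.log hch)).div_const 2).exp
  have hx : ContDiff ℝ ∞ (fun p : Target × Target => shear p.1) :=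
    (hX 1).neg.exp.mul ((hX 2).sinh.div (hX 2).cosh hch)
  have hSi : ContDiff ℝ ∞ (fun p : Target × Target => (scaleS p.1)⁻¹) :=
    hS.inv fun X => (scaleS_pos _).ne'
  have hU : ContDiff ℝ ∞ (fun p : Target × Target => Upsilon p.1 p.2) := by
    unfold Upsilon; fun_prop
  have hT1 : ContDiff ℝ ∞ (fun p : Target × Target => ThetaBar1 p.1 p.2) := by
    unfold ThetaBar1 Theta1 auxForm; fun_prop
  have hT2 : ContDiff ℝ ∞ (fun p : Target × Target => ThetaBar2 B p.1 p.2) := by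
    unfold ThetaBar2 Theta1 Theta2 auxForm; fun_prop
  have ht : ContDiff ℝ ∞ (fun p : Target × Target => Real.sinh (p.1 2) / Real.cosh (p.1 2)) :=
    (hX 2).sinh.div (hX 2).cosh hch
  have hd : ContDiff ℝ ∞ (fun p : Target × Target => p.2 2 / Real.cosh (p.1 2)) :=
    (hY 2).div (hX 2).cosh hch
  have hb : ContDiff ℝ ∞ (fun p : Target × Target => psiBar2 B p.2) := by
    unfold psiBar2; fun_prop
  rw [contDiff_pi]
  intro i
  fin_cases i
  · exact hY 0
  · exact (hY 1).add (ht.mul (hY 2))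
  · exact ((hX 2).sinh.neg.mul (hY 1)).add hd
  · exact ((hP.pow 3).mul hSi).mul (contDiff_const.mul hT1)
  · exact ((hP.pow 3).mul hS).mul ((hx.mul (contDiff_const.mul hT1)).sub (contDiff_const.mul hT2))
  · exact (hP.mul hSi).mul (hY 6)
  · exact (hP.mul hS).mul ((hx.mul (hY 6)).sub hb)
  · exact (hP.pow 2).mul (contDiff_const.mul hU)

theorem contDiff_G (B : Horizon) : ContDiff ℝ ∞ (fun p : Target × Target => G B p.1 p.2) := by
  have h : ∀ i, ContDiff ℝ ∞ (fun p : Target × Target => coframe B p.1 p.2 i) :=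
    contDiff_pi.1 (contDiff_coframe B)
  simp only [G_eq_coframe]
  exact ((((((((contDiff_const.mul ((h 0).pow 2)).add ((h 1).pow 2)).add ((h 2).pow 2)).add
    ((h 3).pow 2)).add ((h 4).pow 2)).add ((h 5).pow 2)).add ((h 6).pow 2)).add ((h 7).pow 2))

theorem coframe_add (B : Horizon) (X Y Z : Target) :
    coframe B X (Y + Z) = coframe B X Y + coframe B X Z := by
  ext i
  fin_cases i
  all_goals simp [coframe, ThetaBar1, ThetaBar2, Theta1, Theta2, auxForm, psiBar1, psiBar2, Upsilon]
  all_goals ring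

theorem coframe_smul (B : Horizon) (k : ℝ) (X Y : Target) :
    coframe B X (k • Y) = k • coframe B X Y := by
  ext i
  fin_cases i
  all_goals simp [coframe, ThetaBar1, ThetaBar2, Theta1, Theta2, auxForm, psiBar1, psiBar2, Upsilon]
  all_goals ring

/-- The connection matrix of a tangent vector. -/
def conn (B : Horizon) (X Y : Target) : Matrix (Fin 7) (Fin 7) ℝ := frameMat (coframe B X Y)

/-- `frameMat` as a linear map. -/
def frameMatL : (Fin 8 → ℝ) →L[ℝ] Matrix (Fin 7) (Fin 7) ℝ :=
  LinearMap.toContinuousLinearMap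
    { toFun := frameMat
      map_add' := fun o p => (frameMat_add o p).symm
      map_smul' := fun k o => frameMat_smul k o }

theorem contDiff_conn (B : Horizon) : ContDiff ℝ ∞ (fun p : Target × Target => conn B p.1 p.2) :=
  frameMatL.contDiff.comp (contDiff_coframe B)

theorem conn_add (B : Horizon) (X Y Z : Target) : conn B X (Y + Z) = conn B X Y + conn B X Z := by
  rw [conn, coframe_add, ← frameMat_add]; rfl

theorem conn_smul (B : Horizon) (k : ℝ) (X Y : Target) : conn B X (k • Y) = k • conn B X Y := by
  rw [conn, coframe_smul, frameMat_smul]; rfl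

/-- Symmetry of the second derivative of a solution of `df = m f`. -/
theorem symm_of_logDeriv {E 𝔸 : Type*} [NormedAddCommGroup E] [NormedSpace ℝ E] [NormedRing 𝔸]
    [NormedAlgebra ℝ 𝔸] {f : E → 𝔸} (hf : ContDiff ℝ ∞ f) {m : E × E → 𝔸} (hm : Differentiable ℝ m)
    (hfm : ∀ X Y, fderiv ℝ f X Y = m (X, Y) * f X) (X H Y : E) :
    (fderiv ℝ m (X, Y) (H, 0) + m (X, Y) * m (X, H)) * f X =
      (fderiv ℝ m (X, H) (Y, 0) + m (X, H) * m (X, Y)) * f X := by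
  have hd : Differentiable ℝ (fderiv ℝ f) :=
    (hf.fderiv_right (m := ∞) (by simp)).differentiable (by simp)
  have key : ∀ H Y, fderiv ℝ (fderiv ℝ f) X H Y =
      (fderiv ℝ m (X, Y) (H, 0) + m (X, Y) * m (X, H)) * f X := by
    intro H Y
    have h1 : HasDerivAt (fun s : ℝ => fderiv ℝ f (X + s • H) Y)
        (fderiv ℝ (fderiv ℝ f) X H Y) 0 := by
      have h3 : HasDerivAt (fun s : ℝ => fderiv ℝ f (X + s • H)) (fderiv ℝ (fderiv ℝ f) X H) 0 :=
        (hd X).hasFDerivAt.hasLineDerivAt H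
      simpa using h3.clm_apply (hasDerivAt_const (0 : ℝ) Y)
    have h4 : HasDerivAt (fun s : ℝ => m (X + s • H, Y)) (fderiv ℝ m (X, Y) (H, 0)) 0 := by
      have h5 : HasDerivAt (fun s : ℝ => m ((X, Y) + s • (H, 0))) (fderiv ℝ m (X, Y) (H, 0)) 0 :=
        (hm (X, Y)).hasFDerivAt.hasLineDerivAt (H, 0)
      simpa using h5
    have h5 : HasDerivAt (fun s : ℝ => f (X + s • H)) (fderiv ℝ f X H) 0 :=
      (hf.differentiable (by simp) X).hasFDerivAt.hasLineDerivAt H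
    have h6 := h4.mul h5
    simp only [hfm] at h1 h6
    have h7 := h1.unique h6
    simp only [zero_smul, add_zero] at h7
    rw [h7, add_mul, mul_assoc]
  have hsymm := second_derivative_symmetric (f := f) (f' := fderiv ℝ f)
    (fun y => (hf.differentiable (by simp) y).hasFDerivAt) (hd X).hasFDerivAt H Y
  rwa [key, key] at hsymm

/-- The derivative of a function of position and velocity that is linear in the velocity. -/
theorem hasDerivAt_variation {E 𝔸 : Type*} [NormedAddCommGroup E] [NormedSpace ℝ E]
    [NormedAddCommGroup 𝔸] [NormedSpace ℝ 𝔸] {m : E × E → 𝔸} (hm : Differentiable ℝ m)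
    (hadd : ∀ X Y Z, m (X, Y + Z) = m (X, Y) + m (X, Z))
    (hsmul : ∀ (k : ℝ) X Y, m (X, k • Y) = k • m (X, Y)) {Φ η : ℝ → E} {Φ' η' : E} {N' : 𝔸} {θ : ℝ}
    (hΦ : HasDerivAt Φ Φ' θ) (hη : HasDerivAt η η' θ)
    (hN : HasDerivAt (fun θ => m (Φ θ, η θ)) N' θ) :
    HasDerivAt (fun t : ℝ => m (Φ θ + t • η θ, Φ' + t • η'))
      (N' + (fderiv ℝ m (Φ θ, Φ') (η θ, 0) - fderiv ℝ m (Φ θ, η θ) (Φ', 0))) 0 := by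
  -- Linearity in the velocity makes the vertical derivative equal to `m` itself. Exchanging the
  -- variation with the derivative in θ therefore leaves only the antisymmetrized horizontal
  -- derivatives.
  have hvert : ∀ X Y K, fderiv ℝ m (X, Y) (0, K) = m (X, K) := by
    intro X Y K
    have h2 : HasDerivAt (fun s : ℝ => m ((X, Y) + s • (0, K))) (fderiv ℝ m (X, Y) (0, K)) 0 :=
      (hm (X, Y)).hasFDerivAt.hasLineDerivAt (0, K)
    have h3 : HasDerivAt (fun s : ℝ => m ((X, Y) + s • (0, K))) (m (X, K)) 0 := by
      simp only [Prod.smul_mk, smul_zero, Prod.mk_add_mk, add_zero, hadd, hsmul]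
      simpa using ((hasDerivAt_id (0 : ℝ)).smul_const (m (X, K))).const_add (m (X, Y))
    exact h2.unique h3
  have hsplit : ∀ X Y H K, fderiv ℝ m (X, Y) (H, K) = fderiv ℝ m (X, Y) (H, 0) + m (X, K) := by
    intro X Y H K
    rw [← hvert X Y K, ← map_add]
    simp
  have h1 : HasDerivAt (fun t : ℝ => m (Φ θ + t • η θ, Φ' + t • η'))
      (fderiv ℝ m (Φ θ, Φ') (η θ, η')) 0 :=
    (hm (Φ θ, Φ')).hasFDerivAt.hasLineDerivAt (η θ, η')
  have h2 : N' = fderiv ℝ m (Φ θ, η θ) (Φ', η') :=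
    hN.unique ((hm (Φ θ, η θ)).hasFDerivAt.comp_hasDerivAt (f := fun θ => (Φ θ, η θ)) θ
      (hΦ.prodMk hη))
  refine h1.congr_deriv ?_
  rw [h2, hsplit, hsplit (Φ θ) (η θ)]
  abel

theorem fderiv_ghat (B : Horizon) (X Y : Target) :
    fderiv ℝ (ghat B) X Y = conn B X Y * ghat B X := by
  have h1 : HasDerivAt (fun s : ℝ => X + s • Y) Y 0 := by
    simpa using ((hasDerivAt_id (0 : ℝ)).smul_const Y).const_add X
  have h2 : HasDerivAt (fun s : ℝ => ghat B (X + s • Y)) (fderiv ℝ (ghat B) X Y) 0 :=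
    ((contDiff_ghat B).differentiable (by simp) X).hasFDerivAt.hasLineDerivAt Y
  have h3 := h2.unique (hasDerivAt_ghat B h1)
  rw [h3, zero_smul, add_zero]
  rfl

/-- The Maurer–Cartan equation. -/
theorem conn_maurerCartan (B : Horizon) (X H Y : Target) :
    fderiv ℝ (fun p : Target × Target => conn B p.1 p.2) (X, Y) (H, 0)
      - fderiv ℝ (fun p : Target × Target => conn B p.1 p.2) (X, H) (Y, 0) =
      conn B X H * conn B X Y - conn B X Y * conn B X H := by
  have h := symm_of_logDeriv (contDiff_ghat B) ((contDiff_conn B).differentiable (by simp))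
    (fderiv_ghat B) X H Y
  have h8 := congrArg (· * jInv (ghat B X)) h
  simp only [mul_assoc, (isG2_ghat B X).mul_jInv, mul_one] at h8
  rw [sub_eq_sub_iff_add_eq_add]
  exact h8.trans (add_comm _ _)

/-- Variation of the connection matrix. -/
theorem conn_variation (B : Horizon) {Φ η : ℝ → Target} {Φ' η' : Target} {N' : Matrix (Fin 7) (Fin 7) ℝ}
    {θ : ℝ} (hΦ : HasDerivAt Φ Φ' θ) (hη : HasDerivAt η η' θ)
    (hN : HasDerivAt (fun θ => conn B (Φ θ) (η θ)) N' θ) :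
    HasDerivAt (fun t : ℝ => conn B (Φ θ + t • η θ) (Φ' + t • η'))
      (N' + (conn B (Φ θ) (η θ) * conn B (Φ θ) Φ' - conn B (Φ θ) Φ' * conn B (Φ θ) (η θ))) 0 := by
  have h := hasDerivAt_variation ((contDiff_conn B).differentiable (by simp))
    (fun X Y Z => conn_add B X Y Z) (fun k X Y => conn_smul B k X Y) hΦ hη hN
  exact h.congr_deriv (congrArg (N' + ·) (conn_maurerCartan B (Φ θ) (η θ) Φ'))

theorem four_mul_G (B : Horizon) (X Y : Target) :
    4 * G B X Y = ((conn B X Y + (conn B X Y)ᵀ) * (conn B X Y + (conn B X Y)ᵀ)).trace :=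
  (trace_frameMat_coframe B X Y).symm

/-- The first variation of the energy density. -/
theorem fderiv_G_variation (B : Horizon) {Φ η : ℝ → Target} {Φ' η' : Target}
    {N' : Matrix (Fin 7) (Fin 7) ℝ} {θ : ℝ} (hΦ : HasDerivAt Φ Φ' θ) (hη : HasDerivAt η η' θ)
    (hN : HasDerivAt (fun θ => conn B (Φ θ) (η θ)) N' θ) :
    let M := conn B (Φ θ) Φ'
    let N := conn B (Φ θ) (η θ)
    fderiv ℝ (fun p : Target × Target => G B p.1 p.2) (Φ θ, Φ') (η θ, η') =
      (((M + Mᵀ) * (N' + N'ᵀ)).trace + ((N + Nᵀ) * (M * Mᵀ - Mᵀ * M)).trace) / 2 := by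
  intro M N
  have h1 : HasDerivAt (fun t : ℝ => G B (Φ θ + t • η θ) (Φ' + t • η'))
      (fderiv ℝ (fun p : Target × Target => G B p.1 p.2) (Φ θ, Φ') (η θ, η')) 0 :=
    ((contDiff_G B).differentiable (by simp) (Φ θ, Φ')).hasFDerivAt.hasLineDerivAt (η θ, η')
  have h2 := h1.const_mul 4
  have hv := conn_variation B hΦ hη hN
  have hS := hasDerivAt_trace_sq (hv.add (hasDerivAt_transpose hv))
  have h3 := h2.unique (hS.congr_of_eventuallyEq (Eventually.of_forall fun t => by
    exact four_mul_G B _ _))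
  -- By cyclicity of the trace, the commutator term and its transpose each pair to tr(N (MMᵀ −
  -- MᵀM)). The result is the linear term subtracted in `excess`, with `N + Nᵀ` in the role of A.
  have h4 : ((M + Mᵀ) * ((N' + (N * M - M * N)) + (N' + (N * M - M * N))ᵀ)).trace =
      ((M + Mᵀ) * (N' + N'ᵀ)).trace + ((N + Nᵀ) * (M * Mᵀ - Mᵀ * M)).trace := by
    have e1 : ((M + Mᵀ) * ((N' + (N * M - M * N)) + (N' + (N * M - M * N))ᵀ)).trace =
        ((M + Mᵀ) * (N' + N'ᵀ)).trace + ((M + Mᵀ) * (N * M - M * N)).trace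
          + ((M + Mᵀ) * (N * M - M * N)ᵀ).trace := by
      rw [transpose_add, ← trace_add, ← trace_add, ← mul_add, ← mul_add]
      congr 2
      abel
    have e2 : ((M + Mᵀ) * (N * M - M * N)ᵀ).trace = ((M + Mᵀ) * (N * M - M * N)).trace := by
      rw [← trace_transpose, transpose_mul, transpose_transpose, transpose_add, transpose_transpose,
        trace_mul_comm, add_comm Mᵀ]
    have e3 : ((M + Mᵀ) * (N * M - M * N)).trace = (N * (M * Mᵀ - Mᵀ * M)).trace := by
      simp only [add_mul, mul_sub, trace_add, trace_sub]
      have a1 : (M * (N * M)).trace = (M * (M * N)).trace := by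
        rw [trace_mul_comm, mul_assoc, trace_mul_comm, mul_assoc]
      have a2 : (Mᵀ * (N * M)).trace = (N * (M * Mᵀ)).trace := by
        rw [trace_mul_comm, mul_assoc]
      have a3 : (Mᵀ * (M * N)).trace = (N * (Mᵀ * M)).trace := by
        rw [← mul_assoc, trace_mul_comm]
      rw [a1, a2, a3]; ring
    have e4 : (Nᵀ * (M * Mᵀ - Mᵀ * M)).trace = (N * (M * Mᵀ - Mᵀ * M)).trace := by
      rw [← trace_transpose, transpose_mul, transpose_transpose, transpose_sub, transpose_mul,
        transpose_mul, transpose_transpose, trace_mul_comm]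
    rw [e1, e2, e3, add_mul N, trace_add (N * _), e4]; ring
  have h5 : (Φ θ + (0 : ℝ) • η θ) = Φ θ := by simp
  have h6 : (Φ' + (0 : ℝ) • η') = Φ' := by simp
  simp only [Pi.add_apply, h5, h6] at h3
  change 4 * _ = 2 * ((M + Mᵀ) * ((N' + (N * M - M * N)) + (N' + (N * M - M * N))ᵀ)).trace at h3
  rw [h4] at h3
  linarith

end FirstVariation

/-! ### The Euler–Lagrange equation in moving-frame form. -/

section EulerLagrange

/-- The tangent vector with given coframe components. -/
def coframeInv (B : Horizon) (X : Target) (o : Fin 8 → ℝ) : Target :=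
  let y6 : ℝ := (scaleP X)⁻¹ * scaleS X * o 5
  let y7 : ℝ := (shear X * y6 - (scaleP X)⁻¹ * (scaleS X)⁻¹ * o 6 - B.q * y6) / B.p
  let y5 : ℝ := (scaleP X)⁻¹ ^ 2 * o 7 / B.p - (X 6 * y7 - X 7 * y6) / √3
  let t1 : ℝ := (scaleP X)⁻¹ ^ 3 * scaleS X * o 3 / B.p
  let t2 : ℝ := (shear X * t1 - (scaleP X)⁻¹ ^ 3 * (scaleS X)⁻¹ * o 4 / B.p - B.q * t1) / B.p
  let y : ℝ := y5 + (X 6 * y7 - X 7 * y6) / (3 * √3)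
  ![o 0, (o 1 - Real.sinh (X 2) * o 2) / Real.cosh (X 2) ^ 2,
    (o 2 + Real.sinh (X 2) * o 1) / Real.cosh (X 2), t1 - X 6 * y, t2 - X 7 * y, y5, y6, y7]

/-- Every field of coframe components is realized by a tangent field, so directions of variation may
be prescribed directly in the frame. -/
theorem coframe_coframeInv {B : Horizon} (hp : B.p ≠ 0) (X : Target) (o : Fin 8 → ℝ) :
    coframe B X (coframeInv B X o) = o := by
  have hP := (scaleP_pos X).ne'
  have hS := (scaleS_pos X).ne'
  have hc := (Real.cosh_pos (X 2)).ne'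
  have hcs := Real.cosh_sq (X 2)
  ext i
  fin_cases i
  · simp [coframe, coframeInv]
  · simp [coframe, coframeInv]
    field_simp
    linear_combination (-o 1) * hcs
  · simp [coframe, coframeInv]
    field_simp
    linear_combination (-o 2) * hcs
  · simp [coframe, coframeInv, ThetaBar1, Theta1, auxForm]
    field_simp
  · simp [coframe, coframeInv, ThetaBar1, ThetaBar2, Theta1, Theta2, auxForm]
    field_simp
    ring
  · simp [coframe, coframeInv, psiBar1]
    field_simp
  · simp [coframe, coframeInv, psiBar1, psiBar2]
    field_simp
    ring
  · simp [coframe, coframeInv, Upsilon]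
    field_simp

theorem contDiff_coframeInv (B : Horizon) :
    ContDiff ℝ ∞ (fun p : Target × (Fin 8 → ℝ) => coframeInv B p.1 p.2) := by
  have hX : ∀ i : Fin 8, ContDiff ℝ ∞ (fun p : Target × (Fin 8 → ℝ) => p.1 i) := fun i =>
    (contDiff_apply ℝ ℝ i).comp contDiff_fst
  have hY : ∀ i : Fin 8, ContDiff ℝ ∞ (fun p : Target × (Fin 8 → ℝ) => p.2 i) := fun i =>
    (contDiff_apply ℝ ℝ i).comp contDiff_snd
  have hch : ∀ p : Target × (Fin 8 → ℝ), Real.cosh (p.1 2) ≠ 0 := fun p => (Real.cosh_pos _).ne'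
  have hch2 : ∀ p : Target × (Fin 8 → ℝ), Real.cosh (p.1 2) ^ 2 ≠ 0 := fun p =>
    pow_ne_zero 2 (hch p)
  have hP : ContDiff ℝ ∞ (fun p : Target × (Fin 8 → ℝ) => (scaleP p.1)⁻¹) :=
    (hX 0).neg.exp.inv fun p => (scaleP_pos _).ne'
  have hS : ContDiff ℝ ∞ (fun p : Target × (Fin 8 → ℝ) => scaleS p.1) :=
    (((hX 1).add ((hX 2).cosh.log hch)).div_const 2).exp
  have hx : ContDiff ℝ ∞ (fun p : Target × (Fin 8 → ℝ) => shear p.1) :=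
    (hX 1).neg.exp.mul ((hX 2).sinh.div (hX 2).cosh hch)
  have hSi : ContDiff ℝ ∞ (fun p : Target × (Fin 8 → ℝ) => (scaleS p.1)⁻¹) :=
    hS.inv fun X => (scaleS_pos _).ne'
  rw [contDiff_pi]
  intro i
  fin_cases i
  all_goals simp only [coframeInv]
  all_goals simp [-inv_pow]
  · exact hY 0
  · exact ((hY 1).sub ((hX 2).sinh.mul (hY 2))).div ((hX 2).cosh.pow 2) hch2
  · exact ((hY 2).add ((hX 2).sinh.mul (hY 1))).div (hX 2).cosh hch
  all_goals fun_prop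

theorem trace_contDiffAt {E : Type*} [NormedAddCommGroup E] [NormedSpace ℝ E] {m : WithTop ℕ∞}
    {f : E → Matrix (Fin 7) (Fin 7) ℝ} {x : E} (hf : ContDiffAt ℝ m f x) :
    ContDiffAt ℝ m (fun y => (f y).trace) x :=
  (LinearMap.toContinuousLinearMap (Matrix.traceLinearMap (Fin 7) ℝ ℝ)).contDiff.contDiffAt.comp x hf

theorem exists_Ioo_of_isCompact {K : Set ℝ} (hK : IsCompact K) {c d : ℝ} (hcd : c < d)
    (h : K ⊆ Set.Ioo c d) : ∃ a b, c < a ∧ a < b ∧ b < d ∧ K ⊆ Set.Ioo a b := by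
  rcases K.eq_empty_or_nonempty with rfl | hne
  · exact ⟨(2 * c + d) / 3, (c + 2 * d) / 3, by linarith, by linarith, by linarith, by simp⟩
  · obtain ⟨m, hm, hm'⟩ := hK.exists_isLeast hne
    obtain ⟨M, hM, hM'⟩ := hK.exists_isGreatest hne
    have h1 := h hm
    have h2 := h hM
    have h3 := hm' hM
    refine ⟨(c + m) / 2, (M + d) / 2, by linarith [h1.1], by linarith [h1.1, h2.2], by linarith [h2.2],
      fun x hx => ⟨?_, ?_⟩⟩
    · linarith [hm' hx, h1.1]
    · linarith [hM' hx, h2.2]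

/-- The pairing of the momentum of `Φ` with a symmetric variation. -/
def momentum (B : Horizon) (ξ : ℝ → ℝ) (Φ : ℝ → Target) (α : ℝ → Fin 8 → ℝ) (θ : ℝ) : ℝ :=
  ξ θ * Real.sin θ / 2 * ((conn B (Φ θ) (deriv Φ θ) + (conn B (Φ θ) (deriv Φ θ))ᵀ) *
    (frameMat (α θ) + (frameMat (α θ))ᵀ)).trace

/-- The derivative of the momentum along a quasi-harmonic map. -/
def force (B : Horizon) (Λ A : ℝ) (ξ : ℝ → ℝ) (Φ : ℝ → Target) (α : ℝ → Fin 8 → ℝ) (θ : ℝ) : ℝ :=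
  ξ θ * Real.sin θ / 2 * (((conn B (Φ θ) (deriv Φ θ) + (conn B (Φ θ) (deriv Φ θ))ᵀ) *
      (frameMat (deriv α θ) + (frameMat (deriv α θ))ᵀ)).trace +
    ((frameMat (α θ) + (frameMat (α θ))ᵀ) *
      (conn B (Φ θ) (deriv Φ θ) * (conn B (Φ θ) (deriv Φ θ))ᵀ
        - (conn B (Φ θ) (deriv Φ θ))ᵀ * conn B (Φ θ) (deriv Φ θ))).trace)
  - 4 * (lambdaCoeff B Λ A * ξ θ * Real.sin θ ^ 3 * Real.exp (-4 * Φ θ 0)) * α θ 0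

theorem frameMat_contDiffAt {f : ℝ → Fin 8 → ℝ} {θ : ℝ} (hf : ContDiffAt ℝ ∞ f θ) :
    ContDiffAt ℝ ∞ (fun t => frameMat (f t)) θ := frameMatL.contDiff.contDiffAt.comp θ hf

theorem conn_contDiffAt (B : Horizon) {Φ : ℝ → Target} (hΦ : ContDiffOn ℝ ∞ Φ (Set.Ioo 0 Real.pi))
    {θ : ℝ} (hθ : θ ∈ Set.Ioo 0 Real.pi) :
    ContDiffAt ℝ ∞ (fun t => conn B (Φ t) (deriv Φ t)) θ := by
  have h1 := hΦ.contDiffAt (isOpen_Ioo.mem_nhds hθ)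
  have h2 : ContDiffAt ℝ ∞ (deriv Φ) θ :=
    (hΦ.deriv_of_isOpen isOpen_Ioo (by simp)).contDiffAt (isOpen_Ioo.mem_nhds hθ)
  exact (contDiff_conn B).contDiffAt.comp θ (h1.prodMk h2)

theorem momentum_contDiffAt (B : Horizon) {ξ : ℝ → ℝ} {Φ : ℝ → Target} {α : ℝ → Fin 8 → ℝ}
    (hξ : ContDiffOn ℝ ∞ ξ (Set.Ioo 0 Real.pi)) (hΦ : ContDiffOn ℝ ∞ Φ (Set.Ioo 0 Real.pi))
    (hα : ContDiffOn ℝ ∞ α (Set.Ioo 0 Real.pi)) {θ : ℝ} (hθ : θ ∈ Set.Ioo 0 Real.pi) :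
    ContDiffAt ℝ ∞ (momentum B ξ Φ α) θ := by
  have hm := isOpen_Ioo.mem_nhds hθ
  have hM := conn_contDiffAt B hΦ hθ
  have hF := frameMat_contDiffAt (hα.contDiffAt hm)
  exact (((hξ.contDiffAt hm).mul Real.contDiff_sin.contDiffAt).div_const 2).mul
    (trace_contDiffAt ((hM.add (contDiffAt_transpose hM)).mul (hF.add (contDiffAt_transpose hF))))

theorem force_continuousAt (B : Horizon) (Λ A : ℝ) {ξ : ℝ → ℝ} {Φ : ℝ → Target} {α : ℝ → Fin 8 → ℝ}
    (hξ : ContDiffOn ℝ ∞ ξ (Set.Ioo 0 Real.pi)) (hΦ : ContDiffOn ℝ ∞ Φ (Set.Ioo 0 Real.pi))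
    (hα : ContDiffOn ℝ ∞ α (Set.Ioo 0 Real.pi)) {θ : ℝ} (hθ : θ ∈ Set.Ioo 0 Real.pi) :
    ContinuousAt (force B Λ A ξ Φ α) θ := by
  have hm := isOpen_Ioo.mem_nhds hθ
  have hM := conn_contDiffAt B hΦ hθ
  have hM' := contDiffAt_transpose hM
  have hF := frameMat_contDiffAt (hα.contDiffAt hm)
  have hα' : ContDiffAt ℝ ∞ (deriv α) θ :=
    (hα.deriv_of_isOpen isOpen_Ioo (by simp)).contDiffAt hm
  have hF' := frameMat_contDiffAt hα'
  have hs : ContDiffAt ℝ ∞ Real.sin θ := Real.contDiff_sin.contDiffAt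
  have hx := hξ.contDiffAt hm
  have h0 : ContDiffAt ℝ ∞ (fun t => Φ t 0) θ := contDiffAt_pi.1 (hΦ.contDiffAt hm) 0
  have ha0 : ContDiffAt ℝ ∞ (fun t => α t 0) θ := contDiffAt_pi.1 (hα.contDiffAt hm) 0
  have h1 := trace_contDiffAt ((hM.add hM').mul (hF'.add (contDiffAt_transpose hF')))
  have h2 := trace_contDiffAt ((hF.add (contDiffAt_transpose hF)).mul
    ((hM.mul hM').sub (hM'.mul hM)))
  have h3 := ((hx.mul hs).div_const 2).mul (h1.add h2)
  have h4 := (contDiffAt_const.mul (((contDiffAt_const.mul hx).mul (hs.pow 3)).mul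
    (contDiffAt_const.mul h0).exp)).mul ha0 (f := fun t => 4 * (lambdaCoeff B Λ A * ξ t *
      Real.sin t ^ 3 * Real.exp (-4 * Φ t 0)))
  exact (h3.sub h4).continuousAt

/-- Vary in the direction with frame components g α, where the cutoff g carries the compact support.
The connection matrix of this direction is g times `frameMat` of α, so the derivative of g appears
exactly against the momentum. -/
theorem euler_lagrange_weak {B : Horizon} (hp : B.p ≠ 0) {Λ A : ℝ} {ξ : ℝ → ℝ} {Φ : ℝ → Target}
    {α : ℝ → Fin 8 → ℝ} (hξ : ContDiffOn ℝ ∞ ξ (Set.Ioo 0 Real.pi))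
    (hΦ : ContDiffOn ℝ ∞ Φ (Set.Ioo 0 Real.pi)) (hα : ContDiffOn ℝ ∞ α (Set.Ioo 0 Real.pi))
    (hq : IsQuasiHarmonic B Λ A ξ Φ) {a b : ℝ} (ha : 0 < a) (hab : a < b) (hb : b < Real.pi)
    {g : ℝ → ℝ} (hg : ContDiff ℝ ∞ g) (hgc : HasCompactSupport g) (hgs : tsupport g ⊆ Set.Ioo a b) :
    ∫ θ in a..b, (deriv g θ * momentum B ξ Φ α θ + g θ * force B Λ A ξ Φ α θ) = 0 := by
  have hsub : Set.Icc a b ⊆ Set.Ioo 0 Real.pi := fun x hx =>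
    ⟨lt_of_lt_of_le ha hx.1, lt_of_le_of_lt hx.2 hb⟩
  have hnh : ∀ {θ}, θ ∈ Set.Icc a b → Set.Ioo 0 Real.pi ∈ 𝓝 θ := fun hθ =>
    isOpen_Ioo.mem_nhds (hsub hθ)
  -- Although `Φ` and `α` are controlled only between the poles, the product is smooth on the whole
  -- line, since it vanishes near every point off the support of `g`.
  set η : ℝ → Target := fun θ => g θ • coframeInv B (Φ θ) (α θ) with hη
  have hηc : ContDiff ℝ ∞ η := by
    rw [contDiff_iff_contDiffAt]
    intro θ
    by_cases h : θ ∈ tsupport g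
    · have hm := hnh (Set.Ioo_subset_Icc_self (hgs h))
      exact hg.contDiffAt.smul ((contDiff_coframeInv B).contDiffAt.comp θ
        ((hΦ.contDiffAt hm).prodMk (hα.contDiffAt hm)))
    · have h0 : η =ᶠ[𝓝 θ] fun _ => 0 := by
        filter_upwards [notMem_tsupport_iff_eventuallyEq.1 h] with t ht
        simp [hη, ht]
      exact contDiffAt_const.congr_of_eventuallyEq h0
  have hηs : tsupport η ⊆ Set.Ioo a b := (tsupport_smul_subset_left _ _).trans hgs
  have hcrit := hq a b ha hab hb η hηc hgc.smul_right hηs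
  have hΦd : ∀ θ ∈ Set.Icc a b, HasDerivAt Φ (deriv Φ θ) θ := fun θ hθ =>
    ((hΦ.contDiffAt (hnh hθ)).differentiableAt (by simp)).hasDerivAt
  have hαd : ∀ θ ∈ Set.Icc a b, HasDerivAt α (deriv α θ) θ := fun θ hθ =>
    ((hα.contDiffAt (hnh hθ)).differentiableAt (by simp)).hasDerivAt
  have hηd : ∀ θ, HasDerivAt η (deriv η θ) θ := fun θ => (hηc.differentiable (by simp) θ).hasDerivAt
  have hgd : ∀ θ, HasDerivAt g (deriv g θ) θ := fun θ => (hg.differentiable (by simp) θ).hasDerivAt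
  have hxc : ContinuousOn (fun θ => (Φ θ, deriv Φ θ)) (Set.Icc a b) :=
    (hΦ.continuousOn.mono hsub).prodMk
      ((hΦ.deriv_of_isOpen (m := ∞) isOpen_Ioo (by simp)).continuousOn.mono hsub)
  have hvc : ContinuousOn (fun θ => (η θ, deriv η θ)) (Set.Icc a b) :=
    (hηc.continuous.prodMk (hηc.continuous_deriv (by simp))).continuousOn
  have hw1 : ContinuousOn (fun θ => ξ θ * Real.sin θ) (Set.Icc a b) :=
    (hξ.continuousOn.mono hsub).mul Real.continuous_sin.continuousOn
  have hw2 : ContinuousOn (fun θ => lambdaCoeff B Λ A * ξ θ * Real.sin θ ^ 3) (Set.Icc a b) :=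
    (continuousOn_const.mul (hξ.continuousOn.mono hsub)).mul
      (Real.continuous_sin.pow 3).continuousOn
  set F2 : Target × Target → ℝ := fun p => Real.exp (-4 * p.1 0) with hF2
  have hF2c : ContDiff ℝ 1 F2 := by
    have : ContDiff ℝ 1 (fun p : Target × Target => p.1 0) :=
      (contDiff_apply ℝ ℝ (0 : Fin 8)).comp contDiff_fst
    exact (contDiff_const.mul this).exp
  have hGc : ContDiff ℝ 1 (fun p : Target × Target => G B p.1 p.2) := (contDiff_G B).of_le (by simp)
  have d1 := hasDerivAt_integral_along hGc hab.le hxc hvc hw1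
  have d2 := hasDerivAt_integral_along hF2c hab.le hxc hvc hw2
  have i1 : ∀ (F : Target × Target → ℝ), ContDiff ℝ 1 F → ∀ t : ℝ, ContinuousOn
      (fun θ => F ((Φ θ, deriv Φ θ) + t • (η θ, deriv η θ))) (Set.Icc a b) := fun F hF t =>
    hF.continuous.comp_continuousOn (hxc.add (hvc.const_smul t))
  have hE : ∀ t : ℝ, quasiEnergy B Λ A ξ a b (fun θ => Φ θ + t • η θ) =
      (∫ θ in a..b, ξ θ * Real.sin θ *
        (fun p : Target × Target => G B p.1 p.2) ((Φ θ, deriv Φ θ) + t • (η θ, deriv η θ)))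
      + ∫ θ in a..b, lambdaCoeff B Λ A * ξ θ * Real.sin θ ^ 3 *
        F2 ((Φ θ, deriv Φ θ) + t • (η θ, deriv η θ)) := by
    intro t
    rw [quasiEnergy_eq B Λ A ξ ha.le hab.le hb.le, ← intervalIntegral.integral_add]
    · refine intervalIntegral.integral_congr fun θ hθ => ?_
      rw [Set.uIcc_of_le hab.le] at hθ
      have : deriv (fun θ => Φ θ + t • η θ) θ = deriv Φ θ + t • deriv η θ :=
        ((hΦd θ hθ).add ((hηd θ).const_smul t)).deriv
      simp only [this, hF2]
      simp
      ring
    · exact (hw1.mul (i1 _ hGc t)).intervalIntegrable_of_Icc hab.le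
    · exact (hw2.mul (i1 _ hF2c t)).intervalIntegrable_of_Icc hab.le
  have hz := hcrit.unique ((d1.add d2).congr_of_eventuallyEq (Eventually.of_forall hE))
  have j1 : ∀ (F : Target × Target → ℝ), ContDiff ℝ 1 F → ContinuousOn
      (fun θ => fderiv ℝ F (Φ θ, deriv Φ θ) (η θ, deriv η θ)) (Set.Icc a b) := fun F hF =>
    ((hF.continuous_fderiv one_ne_zero).comp_continuousOn hxc).clm_apply hvc
  have hsum := intervalIntegral.integral_add (μ := volume)
    ((hw1.mul (j1 _ hGc)).intervalIntegrable_of_Icc hab.le)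
    ((hw2.mul (j1 _ hF2c)).intervalIntegrable_of_Icc hab.le)
  simp only [Pi.mul_apply] at hsum
  rw [← hsum] at hz
  rw [hz]
  refine intervalIntegral.integral_congr fun θ hθ => ?_
  rw [Set.uIcc_of_le hab.le] at hθ
  have hconn : ∀ t, conn B (Φ t) (η t) = g t • frameMat (α t) := fun t => by
    rw [hη]
    simp only
    rw [conn_smul, conn, coframe_coframeInv hp]
  have hN : HasDerivAt (fun t => conn B (Φ t) (η t))
      (deriv g θ • frameMat (α θ) + g θ • frameMat (deriv α θ)) θ := by
    simp only [hconn]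
    have h1 : HasDerivAt (fun t => frameMat (α t)) (frameMat (deriv α θ)) θ :=
      frameMatL.hasFDerivAt.comp_hasDerivAt θ (hαd θ hθ)
    exact ((hgd θ).smul h1).congr_deriv (add_comm _ _)
  have hv := fderiv_G_variation B (hΦd θ hθ) (hηd θ) hN
  have hv2 : fderiv ℝ F2 (Φ θ, deriv Φ θ) (η θ, deriv η θ) =
      -4 * Real.exp (-4 * Φ θ 0) * (g θ * α θ 0) := by
    have h1 : HasDerivAt (fun t : ℝ => F2 ((Φ θ, deriv Φ θ) + t • (η θ, deriv η θ)))
        (fderiv ℝ F2 (Φ θ, deriv Φ θ) (η θ, deriv η θ)) 0 :=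
      (hF2c.differentiable one_ne_zero (Φ θ, deriv Φ θ)).hasFDerivAt.hasLineDerivAt _
    have h2 : HasDerivAt (fun t : ℝ => Φ θ 0 + t * η θ 0) (η θ 0) 0 := by
      simpa using ((hasDerivAt_id (0 : ℝ)).mul_const (η θ 0)).const_add (Φ θ 0)
    have h3 := (h2.const_mul (-4)).exp
    have h4 := h1.unique h3
    rw [h4]
    simp [hη, coframeInv]
    ring
  simp only at hv hv2 ⊢
  rw [hv, hv2, hconn]
  simp only [momentum, force, transpose_add, transpose_smul, ← smul_add, mul_add, add_mul,
    Matrix.mul_smul, Matrix.smul_mul, trace_add, trace_smul, smul_eq_mul]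
  ring

/-- The weak identity and the fundamental lemma of the calculus of variations give equality almost
everywhere; both sides are continuous, so it holds everywhere. No decay of `α` at the poles is
involved, which later admits the logarithm itself as a direction. -/
theorem euler_lagrange {B : Horizon} (hp : B.p ≠ 0) {Λ A : ℝ} {ξ : ℝ → ℝ} {Φ : ℝ → Target}
    {α : ℝ → Fin 8 → ℝ} (hξ : ContDiffOn ℝ ∞ ξ (Set.Ioo 0 Real.pi))
    (hΦ : ContDiffOn ℝ ∞ Φ (Set.Ioo 0 Real.pi)) (hα : ContDiffOn ℝ ∞ α (Set.Ioo 0 Real.pi))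
    (hq : IsQuasiHarmonic B Λ A ξ Φ) {θ : ℝ} (hθ : θ ∈ Set.Ioo 0 Real.pi) :
    HasDerivAt (momentum B ξ Φ α) (force B Λ A ξ Φ α θ) θ := by
  set β := momentum B ξ Φ α with hβ
  set ρ := force B Λ A ξ Φ α with hρ
  have hβc : ContDiffOn ℝ ∞ β (Set.Ioo 0 Real.pi) := fun t ht =>
    (momentum_contDiffAt B hξ hΦ hα ht).contDiffWithinAt
  have hβ' : ContinuousOn (deriv β) (Set.Ioo 0 Real.pi) :=
    (hβc.deriv_of_isOpen (m := ∞) isOpen_Ioo (by simp)).continuousOn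
  have hρc : ContinuousOn ρ (Set.Ioo 0 Real.pi) := fun t ht =>
    (force_continuousAt B Λ A hξ hΦ hα ht).continuousWithinAt
  have hβd : ∀ t ∈ Set.Ioo 0 Real.pi, HasDerivAt β (deriv β t) t := fun t ht =>
    ((momentum_contDiffAt B hξ hΦ hα ht).differentiableAt (by simp)).hasDerivAt
  have hae := isOpen_Ioo.ae_eq_zero_of_integral_contDiff_smul_eq_zero
    (μ := volume) (f := fun t => deriv β t - ρ t) (U := Set.Ioo 0 Real.pi)
    ((hβ'.sub hρc).locallyIntegrableOn measurableSet_Ioo) (by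
      intro g hg hgc hgs
      obtain ⟨a, b, ha, hab, hb, hsupp⟩ := exists_Ioo_of_isCompact hgc Real.pi_pos hgs
      have hsub : Set.Icc a b ⊆ Set.Ioo 0 Real.pi := fun x hx =>
        ⟨lt_of_lt_of_le ha hx.1, lt_of_le_of_lt hx.2 hb⟩
      have hw := euler_lagrange_weak hp hξ hΦ hα hq ha hab hb hg hgc hsupp
      have hg' : ContinuousOn (deriv g) (Set.Icc a b) :=
        (hg.continuous_deriv (by simp)).continuousOn
      have hgcont : ContinuousOn g (Set.Icc a b) := hg.continuous.continuousOn
      have hβcont : ContinuousOn β (Set.Icc a b) := hβc.continuousOn.mono hsub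
      have h1 : ∫ t in a..b, (deriv g t * β t + g t * deriv β t) = 0 := by
        rw [intervalIntegral.integral_eq_sub_of_hasDerivAt (f := fun t => g t * β t)]
        · have ga : g a = 0 := image_eq_zero_of_notMem_tsupport fun h => (hsupp h).1.false
          have gb : g b = 0 := image_eq_zero_of_notMem_tsupport fun h => (hsupp h).2.false
          rw [ga, gb]; ring
        · intro t ht
          rw [Set.uIcc_of_le hab.le] at ht
          exact ((hg.differentiable (by simp) t).hasDerivAt).mul (hβd t (hsub ht))
        · exact ((hg'.mul hβcont).add
            (hgcont.mul (hβ'.mono hsub))).intervalIntegrable_of_Icc hab.le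
      have h2 : ∫ t in a..b, g t • (deriv β t - ρ t) = 0 := by
        have := intervalIntegral.integral_sub (μ := volume)
          (((hg'.mul hβcont).add (hgcont.mul (hβ'.mono hsub))).intervalIntegrable_of_Icc hab.le)
          (((hg'.mul hβcont).add (hgcont.mul (hρc.mono hsub))).intervalIntegrable_of_Icc hab.le)
        simp only [Pi.add_apply, Pi.mul_apply] at this
        rw [h1, hw, sub_zero] at this
        rw [← this]
        exact intervalIntegral.integral_congr fun t _ => by simp only [smul_eq_mul]; ring
      rw [← h2, intervalIntegral.integral_eq_integral_of_support_subset]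
      intro t ht
      have : t ∈ tsupport g := subset_tsupport g (left_ne_zero_of_smul ht)
      exact Set.Ioo_subset_Ioc_self (hsupp this))
  have heq : Set.EqOn (deriv β) ρ (Set.Ioo 0 Real.pi) := by
    refine Measure.eqOn_open_of_ae_eq (μ := volume) ?_ isOpen_Ioo hβ' hρc
    rw [EventuallyEq, ae_restrict_iff' measurableSet_Ioo]
    filter_upwards [hae] with t ht h
    exact sub_eq_zero.1 (ht h)
  rw [← heq hθ]
  exact hβd θ hθ

end EulerLagrange

/-! ### Pointwise convexity inequality for the energy densities. -/

section Reduction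

theorem ghat_first_column (B : Horizon) (X : Target) :
    ghat B X *ᵥ Pi.single 0 1 = scaleP X ^ 2 • Pi.single 0 1 := by
  ext i
  fin_cases i <;> simp [ghat, leviMat, unipMat]

/-- Convexity of the potential term. -/
theorem exp_potential_ge (B : Horizon) (X₀ X₁ : Target) :
    Real.exp (-4 * X₀ 0) * (1 + relLog B X₀ X₁ 0 0) ≤ Real.exp (-4 * X₁ 0) := by
  have hP : ∀ X : Target, (scaleP X ^ 2) ^ 2 = Real.exp (-4 * X 0) := fun X => by
    rw [scaleP, ← pow_mul, ← Real.exp_nat_mul]; push_cast; ring_nf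
  -- The first basis vector is an eigenvector of every `ghat`, with eigenvalue e^{-2u}; hence the
  -- quadratic form of exp A on it is the quotient of the two values of the potential.
  have h1 := quadForm_exp_ge (relLog_isSymm B X₀ X₁) (Pi.single 0 1)
  set k := relMat B X₀ X₁ with hk
  have h2 : k *ᵥ Pi.single 0 1 = ((scaleP X₀ ^ 2)⁻¹ * scaleP X₁ ^ 2) • Pi.single 0 1 := by
    have h3 : k * ghat B X₀ = ghat B X₁ := by
      rw [hk, relMat, mul_assoc, (isG2_ghat B X₀).jInv_mul, mul_one]
    have h4 := ghat_first_column B X₁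
    rw [← h3, ← Matrix.mulVec_mulVec, ghat_first_column, Matrix.mulVec_smul] at h4
    rw [mul_smul, ← h4, smul_smul, inv_mul_cancel₀ (pow_ne_zero 2 (scaleP_pos X₀).ne'), one_smul]
  rw [exp_relLog, ← hk, ← Matrix.mulVec_mulVec, h2, Matrix.mulVec_smul] at h1
  have h5 : (kᵀ *ᵥ Pi.single 0 1) 0 = (scaleP X₀ ^ 2)⁻¹ * scaleP X₁ ^ 2 := by
    have := congrFun h2 0
    simp at this ⊢
    exact this
  simp at h1 h5
  rw [h5] at h1
  rw [← hP, ← hP]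
  have hp0 := (scaleP_pos X₀).ne'
  have := mul_le_mul_of_nonneg_left h1 (sq_nonneg (scaleP X₀ ^ 2))
  calc _ ≤ _ := this
    _ = _ := by field_simp

/-- The energy density. -/
def energyDensity (B : Horizon) (Λ A : ℝ) (ξ : ℝ → ℝ) (Φ : ℝ → Target) (θ : ℝ) : ℝ :=
  ξ θ * Real.sin θ * (G B (Φ θ) (deriv Φ θ)
    + lambdaCoeff B Λ A * Real.exp (-4 * Φ θ 0) * Real.sin θ ^ 2)

/-- The components of the logarithm of the relative Gram matrix along two maps. -/
def relCoord (B : Horizon) (Φ₀ Φ₁ : ℝ → Target) (θ : ℝ) : Fin 8 → ℝ :=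
  frameCoord (relLog B (Φ₀ θ) (Φ₁ θ))

/-- The convexity defect along two maps. -/
def defect (B : Horizon) (Φ₀ Φ₁ : ℝ → Target) (θ : ℝ) : ℝ :=
  excess (conn B (Φ₀ θ) (deriv Φ₀ θ)) (conn B (Φ₁ θ) (deriv Φ₁ θ)) (relLog B (Φ₀ θ) (Φ₁ θ))
    (deriv (fun t => relLog B (Φ₀ t) (Φ₁ t)) θ)

/-- `frameCoord` as a continuous linear map. -/
def frameCoordL : Matrix (Fin 7) (Fin 7) ℝ →L[ℝ] (Fin 8 → ℝ) :=
  LinearMap.toContinuousLinearMap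
    { toFun := frameCoord
      map_add' := fun A B => by
        ext i; fin_cases i <;> simp [frameCoord] <;> ring
      map_smul' := fun k A => by
        ext i; fin_cases i <;> simp [frameCoord] <;> ring }

variable {B : Horizon} {Φ₀ Φ₁ : ℝ → Target}

theorem relLog_contDiffOn (h₀ : ContDiffOn ℝ ∞ Φ₀ (Set.Ioo 0 Real.pi))
    (h₁ : ContDiffOn ℝ ∞ Φ₁ (Set.Ioo 0 Real.pi)) :
    ContDiffOn ℝ ∞ (fun t => relLog B (Φ₀ t) (Φ₁ t)) (Set.Ioo 0 Real.pi) :=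
  ContDiff.comp_contDiffOn (g := fun X : Target × Target => relLog B X.1 X.2)
    (f := fun t => (Φ₀ t, Φ₁ t)) (contDiff_relLog B) (h₀.prodMk h₁)

theorem relCoord_contDiffOn (h₀ : ContDiffOn ℝ ∞ Φ₀ (Set.Ioo 0 Real.pi))
    (h₁ : ContDiffOn ℝ ∞ Φ₁ (Set.Ioo 0 Real.pi)) :
    ContDiffOn ℝ ∞ (relCoord B Φ₀ Φ₁) (Set.Ioo 0 Real.pi) :=
  frameCoordL.contDiff.comp_contDiffOn (relLog_contDiffOn h₀ h₁)

theorem defect_continuousOn (h₀ : ContDiffOn ℝ ∞ Φ₀ (Set.Ioo 0 Real.pi))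
    (h₁ : ContDiffOn ℝ ∞ Φ₁ (Set.Ioo 0 Real.pi)) :
    ContinuousOn (defect B Φ₀ Φ₁) (Set.Ioo 0 Real.pi) := by
  intro θ hθ
  have hm := isOpen_Ioo.mem_nhds hθ
  have hA := relLog_contDiffOn (B := B) h₀ h₁
  have hA' : ContDiffAt ℝ ∞ (deriv (fun t => relLog B (Φ₀ t) (Φ₁ t))) θ :=
    (hA.deriv_of_isOpen isOpen_Ioo (by simp)).contDiffAt hm
  have hM0 := conn_contDiffAt B h₀ hθ
  have hM1 := conn_contDiffAt B h₁ hθ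
  have hS0 := hM0.add (contDiffAt_transpose hM0)
  have hS1 := hM1.add (contDiffAt_transpose hM1)
  have hK := (hM0.mul (contDiffAt_transpose hM0)).sub ((contDiffAt_transpose hM0).mul hM0)
  exact (((trace_contDiffAt (hS1.mul hS1)).sub (trace_contDiffAt (hS0.mul hS0))).sub
    (contDiffAt_const.mul ((trace_contDiffAt (hS0.mul hA')).add
      (trace_contDiffAt ((hA.contDiffAt hm).mul hK))))).continuousAt.continuousWithinAt

theorem defect_bound (h₀ : ContDiffOn ℝ ∞ Φ₀ (Set.Ioo 0 Real.pi))
    (h₁ : ContDiffOn ℝ ∞ Φ₁ (Set.Ioo 0 Real.pi)) {θ : ℝ} (hθ : θ ∈ Set.Ioo 0 Real.pi) :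
    0 ≤ defect B Φ₀ Φ₁ θ ∧ (relLog B (Φ₀ θ) (Φ₁ θ) *
      deriv (fun t => relLog B (Φ₀ t) (Φ₁ t)) θ).trace ^ 2 ≤
      (relLog B (Φ₀ θ) (Φ₁ θ) * relLog B (Φ₀ θ) (Φ₁ θ)).trace * defect B Φ₀ Φ₁ θ := by
  have hm := isOpen_Ioo.mem_nhds hθ
  have d : ∀ {f : ℝ → Target}, ContDiffOn ℝ ∞ f (Set.Ioo 0 Real.pi) → HasDerivAt f (deriv f θ) θ :=
    fun hf => ((hf.contDiffAt hm).differentiableAt (by simp)).hasDerivAt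
  exact relLog_excess_bound B (d h₀) (d h₁)
    (((relLog_contDiffOn h₀ h₁).contDiffAt hm).differentiableAt (by simp)).hasDerivAt

theorem lambdaCoeff_nonneg (B : Horizon) {Λ : ℝ} (A : ℝ) (hΛ : 0 ≤ Λ) : 0 ≤ lambdaCoeff B Λ A := by
  unfold lambdaCoeff; positivity

/-- The defect is four times the difference of the metric terms minus their linear part, and that
linear part is the one in `force`, because the symmetrization of `relCoord` is the relative
logarithm. The potential matches since the zeroth component is −A₀₀/4; its inequality is multiplied
by a coefficient that is nonnegative because Λ ≥ 0. -/
theorem energyDensity_sub_ge {Λ A : ℝ} (hΛ : 0 ≤ Λ) {ξ : ℝ → ℝ}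
    (h₀ : ContDiffOn ℝ ∞ Φ₀ (Set.Ioo 0 Real.pi))
    (h₁ : ContDiffOn ℝ ∞ Φ₁ (Set.Ioo 0 Real.pi)) {θ : ℝ} (hθ : θ ∈ Set.Ioo 0 Real.pi)
    (hξ : 0 < ξ θ) :
    ξ θ * Real.sin θ * defect B Φ₀ Φ₁ θ / 4 + force B Λ A ξ Φ₀ (relCoord B Φ₀ Φ₁) θ ≤
      energyDensity B Λ A ξ Φ₁ θ - energyDensity B Λ A ξ Φ₀ θ := by
  have hm := isOpen_Ioo.mem_nhds hθ
  have hs := Real.sin_pos_of_mem_Ioo hθ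
  have hA := (((relLog_contDiffOn (B := B) h₀ h₁).contDiffAt hm).differentiableAt
    (by simp)).hasDerivAt
  have hα' : deriv (relCoord B Φ₀ Φ₁) θ =
      frameCoord (deriv (fun t => relLog B (Φ₀ t) (Φ₁ t)) θ) :=
    (frameCoordL.hasFDerivAt.comp_hasDerivAt θ hA).deriv
  have hH : frameMat (relCoord B Φ₀ Φ₁ θ) + (frameMat (relCoord B Φ₀ Φ₁ θ))ᵀ =
      relLog B (Φ₀ θ) (Φ₁ θ) := (relLog_eq_frameMat B _ _).symm
  have hH' : frameMat (deriv (relCoord B Φ₀ Φ₁) θ) + (frameMat (deriv (relCoord B Φ₀ Φ₁) θ))ᵀ =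
      deriv (fun t => relLog B (Φ₀ t) (Φ₁ t)) θ := by
    have hd : HasDerivAt (fun t => frameMat (relCoord B Φ₀ Φ₁ t))
        (frameMat (deriv (relCoord B Φ₀ Φ₁) θ)) θ := by
      rw [hα']
      exact frameMatL.hasFDerivAt.comp_hasDerivAt θ
        (frameCoordL.hasFDerivAt.comp_hasDerivAt θ hA)
    refine ((hd.add (hasDerivAt_transpose hd)).congr_of_eventuallyEq
      (Eventually.of_forall fun t => ?_)).unique hA
    exact relLog_eq_frameMat B _ _
  have hpot := exp_potential_ge B (Φ₀ θ) (Φ₁ θ)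
  have hc : relCoord B Φ₀ Φ₁ θ 0 = -relLog B (Φ₀ θ) (Φ₁ θ) 0 0 / 4 := rfl
  have hκ := lambdaCoeff_nonneg B A hΛ
  have h4₀ := four_mul_G B (Φ₀ θ) (deriv Φ₀ θ)
  have h4₁ := four_mul_G B (Φ₁ θ) (deriv Φ₁ θ)
  have hw : 0 ≤ lambdaCoeff B Λ A * ξ θ * Real.sin θ ^ 3 := by positivity
  have hpot' := mul_le_mul_of_nonneg_left hpot hw
  simp only [force, energyDensity, defect, excess, hH, hH', hc]
  rw [← h4₀, ← h4₁]
  linear_combination hpot'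

end Reduction

/-! ### Renormalization: area density against energy density. -/

section AreaIdentity

theorem hasDerivAt_h1 {θ : ℝ} (hθ : θ ∈ Set.Ioo 0 Real.pi) :
    HasDerivAt h1 (Real.cos θ / (2 * Real.sin θ)) θ := by
  have hs := Real.sin_pos_of_mem_Ioo hθ
  refine (((Real.hasDerivAt_sin θ).log hs.ne').div_const 2).congr_deriv ?_
  field_simp

theorem half_pos_of_mem {θ : ℝ} (hθ : θ ∈ Set.Ioo 0 Real.pi) :
    0 < Real.sin (θ / 2) ∧ 0 < Real.cos (θ / 2) ∧ Real.sin θ = 2 * Real.sin (θ / 2) * Real.cos (θ / 2) := by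
  refine ⟨Real.sin_pos_of_pos_of_lt_pi (by linarith [hθ.1]) (by linarith [hθ.1, hθ.2]),
    Real.cos_pos_of_mem_Ioo ⟨by linarith [hθ.1, Real.pi_pos], by linarith [hθ.2]⟩, ?_⟩
  rw [← Real.sin_two_mul]; congr 1; ring

theorem hasDerivAt_h2 {θ : ℝ} (hθ : θ ∈ Set.Ioo 0 Real.pi) : HasDerivAt h2 (1 / Real.sin θ) θ := by
  obtain ⟨h1, h2, h3⟩ := half_pos_of_mem hθ
  have ht : 0 < Real.tan (θ / 2) := by rw [Real.tan_eq_sin_div_cos]; positivity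
  have hd : HasDerivAt (fun θ : ℝ => Real.tan (θ / 2)) (1 / Real.cos (θ / 2) ^ 2 * (1 / 2)) θ :=
    HasDerivAt.comp (h₂ := Real.tan) (h := fun θ => θ / 2) θ (Real.hasDerivAt_tan h2.ne')
      ((hasDerivAt_id θ).div_const 2)
  refine (hd.log ht.ne').congr_deriv ?_
  rw [Real.tan_eq_sin_div_cos, h3]
  field_simp

theorem hasDerivAt_tilde {Ψ : ℝ → Target} {Ψ' : Target} {θ : ℝ} (h : HasDerivAt Ψ Ψ' θ)
    (hθ : θ ∈ Set.Ioo 0 Real.pi) :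
    HasDerivAt (tilde Ψ)
      (Ψ' + ![Real.cos θ / (2 * Real.sin θ), 1 / Real.sin θ, 0, 0, 0, 0, 0, 0]) θ := by
  refine h.add ?_
  rw [hasDerivAt_pi]
  intro i
  fin_cases i
  · exact hasDerivAt_h1 hθ
  · exact hasDerivAt_h2 hθ
  all_goals exact hasDerivAt_const θ (0 : ℝ)

theorem tilde_contDiffOn {Ψ : ℝ → Target} (h : ContDiffOn ℝ ∞ Ψ (Set.Ioo 0 Real.pi)) :
    ContDiffOn ℝ ∞ (tilde Ψ) (Set.Ioo 0 Real.pi) := by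
  refine h.add ?_
  rw [contDiffOn_pi]
  intro i
  have hh1 : ContDiffOn ℝ ∞ h1 (Set.Ioo 0 Real.pi) :=
    (Real.contDiff_sin.contDiffOn.log fun θ hθ => (Real.sin_pos_of_mem_Ioo hθ).ne').div_const 2
  have hh2 : ContDiffOn ℝ ∞ h2 (Set.Ioo 0 Real.pi) := by
    have hs : ContDiffOn ℝ ∞ (fun θ : ℝ => Real.sin (θ / 2) / Real.cos (θ / 2))
        (Set.Ioo 0 Real.pi) :=
      ((Real.contDiff_sin.comp (contDiff_id.div_const 2)).contDiffOn).div
        ((Real.contDiff_cos.comp (contDiff_id.div_const 2)).contDiffOn)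
        fun θ hθ => (half_pos_of_mem hθ).2.1.ne'
    have : h2 = fun θ => Real.log (Real.sin (θ / 2) / Real.cos (θ / 2)) := by
      ext θ; rw [h2, Real.tan_eq_sin_div_cos]
    rw [this]
    exact hs.log fun θ hθ => (div_pos (half_pos_of_mem hθ).1 (half_pos_of_mem hθ).2.1).ne'
  fin_cases i
  · exact hh1
  · exact hh2
  all_goals exact contDiffOn_const

/-- The boundary term relating the area functional to the energy. -/
def boundaryTerm (B : Horizon) (ξ : ℝ → ℝ) (Ψ : ℝ → Target) (θ : ℝ) : ℝ :=
  12 * (Real.cos θ * ξ θ * Ψ θ 0) +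
    2 * ((1 - 2 * (B.s : ℝ) * Real.cos (θ / 2) ^ 2) * ξ θ * Vs B Ψ θ)

/-- The part of the energy density that does not depend on the map. -/
def divergentTerm (B : Horizon) (ξ : ℝ → ℝ) (θ : ℝ) : ℝ :=
  ξ θ * (3 * Real.cos θ ^ 2 + (1 - 2 * (B.s : ℝ) * Real.cos (θ / 2) ^ 2) ^ 2) / Real.sin θ

theorem hasDerivAt_Vs (B : Horizon) {Ψ : ℝ → Target} {Ψ' : Target} {θ : ℝ} (h : HasDerivAt Ψ Ψ' θ)
    (hθ : θ ∈ Set.Ioo 0 Real.pi) :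
    HasDerivAt (Vs B Ψ) (Ψ' 1 + 2 * (B.s : ℝ) * (Real.cos θ / (2 * Real.sin θ))
      + (B.s : ℝ) * (1 / Real.sin θ)) θ :=
  ((hasDerivAt_pi.1 h 1).add ((hasDerivAt_h1 hθ).const_mul _)).add ((hasDerivAt_h2 hθ).const_mul _)

/-- Adding h₁ and h₂ to U and V produces squares of the singular derivatives, which do not see the
map, and cross terms. Integrating the cross terms by parts against the weight gives the boundary
term and the terms linear in U and V_s of the area density. -/
theorem hasDerivAt_boundaryTerm (B : Horizon) {Λ A : ℝ} {ξ : ℝ → ℝ} {Ψ : ℝ → Target} {θ : ℝ}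
    (hθ : θ ∈ Set.Ioo 0 Real.pi) (hξ : DifferentiableAt ℝ ξ θ) (hξ0 : ξ θ ≠ 0)
    (hΨ : DifferentiableAt ℝ Ψ θ) :
    HasDerivAt (boundaryTerm B ξ Ψ) (energyDensity B Λ A ξ (tilde Ψ) θ - divergentTerm B ξ θ
      - areaIntegrand B Λ A ξ Ψ θ) θ := by
  have hs := Real.sin_pos_of_mem_Ioo hθ
  have hd := hΨ.hasDerivAt
  have hV := hasDerivAt_Vs B hd hθ
  have hc : DifferentiableAt ℝ (fun τ => Real.cos τ * ξ τ) θ :=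
    Real.differentiableAt_cos.mul hξ
  have hw : DifferentiableAt ℝ (fun τ => (1 - 2 * (B.s : ℝ) * Real.cos (τ / 2) ^ 2) * ξ τ) θ := by
    fun_prop
  have hR := ((hc.hasDerivAt.mul (hasDerivAt_pi.1 hd 0)).const_mul 12).add
    ((hw.hasDerivAt.mul hV).const_mul 2)
  refine HasDerivAt.congr_deriv (f := boundaryTerm B ξ Ψ) hR ?_
  have hcos : Real.cos (θ / 2) ^ 2 = (1 + Real.cos θ) / 2 := by rw [Real.cos_sq]; ring_nf
  have hcosh : Real.cosh (Ψ θ 2) ^ 2 = 1 + Real.sinh (Ψ θ 2) ^ 2 := by rw [Real.cosh_sq]; ring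
  have e0 : ∀ k : ℝ, Real.exp (-k * (Ψ θ 0 + h1 θ) - (Ψ θ 1 + h2 θ)) =
      Real.exp (-k * h1 θ - h2 θ - k * Ψ θ 0 - Ψ θ 1) := fun k => by congr 1; ring
  have e1 : ∀ k : ℝ, Real.exp (-k * (Ψ θ 0 + h1 θ) + (Ψ θ 1 + h2 θ)) =
      Real.exp (-k * h1 θ + h2 θ - k * Ψ θ 0 + Ψ θ 1) := fun k => by congr 1; ring
  have e2 : Real.exp (-(Ψ θ 1 + h2 θ)) = Real.exp (-h2 θ - Ψ θ 1) := by congr 1; ring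
  have e3 : Real.exp (-4 * (Ψ θ 0 + h1 θ)) = Real.exp (-4 * h1 θ - 4 * Ψ θ 0) := by congr 1; ring
  have e4 : Real.exp (-4 * h1 θ - 4 * Ψ θ 0) * Real.sin θ ^ 2 = Real.exp (-4 * Ψ θ 0) := by
    have : Real.exp (-4 * h1 θ) = (Real.sin θ ^ 2)⁻¹ := by
      rw [h1, show -4 * (Real.log (Real.sin θ) / 2) = -(Real.log (Real.sin θ) + Real.log (Real.sin θ))
        by ring, Real.exp_neg, Real.exp_add, Real.exp_log hs, sq]
    rw [sub_eq_add_neg, Real.exp_add, this]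
    field_simp
  have e06 := e0 6
  have e02 := e0 2
  have e16 := e1 6
  have e12 := e1 2
  have t0 : tilde Ψ θ 0 = Ψ θ 0 + h1 θ := rfl
  have t1 : tilde Ψ θ 1 = Ψ θ 1 + h2 θ := rfl
  have t2 : tilde Ψ θ 2 = Ψ θ 2 := add_zero _
  have t6 : tilde Ψ θ 6 = Ψ θ 6 := add_zero _
  have t7 : tilde Ψ θ 7 = Ψ θ 7 := add_zero _
  have hGd : energyDensity B Λ A ξ (tilde Ψ) θ = ξ θ * Real.sin θ * (G B (tilde Ψ θ)
      (deriv Ψ θ + ![Real.cos θ / (2 * Real.sin θ), 1 / Real.sin θ, 0, 0, 0, 0, 0, 0])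
      + lambdaCoeff B Λ A * (Real.exp (-4 * tilde Ψ θ 0) * Real.sin θ ^ 2)) := by
    rw [energyDensity, (hasDerivAt_tilde hd hθ).deriv, mul_assoc (lambdaCoeff B Λ A)]
  have hY : ∀ i : Fin 8, (deriv Ψ θ + ![Real.cos θ / (2 * Real.sin θ), 1 / Real.sin θ, 0, 0, 0, 0, 0, 0]
      : Target) i = deriv Ψ θ i +
        (![Real.cos θ / (2 * Real.sin θ), 1 / Real.sin θ, 0, 0, 0, 0, 0, 0] : Target) i := fun i => rfl
  rw [hGd, areaIntegrand, divergentTerm]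
  simp only [G, ThetaBar1, ThetaBar2, Theta1, Theta2, auxForm, psiBar1, psiBar2, Upsilon, t0, t1, t2,
    t6, t7, hY, e06, e02, e16, e12, e2, e3, e4, hV.deriv, (hasDerivAt_h2 hθ).deriv, hcosh, hcos]
  simp
  generalize deriv (fun τ => Real.cos τ * ξ τ) θ = d1
  generalize deriv (fun τ => (1 - 2 * (B.s : ℝ) * Real.cos (τ / 2) ^ 2) * ξ τ) θ = d2
  field_simp
  ring

end AreaIdentity

/-! ### From the convexity defect to a weighted pointwise bound. -/

section Poincare

/-- Cauchy–Schwarz, read off from the discriminant of the nonnegative quadratic c ↦ ∫ (c√e − 1)². -/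
theorem sq_integral_sqrt_le {e : ℝ → ℝ} {a b : ℝ} (hab : a ≤ b) (he : ContinuousOn e (Set.Icc a b))
    (h0 : ∀ t ∈ Set.Icc a b, 0 ≤ e t) :
    (∫ t in a..b, √(e t)) ^ 2 ≤ (b - a) * ∫ t in a..b, e t := by
  have hs : ContinuousOn (fun t => √(e t)) (Set.Icc a b) := he.sqrt
  have key : ∀ c : ℝ, 0 ≤ (∫ t in a..b, e t) * (c * c) + (-2 * ∫ t in a..b, √(e t)) * c + (b - a) := by
    intro c
    have h1 : 0 ≤ ∫ t in a..b, (c * √(e t) - 1) ^ 2 :=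
      intervalIntegral.integral_nonneg hab fun t _ => sq_nonneg _
    have h2 : ∫ t in a..b, (c * √(e t) - 1) ^ 2 =
        ∫ t in a..b, ((c * c) * e t - (2 * c) * √(e t) + 1) := by
      refine intervalIntegral.integral_congr fun t ht => ?_
      rw [Set.uIcc_of_le hab] at ht
      have := Real.sq_sqrt (h0 t ht)
      linear_combination c ^ 2 * this
    rw [h2, intervalIntegral.integral_add, intervalIntegral.integral_sub,
      intervalIntegral.integral_const_mul, intervalIntegral.integral_const_mul,
      intervalIntegral.integral_const] at h1
    · simp at h1; linarith
    · exact (continuousOn_const.mul he).intervalIntegrable_of_Icc hab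
    · exact (continuousOn_const.mul hs).intervalIntegrable_of_Icc hab
    · exact ((continuousOn_const.mul he).sub (continuousOn_const.mul hs)).intervalIntegrable_of_Icc hab
    · exact intervalIntegrable_const
  have := discrim_le_zero key
  rw [discrim] at this
  nlinarith

variable {B : Horizon} {Φ₀ Φ₁ : ℝ → Target}

/-- By convexity √(tr A²) varies at a rate at most the square root of the defect. The factor 4 comes
from the one half in `relDist`. -/
theorem relDist_variation (h₀ : ContDiffOn ℝ ∞ Φ₀ (Set.Ioo 0 Real.pi))
    (h₁ : ContDiffOn ℝ ∞ Φ₁ (Set.Ioo 0 Real.pi)) {a b : ℝ} (ha : 0 < a) (hab : a ≤ b)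
    (hb : b < Real.pi) :
    4 * (relDist B (Φ₀ b) (Φ₁ b) - relDist B (Φ₀ a) (Φ₁ a)) ^ 2 ≤
      (b - a) * ∫ t in a..b, defect B Φ₀ Φ₁ t := by
  have hsub : Set.Icc a b ⊆ Set.Ioo 0 Real.pi := fun x hx =>
    ⟨lt_of_lt_of_le ha hx.1, lt_of_le_of_lt hx.2 hb⟩
  have he : ContinuousOn (defect B Φ₀ Φ₁) (Set.Icc a b) := (defect_continuousOn h₀ h₁).mono hsub
  have h1 := sq_integral_sqrt_le hab he fun t ht => (defect_bound h₀ h₁ (hsub ht)).1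
  refine le_trans ?_ h1
  set A : ℝ → Matrix (Fin 7) (Fin 7) ℝ := fun t => relLog B (Φ₀ t) (Φ₁ t) with hA
  have h2 := sqrt_sub_sqrt_le_integral (N := fun t => (A t * A t).trace)
    (N' := fun t => (A t * deriv A t).trace) (e := fun t => √(defect B Φ₀ Φ₁ t)) hab
    (fun t _ => trace_sq_nonneg (relLog_isSymm _ _ _))
    (fun t ht => hasDerivAt_trace_sq
      (((relLog_contDiffOn h₀ h₁).contDiffAt (isOpen_Ioo.mem_nhds (hsub ht))).differentiableAt
        (by simp)).hasDerivAt)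
    (fun t _ => Real.sqrt_nonneg _)
    (fun t ht => by
      have := defect_bound (B := B) h₀ h₁ (hsub ht)
      rw [Real.sq_sqrt this.1]
      exact this.2)
    he.sqrt.integrableOn_Icc
  have h3 := sq_le_sq' (by linarith [abs_nonneg (√((A b * A b).trace) - √((A a * A a).trace)), h2]) h2
  rw [sq_abs] at h3
  refine le_trans (le_of_eq ?_) h3
  simp only [relDist, hA]
  ring

/-- On a compact subinterval the linear part of the energy difference is the derivative of the
momentum, and renormalization subtracts the boundary terms. The divergent parts are the same for
both maps and cancel, so everything but the defect is collected in the end values of `F`. -/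
theorem integral_sin_defect_le {Λ A : ℝ} (hp : B.p ≠ 0) (hΛ : 0 ≤ Λ) {ξ : ℝ → ℝ} {m : ℝ}
    (hξ : ContDiffOn ℝ ∞ ξ (Set.Ioo 0 Real.pi)) (hm : 0 < m) (hξm : ∀ θ ∈ Set.Ioo 0 Real.pi, m ≤ ξ θ)
    {Ψ₀ Ψ : ℝ → Target} (h₀ : ContDiffOn ℝ ∞ Ψ₀ (Set.Ioo 0 Real.pi))
    (h₁ : ContDiffOn ℝ ∞ Ψ (Set.Ioo 0 Real.pi)) (hq : IsQuasiHarmonic B Λ A ξ (tilde Ψ₀))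
    (i₀ : IntervalIntegrable (areaIntegrand B Λ A ξ Ψ₀) volume 0 Real.pi)
    (i₁ : IntervalIntegrable (areaIntegrand B Λ A ξ Ψ) volume 0 Real.pi) {F : ℝ → ℝ}
    (hF : F = fun θ => momentum B ξ (tilde Ψ₀) (relCoord B (tilde Ψ₀) (tilde Ψ)) θ
      - (boundaryTerm B ξ Ψ θ - boundaryTerm B ξ Ψ₀ θ))
    {a b : ℝ} (ha : 0 < a) (hab : a ≤ b) (hb : b < Real.pi) :
    F b - F a + m / 4 * ∫ t in a..b, Real.sin t * defect B (tilde Ψ₀) (tilde Ψ) t ≤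
      ∫ t in a..b, (areaIntegrand B Λ A ξ Ψ t - areaIntegrand B Λ A ξ Ψ₀ t) := by
  have hsub : Set.Icc a b ⊆ Set.Ioo 0 Real.pi := fun x hx =>
    ⟨lt_of_lt_of_le ha hx.1, lt_of_le_of_lt hx.2 hb⟩
  have ht₀ := tilde_contDiffOn h₀
  have ht₁ := tilde_contDiffOn h₁
  have he : ContinuousOn (fun t => m / 4 * (Real.sin t * defect B (tilde Ψ₀) (tilde Ψ) t))
      (Set.Icc a b) :=
    continuousOn_const.mul (Real.continuous_sin.continuousOn.mul
      ((defect_continuousOn ht₀ ht₁).mono hsub))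
  have hd : ∀ t ∈ Set.Icc a b, HasDerivAt F
      (force B Λ A ξ (tilde Ψ₀) (relCoord B (tilde Ψ₀) (tilde Ψ)) t
        - ((energyDensity B Λ A ξ (tilde Ψ) t - divergentTerm B ξ t - areaIntegrand B Λ A ξ Ψ t)
          - (energyDensity B Λ A ξ (tilde Ψ₀) t - divergentTerm B ξ t
            - areaIntegrand B Λ A ξ Ψ₀ t))) t := by
    intro t ht
    have hmem := isOpen_Ioo.mem_nhds (hsub ht)
    have hx : DifferentiableAt ℝ ξ t := (hξ.contDiffAt hmem).differentiableAt (by simp)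
    have hx0 : ξ t ≠ 0 := (hm.trans_le (hξm t (hsub ht))).ne'
    rw [hF]
    exact (euler_lagrange hp hξ ht₀ (relCoord_contDiffOn ht₀ ht₁) hq (hsub ht)).sub
      ((hasDerivAt_boundaryTerm B (hsub ht) hx hx0
        ((h₁.contDiffAt hmem).differentiableAt (by simp))).sub
      (hasDerivAt_boundaryTerm B (hsub ht) hx hx0
        ((h₀.contDiffAt hmem).differentiableAt (by simp))))
  have hu : Set.Icc a b ⊆ Set.uIcc 0 Real.pi := by
    rw [Set.uIcc_of_le Real.pi_pos.le]
    exact hsub.trans Set.Ioo_subset_Icc_self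
  have hu' : Set.uIcc a b ⊆ Set.uIcc 0 Real.pi := by rw [Set.uIcc_of_le hab]; exact hu
  have hi := (i₁.sub i₀).mono_set hu'
  have hei : IntervalIntegrable (fun t => m / 4 * (Real.sin t * defect B (tilde Ψ₀) (tilde Ψ) t))
      volume a b := he.intervalIntegrable_of_Icc hab
  have hle := intervalIntegral.sub_le_integral_of_hasDeriv_right_of_le (g := F)
    (φ := fun t => (areaIntegrand B Λ A ξ Ψ t - areaIntegrand B Λ A ξ Ψ₀ t)
      - m / 4 * (Real.sin t * defect B (tilde Ψ₀) (tilde Ψ) t)) hab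
    (fun t ht => (hd t ht).continuousAt.continuousWithinAt)
    (fun t ht => (hd t (Set.Ioo_subset_Icc_self ht)).hasDerivWithinAt)
    (by
      rw [integrableOn_Icc_iff_integrableOn_Ioc, ← intervalIntegrable_iff_integrableOn_Ioc_of_le hab]
      exact hi.sub hei)
    (fun t ht => by
      have htI := hsub (Set.Ioo_subset_Icc_self ht)
      have h1 := energyDensity_sub_ge (B := B) (A := A) (ξ := ξ) hΛ ht₀ ht₁ htI
        (hm.trans_le (hξm t htI))
      have h2 := (defect_bound (B := B) ht₀ ht₁ htI).1
      have h3 := Real.sin_pos_of_mem_Ioo htI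
      have h4 := mul_le_mul_of_nonneg_right (hξm t htI) (mul_nonneg h3.le h2)
      linarith)
  rw [intervalIntegral.integral_sub hi hei, intervalIntegral.integral_const_mul] at hle
  linarith

theorem tendsto_integral_shrink {f : ℝ → ℝ} {c : ℝ} (hc : 0 < c)
    (hf : IntervalIntegrable f volume 0 c) :
    Tendsto (fun a => ∫ t in a..(c - a), f t) (𝓝[>] 0) (𝓝 (∫ t in (0 : ℝ)..c, f t)) := by
  have hcont : ContinuousOn (fun x => ∫ t in (0 : ℝ)..x, f t) (Set.Icc 0 c) := by
    have := intervalIntegral.continuousOn_primitive_interval (μ := volume) (f := f) (a := 0) (b := c)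
      (by rw [Set.uIcc_of_le hc.le, integrableOn_Icc_iff_integrableOn_Ioc,
            ← intervalIntegrable_iff_integrableOn_Ioc_of_le hc.le]; exact hf)
    rwa [Set.uIcc_of_le hc.le] at this
  have hmem : ∀ᶠ a : ℝ in 𝓝[>] 0, a ∈ Set.Icc 0 c := by
    filter_upwards [Ioo_mem_nhdsGT hc] with a ha using Set.Ioo_subset_Icc_self ha
  have t1 : Tendsto (fun a : ℝ => ∫ t in (0 : ℝ)..a, f t) (𝓝[>] 0) (𝓝 (∫ t in (0 : ℝ)..0, f t)) :=
    (hcont 0 ⟨le_rfl, hc.le⟩).tendsto.comp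
      (tendsto_nhdsWithin_iff.2 ⟨tendsto_id.mono_left nhdsWithin_le_nhds, hmem⟩)
  have t2 : Tendsto (fun a : ℝ => ∫ t in (0 : ℝ)..(c - a), f t) (𝓝[>] 0)
      (𝓝 (∫ t in (0 : ℝ)..c, f t)) := by
    refine (hcont c ⟨hc.le, le_rfl⟩).tendsto.comp (tendsto_nhdsWithin_iff.2 ⟨?_, ?_⟩)
    · have : Tendsto (fun a : ℝ => c - a) (𝓝 0) (𝓝 (c - 0)) := tendsto_const_nhds.sub tendsto_id
      rw [sub_zero] at this
      exact this.mono_left nhdsWithin_le_nhds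
    · filter_upwards [hmem] with a ha
      exact ⟨by linarith [ha.2], by linarith [ha.1]⟩
  have t3 := t2.sub t1
  rw [intervalIntegral.integral_same, sub_zero] at t3
  refine t3.congr' ?_
  filter_upwards [hmem] with a ha
  have ii : ∀ x ∈ Set.Icc 0 c, IntervalIntegrable f volume 0 x := fun x hx =>
    hf.mono_set (by rw [Set.uIcc_of_le hx.1, Set.uIcc_of_le hc.le]; exact Set.Icc_subset_Icc_right hx.2)
  rw [intervalIntegral.integral_interval_sub_left
    (ii _ ⟨by linarith [ha.2], by linarith [ha.1]⟩) (ii a ha)]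

/-- The sine weight degenerates at the poles, so the distance is compared with its value at the
equator: moving from θ toward π/2 the weight is at least sin θ. This replaces a Poincaré inequality
on the sphere. -/
theorem relDist_pointwise_bound {Λ A : ℝ} (hp : B.p ≠ 0) (hΛ : 0 ≤ Λ) {ξ : ℝ → ℝ} {m : ℝ}
    (hξ : ContDiffOn ℝ ∞ ξ (Set.Ioo 0 Real.pi)) (hm : 0 < m) (hξm : ∀ θ ∈ Set.Ioo 0 Real.pi, m ≤ ξ θ)
    {Ψ₀ Ψ : ℝ → Target} (h₀ : ContDiffOn ℝ ∞ Ψ₀ (Set.Ioo 0 Real.pi))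
    (h₁ : ContDiffOn ℝ ∞ Ψ (Set.Ioo 0 Real.pi)) (hq : IsQuasiHarmonic B Λ A ξ (tilde Ψ₀))
    (i₀ : IntervalIntegrable (areaIntegrand B Λ A ξ Ψ₀) volume 0 Real.pi)
    (i₁ : IntervalIntegrable (areaIntegrand B Λ A ξ Ψ) volume 0 Real.pi)
    (hF : Tendsto (fun θ => momentum B ξ (tilde Ψ₀) (relCoord B (tilde Ψ₀) (tilde Ψ)) θ
      - (boundaryTerm B ξ Ψ θ - boundaryTerm B ξ Ψ₀ θ)) poles (𝓝 0))
    {θ : ℝ} (hθ : θ ∈ Set.Ioo 0 Real.pi) :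
    m * ((relDist B (tilde Ψ₀ θ) (tilde Ψ θ)
      - relDist B (tilde Ψ₀ (Real.pi / 2)) (tilde Ψ (Real.pi / 2))) ^ 2 * Real.sin θ) ≤
      2 * Real.pi * (areaFunctional B Λ A ξ Ψ - areaFunctional B Λ A ξ Ψ₀) := by
  have hpi := Real.pi_pos
  have ht₀ := tilde_contDiffOn h₀
  have ht₁ := tilde_contDiffOn h₁
  set e := defect B (tilde Ψ₀) (tilde Ψ) with he
  have hec : ContinuousOn e (Set.Ioo 0 Real.pi) := defect_continuousOn ht₀ ht₁
  have he0 : ∀ t ∈ Set.Ioo 0 Real.pi, 0 ≤ e t := fun t ht => (defect_bound ht₀ ht₁ ht).1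
  set d : ℝ → ℝ := fun t => relDist B (tilde Ψ₀ t) (tilde Ψ t) with hd
  have hs := Real.sin_pos_of_mem_Ioo hθ
  -- the variation of the distance between `θ` and the equator
  have key : ∀ a b, 0 < a → a ≤ θ → a ≤ Real.pi / 2 → θ ≤ b → Real.pi / 2 ≤ b → b < Real.pi →
      (d θ - d (Real.pi / 2)) ^ 2 * Real.sin θ ≤ Real.pi / 8 * ∫ t in a..b, Real.sin t * e t := by
    intro a b ha haθ hap hθb hpb hb
    -- The constant π/8 is the interval length bound π/2 divided by the factor 4 of
    -- `relDist_variation`.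
    have gen : ∀ x y, a ≤ x → x ≤ y → y ≤ b → y - x ≤ Real.pi / 2 →
        (∀ t ∈ Set.Icc x y, Real.sin θ ≤ Real.sin t) →
        (d y - d x) ^ 2 * Real.sin θ ≤ Real.pi / 8 * ∫ t in a..b, Real.sin t * e t := by
      intro x y hax hxy hyb hlen hsin
      have hsubI : Set.Icc a b ⊆ Set.Ioo 0 Real.pi := fun t ht =>
        ⟨lt_of_lt_of_le ha ht.1, lt_of_le_of_lt ht.2 hb⟩
      have hsub : Set.Icc x y ⊆ Set.Icc a b := Set.Icc_subset_Icc hax hyb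
      have h1 := relDist_variation (B := B) ht₀ ht₁ (ha.trans_le hax) hxy (lt_of_le_of_lt hyb hb)
      have c1 : ContinuousOn (fun t => Real.sin t * e t) (Set.Icc a b) :=
        Real.continuous_sin.continuousOn.mul (hec.mono hsubI)
      have h2 : Real.sin θ * ∫ t in x..y, e t ≤ ∫ t in x..y, Real.sin t * e t := by
        rw [← intervalIntegral.integral_const_mul]
        refine intervalIntegral.integral_mono_on hxy ?_ ?_ fun t ht =>
          mul_le_mul_of_nonneg_right (hsin t ht) (he0 t (hsubI (hsub ht)))
        · exact (continuousOn_const.mul (hec.mono (hsub.trans hsubI))).intervalIntegrable_of_Icc hxy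
        · exact (c1.mono hsub).intervalIntegrable_of_Icc hxy
      have h3 : ∫ t in x..y, Real.sin t * e t ≤ ∫ t in a..b, Real.sin t * e t := by
        refine intervalIntegral.integral_mono_interval hax hxy hyb ?_
          (c1.intervalIntegrable_of_Icc (hax.trans (hxy.trans hyb)))
        filter_upwards [ae_restrict_mem measurableSet_Ioc] with t ht
        have := hsubI (Set.Ioc_subset_Icc_self ht)
        exact mul_nonneg (Real.sin_pos_of_mem_Ioo this).le (he0 t this)
      have h4 : 0 ≤ ∫ t in x..y, e t :=
        intervalIntegral.integral_nonneg hxy fun t ht => he0 t (hsubI (hsub ht))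
      have h5 : 4 * (d y - d x) ^ 2 ≤ Real.pi / 2 * ∫ t in x..y, e t :=
        h1.trans (mul_le_mul_of_nonneg_right hlen h4)
      nlinarith [mul_le_mul_of_nonneg_right h5 hs.le]
    rcases le_total θ (Real.pi / 2) with h | h
    · have := gen θ (Real.pi / 2) haθ h hpb (by linarith [hθ.1]) fun t ht =>
        Real.strictMonoOn_sin.monotoneOn ⟨by linarith [hθ.1], h⟩
          ⟨by linarith [hθ.1, ht.1], ht.2⟩ ht.1
      rwa [sub_sq_comm] at this
    · refine gen (Real.pi / 2) θ hap h hθb (by linarith [hθ.2]) fun t ht => ?_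
      rw [← Real.sin_pi_sub θ, ← Real.sin_pi_sub t]
      exact Real.strictMonoOn_sin.monotoneOn ⟨by linarith [hθ.2], by linarith⟩
        ⟨by linarith [ht.2, hθ.2], by linarith [ht.1]⟩ (by linarith [ht.2])
  have hp0 : Tendsto (fun a : ℝ => a) (𝓝[>] 0) poles := by
    rw [poles]; exact tendsto_id.mono_right le_sup_left
  have hp1 : Tendsto (fun a : ℝ => Real.pi - a) (𝓝[>] 0) poles := by
    have h1 : Tendsto (fun a : ℝ => Real.pi - a) (𝓝[>] 0) (𝓝[<] Real.pi) := by
      refine tendsto_nhdsWithin_iff.2 ⟨?_, ?_⟩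
      · have : Tendsto (fun a : ℝ => Real.pi - a) (𝓝 0) (𝓝 (Real.pi - 0)) :=
          tendsto_const_nhds.sub tendsto_id
        rw [sub_zero] at this
        exact this.mono_left nhdsWithin_le_nhds
      · filter_upwards [self_mem_nhdsWithin] with a ha
        simpa using ha
    rw [poles]; exact h1.mono_right le_sup_right
  have hlim := (tendsto_integral_shrink hpi (i₁.sub i₀)).sub ((hF.comp hp1).sub (hF.comp hp0))
  -- The factor π/2 converts m/4 into mπ/8, and the integral is four times the difference of the
  -- functionals; this produces 2π.
  have hval : Real.pi / 2 * ((∫ t in (0 : ℝ)..Real.pi,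
      (areaIntegrand B Λ A ξ Ψ t - areaIntegrand B Λ A ξ Ψ₀ t)) - (0 - 0)) =
      2 * Real.pi * (areaFunctional B Λ A ξ Ψ - areaFunctional B Λ A ξ Ψ₀) := by
    rw [intervalIntegral.integral_sub i₁ i₀, areaFunctional, areaFunctional]; ring
  rw [← hval]
  refine ge_of_tendsto (hlim.const_mul (Real.pi / 2)) ?_
  have hmin : 0 < min θ (Real.pi - θ) := lt_min hθ.1 (by linarith [hθ.2])
  filter_upwards [Ioo_mem_nhdsGT (lt_min hmin (show 0 < Real.pi / 2 by positivity))] with a ha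
  have a1 : a < θ := ha.2.trans_le ((min_le_left _ _).trans (min_le_left _ _))
  have a2 : a < Real.pi - θ := ha.2.trans_le ((min_le_left _ _).trans (min_le_right _ _))
  have a3 : a < Real.pi / 2 := ha.2.trans_le (min_le_right _ _)
  have k1 := key a (Real.pi - a) ha.1 a1.le a3.le (by linarith) (by linarith) (by linarith [ha.1])
  have k2 := integral_sin_defect_le (A := A) hp hΛ hξ hm hξm h₀ h₁ hq i₀ i₁ rfl ha.1
    (show a ≤ Real.pi - a by linarith) (by linarith [ha.1])
  simp only [Function.comp_apply] at k2 ⊢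
  have k3 := mul_le_mul_of_nonneg_left k1 hm.le
  have k4 := mul_le_mul_of_nonneg_left k2 (show 0 ≤ Real.pi / 2 by positivity)
  refine k3.trans ?_
  rw [← he] at k4
  linarith

end Poincare

/-! ### Position of one point relative to another in the solvable group. -/

section RelativePosition

/-- The nilpotent group law solved for the left factor. Its parameters are the twisted differences
that have to be small at the poles, in place of the plain differences of the potentials. -/
theorem unipMat_mul_unipMat (a₀ b₀ c₀ z₀ w₀ a b c z w : ℝ) :
    unipMat (a - a₀) (b - b₀) (c - c₀ + rt3 * (a₀ * b - a * b₀))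
      (z - z₀ + a₀ * (c - c₀) + rt3 / 3 * ((2 * a₀ - a) * (a₀ * b - a * b₀)))
      (w - w₀ + b₀ * (c - c₀) + rt3 / 3 * ((2 * b₀ - b) * (a₀ * b - a * b₀))) *
      unipMat a₀ b₀ c₀ z₀ w₀ = unipMat a b c z w := by
  have hr := rt3_sq
  have ht := sqrt_two_mul_self
  ext i j
  fin_cases i <;> fin_cases j
  all_goals simp [unipMat, Matrix.mul_apply, Fin.sum_univ_seven]
  all_goals generalize rt3 = r at *
  all_goals generalize √2 = q at *
  all_goals grind

theorem leviMat_mul_leviMat {P₀ s₀ : ℝ} (hP : P₀ ≠ 0) (hs : s₀ ≠ 0) (P s x₀ x : ℝ) :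
    leviMat (P / P₀) (s / s₀) (s₀ ^ 2 * (x - x₀)) * leviMat P₀ s₀ x₀ = leviMat P s x := by
  ext i j
  fin_cases i <;> fin_cases j
  all_goals simp [leviMat, Matrix.mul_apply, Fin.sum_univ_seven]
  all_goals field_simp
  all_goals ring

theorem unipMat_mul_leviMat {P s : ℝ} (hP : P ≠ 0) (hs : s ≠ 0) (x a b c z w : ℝ) :
    unipMat (P * s⁻¹ * a) (P * s * (b - x * a)) (P ^ 2 * c) (P ^ 3 * s⁻¹ * z)
      (P ^ 3 * s * (w - x * z)) * leviMat P s x = leviMat P s x * unipMat a b c z w := by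
  ext i j
  fin_cases i <;> fin_cases j
  all_goals simp [leviMat, unipMat, Matrix.mul_apply, Fin.sum_univ_seven]
  all_goals field_simp
  all_goals ring

/-- Differences of the potentials, adapted to the Heisenberg-type group structure. -/
def chiDiff (B : Horizon) (X₀ X₁ : Target) : ℝ :=
  B.p * X₁ 5 - B.p * X₀ 5 + rt3 * (psiBar1 X₀ * psiBar2 B X₁ - psiBar1 X₁ * psiBar2 B X₀)

/-- The first twisted difference. -/
def zetaDiff1 (B : Horizon) (X₀ X₁ : Target) : ℝ :=
  B.p * zetaBar1 X₁ - B.p * zetaBar1 X₀ + psiBar1 X₀ * (B.p * X₁ 5 - B.p * X₀ 5)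
    + rt3 / 3 * ((2 * psiBar1 X₀ - psiBar1 X₁) *
      (psiBar1 X₀ * psiBar2 B X₁ - psiBar1 X₁ * psiBar2 B X₀))

/-- The second twisted difference. -/
def zetaDiff2 (B : Horizon) (X₀ X₁ : Target) : ℝ :=
  B.p * zetaBar2 B X₁ - B.p * zetaBar2 B X₀ + psiBar2 B X₀ * (B.p * X₁ 5 - B.p * X₀ 5)
    + rt3 / 3 * ((2 * psiBar2 B X₀ - psiBar2 B X₁) *
      (psiBar1 X₀ * psiBar2 B X₁ - psiBar1 X₁ * psiBar2 B X₀))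

/-- The position of `X₁` relative to `X₀`. -/
def relPoint (B : Horizon) (X₀ X₁ : Target) : Target :=
  iwasawa B (X₁ 0 - X₀ 0) ((scaleS X₁ / scaleS X₀) ^ 2)
    (Real.sinh (X₁ 2) - (scaleS X₁ / scaleS X₀) ^ 2 * Real.sinh (X₀ 2))
    (scaleP X₀ * (scaleS X₀)⁻¹ * (psiBar1 X₁ - psiBar1 X₀))
    (scaleP X₀ * scaleS X₀ * ((psiBar2 B X₁ - psiBar2 B X₀) - shear X₀ * (psiBar1 X₁ - psiBar1 X₀)))
    (scaleP X₀ ^ 2 * chiDiff B X₀ X₁)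
    (scaleP X₀ ^ 3 * (scaleS X₀)⁻¹ * zetaDiff1 B X₀ X₁)
    (scaleP X₀ ^ 3 * scaleS X₀ * (zetaDiff2 B X₀ X₁ - shear X₀ * zetaDiff1 B X₀ X₁))

theorem scaleS_sq_mul_shear (X : Target) : scaleS X ^ 2 * shear X = Real.sinh (X 2) := by
  rw [scaleS_sq, shear, Real.exp_neg]
  have := Real.cosh_pos (X 2)
  field_simp

/-- Move the unipotent quotient past the Levi factor of `X₀` by conjugation, then divide the Levi
factors; the conjugation weights are the scale factors in `relPoint`. -/
theorem ghat_relPoint {B : Horizon} (hp : B.p ≠ 0) (X₀ X₁ : Target) :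
    ghat B (relPoint B X₀ X₁) * ghat B X₀ = ghat B X₁ := by
  have hP := (scaleP_pos X₀).ne'
  have hS := (scaleS_pos X₀).ne'
  have hS1 := scaleS_pos X₁
  have h1 : Real.exp (-(X₁ 0 - X₀ 0)) = scaleP X₁ / scaleP X₀ := by
    rw [scaleP, scaleP, ← Real.exp_sub]; ring_nf
  have h2 : √((scaleS X₁ / scaleS X₀) ^ 2) = scaleS X₁ / scaleS X₀ :=
    Real.sqrt_sq (div_pos hS1 (scaleS_pos X₀)).le
  have h3 : (Real.sinh (X₁ 2) - (scaleS X₁ / scaleS X₀) ^ 2 * Real.sinh (X₀ 2)) /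
      (scaleS X₁ / scaleS X₀) ^ 2 = scaleS X₀ ^ 2 * (shear X₁ - shear X₀) := by
    rw [← scaleS_sq_mul_shear, ← scaleS_sq_mul_shear]
    field_simp
  rw [relPoint, ghat_iwasawa hp (pow_pos (div_pos hS1 (scaleS_pos X₀)) 2), h1, h2, h3]
  rw [ghat, ghat, mul_assoc, ← mul_assoc (unipMat _ _ _ _ _), unipMat_mul_leviMat hP hS, ← mul_assoc,
    ← mul_assoc, leviMat_mul_leviMat hP hS, mul_assoc, chiDiff, zetaDiff1, zetaDiff2,
    unipMat_mul_unipMat]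

theorem relMat_eq_ghat {B : Horizon} (hp : B.p ≠ 0) (X₀ X₁ : Target) :
    relMat B X₀ X₁ = ghat B (relPoint B X₀ X₁) := by
  rw [relMat, ← ghat_relPoint hp X₀ X₁, mul_assoc, (isG2_ghat B X₀).mul_jInv, mul_one]

/-- Invariance under the group moves the first point to the origin. The logarithm between two
diverging maps then depends only on the relative position, which stays bounded at the poles. -/
theorem relLog_eq_relPoint {B : Horizon} (hp : B.p ≠ 0) (X₀ X₁ : Target) :
    relLog B X₀ X₁ = relLog B 0 (relPoint B X₀ X₁) := by
  have : relMat B 0 (relPoint B X₀ X₁) = ghat B (relPoint B X₀ X₁) := by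
    rw [relMat, ghat_zero, jInv, transpose_one, mul_one, formJ_mul_self, mul_one]
  rw [relLog, relLog, this, relMat_eq_ghat hp]

/-- On the flat of diagonal matrices the logarithm is explicit. -/
theorem frameCoord_relLog_flat (B : Horizon) (u v : ℝ) :
    frameCoord (relLog B 0 ![u, v, 0, 0, 0, 0, 0, 0]) = ![u, v, 0, 0, 0, 0, 0, 0] := by
  set X : Target := ![u, v, 0, 0, 0, 0, 0, 0] with hX
  set l : Fin 7 → ℝ := ![-4 * u, -2 * u + v, -2 * u - v, 0, 2 * u + v, 2 * u - v, 4 * u] with hl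
  have hlog : relLog B 0 X = diagonal l := by
    refine log_unique (relLog_isSymm B 0 X) (Matrix.isSymm_diagonal l) ?_ ?_
    · rw [exp_relLog]; exact isSPD_relMat B 0 X
    · have : relMat B 0 X = ghat B X := by
        rw [relMat, ghat_zero, jInv, transpose_one, mul_one, formJ_mul_self, mul_one]
      rw [exp_relLog, this, exp_diagonal_real]
      ext i j
      fin_cases i <;> fin_cases j
      all_goals simp [ghat, leviMat, unipMat, scaleP, scaleS, shear, psiBar1, psiBar2, zetaBar1,
        zetaBar2, Matrix.mul_apply, Fin.sum_univ_seven, hX, hl, ← Real.exp_add, ← Real.exp_neg,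
        ← Real.exp_nat_mul]
      all_goals ring
  rw [hlog]
  ext i
  fin_cases i <;> simp [frameCoord, hl, hX]
  ring

end RelativePosition

/-! ### Orders of vanishing at the poles in powers of √(sin θ). -/

section Poles

/-- `√(sin θ)`. -/
def rootSin (θ : ℝ) : ℝ := √(Real.sin θ)

/-- One of the two poles. -/
def IsPole (l : Filter ℝ) : Prop := l = 𝓝[>] 0 ∨ l = 𝓝[<] Real.pi

/-- `f = O((sin θ)^{n/2})`. -/
def Ord (l : Filter ℝ) (n : ℤ) (f : ℝ → ℝ) : Prop := f =O[l] fun θ => rootSin θ ^ n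

theorem rootSin_pos {θ : ℝ} (h : θ ∈ Set.Ioo 0 Real.pi) : 0 < rootSin θ :=
  Real.sqrt_pos.2 (Real.sin_pos_of_mem_Ioo h)

theorem rootSin_le_one (θ : ℝ) : rootSin θ ≤ 1 := Real.sqrt_le_one.2 (Real.sin_le_one θ)

theorem rootSin_sq {θ : ℝ} (h : θ ∈ Set.Ioo 0 Real.pi) : rootSin θ ^ 2 = Real.sin θ :=
  Real.sq_sqrt (Real.sin_pos_of_mem_Ioo h).le

variable {l : Filter ℝ} {f g : ℝ → ℝ} {m n : ℤ}

theorem IsPole.eventually_mem (hl : IsPole l) : ∀ᶠ θ in l, θ ∈ Set.Ioo 0 Real.pi := by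
  rcases hl with rfl | rfl
  · exact Ioo_mem_nhdsGT Real.pi_pos
  · exact Ioo_mem_nhdsLT Real.pi_pos

theorem IsPole.le_poles (hl : IsPole l) : l ≤ poles := by
  rcases hl with rfl | rfl
  · exact le_sup_left
  · exact le_sup_right

theorem IsPole.tendsto_rootSin (hl : IsPole l) : Tendsto rootSin l (𝓝 0) := by
  have hc : Continuous rootSin := Real.continuous_sin.sqrt
  rcases hl with rfl | rfl
  · have := hc.tendsto 0
    simp only [rootSin, Real.sin_zero, Real.sqrt_zero] at this
    exact this.mono_left nhdsWithin_le_nhds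
  · have := hc.tendsto Real.pi
    simp only [rootSin, Real.sin_pi, Real.sqrt_zero] at this
    exact this.mono_left nhdsWithin_le_nhds

theorem Ord.add (hf : Ord l n f) (hg : Ord l n g) : Ord l n (fun θ => f θ + g θ) := IsBigO.add hf hg

theorem Ord.sub (hf : Ord l n f) (hg : Ord l n g) : Ord l n (fun θ => f θ - g θ) := IsBigO.sub hf hg

theorem Ord.neg (hf : Ord l n f) : Ord l n (fun θ => -f θ) := IsBigO.neg_left hf

theorem Ord.const_mul (c : ℝ) (hf : Ord l n f) : Ord l n (fun θ => c * f θ) :=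
  IsBigO.const_mul_left hf c

theorem Ord.mul (hl : IsPole l) (hf : Ord l m f) (hg : Ord l n g) :
    Ord l (m + n) (fun θ => f θ * g θ) := by
  refine (IsBigO.mul hf hg).congr' EventuallyEq.rfl ?_
  filter_upwards [hl.eventually_mem] with θ hθ
  exact (zpow_add₀ (rootSin_pos hθ).ne' m n).symm

theorem Ord.mono (hl : IsPole l) (hf : Ord l m f) (h : n ≤ m) : Ord l n f := by
  refine hf.trans (IsBigO.of_bound 1 ?_)
  filter_upwards [hl.eventually_mem] with θ hθ
  have hq := rootSin_pos hθ
  rw [Real.norm_of_nonneg (zpow_nonneg hq.le _), Real.norm_of_nonneg (zpow_nonneg hq.le _), one_mul]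
  exact zpow_le_zpow_right_of_le_one₀ hq (rootSin_le_one θ) h

theorem Ord.mul' (hl : IsPole l) (hf : Ord l m f) (hg : Ord l n g) {k : ℤ} (h : k ≤ m + n) :
    Ord l k (fun θ => f θ * g θ) := (hf.mul hl hg).mono hl h

theorem Ord.pow (hf : Ord l n f) (k : ℕ) : Ord l (k * n) (fun θ => f θ ^ k) := by
  refine (IsBigO.pow hf k).congr' EventuallyEq.rfl ?_
  exact Eventually.of_forall fun θ => by
    simp only
    rw [mul_comm, _root_.zpow_mul, zpow_natCast]

theorem Ord.congr (hl : IsPole l) (hf : Ord l n f) (h : ∀ θ ∈ Set.Ioo 0 Real.pi, f θ = g θ) :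
    Ord l n g :=
  IsBigO.congr' hf (hl.eventually_mem.mono fun θ hθ => h θ hθ) EventuallyEq.rfl

theorem ord_zero_iff : Ord l 0 f ↔ f =O[l] fun _ => (1 : ℝ) := by simp [Ord]

theorem ord_zero_of_continuous (hl : IsPole l) (hf : Continuous f) : Ord l 0 f := by
  rw [ord_zero_iff]
  rcases hl with rfl | rfl
  · exact ((hf.tendsto _).isBigO_one ℝ).mono nhdsWithin_le_nhds
  · exact ((hf.tendsto _).isBigO_one ℝ).mono nhdsWithin_le_nhds

theorem ord_const (l : Filter ℝ) (c : ℝ) : Ord l 0 (fun _ => c) := by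
  rw [ord_zero_iff]; exact isBigO_const_const c one_ne_zero l

theorem ord_sin (hl : IsPole l) : Ord l 2 Real.sin := by
  refine IsBigO.of_bound 1 ?_
  filter_upwards [hl.eventually_mem] with θ hθ
  rw [zpow_ofNat, rootSin_sq hθ, one_mul]

theorem ord_inv_sin (hl : IsPole l) : Ord l (-2) (fun θ => 1 / Real.sin θ) := by
  refine IsBigO.of_bound 1 ?_
  filter_upwards [hl.eventually_mem] with θ hθ
  rw [_root_.zpow_neg, zpow_ofNat, rootSin_sq hθ, one_mul, one_div]

theorem Ord.of_sin (hl : IsPole l) (h : f =O[l] Real.sin) : Ord l 2 f := h.trans (ord_sin hl)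

theorem Ord.isLittleO (hl : IsPole l) (hf : Ord l n f) (hn : 0 < n) :
    f =o[l] fun _ => (1 : ℝ) := by
  have h1 : Ord l 1 f := hf.mono hl (by omega)
  refine IsBigO.trans_isLittleO h1 ?_
  rw [isLittleO_one_iff]
  simpa using hl.tendsto_rootSin

theorem Ord.tendsto (hl : IsPole l) (hf : Ord l n f) (hn : 0 < n) : Tendsto f l (𝓝 0) :=
  (isLittleO_one_iff ℝ).1 (hf.isLittleO hl hn)

/-- Integration from the pole. -/
theorem ord_integrate_zero {f' : ℝ → ℝ} (hn : 0 ≤ n) (hd : ∀ θ ∈ Set.Ioo 0 Real.pi, HasDerivAt f (f' θ) θ)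
    (h0 : Tendsto f (𝓝[>] 0) (𝓝 0)) (hf' : Ord (𝓝[>] 0) n f') : Ord (𝓝[>] 0) (n + 2) f := by
  obtain ⟨C, hC0, hC⟩ := IsBigO.exists_pos hf'
  rw [IsBigOWith] at hC
  obtain ⟨δ, hδ, hδC⟩ := (eventually_nhdsWithin_iff.1 hC |> Metric.eventually_nhds_iff.1)
  refine IsBigO.of_bound (C * (Real.pi / 2)) ?_
  filter_upwards [Ioo_mem_nhdsGT (lt_min hδ (show (0 : ℝ) < Real.pi / 2 by positivity))] with θ hθ
  have h1 : θ < δ := hθ.2.trans_le (min_le_left _ _)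
  have h2 : θ < Real.pi / 2 := hθ.2.trans_le (min_le_right _ _)
  have hpi := Real.pi_pos
  have hI : θ ∈ Set.Ioo 0 Real.pi := ⟨hθ.1, by linarith⟩
  have hq := rootSin_pos hI
  have hbd : ∀ t ∈ Set.Ioc 0 θ, ‖f' t‖ ≤ C * rootSin θ ^ n := by
    intro t ht
    have h3 := hδC (y := t) (by rw [Real.dist_eq, sub_zero, abs_of_pos ht.1]; linarith [ht.2]) ht.1
    have hqt : 0 < rootSin t := rootSin_pos ⟨ht.1, by linarith [ht.2]⟩
    rw [Real.norm_of_nonneg (zpow_nonneg hqt.le _)] at h3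
    refine h3.trans (mul_le_mul_of_nonneg_left ?_ hC0.le)
    refine zpow_le_zpow_left₀ hn hqt.le (Real.sqrt_le_sqrt ?_)
    exact Real.strictMonoOn_sin.monotoneOn ⟨by linarith [ht.1], by linarith [ht.2]⟩
      ⟨by linarith [hθ.1], h2.le⟩ ht.2
  have hdiff : ∀ t ∈ Set.Ioo 0 θ, ‖f θ - f t‖ ≤ C * rootSin θ ^ n * θ := by
    intro t ht
    have h4 := Convex.norm_image_sub_le_of_norm_hasDerivWithin_le (f := f) (f' := f')
      (s := Set.Icc t θ) (C := C * rootSin θ ^ n) (x := t) (y := θ)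
      (fun s hs => (hd s ⟨ht.1.trans_le hs.1, by linarith [hs.2]⟩).hasDerivWithinAt)
      (fun s hs => hbd s ⟨ht.1.trans_le hs.1, hs.2⟩) (convex_Icc t θ) ⟨le_rfl, ht.2.le⟩ ⟨ht.2.le, le_rfl⟩
    refine h4.trans (mul_le_mul_of_nonneg_left ?_ (by positivity))
    rw [Real.norm_of_nonneg (by linarith [ht.2])]
    linarith [ht.1]
  have hlim : ‖f θ‖ ≤ C * rootSin θ ^ n * θ := by
    have h5 : Tendsto (fun t => ‖f θ - f t‖) (𝓝[>] 0) (𝓝 ‖f θ - 0‖) :=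
      (tendsto_const_nhds.sub h0).norm
    rw [sub_zero] at h5
    refine le_of_tendsto h5 ?_
    filter_upwards [Ioo_mem_nhdsGT hθ.1] with t ht using hdiff t ht
  have hsin : θ ≤ Real.pi / 2 * rootSin θ ^ 2 := by
    rw [rootSin_sq hI]
    have := Real.mul_le_sin hθ.1.le h2.le
    rw [div_mul_eq_mul_div, div_le_iff₀ hpi] at this
    linarith
  rw [Real.norm_of_nonneg (zpow_nonneg hq.le _), zpow_add₀ hq.ne', zpow_ofNat]
  calc ‖f θ‖ ≤ C * rootSin θ ^ n * θ := hlim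
    _ ≤ C * rootSin θ ^ n * (Real.pi / 2 * rootSin θ ^ 2) :=
        mul_le_mul_of_nonneg_left hsin (by positivity)
    _ = _ := by ring

theorem tendsto_pi_sub_left : Tendsto (fun a : ℝ => Real.pi - a) (𝓝[>] 0) (𝓝[<] Real.pi) := by
  refine tendsto_nhdsWithin_iff.2 ⟨?_, ?_⟩
  · have : Tendsto (fun a : ℝ => Real.pi - a) (𝓝 0) (𝓝 (Real.pi - 0)) :=
      tendsto_const_nhds.sub tendsto_id
    rw [sub_zero] at this
    exact this.mono_left nhdsWithin_le_nhds
  · filter_upwards [self_mem_nhdsWithin] with a ha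
    simpa using ha

theorem tendsto_pi_sub_right : Tendsto (fun a : ℝ => Real.pi - a) (𝓝[<] Real.pi) (𝓝[>] 0) := by
  refine tendsto_nhdsWithin_iff.2 ⟨?_, ?_⟩
  · have : Tendsto (fun a : ℝ => Real.pi - a) (𝓝 Real.pi) (𝓝 (Real.pi - Real.pi)) :=
      tendsto_const_nhds.sub tendsto_id
    rw [sub_self] at this
    exact this.mono_left nhdsWithin_le_nhds
  · filter_upwards [self_mem_nhdsWithin] with a ha
    simpa using ha

/-- Integration from a pole gains a factor comparable to sin θ, which is two orders in √(sin θ). The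
pole π is reduced to 0 by reflection. -/
theorem Ord.integrate (hl : IsPole l) {f' : ℝ → ℝ} (hf' : Ord l n f') (hn : 0 ≤ n)
    (hd : ∀ θ ∈ Set.Ioo 0 Real.pi, HasDerivAt f (f' θ) θ) (h0 : Tendsto f l (𝓝 0)) :
    Ord l (n + 2) f := by
  have hrs : ∀ θ, rootSin (Real.pi - θ) = rootSin θ := fun θ => by rw [rootSin, Real.sin_pi_sub]; rfl
  rcases hl with rfl | rfl
  · exact ord_integrate_zero hn hd h0 hf'
  · have h1 : Ord (𝓝[>] 0) n (fun θ => -f' (Real.pi - θ)) := by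
      have := (IsBigO.comp_tendsto hf' tendsto_pi_sub_left).neg_left
      exact this.congr (fun _ => rfl) (fun θ => by simp only [Function.comp_apply, hrs])
    have h2 := ord_integrate_zero (f := fun θ => f (Real.pi - θ)) hn (fun θ hθ => by
      have := (hd (Real.pi - θ) ⟨by linarith [hθ.2], by linarith [hθ.1]⟩).comp_const_sub Real.pi θ
      exact this) (h0.comp tendsto_pi_sub_left) h1
    have h3 := IsBigO.comp_tendsto h2 tendsto_pi_sub_right
    exact h3.congr (fun θ => by simp only [Function.comp_apply, sub_sub_cancel])
      (fun θ => by simp only [Function.comp_apply, hrs])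

theorem integrable_of_isBigO_poles (hc : ContinuousOn f (Set.Ioo 0 Real.pi))
    (h : f =O[poles] fun _ => (1 : ℝ)) : IntervalIntegrable f volume 0 Real.pi := by
  rw [intervalIntegrable_iff_integrableOn_Ioo_of_le Real.pi_pos.le]
  have hpi := Real.pi_pos
  obtain ⟨C, hC⟩ := h.bound
  rw [poles, eventually_sup] at hC
  obtain ⟨a, ha, hCa⟩ := mem_nhdsGT_iff_exists_Ioo_subset.1 hC.1
  obtain ⟨b, hb, hCb⟩ := mem_nhdsLT_iff_exists_Ioo_subset.1 hC.2
  have ha' : 0 < a := ha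
  have hb' : b < Real.pi := hb
  obtain ⟨D, hD⟩ := (isCompact_Icc (a := min (a / 2) 1) (b := max ((b + Real.pi) / 2)
    1)).exists_bound_of_continuousOn (f := f) (hc.mono fun x hx => ⟨(lt_min (by linarith) one_pos).trans_le hx.1,
      hx.2.trans_lt (max_lt (by linarith) (by linarith [Real.pi_gt_three]))⟩)
  refine Integrable.of_bound (hc.aestronglyMeasurable measurableSet_Ioo) (max C D) ?_
  refine (ae_restrict_mem measurableSet_Ioo).mono fun θ hθ => ?_
  by_cases h1 : θ < a
  · have := hCa ⟨hθ.1, h1⟩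
    simp only [Set.mem_ofPred_eq, norm_one, mul_one] at this
    exact this.trans (le_max_left _ _)
  by_cases h2 : b < θ
  · have := hCb ⟨h2, hθ.2⟩
    simp only [Set.mem_ofPred_eq, norm_one, mul_one] at this
    exact this.trans (le_max_left _ _)
  push Not at h1 h2
  exact (hD θ ⟨(min_le_left _ _).trans (by linarith), le_trans (by linarith) (le_max_left _ _)⟩).trans
    (le_max_right _ _)

end Poles

/-! ### Uniform asymptotic data for all horizon topologies. -/

section PoleData

variable {l : Filter ℝ} {f g : ℝ → ℝ} {m n : ℤ}

theorem ord_zero_of_continuousAt {x : ℝ} (hl : l ≤ 𝓝 x) (hf : ContinuousAt f x) : Ord l 0 f :=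
  ord_zero_iff.2 ((hf.tendsto.isBigO_one ℝ).mono hl)

theorem Ord.exp (hf : Ord l 0 f) : Ord l 0 (fun θ => Real.exp (f θ)) := by
  obtain ⟨C, hC⟩ := (ord_zero_iff.1 hf).bound
  refine ord_zero_iff.2 (IsBigO.of_bound (Real.exp C) (hC.mono fun θ h => ?_))
  rw [norm_one, mul_one] at *
  rw [Real.norm_of_nonneg (Real.exp_pos _).le]
  exact Real.exp_le_exp.2 ((le_abs_self _).trans h)

theorem Ord.comp_continuousAt (hl : IsPole l) (hf : Ord l n f) (hn : 0 < n) {F : ℝ → ℝ}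
    (hF : ContinuousAt F 0) : Ord l 0 (fun θ => F (f θ)) :=
  ord_zero_iff.2 ((hF.tendsto.comp (hf.tendsto hl hn)).isBigO_one ℝ)

theorem Ord.sinh (hl : IsPole l) (hf : Ord l n f) (hn : 0 < n) : Ord l n (fun θ => Real.sinh (f θ)) := by
  have h1 : (fun x : ℝ => Real.sinh x) =O[𝓝 0] fun x => x := by
    have := (Real.hasDerivAt_sinh 0).isBigO_sub
    simpa using this
  exact (h1.comp_tendsto (hf.tendsto hl hn)).trans hf

theorem sqrt_sin_half_ord_zero : Ord (𝓝[>] 0) 1 (fun θ => √(Real.sin (θ / 2))) := by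
  have h1 : Ord (𝓝[>] 0) 0 (fun θ => (√(2 * Real.cos (θ / 2)))⁻¹) := by
    refine ord_zero_of_continuousAt nhdsWithin_le_nhds (ContinuousAt.inv₀ (by fun_prop) ?_)
    simp
  have h2 : Ord (𝓝[>] 0) 1 rootSin := by simpa [Ord] using isBigO_refl rootSin _
  refine (h2.mul' (Or.inl rfl) h1 (k := 1) (by norm_num)).congr (Or.inl rfl) fun θ hθ => ?_
  obtain ⟨hs, hc, h⟩ := half_pos_of_mem hθ
  rw [rootSin, ← Real.sqrt_inv, ← Real.sqrt_mul (Real.sin_pos_of_mem_Ioo hθ).le, h]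
  congr 1
  field_simp

theorem sqrt_cos_half_ord_pi : Ord (𝓝[<] Real.pi) 1 (fun θ => √(Real.cos (θ / 2))) := by
  have h1 : Ord (𝓝[<] Real.pi) 0 (fun θ => (√(2 * Real.sin (θ / 2)))⁻¹) := by
    refine ord_zero_of_continuousAt nhdsWithin_le_nhds (ContinuousAt.inv₀ (by fun_prop) ?_)
    simp
  have h2 : Ord (𝓝[<] Real.pi) 1 rootSin := by simpa [Ord] using isBigO_refl rootSin _
  refine (h2.mul' (Or.inr rfl) h1 (k := 1) (by norm_num)).congr (Or.inr rfl) fun θ hθ => ?_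
  obtain ⟨hs, hc, h⟩ := half_pos_of_mem hθ
  rw [rootSin, ← Real.sqrt_inv, ← Real.sqrt_mul (Real.sin_pos_of_mem_Ioo hθ).le, h]
  congr 1
  field_simp

theorem sq_isBigO_sqrt {F : ℝ → ℝ} (h0 : ∀ᶠ θ in l, 0 ≤ F θ) (h1 : ∀ θ, F θ ≤ 1) :
    (fun θ => F θ ^ 2) =O[l] fun θ => √(F θ) := by
  refine IsBigO.of_bound 1 (h0.mono fun θ h => ?_)
  rw [Real.norm_of_nonneg (by positivity), Real.norm_of_nonneg (by positivity), one_mul]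
  exact Real.le_sqrt_of_sq_le (by nlinarith [h1 θ, pow_le_one₀ h (h1 θ) (n := 3)])

theorem self_isBigO_sqrt {F : ℝ → ℝ} (h0 : ∀ᶠ θ in l, 0 ≤ F θ) (h1 : ∀ θ, F θ ≤ 1) :
    F =O[l] fun θ => √(F θ) := by
  refine IsBigO.of_bound 1 (h0.mono fun θ h => ?_)
  rw [Real.norm_of_nonneg (by positivity), Real.norm_of_nonneg (by positivity), one_mul]
  exact Real.le_sqrt_of_sq_le (by nlinarith [h1 θ])

theorem eventually_poles_mem : ∀ᶠ θ in poles, θ ∈ Set.Ioo 0 Real.pi :=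
  eventually_sup.2 ⟨IsPole.eventually_mem (Or.inl rfl), IsPole.eventually_mem (Or.inr rfl)⟩

/-- The model asymptotics are stronger than those required of a competitor. -/
theorem ModelAsymptotics.toMapAsymptotics {B : Horizon} {Ψ : ℝ → Target} (h : ModelAsymptotics B Ψ) :
    MapAsymptotics B Ψ := by
  have hs : (fun θ => Real.sin (θ / 2) ^ 2) =O[poles] fun θ => √(Real.sin (θ / 2)) :=
    sq_isBigO_sqrt (eventually_poles_mem.mono fun θ hθ => (half_pos_of_mem hθ).1.le)
      fun θ => Real.sin_le_one _
  have hc : (fun θ => Real.cos (θ / 2) ^ 2) =O[poles] fun θ => √(Real.cos (θ / 2)) :=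
    sq_isBigO_sqrt (eventually_poles_mem.mono fun θ hθ => (half_pos_of_mem hθ).2.1.le)
      fun θ => Real.cos_le_one _
  have hss : Real.sin =O[poles] fun θ => √(Real.sin θ) :=
    self_isBigO_sqrt (eventually_poles_mem.mono fun θ hθ => (Real.sin_pos_of_mem_Ioo hθ).le)
      fun θ => Real.sin_le_one _
  exact
    { h.toCommonAsymptotics with
      psi1_asymp := fun h0 => (h.psi1_asymp h0).trans hs
      psi2_asymp := fun h0 => (h.psi2_asymp h0).trans hc
      dpsi1_asymp := fun h0 => (h.dpsi1_asymp h0).trans hss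
      dpsi2_asymp := fun h0 => (h.dpsi2_asymp h0).trans hss
      dzeta1_asymp := fun h0 => (h.dzeta1_asymp h0).trans (hs.mul (isBigO_refl _ _))
      dzeta2_asymp := fun h0 => (h.dzeta2_asymp h0).trans (hc.mul (isBigO_refl _ _)) }

/-- Orders of vanishing at a pole; `j` is the order of `scaleS`. -/
structure PoleData (B : Horizon) (l : Filter ℝ) (j : ℤ) (Ψ : ℝ → Target) : Prop where
  U : Ord l 0 (fun θ => Ψ θ 0)
  dU : Ord l 2 (fun θ => deriv Ψ θ 0)
  W : Ord l 2 (fun θ => Ψ θ 2)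
  dW : Ord l 0 (fun θ => deriv Ψ θ 2)
  dchi : Ord l 2 (fun θ => deriv Ψ θ 5)
  psi1 : Ord l 0 (fun θ => psiBar1 (Ψ θ))
  psi2 : Ord l 0 (fun θ => psiBar2 B (Ψ θ))
  dpsi1 : Ord l 1 (fun θ => psiBar1 (deriv Ψ θ))
  dpsi2 : Ord l 1 (fun θ => psiBar2 B (deriv Ψ θ))
  Theta1 : Ord l (2 + j) (fun θ => ThetaBar1 (Ψ θ) (deriv Ψ θ))
  Theta2 : Ord l (2 - j) (fun θ => ThetaBar2 B (Ψ θ) (deriv Ψ θ))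
  Vs : Ord l 0 (Vs B Ψ)
  dV : Ord l 4 (fun θ => Real.sin θ * deriv Ψ θ 1 + 2 * (B.s : ℝ) * Real.cos (θ / 2) ^ 2)
  v : Ord l 0 (fun θ => Ψ θ 1 + h2 θ - j * Real.log (Real.sin θ))

theorem tan_half_mul_sin {θ : ℝ} (hθ : θ ∈ Set.Ioo 0 Real.pi) :
    Real.tan (θ / 2) * Real.sin θ = 2 * Real.sin (θ / 2) ^ 2 := by
  obtain ⟨hs, hc, h⟩ := half_pos_of_mem hθ
  rw [h, Real.tan_eq_sin_div_cos]
  field_simp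

theorem h2_add_log_sin {θ : ℝ} (hθ : θ ∈ Set.Ioo 0 Real.pi) :
    h2 θ + Real.log (Real.sin θ) = Real.log 2 + 2 * Real.log (Real.sin (θ / 2)) := by
  obtain ⟨hs, hc, h⟩ := half_pos_of_mem hθ
  have ht : 0 < Real.tan (θ / 2) := by rw [Real.tan_eq_sin_div_cos]; positivity
  rw [h2, ← Real.log_mul ht.ne' (Real.sin_pos_of_mem_Ioo hθ).ne', tan_half_mul_sin hθ,
    Real.log_mul two_ne_zero (by positivity), Real.log_pow]
  norm_num

theorem h2_sub_log_sin {θ : ℝ} (hθ : θ ∈ Set.Ioo 0 Real.pi) :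
    h2 θ - Real.log (Real.sin θ) = -(Real.log 2 + 2 * Real.log (Real.cos (θ / 2))) := by
  obtain ⟨hs, hc, h⟩ := half_pos_of_mem hθ
  rw [h2, h, Real.tan_eq_sin_div_cos, Real.log_div hs.ne' hc.ne', Real.log_mul (by positivity) hc.ne',
    Real.log_mul two_ne_zero hs.ne']
  ring

theorem p_mul_ThetaBar1 (B : Horizon) (X Y : Target) : B.p * ThetaBar1 X Y = B.p * zetaBar1 Y +
    psiBar1 X * (B.p * Y 5 + rt3 / 3 * (psiBar1 X * psiBar2 B Y - psiBar2 B X * psiBar1 Y)) := by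
  have : √3 ≠ 0 := by positivity
  simp only [ThetaBar1, Theta1, auxForm, zetaBar1, psiBar1, psiBar2, rt3]
  field_simp
  ring

theorem p_mul_ThetaBar2 (B : Horizon) (X Y : Target) : B.p * ThetaBar2 B X Y = B.p * zetaBar2 B Y +
    psiBar2 B X * (B.p * Y 5 + rt3 / 3 * (psiBar1 X * psiBar2 B Y - psiBar2 B X * psiBar1 Y)) := by
  have : √3 ≠ 0 := by positivity
  simp only [ThetaBar2, Theta1, Theta2, auxForm, zetaBar2, psiBar1, psiBar2, rt3]
  field_simp
  ring

theorem p_mul_Upsilon (B : Horizon) (X Y : Target) : B.p * Upsilon X Y =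
    B.p * Y 5 + rt3 * (psiBar1 X * psiBar2 B Y - psiBar2 B X * psiBar1 Y) := by
  have : √3 ≠ 0 := by positivity
  simp only [Upsilon, psiBar1, psiBar2, rt3]
  field_simp
  ring

theorem Ord.of_const_mul {c : ℝ} (hc : c ≠ 0) (h : Ord l n (fun θ => c * f θ)) : Ord l n f :=
  (isBigO_const_mul_left_iff hc).1 h

theorem hasDerivAt_psiBar1 {Ψ : ℝ → Target} {θ : ℝ} (h : DifferentiableAt ℝ Ψ θ) :
    HasDerivAt (fun θ => psiBar1 (Ψ θ)) (psiBar1 (deriv Ψ θ)) θ :=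
  hasDerivAt_pi.1 h.hasDerivAt 6

theorem hasDerivAt_psiBar2 (B : Horizon) {Ψ : ℝ → Target} {θ : ℝ} (h : DifferentiableAt ℝ Ψ θ) :
    HasDerivAt (fun θ => psiBar2 B (Ψ θ)) (psiBar2 B (deriv Ψ θ)) θ :=
  ((hasDerivAt_pi.1 h.hasDerivAt 6).const_mul B.q).add ((hasDerivAt_pi.1 h.hasDerivAt 7).const_mul B.p)

theorem hasDerivAt_zetaBar1 {Ψ : ℝ → Target} {θ : ℝ} (h : DifferentiableAt ℝ Ψ θ) :
    HasDerivAt (fun θ => zetaBar1 (Ψ θ)) (zetaBar1 (deriv Ψ θ)) θ :=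
  hasDerivAt_pi.1 h.hasDerivAt 3

theorem hasDerivAt_zetaBar2 (B : Horizon) {Ψ : ℝ → Target} {θ : ℝ} (h : DifferentiableAt ℝ Ψ θ) :
    HasDerivAt (fun θ => zetaBar2 B (Ψ θ)) (zetaBar2 B (deriv Ψ θ)) θ :=
  ((hasDerivAt_pi.1 h.hasDerivAt 3).const_mul B.q).add ((hasDerivAt_pi.1 h.hasDerivAt 4).const_mul B.p)

/-- The order of the one-form `dχ + (ψ¹dψ² - ψ²dψ¹)/(3√3)`. -/
theorem ord_auxForm (hl : IsPole l) (c : ℝ) {a b a' b' x' : ℝ → ℝ} (ha : Ord l 0 a)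
    (hb : Ord l 0 b) (ha' : Ord l 1 a') (hb' : Ord l 1 b') (hx : Ord l 2 x') (p : ℝ) :
    Ord l 1 (fun θ => p * x' θ + c * (a θ * b' θ - b θ * a' θ)) :=
  ((hx.mono hl (by norm_num)).const_mul p).add
    (((ha.mul' hl hb' (by norm_num)).sub (hb.mul' hl ha' (by norm_num))).const_mul c)

/-- At θ = 0 the function tan(θ/2) vanishes like sin θ, so e^v has that order and `j = 1`. The
assumed order 1 of ψ̄¹ is too weak for Θ̄¹; integrating its derivative from the pole, where ψ̄¹
tends to zero, improves it to order 3. -/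
theorem MapAsymptotics.poleData_lens_zero {p q : ℕ} (hp : p ≠ 0) {Ψ : ℝ → Target}
    (hd : ∀ θ ∈ Set.Ioo 0 Real.pi, DifferentiableAt ℝ Ψ θ)
    (h : MapAsymptotics (.lens p q) Ψ) : PoleData (.lens p q) (𝓝[>] 0) 1 Ψ := by
  have hl : IsPole (𝓝[>] (0 : ℝ)) := Or.inl rfl
  have hle := hl.le_poles
  have hs : (Horizon.lens p q).s = 0 := rfl
  have hp' : (Horizon.lens p q).p ≠ 0 := Nat.cast_ne_zero.2 hp
  have hrs : (fun θ => √(Real.sin θ)) =O[𝓝[>] (0 : ℝ)] fun θ => rootSin θ ^ (1 : ℤ) := by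
    simp only [zpow_one]; exact isBigO_refl rootSin _
  have hsc : Ord (𝓝[>] 0) 0 (fun θ => √(Real.cos (θ / 2))) :=
    ord_zero_of_continuous hl (by fun_prop)
  have hdp1 : Ord (𝓝[>] 0) 1 (fun θ => psiBar1 (deriv Ψ θ)) := ((h.dpsi1_asymp hs).mono hle).trans hrs
  have hdp2 : Ord (𝓝[>] 0) 1 (fun θ => psiBar2 _ (deriv Ψ θ)) :=
    ((h.dpsi2_asymp hs).mono hle).trans hrs
  have hp1 : Ord (𝓝[>] 0) 1 (fun θ => psiBar1 (Ψ θ)) :=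
    ((h.psi1_asymp hs).mono hle).trans sqrt_sin_half_ord_zero
  have hp1' : Ord (𝓝[>] 0) 3 (fun θ => psiBar1 (Ψ θ)) :=
    hdp1.integrate hl (by norm_num) (fun θ hθ => hasDerivAt_psiBar1 (hd θ hθ)) (hp1.tendsto hl one_pos)
  have hp2 : Ord (𝓝[>] 0) 0 (fun θ => psiBar2 _ (Ψ θ)) := ((h.psi2_asymp hs).mono hle).trans hsc
  have hdchi := Ord.of_sin hl (h.dchi_asymp.mono hle)
  have haux := ord_auxForm hl (rt3 / 3) (hp1.mono hl zero_le_one) hp2 hdp1 hdp2 hdchi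
    (Horizon.lens p q).p
  have hz1 : Ord (𝓝[>] 0) 3 (fun θ => zetaBar1 (deriv Ψ θ)) :=
    ((h.dzeta1_asymp hs).mono hle).trans (sqrt_sin_half_ord_zero.mul hl (ord_sin hl))
  have hz2 : Ord (𝓝[>] 0) 2 (fun θ => zetaBar2 _ (deriv Ψ θ)) :=
    ((h.dzeta2_asymp hs).mono hle).trans (hsc.mul hl (ord_sin hl))
  have hV : Ord (𝓝[>] 0) 0 (fun θ => Ψ θ 1) := ord_zero_iff.2 ((h.V_bdd hs).mono hle)
  refine
    { U := ord_zero_iff.2 (h.U_bdd.mono hle)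
      dU := Ord.of_sin hl (h.dU_asymp.mono hle)
      W := Ord.of_sin hl (h.W_asymp.mono hle)
      dW := ord_zero_iff.2 (h.dW_bdd.mono hle)
      dchi := hdchi
      psi1 := hp1.mono hl zero_le_one
      psi2 := hp2
      dpsi1 := hdp1
      dpsi2 := hdp2
      Theta1 := ?_
      Theta2 := ?_
      Vs := hV.congr hl fun θ _ => by simp [MinSugra.Vs, Horizon.s]
      dV := ?_
      v := ?_ }
  · refine Ord.of_const_mul hp' ?_
    simp only [p_mul_ThetaBar1]
    exact (hz1.const_mul _).add (hp1'.mul' hl haux (by norm_num))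
  · refine Ord.of_const_mul hp' ?_
    simp only [p_mul_ThetaBar2]
    exact ((hz2.const_mul _).mono hl (by norm_num)).add (hp2.mul' hl haux (by norm_num))
  · refine ((ord_sin hl).mul' hl (Ord.of_sin hl ((h.dV_asymp hs).mono hle)) (k := 4)
      (by norm_num)).congr hl fun θ _ => ?_
    simp [Horizon.s]
  · have h1 : Ord (𝓝[>] 0) 0 (fun θ => -(Real.log 2 + 2 * Real.log (Real.cos (θ / 2)))) := by
      refine ord_zero_of_continuousAt nhdsWithin_le_nhds (((continuousAt_const.mul
        (ContinuousAt.log (by fun_prop) (by simp))).const_add _ |>.neg))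
    refine (hV.add h1).congr hl fun θ hθ => ?_
    rw [← h2_sub_log_sin hθ]; push_cast; ring

/-- At θ = π the function tan(θ/2) blows up like 1/sin θ, so `j = -1` and the two indices exchange
roles. -/
theorem MapAsymptotics.poleData_lens_pi {p q : ℕ} (hp : p ≠ 0) {Ψ : ℝ → Target}
    (hd : ∀ θ ∈ Set.Ioo 0 Real.pi, DifferentiableAt ℝ Ψ θ)
    (h : MapAsymptotics (.lens p q) Ψ) : PoleData (.lens p q) (𝓝[<] Real.pi) (-1) Ψ := by
  have hl : IsPole (𝓝[<] Real.pi) := Or.inr rfl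
  have hle := hl.le_poles
  have hs : (Horizon.lens p q).s = 0 := rfl
  have hp' : (Horizon.lens p q).p ≠ 0 := Nat.cast_ne_zero.2 hp
  have hrs : (fun θ => √(Real.sin θ)) =O[𝓝[<] Real.pi] fun θ => rootSin θ ^ (1 : ℤ) := by
    simp only [zpow_one]; exact isBigO_refl rootSin _
  have hsc : Ord (𝓝[<] Real.pi) 0 (fun θ => √(Real.sin (θ / 2))) :=
    ord_zero_of_continuous hl (by fun_prop)
  have hdp1 : Ord (𝓝[<] Real.pi) 1 (fun θ => psiBar1 (deriv Ψ θ)) :=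
    ((h.dpsi1_asymp hs).mono hle).trans hrs
  have hdp2 : Ord (𝓝[<] Real.pi) 1 (fun θ => psiBar2 _ (deriv Ψ θ)) :=
    ((h.dpsi2_asymp hs).mono hle).trans hrs
  have hp2 : Ord (𝓝[<] Real.pi) 1 (fun θ => psiBar2 _ (Ψ θ)) :=
    ((h.psi2_asymp hs).mono hle).trans sqrt_cos_half_ord_pi
  have hp2' : Ord (𝓝[<] Real.pi) 3 (fun θ => psiBar2 _ (Ψ θ)) :=
    hdp2.integrate hl (by norm_num) (fun θ hθ => hasDerivAt_psiBar2 _ (hd θ hθ))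
      (hp2.tendsto hl one_pos)
  have hp1 : Ord (𝓝[<] Real.pi) 0 (fun θ => psiBar1 (Ψ θ)) := ((h.psi1_asymp hs).mono hle).trans hsc
  have hdchi := Ord.of_sin hl (h.dchi_asymp.mono hle)
  have haux := ord_auxForm hl (rt3 / 3) hp1 (hp2.mono hl zero_le_one) hdp1 hdp2 hdchi
    (Horizon.lens p q).p
  have hz1 : Ord (𝓝[<] Real.pi) 2 (fun θ => zetaBar1 (deriv Ψ θ)) :=
    ((h.dzeta1_asymp hs).mono hle).trans (hsc.mul hl (ord_sin hl))
  have hz2 : Ord (𝓝[<] Real.pi) 3 (fun θ => zetaBar2 _ (deriv Ψ θ)) :=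
    ((h.dzeta2_asymp hs).mono hle).trans (sqrt_cos_half_ord_pi.mul hl (ord_sin hl))
  have hV : Ord (𝓝[<] Real.pi) 0 (fun θ => Ψ θ 1) := ord_zero_iff.2 ((h.V_bdd hs).mono hle)
  refine
    { U := ord_zero_iff.2 (h.U_bdd.mono hle)
      dU := Ord.of_sin hl (h.dU_asymp.mono hle)
      W := Ord.of_sin hl (h.W_asymp.mono hle)
      dW := ord_zero_iff.2 (h.dW_bdd.mono hle)
      dchi := hdchi
      psi1 := hp1
      psi2 := hp2.mono hl zero_le_one
      dpsi1 := hdp1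
      dpsi2 := hdp2
      Theta1 := ?_
      Theta2 := ?_
      Vs := hV.congr hl fun θ _ => by simp [MinSugra.Vs, Horizon.s]
      dV := ?_
      v := ?_ }
  · refine Ord.of_const_mul hp' ?_
    simp only [p_mul_ThetaBar1]
    exact ((hz1.const_mul _).mono hl (by norm_num)).add (hp1.mul' hl haux (by norm_num))
  · refine Ord.of_const_mul hp' ?_
    simp only [p_mul_ThetaBar2]
    exact (hz2.const_mul _).add (hp2'.mul' hl haux (by norm_num))
  · refine ((ord_sin hl).mul' hl (Ord.of_sin hl ((h.dV_asymp hs).mono hle)) (k := 4)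
      (by norm_num)).congr hl fun θ _ => ?_
    simp [Horizon.s]
  · have h1 : Ord (𝓝[<] Real.pi) 0 (fun θ => Real.log 2 + 2 * Real.log (Real.sin (θ / 2))) := by
      refine ord_zero_of_continuousAt nhdsWithin_le_nhds ((continuousAt_const.mul
        (ContinuousAt.log (by fun_prop) (by simp))).const_add _)
    refine (hV.add h1).congr hl fun θ hθ => ?_
    rw [← h2_add_log_sin hθ]; push_cast; ring

/-- The prescribed logarithm in V reverses the sign of the singularity at θ = 0, so `j = -1` at both
poles. The order of Θ̄² cannot be derived from the potentials here and comes from the explicit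
assumption on it. -/
theorem MapAsymptotics.poleData_ring {Ψ : ℝ → Target} (hl : IsPole l)
    (h : MapAsymptotics .ring Ψ) : PoleData .ring l (-1) Ψ := by
  have hle := hl.le_poles
  have hs : Horizon.ring.s = 1 := rfl
  have hp1 : Ord l 0 (fun θ => psiBar1 (Ψ θ)) := ord_zero_iff.2 ((h.psi1_ring hs).mono hle)
  have hp2 : Ord l 0 (fun θ => psiBar2 _ (Ψ θ)) := ord_zero_iff.2 ((h.psi2_ring hs).mono hle)
  have hdp1 : Ord l 1 (fun θ => psiBar1 (deriv Ψ θ)) :=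
    (Ord.of_sin hl ((h.dpsi1_ring hs).mono hle)).mono hl (by norm_num)
  have hdp2 : Ord l 1 (fun θ => psiBar2 _ (deriv Ψ θ)) :=
    (Ord.of_sin hl ((h.dpsi2_ring hs).mono hle)).mono hl (by norm_num)
  have hdchi := Ord.of_sin hl (h.dchi_asymp.mono hle)
  have haux := ord_auxForm hl (rt3 / 3) hp1 hp2 hdp1 hdp2 hdchi Horizon.ring.p
  have hz1 := Ord.of_sin hl ((h.dzeta1_ring hs).mono hle)
  have hV : Ord l 0 (fun θ => Ψ θ 1 + 2 * Real.log (Real.sin (θ / 2)) + Real.log 2) :=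
    (ord_zero_iff.2 ((h.V_ring hs).mono hle)).add (ord_const l _)
  refine
    { U := ord_zero_iff.2 (h.U_bdd.mono hle)
      dU := Ord.of_sin hl (h.dU_asymp.mono hle)
      W := Ord.of_sin hl (h.W_asymp.mono hle)
      dW := ord_zero_iff.2 (h.dW_bdd.mono hle)
      dchi := hdchi
      psi1 := hp1
      psi2 := hp2
      dpsi1 := hdp1
      dpsi2 := hdp2
      Theta1 := ?_
      Theta2 := ?_
      Vs := hV.congr hl fun θ hθ => ?_
      dV := ?_
      v := hV.congr hl fun θ hθ => ?_ }
  · refine Ord.of_const_mul (c := Horizon.ring.p) one_ne_zero ?_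
    simp only [p_mul_ThetaBar1]
    exact ((hz1.const_mul _).mono hl (by norm_num)).add (hp1.mul' hl haux (by norm_num))
  · refine Ord.mono hl (m := 4) (((h.Theta2_ring hs).mono hle).trans ?_) (by norm_num)
    exact (ord_sin hl).pow 2
  · have := h2_add_log_sin hθ
    simp only [MinSugra.Vs, hs, h1, Nat.cast_one]
    linarith
  · refine ((ord_sin hl).mul' hl (Ord.of_sin hl ((h.dV_ring hs).mono hle)) (k := 4)
      (by norm_num)).congr hl fun θ hθ => ?_
    obtain ⟨hs', hc, h⟩ := half_pos_of_mem hθ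
    simp only [hs, Nat.cast_one, Real.cot_eq_cos_div_sin, mul_add, h]
    field_simp
  · have := h2_add_log_sin hθ
    push_cast
    linarith

/-- The exponent depends only on the topology and the pole, so the competitor and the model share
it. -/
theorem exists_poleData {B : Horizon} (hB : B.Admissible) (hl : IsPole l) :
    ∃ j : ℤ, (j = 1 ∨ j = -1) ∧ ∀ Ψ : ℝ → Target, (∀ θ ∈ Set.Ioo 0 Real.pi, DifferentiableAt ℝ Ψ θ) →
      MapAsymptotics B Ψ → PoleData B l j Ψ := by
  cases B with
  | lens p q =>
    have hp : p ≠ 0 := by have := hB.1; omega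
    rcases hl with rfl | rfl
    · exact ⟨1, Or.inl rfl, fun Ψ hd h => h.poleData_lens_zero hp hd⟩
    · exact ⟨-1, Or.inr rfl, fun Ψ hd h => h.poleData_lens_pi hp hd⟩
  | ring => exact ⟨-1, Or.inr rfl, fun Ψ _ h => h.poleData_ring hl⟩

end PoleData

/-! ### Orders of the scale factors and of the coframe of a singular map. -/

section PoleOrders

variable {l : Filter ℝ} {f g : ℝ → ℝ} {m n j : ℤ} {B : Horizon} {Ψ Ψ₀ : ℝ → Target}

theorem tilde_zero (Ψ : ℝ → Target) (θ : ℝ) : tilde Ψ θ 0 = Ψ θ 0 + h1 θ := rfl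

theorem tilde_one (Ψ : ℝ → Target) (θ : ℝ) : tilde Ψ θ 1 = Ψ θ 1 + h2 θ := rfl

theorem tilde_two (Ψ : ℝ → Target) (θ : ℝ) : tilde Ψ θ 2 = Ψ θ 2 := by simp [tilde]

theorem tilde_potential (Ψ : ℝ → Target) (θ : ℝ) (i : Fin 8) (hi : 3 ≤ i) : tilde Ψ θ i = Ψ θ i := by
  fin_cases i <;> first | (exact absurd hi (by decide)) | simp [tilde]

theorem exp_half_log_sin {θ : ℝ} (hθ : θ ∈ Set.Ioo 0 Real.pi) (k : ℤ) :
    Real.exp (k * (Real.log (Real.sin θ) / 2)) = rootSin θ ^ k := by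
  rw [← Real.rpow_intCast, Real.rpow_def_of_pos (rootSin_pos hθ), rootSin,
    Real.log_sqrt (Real.sin_pos_of_mem_Ioo hθ).le, mul_comm]

theorem Ord.exp_of_log {k : ℤ} (hl : IsPole l)
    (h : Ord l 0 (fun θ => f θ - k * (Real.log (Real.sin θ) / 2))) :
    Ord l k (fun θ => Real.exp (f θ)) := by
  have h1 : Ord l k (fun θ => rootSin θ ^ k) := isBigO_refl _ _
  refine (h.exp.mul' hl h1 (k := k) (by simp)).congr hl fun θ hθ => ?_
  rw [← exp_half_log_sin hθ, ← Real.exp_add]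
  ring_nf

namespace PoleData

theorem scaleP (h : PoleData B l j Ψ) (hl : IsPole l) :
    Ord l (-1) (fun θ => scaleP (tilde Ψ θ)) := by
  refine Ord.exp_of_log hl (h.U.neg.congr hl fun θ _ => ?_)
  rw [tilde_zero, h1]; push_cast; ring

theorem logcosh (h : PoleData B l j Ψ) (hl : IsPole l) :
    Ord l 0 (fun θ => Real.log (Real.cosh (Ψ θ 2))) :=
  h.W.comp_continuousAt hl (by norm_num) (F := fun x => Real.log (Real.cosh x))
    (ContinuousAt.log (Real.continuous_cosh.continuousAt) (by simp))

theorem scaleS (h : PoleData B l j Ψ) (hl : IsPole l) :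
    Ord l j (fun θ => scaleS (tilde Ψ θ)) := by
  refine Ord.exp_of_log hl (((h.v.add (h.logcosh hl)).const_mul (1 / 2)).congr hl fun θ _ => ?_)
  rw [tilde_one, tilde_two]; ring

theorem scaleS_inv (h : PoleData B l j Ψ) (hl : IsPole l) :
    Ord l (-j) (fun θ => (MinSugra.scaleS (tilde Ψ θ))⁻¹) := by
  simp only [MinSugra.scaleS, ← Real.exp_neg]
  refine Ord.exp_of_log hl (((h.v.add (h.logcosh hl)).const_mul (-1 / 2)).congr hl fun θ _ => ?_)
  rw [tilde_one, tilde_two]; push_cast; ring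

theorem sinhW (h : PoleData B l j Ψ) (hl : IsPole l) : Ord l 2 (fun θ => Real.sinh (Ψ θ 2)) :=
  h.W.sinh hl (by norm_num)

/-- From the identity `scaleS ^ 2 * shear = sinh w`: the order of sinh w is 2 and that of `scaleS ^
2` is 2j. -/
theorem shear (h : PoleData B l j Ψ) (hl : IsPole l) :
    Ord l (2 - 2 * j) (fun θ => shear (tilde Ψ θ)) := by
  refine (((h.scaleS_inv hl).pow 2).mul' hl (h.sinhW hl) (k := 2 - 2 * j)
    (by push_cast; omega)).congr hl fun θ _ => ?_
  have := scaleS_sq_mul_shear (tilde Ψ θ)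
  rw [tilde_two] at this
  rw [← this]
  have := (scaleS_pos (tilde Ψ θ)).ne'
  field_simp

end PoleData

theorem deriv_tilde {θ : ℝ} (hθ : θ ∈ Set.Ioo 0 Real.pi) (hd : DifferentiableAt ℝ Ψ θ) :
    deriv (tilde Ψ) θ = deriv Ψ θ +
      ![Real.cos θ / (2 * Real.sin θ), 1 / Real.sin θ, 0, 0, 0, 0, 0, 0] :=
  (hasDerivAt_tilde hd.hasDerivAt hθ).deriv

theorem coframe_tilde (B : Horizon) {θ : ℝ} (hθ : θ ∈ Set.Ioo 0 Real.pi)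
    (hd : DifferentiableAt ℝ Ψ θ) :
    coframe B (tilde Ψ θ) (deriv (tilde Ψ) θ) =
      ![deriv Ψ θ 0 + Real.cos θ / (2 * Real.sin θ),
        deriv Ψ θ 1 + 1 / Real.sin θ + Real.sinh (Ψ θ 2) / Real.cosh (Ψ θ 2) * deriv Ψ θ 2,
        -Real.sinh (Ψ θ 2) * (deriv Ψ θ 1 + 1 / Real.sin θ) + deriv Ψ θ 2 / Real.cosh (Ψ θ 2),
        scaleP (tilde Ψ θ) ^ 3 * (scaleS (tilde Ψ θ))⁻¹ * (B.p * ThetaBar1 (Ψ θ) (deriv Ψ θ)),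
        scaleP (tilde Ψ θ) ^ 3 * scaleS (tilde Ψ θ) *
          (shear (tilde Ψ θ) * (B.p * ThetaBar1 (Ψ θ) (deriv Ψ θ))
            - B.p * ThetaBar2 B (Ψ θ) (deriv Ψ θ)),
        scaleP (tilde Ψ θ) * (scaleS (tilde Ψ θ))⁻¹ * psiBar1 (deriv Ψ θ),
        scaleP (tilde Ψ θ) * scaleS (tilde Ψ θ) *
          (shear (tilde Ψ θ) * psiBar1 (deriv Ψ θ) - psiBar2 B (deriv Ψ θ)),
        scaleP (tilde Ψ θ) ^ 2 * (B.p * Upsilon (Ψ θ) (deriv Ψ θ))] := by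
  have t6 := tilde_potential Ψ θ 6 (by decide)
  have t7 := tilde_potential Ψ θ 7 (by decide)
  rw [deriv_tilde hθ hd, coframe, tilde_two]
  simp [ThetaBar1, ThetaBar2, Theta1, Theta2, auxForm, psiBar1, psiBar2, Upsilon, t6, t7]

namespace PoleData

theorem sin_mul_dV (h : PoleData B l j Ψ) (hl : IsPole l) :
    Ord l 0 (fun θ => Real.sin θ * deriv Ψ θ 1 + 1) := by
  have h1 : Ord l 0 (fun θ => 1 - 2 * (B.s : ℝ) * Real.cos (θ / 2) ^ 2) :=
    ord_zero_of_continuous hl (by fun_prop)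
  exact ((h.dV.mono hl (by norm_num)).add h1).congr hl fun θ _ => by ring

theorem sechW (h : PoleData B l j Ψ) (hl : IsPole l) :
    Ord l 0 (fun θ => (Real.cosh (Ψ θ 2))⁻¹) :=
  h.W.comp_continuousAt hl (by norm_num) (F := fun x => (Real.cosh x)⁻¹)
    (ContinuousAt.inv₀ (Real.continuous_cosh.continuousAt) (by simp))

theorem upsilon (h : PoleData B l j Ψ) (hl : IsPole l) :
    Ord l 1 (fun θ => B.p * Upsilon (Ψ θ) (deriv Ψ θ)) := by
  simp only [p_mul_Upsilon]
  exact ord_auxForm hl rt3 h.psi1 h.psi2 h.dpsi1 h.dpsi2 h.dchi B.p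

theorem coframe_two (hd : ∀ θ ∈ Set.Ioo 0 Real.pi, DifferentiableAt ℝ Ψ θ)
    (h : PoleData B l j Ψ) (hl : IsPole l) :
    Ord l 2 (fun θ => Real.sin θ * coframe B (tilde Ψ θ) (deriv (tilde Ψ) θ) 2) := by
  refine (((h.sinhW hl).neg.mul' hl (h.sin_mul_dV hl) (k := 2) (by norm_num)).add
    ((ord_sin hl).mul' hl (h.dW.mul hl (h.sechW hl)) (by norm_num))).congr hl fun θ hθ => ?_
  have := Real.sin_pos_of_mem_Ioo hθ
  rw [coframe_tilde B hθ (hd θ hθ)]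
  simp
  field_simp

/-- The orders 2 ± j of Θ̄¹ and Θ̄² compensate the factors `scaleS⁻¹` and `scaleS`, so j drops out
and `scaleP ^ 3` leaves order −1. The other components are at least as good because |j| = 1. The
squares are then of order −2, just compensated by the weight sin θ. -/
theorem coframe_potential (hd : ∀ θ ∈ Set.Ioo 0 Real.pi, DifferentiableAt ℝ Ψ θ)
    (h : PoleData B l j Ψ) (hl : IsPole l) (hj : j = 1 ∨ j = -1) (a : Fin 8) (ha : 3 ≤ a) :
    Ord l (-1) (fun θ => coframe B (tilde Ψ θ) (deriv (tilde Ψ) θ) a) := by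
  have hP := h.scaleP hl
  have hS := h.scaleS hl
  have hS' := h.scaleS_inv hl
  have hx := h.shear hl
  have h1 := h.Theta1.const_mul B.p
  have h2 := h.Theta2.const_mul B.p
  have main : ∀ k : Fin 8, 3 ≤ k → Ord l (-1) (fun θ => (![0, 0, 0,
        MinSugra.scaleP (tilde Ψ θ) ^ 3 * (MinSugra.scaleS (tilde Ψ θ))⁻¹ *
          (B.p * ThetaBar1 (Ψ θ) (deriv Ψ θ)),
        MinSugra.scaleP (tilde Ψ θ) ^ 3 * MinSugra.scaleS (tilde Ψ θ) *
          (MinSugra.shear (tilde Ψ θ) * (B.p * ThetaBar1 (Ψ θ) (deriv Ψ θ))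
            - B.p * ThetaBar2 B (Ψ θ) (deriv Ψ θ)),
        MinSugra.scaleP (tilde Ψ θ) * (MinSugra.scaleS (tilde Ψ θ))⁻¹ * psiBar1 (deriv Ψ θ),
        MinSugra.scaleP (tilde Ψ θ) * MinSugra.scaleS (tilde Ψ θ) *
          (MinSugra.shear (tilde Ψ θ) * psiBar1 (deriv Ψ θ) - psiBar2 B (deriv Ψ θ)),
        MinSugra.scaleP (tilde Ψ θ) ^ 2 * (B.p * Upsilon (Ψ θ) (deriv Ψ θ))] : Fin 8 → ℝ) k) := by
    intro k hk
    fin_cases k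
    · exact absurd hk (by decide)
    · exact absurd hk (by decide)
    · exact absurd hk (by decide)
    · exact ((hP.pow 3).mul hl hS').mul' hl h1 (by push_cast; omega)
    · exact ((hP.pow 3).mul hl hS).mul' hl
        ((hx.mul' hl h1 (k := 2 - j) (by omega)).sub h2) (by push_cast; omega)
    · exact (hP.mul hl hS').mul' hl h.dpsi1 (by omega)
    · exact (hP.mul hl hS).mul' hl
        ((hx.mul' hl h.dpsi1 (k := 1) (by omega)).sub h.dpsi2) (by omega)
    · exact (hP.pow 2).mul' hl (h.upsilon hl) (by norm_num)
  refine (main a ha).congr hl fun θ hθ => ?_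
  rw [coframe_tilde B hθ (hd θ hθ)]
  fin_cases a <;> first | (exact absurd ha (by decide)) | rfl

end PoleData

end PoleOrders

/-! ### Boundedness and integrability of the renormalized density. -/

section AreaIntegrable

variable {l : Filter ℝ} {j : ℤ} {B : Horizon} {Ψ : ℝ → Target} {ξ : ℝ → ℝ} {Λ A : ℝ}

/-- The renormalized density in terms of the coframe. -/
theorem areaIntegrand_eq {θ : ℝ} (hθ : θ ∈ Set.Ioo 0 Real.pi) (hξ : DifferentiableAt ℝ ξ θ)
    (hξ0 : ξ θ ≠ 0) (hΨ : DifferentiableAt ℝ Ψ θ) :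
    areaIntegrand B Λ A ξ Ψ θ = ξ θ * (Real.sin θ * (12 * deriv Ψ θ 0 ^ 2
        + ((Real.sin θ * deriv Ψ θ 1 + 2 * (B.s : ℝ) * Real.cos (θ / 2) ^ 2) * (1 / Real.sin θ)) ^ 2
        + deriv Ψ θ 2 ^ 2
        + (Real.sinh (Ψ θ 2) * ((Real.sin θ * deriv Ψ θ 1 + 1) * (1 / Real.sin θ))) ^ 2
        + (coframe B (tilde Ψ θ) (deriv (tilde Ψ) θ) 3 ^ 2
          + coframe B (tilde Ψ θ) (deriv (tilde Ψ) θ) 4 ^ 2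
          + coframe B (tilde Ψ θ) (deriv (tilde Ψ) θ) 5 ^ 2
          + coframe B (tilde Ψ θ) (deriv (tilde Ψ) θ) 6 ^ 2
          + coframe B (tilde Ψ θ) (deriv (tilde Ψ) θ) 7 ^ 2)
        + lambdaCoeff B Λ A * (scaleP (tilde Ψ θ) ^ 4 * Real.sin θ ^ 2)))
      - (12 * (Ψ θ 0 * (Real.cos θ * deriv ξ θ - Real.sin θ * ξ θ))
        + 2 * (Vs B Ψ θ * ((1 - 2 * (B.s : ℝ) * Real.cos (θ / 2) ^ 2) * deriv ξ θ
          + (B.s : ℝ) * Real.sin θ * ξ θ))) := by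
  have hs := Real.sin_pos_of_mem_Ioo hθ
  have hd := hΨ.hasDerivAt
  have hw : HasDerivAt (fun τ => 1 - 2 * (B.s : ℝ) * Real.cos (τ / 2) ^ 2) ((B.s : ℝ) * Real.sin θ) θ := by
    have h1 := ((((Real.hasDerivAt_cos (θ / 2)).comp θ ((hasDerivAt_id θ).div_const 2)).pow 2).const_mul
      (2 * (B.s : ℝ))).const_sub 1
    refine h1.congr_deriv ?_
    simp only [Function.comp_apply, id]
    rw [(half_pos_of_mem hθ).2.2]
    push_cast; ring
  have hR := ((((Real.hasDerivAt_cos θ).mul hξ.hasDerivAt).mul (hasDerivAt_pi.1 hd 0)).const_mul 12).add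
    (((hw.mul hξ.hasDerivAt).mul (hasDerivAt_Vs B hd hθ)).const_mul 2)
  have hE := (hasDerivAt_boundaryTerm B (Λ := Λ) (A := A) hθ hξ hξ0 hΨ).unique
    (f := boundaryTerm B ξ Ψ) hR
  have hcos : Real.cos (θ / 2) ^ 2 = (1 + Real.cos θ) / 2 := by rw [Real.cos_sq]; ring_nf
  have hP : Real.exp (-4 * tilde Ψ θ 0) = scaleP (tilde Ψ θ) ^ 4 := by
    rw [scaleP, ← Real.exp_nat_mul]; ring_nf
  have hc := Real.cosh_pos (Ψ θ 2)
  have hcs := Real.cosh_sq (Ψ θ 2)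
  have hvw : (deriv Ψ θ 1 + 1 / Real.sin θ + Real.sinh (Ψ θ 2) / Real.cosh (Ψ θ 2) * deriv Ψ θ 2) ^ 2 +
        (-Real.sinh (Ψ θ 2) * (deriv Ψ θ 1 + 1 / Real.sin θ) + deriv Ψ θ 2 / Real.cosh (Ψ θ 2)) ^ 2 =
      (Real.sinh (Ψ θ 2) ^ 2 + 1) * (deriv Ψ θ 1 + 1 / Real.sin θ) ^ 2 + deriv Ψ θ 2 ^ 2 := by
    rw [← hcs]
    generalize deriv Ψ θ 1 + 1 / Real.sin θ = y
    field_simp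
    linear_combination -(Real.cosh (Ψ θ 2) ^ 2 * y ^ 2 + deriv Ψ θ 2 ^ 2) * hcs
  have h0 : coframe B (tilde Ψ θ) (deriv (tilde Ψ) θ) 0 = deriv Ψ θ 0 + Real.cos θ / (2 * Real.sin θ) := by
    rw [coframe_tilde B hθ hΨ]; rfl
  have h12 : coframe B (tilde Ψ θ) (deriv (tilde Ψ) θ) 1 ^ 2 +
      coframe B (tilde Ψ θ) (deriv (tilde Ψ) θ) 2 ^ 2 =
      (Real.sinh (Ψ θ 2) ^ 2 + 1) * (deriv Ψ θ 1 + 1 / Real.sin θ) ^ 2 + deriv Ψ θ 2 ^ 2 := by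
    rw [← hvw, coframe_tilde B hθ hΨ]; rfl
  simp only [energyDensity, divergentTerm, G_eq_coframe, Pi.mul_apply, hP, hcos, h0] at hE ⊢
  generalize coframe B (tilde Ψ θ) (deriv (tilde Ψ) θ) 1 = o1 at *
  generalize coframe B (tilde Ψ θ) (deriv (tilde Ψ) θ) 2 = o2 at *
  have h2 : o2 ^ 2 = (Real.sinh (Ψ θ 2) ^ 2 + 1) * (deriv Ψ θ 1 + 1 / Real.sin θ) ^ 2 + deriv Ψ θ 2 ^ 2
    - o1 ^ 2 := by linarith
  rw [h2] at hE
  rw [sub_eq_iff_eq_add, ← sub_eq_iff_eq_add'] at hE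
  rw [← hE]
  field_simp
  ring

/-- After renormalization every square has order at least −2 and is multiplied by sin θ, while the
terms linear in U and V_s have bounded coefficients. -/
theorem PoleData.areaIntegrand_bounded (hd : ∀ θ ∈ Set.Ioo 0 Real.pi, DifferentiableAt ℝ Ψ θ)
    (h : PoleData B l j Ψ) (hl : IsPole l) (hj : j = 1 ∨ j = -1)
    (hξd : ∀ θ ∈ Set.Ioo 0 Real.pi, DifferentiableAt ℝ ξ θ)
    (hξ0 : ∀ θ ∈ Set.Ioo 0 Real.pi, ξ θ ≠ 0) (hξ : Ord l 0 ξ) (hξ' : Ord l 0 (deriv ξ)) :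
    Ord l 0 (areaIntegrand B Λ A ξ Ψ) := by
  have hs := ord_sin hl
  have hi := ord_inv_sin hl
  have hc := ord_zero_of_continuous hl Real.continuous_cos
  have hw : Ord l 0 (fun θ => 1 - 2 * (B.s : ℝ) * Real.cos (θ / 2) ^ 2) :=
    ord_zero_of_continuous hl (by fun_prop)
  have sq : ∀ {f : ℝ → ℝ}, Ord l (-1) f → Ord l (-2) (fun θ => f θ ^ 2) := fun hf => hf.pow 2
  have ha : ∀ a : Fin 8, 3 ≤ a → Ord l (-2)
      (fun θ => coframe B (tilde Ψ θ) (deriv (tilde Ψ) θ) a ^ 2) := fun a ha =>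
    sq (h.coframe_potential hd hl hj a ha)
  have t0 := sq (h.dU.mono hl (by norm_num))
  have t1 := sq (h.dV.mul' hl hi (k := -1) (by norm_num))
  have t2 := sq (h.dW.mono hl (by norm_num))
  have t3 := sq ((h.sinhW hl).mul' hl ((h.sin_mul_dV hl).mul hl hi) (k := -1) (by norm_num))
  have t4 := (((ha 3 le_rfl).add (ha 4 (by decide))).add (ha 5 (by decide))).add (ha 6 (by decide))
    |>.add (ha 7 (by decide))
  have t5 := ((((h.scaleP hl).pow 4).mul' hl (hs.pow 2) (k := -2)
    (by norm_num)).const_mul (lambdaCoeff B Λ A))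
  have m1 := hξ.mul' hl (hs.mul hl ((((((t0.const_mul 12).add t1).add t2).add t3).add t4).add t5))
    (k := 0) (by norm_num)
  have m2 := (h.U.mul' hl ((hc.mul' hl hξ' (k := 0) (by norm_num)).sub (hs.mul' hl hξ (by norm_num)))
    (k := 0) (by norm_num)).const_mul 12
  have m3 := (h.Vs.mul' hl ((hw.mul' hl hξ' (k := 0) (by norm_num)).add
    ((hs.const_mul (B.s : ℝ)).mul' hl hξ (by norm_num))) (k := 0) (by norm_num)).const_mul 2
  exact (m1.sub (m2.add m3)).congr hl fun θ hθ =>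
    (areaIntegrand_eq hθ (hξd θ hθ) (hξ0 θ hθ) (hd θ hθ)).symm

theorem areaIntegrand_continuousOn (hξ : ContDiffOn ℝ ∞ ξ (Set.Ioo 0 Real.pi))
    (hξ0 : ∀ θ ∈ Set.Ioo 0 Real.pi, ξ θ ≠ 0) (hΨ : ContDiffOn ℝ ∞ Ψ (Set.Ioo 0 Real.pi)) :
    ContinuousOn (areaIntegrand B Λ A ξ Ψ) (Set.Ioo 0 Real.pi) := by
  refine ContinuousOn.congr ?_ fun t ht => areaIntegrand_eq ht
    ((hξ.contDiffAt (isOpen_Ioo.mem_nhds ht)).differentiableAt (by simp)) (hξ0 t ht)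
    ((hΨ.contDiffAt (isOpen_Ioo.mem_nhds ht)).differentiableAt (by simp))
  intro θ hθ
  have hm := isOpen_Ioo.mem_nhds hθ
  have ht := tilde_contDiffOn hΨ
  refine ContinuousAt.continuousWithinAt ?_
  have cξ := (hξ.contDiffAt hm).continuousAt
  have cξ' : ContinuousAt (deriv ξ) θ :=
    ((hξ.deriv_of_isOpen (m := 0) isOpen_Ioo (by simp)).contDiffAt hm).continuousAt
  have cΨ : ∀ i, ContinuousAt (fun t => Ψ t i) θ := fun i =>
    continuousAt_pi.1 (hΨ.contDiffAt hm).continuousAt i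
  have cΨ' : ∀ i, ContinuousAt (fun t => deriv Ψ t i) θ := fun i => continuousAt_pi.1
    ((hΨ.deriv_of_isOpen (m := 0) isOpen_Ioo (by simp)).contDiffAt hm).continuousAt i
  have cT : ContinuousAt (tilde Ψ) θ := (ht.contDiffAt hm).continuousAt
  have cT' : ContinuousAt (deriv (tilde Ψ)) θ :=
    ((ht.deriv_of_isOpen (m := 0) isOpen_Ioo (by simp)).contDiffAt hm).continuousAt
  have cω : ∀ a, ContinuousAt (fun t => coframe B (tilde Ψ t) (deriv (tilde Ψ) t) a) θ := fun a =>
    continuousAt_pi.1 (((contDiff_coframe B).continuous.continuousAt).comp (cT.prodMk cT')) a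
  have cP : ContinuousAt (fun t => scaleP (tilde Ψ t)) θ :=
    Real.continuous_exp.continuousAt.comp (continuousAt_pi.1 cT 0).neg
  have cS : ContinuousAt (fun t => 1 / Real.sin t) θ :=
    continuousAt_const.div Real.continuous_sin.continuousAt (Real.sin_pos_of_mem_Ioo hθ).ne'
  have cV : ContinuousAt (Vs B Ψ) θ := (hasDerivAt_Vs B
    ((hΨ.contDiffAt hm).differentiableAt (by simp)).hasDerivAt hθ).continuousAt
  have c0 := cΨ 0
  have c0' := cΨ' 0
  have c1' := cΨ' 1
  have c2' := cΨ' 2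
  have csh : ContinuousAt (fun t => Real.sinh (Ψ t 2)) θ :=
    Real.continuous_sinh.continuousAt.comp (cΨ 2)
  have w3 := cω 3
  have w4 := cω 4
  have w5 := cω 5
  have w6 := cω 6
  have w7 := cω 7
  fun_prop

theorem areaIntegrand_integrable (hB : B.Admissible) (hΨ : ContDiffOn ℝ ∞ Ψ (Set.Ioo 0 Real.pi))
    (h : MapAsymptotics B Ψ) (hξ : ContDiffOn ℝ ∞ ξ (Set.Ioo 0 Real.pi))
    (hξ0 : ∀ θ ∈ Set.Ioo 0 Real.pi, ξ θ ≠ 0) (hb : ∀ l, IsPole l → Ord l 0 ξ)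
    (hb' : ∀ l, IsPole l → Ord l 0 (deriv ξ)) :
    IntervalIntegrable (areaIntegrand B Λ A ξ Ψ) volume 0 Real.pi := by
  have hd : ∀ {E : Type} [NormedAddCommGroup E] [NormedSpace ℝ E] {f : ℝ → E},
      ContDiffOn ℝ ∞ f (Set.Ioo 0 Real.pi) → ∀ θ ∈ Set.Ioo 0 Real.pi, DifferentiableAt ℝ f θ :=
    fun hf θ hθ => (hf.contDiffAt (isOpen_Ioo.mem_nhds hθ)).differentiableAt (by simp)
  have key : ∀ l, IsPole l → areaIntegrand B Λ A ξ Ψ =O[l] fun _ => (1 : ℝ) := fun l hl => by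
    obtain ⟨j, hj, H⟩ := exists_poleData hB hl
    exact ord_zero_iff.1 ((H Ψ (hd hΨ) h).areaIntegrand_bounded (hd hΨ) hl hj (hd hξ) hξ0 (hb l hl)
      (hb' l hl))
  exact integrable_of_isBigO_poles (areaIntegrand_continuousOn hξ hξ0 hΨ)
    ((key _ (Or.inl rfl)).sup (key _ (Or.inr rfl)))

end AreaIntegrable

/-! ### Differences of two maps with equal axis values. -/

section PairOrders

variable {l : Filter ℝ} {n j : ℤ} {B : Horizon} {Ψ Ψ₀ : ℝ → Target}

/-- Integration of the twisted difference of two horizontal lifts. -/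
theorem ord_twisted_difference (hl : IsPole l) {r : ℝ} {a₀ a₁ b₀ b₁ c₀ c₁ z₀ z₁ x₀ x₁
      a₀' a₁' b₀' b₁' c₀' c₁' z₀' z₁' x₀' x₁' : ℝ → ℝ}
    (da₀ : ∀ θ ∈ Set.Ioo 0 Real.pi, HasDerivAt a₀ (a₀' θ) θ)
    (da₁ : ∀ θ ∈ Set.Ioo 0 Real.pi, HasDerivAt a₁ (a₁' θ) θ)
    (db₀ : ∀ θ ∈ Set.Ioo 0 Real.pi, HasDerivAt b₀ (b₀' θ) θ)
    (db₁ : ∀ θ ∈ Set.Ioo 0 Real.pi, HasDerivAt b₁ (b₁' θ) θ)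
    (dc₀ : ∀ θ ∈ Set.Ioo 0 Real.pi, HasDerivAt c₀ (c₀' θ) θ)
    (dc₁ : ∀ θ ∈ Set.Ioo 0 Real.pi, HasDerivAt c₁ (c₁' θ) θ)
    (dz₀ : ∀ θ ∈ Set.Ioo 0 Real.pi, HasDerivAt z₀ (z₀' θ) θ)
    (dz₁ : ∀ θ ∈ Set.Ioo 0 Real.pi, HasDerivAt z₁ (z₁' θ) θ)
    (dx₀ : ∀ θ ∈ Set.Ioo 0 Real.pi, HasDerivAt x₀ (x₀' θ) θ)
    (dx₁ : ∀ θ ∈ Set.Ioo 0 Real.pi, HasDerivAt x₁ (x₁' θ) θ)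
    (oa₀ : Ord l 0 a₀) (ob₀ : Ord l 0 b₀) (ox₀ : Ord l 0 x₀) (ox₁ : Ord l 0 x₁)
    (oa₀' : Ord l 1 a₀') (oa₁' : Ord l 1 a₁') (ob₀' : Ord l 1 b₀') (ob₁' : Ord l 1 b₁')
    (oc₁' : Ord l 1 c₁') (ox₀' : Ord l 1 x₀') (ox₁' : Ord l 1 x₁')
    (oa : Ord l 3 (fun θ => a₁ θ - a₀ θ)) (ob : Ord l 3 (fun θ => b₁ θ - b₀ θ))
    (ox : Ord l 3 (fun θ => x₁ θ - x₀ θ)) (oc : Ord l 3 (fun θ => c₁ θ - c₀ θ))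
    (oz₀ : Ord l n (fun θ => z₀' θ + x₀ θ * (c₀' θ + r * (a₀ θ * b₀' θ - b₀ θ * a₀' θ))))
    (oz₁ : Ord l n (fun θ => z₁' θ + x₁ θ * (c₁' θ + r * (a₁ θ * b₁' θ - b₁ θ * a₁' θ))))
    (hn0 : 0 ≤ n) (hn : n ≤ 4) (hz : Tendsto (fun θ => z₁ θ - z₀ θ) l (𝓝 0)) :
    Ord l (n + 2) (fun θ => z₁ θ - z₀ θ + x₀ θ * (c₁ θ - c₀ θ)
      + r * ((2 * x₀ θ - x₁ θ) * (a₀ θ * b₁ θ - a₁ θ * b₀ θ))) := by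
  have om : Ord l 3 (fun θ => a₀ θ * b₁ θ - a₁ θ * b₀ θ) :=
    ((oa₀.mul' hl ob (k := 3) (by norm_num)).sub (ob₀.mul' hl oa (by norm_num))).congr hl
      fun θ _ => by ring
  have ot₀ : Ord l 1 (fun θ => a₀ θ * b₀' θ - b₀ θ * a₀' θ) :=
    (oa₀.mul' hl ob₀' (by norm_num)).sub (ob₀.mul' hl oa₀' (by norm_num))
  have oδ' : Ord l 1 (fun θ => a₀ θ * (b₁' θ - b₀' θ) - b₀ θ * (a₁' θ - a₀' θ)) :=
    (oa₀.mul' hl (ob₁'.sub ob₀') (by norm_num)).sub (ob₀.mul' hl (oa₁'.sub oa₀') (by norm_num))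
  have o1 : Ord l 4 (fun θ => (a₁ θ - a₀ θ) * b₁' θ - (b₁ θ - b₀ θ) * a₁' θ) :=
    (oa.mul' hl ob₁' (by norm_num)).sub (ob.mul' hl oa₁' (by norm_num))
  have o2 : Ord l 4 (fun θ => a₀' θ * (b₁ θ - b₀ θ) - b₀' θ * (a₁ θ - a₀ θ)) :=
    (oa₀'.mul' hl ob (by norm_num)).sub (ob₀'.mul' hl oa (by norm_num))
  have o3 : Ord l 4 (fun θ => (x₁ θ - x₀ θ) * c₁' θ) := ox.mul' hl oc₁' (by norm_num)
  have o4 : Ord l 4 (fun θ => x₀' θ * (c₁ θ - c₀ θ)) := ox₀'.mul' hl oc (by norm_num)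
  have o5 : Ord l 4 (fun θ => (x₁ θ - x₀ θ) * (a₀ θ * (b₁' θ - b₀' θ) - b₀ θ * (a₁' θ - a₀' θ))) :=
    ox.mul' hl oδ' (by norm_num)
  have o6 : Ord l 4 (fun θ => x₁ θ * ((a₁ θ - a₀ θ) * b₁' θ - (b₁ θ - b₀ θ) * a₁' θ)) :=
    ox₁.mul' hl o1 (by norm_num)
  have o7 : Ord l 4 (fun θ => (x₁ θ - x₀ θ) * (a₀ θ * b₀' θ - b₀ θ * a₀' θ)) :=
    ox.mul' hl ot₀ (by norm_num)
  have o8 : Ord l 4 (fun θ => (2 * x₀' θ - x₁' θ) * (a₀ θ * b₁ θ - a₁ θ * b₀ θ)) :=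
    ((ox₀'.const_mul 2).sub ox₁').mul' hl om (by norm_num)
  have o9 : Ord l 4 (fun θ => (2 * x₀ θ - x₁ θ) * (a₀' θ * (b₁ θ - b₀ θ) - b₀' θ * (a₁ θ - a₀ θ))) :=
    ((ox₀.const_mul 2).sub ox₁).mul' hl o2 (by norm_num)
  -- The purpose of the twist: apart from the two horizontal forms, each term of the derivative
  -- pairs a difference of order 3 with a derivative of order 1. The plain difference would leave
  -- products of order 1 only.
  have hcub := (((((o5.const_mul (-2)).sub o6).sub o7).add o8).add o9).const_mul r
  have hder := (oz₁.sub oz₀).add (((o4.sub o3).add hcub).mono hl hn)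
  refine hder.integrate hl hn0 (fun θ hθ => ?_) ?_
  · have H := (((dz₁ θ hθ).sub (dz₀ θ hθ)).add ((dx₀ θ hθ).mul ((dc₁ θ hθ).sub (dc₀ θ hθ)))).add
      ((((dx₀ θ hθ).const_mul 2).sub (dx₁ θ hθ)).mul
        (((da₀ θ hθ).mul (db₁ θ hθ)).sub ((da₁ θ hθ).mul (db₀ θ hθ))) |>.const_mul r)
    refine HasDerivAt.congr_deriv H ?_
    simp only [Pi.sub_apply, Pi.mul_apply]
    ring
  · have h1 := (ox₀.mul' hl oc (k := 3) (by norm_num)).tendsto hl (by norm_num)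
    have h2 := ((((ox₀.const_mul 2).sub ox₁).mul' hl om (k := 3) (by norm_num)).const_mul r).tendsto hl
      (by norm_num)
    simpa using (hz.add h1).add h2

/-- The difference of two maps with the same potentials on the axis. -/
structure PairData (B : Horizon) (l : Filter ℝ) (j : ℤ) (Ψ₀ Ψ : ℝ → Target) : Prop where
  psi1 : Ord l 3 (fun θ => psiBar1 (Ψ θ) - psiBar1 (Ψ₀ θ))
  psi2 : Ord l 3 (fun θ => psiBar2 B (Ψ θ) - psiBar2 B (Ψ₀ θ))
  chi : Ord l 3 (fun θ => chiDiff B (Ψ₀ θ) (Ψ θ))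
  zeta1 : Ord l (4 + j) (fun θ => zetaDiff1 B (Ψ₀ θ) (Ψ θ))
  zeta2 : Ord l (4 - j) (fun θ => zetaDiff2 B (Ψ₀ θ) (Ψ θ))

/-- Equality on the axis allows every difference to be integrated from the pole. The ζ differences
gain two orders over Θ̄¹ and Θ̄², which gives the exponents 4 ± j. -/
theorem PoleData.pairData (hl : IsPole l) (hj : j = 1 ∨ j = -1)
    (hd₀ : ∀ θ ∈ Set.Ioo 0 Real.pi, DifferentiableAt ℝ Ψ₀ θ)
    (hd : ∀ θ ∈ Set.Ioo 0 Real.pi, DifferentiableAt ℝ Ψ θ)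
    (h₀ : PoleData B l j Ψ₀) (h : PoleData B l j Ψ) (hag : PotentialsAgree Ψ Ψ₀) :
    PairData B l j Ψ₀ Ψ := by
  have ag : ∀ i : Fin 8, 3 ≤ i → Tendsto (fun θ => Ψ θ i - Ψ₀ θ i) l (𝓝 0) := fun i hi =>
    (hag i hi).mono_left hl.le_poles
  have ag2 : ∀ i k : Fin 8, 3 ≤ i → 3 ≤ k → Tendsto (fun θ => (B.q * Ψ θ i + B.p * Ψ θ k)
      - (B.q * Ψ₀ θ i + B.p * Ψ₀ θ k)) l (𝓝 0) := fun i k hi hk => by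
    have := ((ag i hi).const_mul B.q).add ((ag k hk).const_mul B.p)
    simp only [mul_zero, add_zero] at this
    exact this.congr fun θ => by ring
  have da₀ := fun θ hθ => hasDerivAt_psiBar1 (hd₀ θ hθ)
  have da := fun θ hθ => hasDerivAt_psiBar1 (hd θ hθ)
  have db₀ := fun θ hθ => hasDerivAt_psiBar2 B (hd₀ θ hθ)
  have db := fun θ hθ => hasDerivAt_psiBar2 B (hd θ hθ)
  have dc₀ := fun θ hθ => (hasDerivAt_pi.1 (hd₀ θ hθ).hasDerivAt 5).const_mul B.p
  have dc := fun θ hθ => (hasDerivAt_pi.1 (hd θ hθ).hasDerivAt 5).const_mul B.p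
  have dz₀ := fun θ hθ => (hasDerivAt_zetaBar1 (hd₀ θ hθ)).const_mul B.p
  have dz := fun θ hθ => (hasDerivAt_zetaBar1 (hd θ hθ)).const_mul B.p
  have dy₀ := fun θ hθ => (hasDerivAt_zetaBar2 B (hd₀ θ hθ)).const_mul B.p
  have dy := fun θ hθ => (hasDerivAt_zetaBar2 B (hd θ hθ)).const_mul B.p
  have p1 : Ord l 3 (fun θ => psiBar1 (Ψ θ) - psiBar1 (Ψ₀ θ)) :=
    (h.dpsi1.sub h₀.dpsi1).integrate hl (by norm_num) (fun θ hθ => (da θ hθ).sub (da₀ θ hθ))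
      (ag 6 (by decide))
  have p2 : Ord l 3 (fun θ => psiBar2 B (Ψ θ) - psiBar2 B (Ψ₀ θ)) :=
    (h.dpsi2.sub h₀.dpsi2).integrate hl (by norm_num) (fun θ hθ => (db θ hθ).sub (db₀ θ hθ))
      (ag2 6 7 (by decide) (by decide))
  have hcd₀ : Ord l 1 (fun θ => B.p * deriv Ψ₀ θ 5) := (h₀.dchi.const_mul _).mono hl (by norm_num)
  have hcd : Ord l 1 (fun θ => B.p * deriv Ψ θ 5) := (h.dchi.const_mul _).mono hl (by norm_num)
  have hc0 : Tendsto (fun θ => B.p * Ψ θ 5 - B.p * Ψ₀ θ 5) l (𝓝 0) := by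
    have := (ag 5 (by decide)).const_mul B.p
    simp only [mul_zero] at this
    exact this.congr fun θ => by ring
  have c : Ord l 3 (fun θ => B.p * Ψ θ 5 - B.p * Ψ₀ θ 5) :=
    (hcd.sub hcd₀).integrate hl (by norm_num) (fun θ hθ => (dc θ hθ).sub (dc₀ θ hθ)) hc0
  refine ⟨p1, p2, ?_, ?_, ?_⟩
  · refine (c.add (((h₀.psi1.mul' hl p2 (k := 3) (by norm_num)).sub
      (h₀.psi2.mul' hl p1 (by norm_num))).const_mul rt3)).congr hl fun θ _ => ?_
    rw [chiDiff]; ring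
  · have := ord_twisted_difference hl (r := rt3 / 3) (n := 2 + j) da₀ da db₀ db dc₀ dc dz₀ dz da₀ da
      h₀.psi1 h₀.psi2 h₀.psi1 h.psi1 h₀.dpsi1 h.dpsi1 h₀.dpsi2 h.dpsi2 hcd h₀.dpsi1 h.dpsi1 p1 p2 p1 c
      ((h₀.Theta1.const_mul B.p).congr hl fun θ _ => p_mul_ThetaBar1 B _ _)
      ((h.Theta1.const_mul B.p).congr hl fun θ _ => p_mul_ThetaBar1 B _ _) (by omega) (by omega)
      (by
        have := (ag 3 le_rfl).const_mul B.p
        simp only [mul_zero] at this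
        exact this.congr fun θ => by simp only [zetaBar1]; ring)
    exact this.mono hl (by omega)
  · have := ord_twisted_difference hl (r := rt3 / 3) (n := 2 - j) da₀ da db₀ db dc₀ dc dy₀ dy db₀ db
      h₀.psi1 h₀.psi2 h₀.psi2 h.psi2 h₀.dpsi1 h.dpsi1 h₀.dpsi2 h.dpsi2 hcd h₀.dpsi2 h.dpsi2 p1 p2 p2 c
      ((h₀.Theta2.const_mul B.p).congr hl fun θ _ => p_mul_ThetaBar2 B _ _)
      ((h.Theta2.const_mul B.p).congr hl fun θ _ => p_mul_ThetaBar2 B _ _) (by omega) (by omega)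
      (by
        have := (ag2 3 4 le_rfl (by decide)).const_mul B.p
        simp only [mul_zero] at this
        exact this.congr fun θ => by simp only [zetaBar2]; ring)
    exact this.mono hl (by omega)

end PairOrders

/-! ### Cancellation of the boundary terms at the poles. -/

section BoundaryLimit

variable {l : Filter ℝ} {n j : ℤ} {B : Horizon} {Ψ Ψ₀ : ℝ → Target} {ξ : ℝ → ℝ}

/-- A continuous map is uniformly continuous along bounded families. -/
theorem tendsto_sub_of_bounded {α E F : Type*} [NormedAddCommGroup E] [ProperSpace E]
    [NormedAddCommGroup F] {l : Filter α} {f : E → F} (hf : Continuous f) {X Y : α → E}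
    (hY : Y =O[l] fun _ => (1 : ℝ)) (hXY : Tendsto (fun t => X t - Y t) l (𝓝 0)) :
    Tendsto (fun t => f (X t) - f (Y t)) l (𝓝 0) := by
  obtain ⟨C, hC⟩ := hY.bound
  have hu := (isCompact_closedBall (0 : E) (C + 1)).uniformContinuousOn_of_continuous hf.continuousOn
  rw [Metric.uniformContinuousOn_iff] at hu
  rw [Metric.tendsto_nhds]
  intro ε hε
  obtain ⟨δ, hδ, H⟩ := hu ε hε
  filter_upwards [hC, Metric.tendsto_nhds.1 hXY (min δ 1) (lt_min hδ one_pos)] with t h1 h2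
  rw [norm_one, mul_one] at h1
  rw [dist_zero_right] at h2 ⊢
  have h3 : ‖X t‖ ≤ C + 1 := by
    calc ‖X t‖ = ‖(X t - Y t) + Y t‖ := by rw [sub_add_cancel]
      _ ≤ ‖X t - Y t‖ + ‖Y t‖ := norm_add_le _ _
      _ ≤ C + 1 := by linarith [h2.le.trans (min_le_right δ 1)]
  have := H (X t) (by simpa using h3) (Y t) (by simpa using h1.trans (by linarith))
    (by rw [dist_eq_norm]; exact h2.trans_le (min_le_left _ _))
  rwa [dist_eq_norm] at this

theorem tendsto_mul_ord_zero {f g : ℝ → ℝ} (hf : Tendsto f l (𝓝 0)) (hg : Ord l 0 g) :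
    Tendsto (fun θ => f θ * g θ) l (𝓝 0) := by
  have := ((isLittleO_one_iff ℝ).2 hf).mul_isBigO (ord_zero_iff.1 hg)
  simp only [mul_one] at this
  exact (isLittleO_one_iff ℝ).1 this

theorem log_scaleS_div_sq (X₀ X₁ : Target) : Real.log ((scaleS X₁ / scaleS X₀) ^ 2) =
    (X₁ 1 + Real.log (Real.cosh (X₁ 2))) - (X₀ 1 + Real.log (Real.cosh (X₀ 2))) := by
  rw [Real.log_pow, Real.log_div (scaleS_pos _).ne' (scaleS_pos _).ne', scaleS, scaleS, Real.log_exp,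
    Real.log_exp]
  push_cast; ring

/-- The difference of the two unbounded coordinates. -/
def flatDiff (Ψ₀ Ψ : ℝ → Target) (θ : ℝ) : Target :=
  ![Ψ θ 0 - Ψ₀ θ 0, Ψ θ 1 - Ψ₀ θ 1, 0, 0, 0, 0, 0, 0]

/-- Each potential component of the relative position is a singular weight times a twisted
difference; the exponents add up to at least 1 in every case. Only U and V may keep a bounded,
possibly nonconvergent, difference. -/
theorem PoleData.tendsto_relPoint (hl : IsPole l) (hj : j = 1 ∨ j = -1)
    (h₀ : PoleData B l j Ψ₀) (h : PoleData B l j Ψ) (hp : PairData B l j Ψ₀ Ψ) :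
    Tendsto (fun θ => relPoint B (tilde Ψ₀ θ) (tilde Ψ θ) - flatDiff Ψ₀ Ψ θ) l (𝓝 0) := by
  have e6 : ∀ (Ψ : ℝ → Target) θ, psiBar1 (tilde Ψ θ) = psiBar1 (Ψ θ) := fun Ψ θ =>
    tilde_potential Ψ θ 6 (by decide)
  have e7 : ∀ (Ψ : ℝ → Target) θ, psiBar2 B (tilde Ψ θ) = psiBar2 B (Ψ θ) := fun Ψ θ => by
    simp only [psiBar2, tilde_potential Ψ θ 6 (by decide), tilde_potential Ψ θ 7 (by decide)]
  have e5 : ∀ θ, chiDiff B (tilde Ψ₀ θ) (tilde Ψ θ) = chiDiff B (Ψ₀ θ) (Ψ θ) := fun θ => by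
    simp only [chiDiff, e6, e7, tilde_potential _ θ 5 (by decide)]
  have e3 : ∀ θ, zetaDiff1 B (tilde Ψ₀ θ) (tilde Ψ θ) = zetaDiff1 B (Ψ₀ θ) (Ψ θ) := fun θ => by
    simp only [zetaDiff1, zetaBar1, e6, e7, tilde_potential _ θ 5 (by decide),
      tilde_potential _ θ 3 le_rfl]
  have e4 : ∀ θ, zetaDiff2 B (tilde Ψ₀ θ) (tilde Ψ θ) = zetaDiff2 B (Ψ₀ θ) (Ψ θ) := fun θ => by
    simp only [zetaDiff2, zetaBar2, e6, e7, tilde_potential _ θ 5 (by decide),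
      tilde_potential _ θ 3 le_rfl, tilde_potential _ θ 4 (by decide)]
  have hP := h₀.scaleP hl
  have hS := h₀.scaleS hl
  have hS' := h₀.scaleS_inv hl
  have hx := h₀.shear hl
  have hy := ((h.sinhW hl).sub ((((h.scaleS hl).mul hl hS').pow 2).mul' hl (h₀.sinhW hl)
    (k := 2) (by push_cast; omega))).tendsto hl (by norm_num)
  have ha := ((hP.mul hl hS').mul' hl hp.psi1 (k := 1) (by omega)).tendsto hl one_pos
  have hb := ((hP.mul hl hS).mul' hl (hp.psi2.sub (hx.mul' hl hp.psi1 (by omega))) (k := 1)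
    (by omega)).tendsto hl one_pos
  have hc := ((hP.pow 2).mul' hl hp.chi (k := 1) (by norm_num)).tendsto hl one_pos
  have hz := (((hP.pow 3).mul hl hS').mul' hl hp.zeta1 (k := 1) (by push_cast; omega)).tendsto hl
    one_pos
  have hw := (((hP.pow 3).mul hl hS).mul' hl (hp.zeta2.sub (hx.mul' hl hp.zeta1 (by omega)))
    (k := 1) (by push_cast; omega)).tendsto hl one_pos
  have hlc : ∀ {f : ℝ → ℝ}, Tendsto f l (𝓝 0) →
      Tendsto (fun θ => Real.log (Real.cosh (f θ))) l (𝓝 0) := fun hf => by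
    have hcont : ContinuousAt (fun x => Real.log (Real.cosh x)) 0 :=
      ContinuousAt.log (Real.continuous_cosh.continuousAt) (by simp)
    simpa [Function.comp_def] using hcont.tendsto.comp hf
  have hys : Tendsto (fun θ => Real.arsinh (Real.sinh (Ψ θ 2) - (MinSugra.scaleS (tilde Ψ θ) *
      (MinSugra.scaleS (tilde Ψ₀ θ))⁻¹) ^ 2 * Real.sinh (Ψ₀ θ 2))) l (𝓝 0) := by
    have := (Real.continuous_arsinh.tendsto 0).comp hy
    rw [Real.arsinh_zero] at this
    exact this
  have h1 := ((hlc (h.W.tendsto hl (by norm_num))).sub (hlc (h₀.W.tendsto hl (by norm_num)))).sub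
    (hlc hys)
  rw [tendsto_pi_nhds]
  intro i
  fin_cases i
  · refine tendsto_const_nhds.congr' (Eventually.of_forall fun θ => ?_)
    simp only [relPoint, iwasawa, flatDiff, tilde_zero]
    simp
  · simp only [sub_zero] at h1
    refine h1.congr fun θ => ?_
    simp only [relPoint, iwasawa, flatDiff, log_scaleS_div_sq]
    simp only [tilde_one, tilde_two, div_eq_mul_inv]
    simp
    ring
  · refine hys.congr fun θ => ?_
    simp only [relPoint, iwasawa, flatDiff, tilde_two, div_eq_mul_inv]
    simp
  · have := hz.div_const B.p
    simp only [zero_div] at this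
    refine this.congr fun θ => ?_
    simp only [relPoint, iwasawa, flatDiff, e3]
    simp
  · have := ((hw.div_const B.p).sub ((hz.div_const B.p).const_mul B.q)).div_const B.p
    simp only [zero_div, mul_zero, sub_zero] at this
    refine this.congr fun θ => ?_
    simp only [relPoint, iwasawa, flatDiff, e3, e4]
    simp
  · have := hc.div_const B.p
    simp only [zero_div] at this
    refine this.congr fun θ => ?_
    simp only [relPoint, iwasawa, flatDiff, e5]
    simp
  · refine ha.congr fun θ => ?_
    simp only [relPoint, iwasawa, flatDiff, e6]
    simp
  · have := (hb.sub (ha.const_mul B.q)).div_const B.p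
    simp only [zero_div, mul_zero, sub_zero] at this
    refine this.congr fun θ => ?_
    simp only [relPoint, iwasawa, flatDiff, e6, e7]
    simp

theorem Vs_sub (B : Horizon) (Ψ₀ Ψ : ℝ → Target) (θ : ℝ) :
    Vs B Ψ θ - Vs B Ψ₀ θ = Ψ θ 1 - Ψ₀ θ 1 := by simp only [Vs]; ring

theorem PoleData.flatDiff_bounded (hl : IsPole l) (h₀ : PoleData B l j Ψ₀) (h : PoleData B l j Ψ) :
    flatDiff Ψ₀ Ψ =O[l] fun _ => (1 : ℝ) := by
  rw [isBigO_pi]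
  intro i
  fin_cases i
  · exact ord_zero_iff.1 (h.U.sub h₀.U)
  · exact ord_zero_iff.1 ((h.Vs.sub h₀.Vs).congr hl fun θ _ => Vs_sub B Ψ₀ Ψ θ)
  all_goals exact isBigO_zero _ _

/-- Uniform continuity of the logarithm on bounded sets replaces the relative position by its
diagonal part, on which the logarithm is the identity in frame coordinates. -/
theorem tendsto_relCoord (hB : B.p ≠ 0) (hl : IsPole l) (hj : j = 1 ∨ j = -1)
    (h₀ : PoleData B l j Ψ₀) (h : PoleData B l j Ψ) (hp : PairData B l j Ψ₀ Ψ) :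
    Tendsto (fun θ => relCoord B (tilde Ψ₀) (tilde Ψ) θ - flatDiff Ψ₀ Ψ θ) l (𝓝 0) := by
  have hlog : Continuous (fun X : Target => relLog B 0 X) :=
    (contDiff_relLog B).continuous.comp (f := fun X : Target => ((0 : Target), X)) (by fun_prop)
  have hcont : Continuous (fun X : Target => frameCoord (relLog B 0 X)) :=
    frameCoordL.continuous.comp hlog
  refine (tendsto_sub_of_bounded hcont (h₀.flatDiff_bounded hl h)
    (PoleData.tendsto_relPoint hl hj h₀ h hp)).congr fun θ => ?_
  rw [relCoord, relLog_eq_relPoint hB (tilde Ψ₀ θ)]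
  congr 1
  exact frameCoord_relLog_flat B _ _

theorem trace_frameMat_mul (o α : Fin 8 → ℝ) :
    ((frameMat o + (frameMat o)ᵀ) * (frameMat α + (frameMat α)ᵀ)).trace =
      4 * (12 * (o 0 * α 0) + o 1 * α 1 + o 2 * α 2 + o 3 * α 3 + o 4 * α 4 + o 5 * α 5
        + o 6 * α 6 + o 7 * α 7) := by
  have h1 := trace_frameMat_sq (o + α)
  have h2 := trace_frameMat_sq o
  have h3 := trace_frameMat_sq α
  have hadd : frameMat (o + α) = frameMat o + frameMat α := map_add frameMatL o α
  have h4 : frameMat (o + α) + (frameMat (o + α))ᵀ =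
      (frameMat o + (frameMat o)ᵀ) + (frameMat α + (frameMat α)ᵀ) := by
    rw [hadd, transpose_add]; abel
  rw [h4] at h1
  generalize frameMat o + (frameMat o)ᵀ = M at *
  generalize frameMat α + (frameMat α)ᵀ = N at *
  simp only [add_mul, mul_add, trace_add, h2, h3, trace_mul_comm N M, Pi.add_apply] at h1
  linarith

/-- The boundary terms of the first variation cancel at the poles. -/
theorem tendsto_momentum_sub_boundaryTerm (hB : B.p ≠ 0) (hl : IsPole l) (hj : j = 1 ∨ j = -1)
    (hd₀ : ∀ θ ∈ Set.Ioo 0 Real.pi, DifferentiableAt ℝ Ψ₀ θ) (hξ : Ord l 0 ξ)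
    (h₀ : PoleData B l j Ψ₀) (h : PoleData B l j Ψ) (hp : PairData B l j Ψ₀ Ψ) :
    Tendsto (fun θ => momentum B ξ (tilde Ψ₀) (relCoord B (tilde Ψ₀) (tilde Ψ)) θ
      - (boundaryTerm B ξ Ψ θ - boundaryTerm B ξ Ψ₀ θ)) l (𝓝 0) := by
  have hT := tendsto_relCoord hB hl hj h₀ h hp
  set α := relCoord B (tilde Ψ₀) (tilde Ψ) with hα
  have hTi := tendsto_pi_nhds.1 hT
  have hb : ∀ i, Ord l 0 (fun θ => α θ i) := fun i => by
    have h1 : Ord l 0 (fun θ => flatDiff Ψ₀ Ψ θ i) :=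
      ord_zero_iff.2 (isBigO_pi.1 (h₀.flatDiff_bounded hl h) i)
    have h2 : Ord l 0 (fun θ => α θ i - flatDiff Ψ₀ Ψ θ i) := ord_zero_iff.2 ((hTi i).isBigO_one ℝ)
    exact (h2.add h1).congr hl fun θ _ => by ring
  have hcos := ord_zero_of_continuous hl Real.continuous_cos
  have hw : Ord l 0 (fun θ => 1 - 2 * (B.s : ℝ) * Real.cos (θ / 2) ^ 2) :=
    ord_zero_of_continuous hl (by fun_prop)
  -- The component along v times sin θ is this error plus 1 − 2s cos²(θ/2); likewise the component
  -- along u tends to half of cos θ. These are the coefficients of V_s and U in the boundary term.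
  have s1 : Ord l 2 (fun θ => Real.sin θ * deriv Ψ₀ θ 1 + 2 * (B.s : ℝ) * Real.cos (θ / 2) ^ 2
      + Real.sin θ * (Real.sinh (Ψ₀ θ 2) * ((Real.cosh (Ψ₀ θ 2))⁻¹ * deriv Ψ₀ θ 2))) :=
    (h₀.dV.mono hl (by norm_num)).add ((ord_sin hl).mul' hl ((h₀.sinhW hl).mul hl
      ((h₀.sechW hl).mul hl h₀.dW)) (by norm_num))
  have t0 := ((((ord_sin hl).mul' hl h₀.dU (k := 2) (by norm_num)).mul' hl (hb 0) (k := 2)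
    (by norm_num)).tendsto hl (by norm_num)).const_mul 12
  have t0' := (tendsto_mul_ord_zero (hTi 0) hcos).const_mul 6
  have t1 := (s1.mul' hl (hb 1) (k := 2) (by norm_num)).tendsto hl (by norm_num)
  have t1' := tendsto_mul_ord_zero (hTi 1) hw
  have t2 := ((h₀.coframe_two hd₀ hl).mul' hl (hb 2) (k := 2) (by norm_num)).tendsto hl (by norm_num)
  have ta : ∀ a : Fin 8, 3 ≤ a → Tendsto (fun θ => Real.sin θ *
      coframe B (tilde Ψ₀ θ) (deriv (tilde Ψ₀) θ) a * α θ a) l (𝓝 0) := fun a ha =>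
    (((ord_sin hl).mul hl (h₀.coframe_potential hd₀ hl hj a ha)).mul' hl (hb a) (k := 1)
      (by norm_num)).tendsto hl one_pos
  have tot := (((((((((t0.add t0').add t1).add t1').add t2).add (ta 3 le_rfl)).add
    (ta 4 (by decide))).add (ta 5 (by decide))).add (ta 6 (by decide))).add (ta 7 (by decide)))
  simp only [mul_zero, add_zero] at tot
  have fin := (tendsto_mul_ord_zero tot hξ).const_mul 2
  rw [mul_zero] at fin
  refine fin.congr' (hl.eventually_mem.mono fun θ hθ => ?_)
  have hs := Real.sin_pos_of_mem_Ioo hθ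
  have hch := Real.cosh_pos (Ψ₀ θ 2)
  have c0 : coframe B (tilde Ψ₀ θ) (deriv (tilde Ψ₀) θ) 0 =
      deriv Ψ₀ θ 0 + Real.cos θ / (2 * Real.sin θ) := by rw [coframe_tilde B hθ (hd₀ θ hθ)]; rfl
  have c1 : coframe B (tilde Ψ₀ θ) (deriv (tilde Ψ₀) θ) 1 = deriv Ψ₀ θ 1 + 1 / Real.sin θ
      + Real.sinh (Ψ₀ θ 2) / Real.cosh (Ψ₀ θ 2) * deriv Ψ₀ θ 2 := by
    rw [coframe_tilde B hθ (hd₀ θ hθ)]; rfl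
  have f0 : flatDiff Ψ₀ Ψ θ 0 = Ψ θ 0 - Ψ₀ θ 0 := rfl
  have f1 : flatDiff Ψ₀ Ψ θ 1 = Vs B Ψ θ - Vs B Ψ₀ θ := (Vs_sub B Ψ₀ Ψ θ).symm
  simp only [momentum, conn, trace_frameMat_mul, boundaryTerm, c0, c1, Pi.sub_apply, f0, f1]
  generalize coframe B (tilde Ψ₀ θ) (deriv (tilde Ψ₀) θ) = o
  field_simp
  ring

theorem tendsto_momentum_poles (hB : B.Admissible)
    (hd₀ : ∀ θ ∈ Set.Ioo 0 Real.pi, DifferentiableAt ℝ Ψ₀ θ)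
    (hd : ∀ θ ∈ Set.Ioo 0 Real.pi, DifferentiableAt ℝ Ψ θ) (hξ : ∀ l, IsPole l → Ord l 0 ξ)
    (h₀ : MapAsymptotics B Ψ₀) (h : MapAsymptotics B Ψ) (hag : PotentialsAgree Ψ Ψ₀) :
    Tendsto (fun θ => momentum B ξ (tilde Ψ₀) (relCoord B (tilde Ψ₀) (tilde Ψ)) θ
      - (boundaryTerm B ξ Ψ θ - boundaryTerm B ξ Ψ₀ θ)) poles (𝓝 0) := by
  have key : ∀ l, IsPole l → Tendsto (fun θ => momentum B ξ (tilde Ψ₀)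
      (relCoord B (tilde Ψ₀) (tilde Ψ)) θ - (boundaryTerm B ξ Ψ θ - boundaryTerm B ξ Ψ₀ θ)) l
      (𝓝 0) := fun l hl => by
    obtain ⟨j, hj, H⟩ := exists_poleData hB hl
    have d₀ := H Ψ₀ hd₀ h₀
    have d := H Ψ hd h
    exact tendsto_momentum_sub_boundaryTerm hB.p_pos.ne' hl hj hd₀ (hξ l hl) d₀ d
      (PoleData.pairData hl hj hd₀ hd d₀ d hag)
  exact (key _ (Or.inl rfl)).sup (key _ (Or.inr rfl))

end BoundaryLimit

/-! ### Variance over the sphere, and regularity of the weight. -/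

section Conclusion

variable {B : Horizon}

theorem relDist_continuousOn {Φ₀ Φ₁ : ℝ → Target} (h₀ : ContDiffOn ℝ ∞ Φ₀ (Set.Ioo 0 Real.pi))
    (h₁ : ContDiffOn ℝ ∞ Φ₁ (Set.Ioo 0 Real.pi)) :
    ContinuousOn (fun θ => relDist B (Φ₀ θ) (Φ₁ θ)) (Set.Ioo 0 Real.pi) := by
  intro θ hθ
  have hm := isOpen_Ioo.mem_nhds hθ
  have hA := (relLog_contDiffOn (B := B) h₀ h₁).contDiffAt hm
  exact ((trace_contDiffAt (hA.mul hA)).continuousAt.sqrt.div_const 2).continuousWithinAt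

theorem integrableOn_of_bound_sin {g : ℝ → ℝ} {M : ℝ} (hg : ContinuousOn g (Set.Ioo 0 Real.pi))
    (h : ∀ θ ∈ Set.Ioo 0 Real.pi, |g θ| * Real.sin θ ≤ M) :
    IntegrableOn (fun θ => g θ * Real.sin θ) (Set.Ioo 0 Real.pi) := by
  refine Integrable.of_bound ((hg.mul Real.continuous_sin.continuousOn).aestronglyMeasurable
    measurableSet_Ioo) M ((ae_restrict_mem measurableSet_Ioo).mono fun θ hθ => ?_)
  rw [Real.norm_eq_abs, abs_mul, abs_of_pos (Real.sin_pos_of_mem_Ioo hθ)]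
  exact h θ hθ

theorem integrable_volS3_of_bound {g : ℝ → ℝ} {M : ℝ} (hg : ContinuousOn g (Set.Ioo 0 Real.pi))
    (h : ∀ θ ∈ Set.Ioo 0 Real.pi, |g θ| * Real.sin θ ≤ M) :
    Integrable (fun x : ℝ × ℝ × ℝ => g x.1) volS3 :=
  integrable_volS3 (integrableOn_of_bound_sin hg h)

theorem isFiniteMeasure_volS3 : IsFiniteMeasure volS3 := by
  have h := integrable_volS3_of_bound (g := fun _ => (1 : ℝ)) (M := 1) continuousOn_const
    fun θ _ => by simpa using Real.sin_le_one θ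
  exact ((integrable_const_iff).1 h).resolve_left one_ne_zero

/-- A weighted pointwise bound controls the variance over the sphere. -/
theorem variance_volS3_le {d : ℝ → ℝ} {c K : ℝ} (hd : ContinuousOn d (Set.Ioo 0 Real.pi))
    (h : ∀ θ ∈ Set.Ioo 0 Real.pi, (d θ - c) ^ 2 * Real.sin θ ≤ K) :
    Integrable (fun x : ℝ × ℝ × ℝ => d x.1) volS3 ∧
    Integrable (fun x : ℝ × ℝ × ℝ => (d x.1 - ⨍ y, d y.1 ∂volS3) ^ 2) volS3 ∧
    ∫ x, (d x.1 - ⨍ y, d y.1 ∂volS3) ^ 2 ∂volS3 ≤ Real.pi ^ 3 * K := by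
  have := isFiniteMeasure_volS3
  have hpi := Real.pi_pos
  have i1 : Integrable (fun x : ℝ × ℝ × ℝ => d x.1) volS3 := by
    refine integrable_volS3_of_bound (M := K + 1 + |c|) hd fun θ hθ => ?_
    have hs := Real.sin_pos_of_mem_Ioo hθ
    have hs1 := Real.sin_le_one θ
    have h1 : |d θ| ≤ |d θ - c| + |c| := by
      calc |d θ| = |(d θ - c) + c| := by rw [sub_add_cancel]
        _ ≤ _ := abs_add_le _ _
    have h2 : |d θ - c| ≤ (d θ - c) ^ 2 + 1 := by
      rw [← sq_abs]; nlinarith [sq_nonneg (|d θ - c| - 1), abs_nonneg (d θ - c)]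
    have h3 : |d θ| * Real.sin θ ≤ ((d θ - c) ^ 2 + 1 + |c|) * Real.sin θ :=
      mul_le_mul_of_nonneg_right (by linarith) hs.le
    have h4 : (1 + |c|) * Real.sin θ ≤ 1 + |c| := mul_le_of_le_one_right (by positivity) hs1
    linarith [h θ hθ]
  have i2 : ∀ e, Integrable (fun x : ℝ × ℝ × ℝ => (d x.1 - e) ^ 2) volS3 := fun e => by
    refine integrable_volS3_of_bound (g := fun θ => (d θ - e) ^ 2) (M := 2 * K + 2 * (c - e) ^ 2)
      ((hd.sub continuousOn_const).pow 2) fun θ hθ => ?_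
    have hs := Real.sin_pos_of_mem_Ioo hθ
    have hs1 := Real.sin_le_one θ
    rw [abs_of_nonneg (sq_nonneg _)]
    have h3 : (d θ - e) ^ 2 * Real.sin θ ≤ (2 * (d θ - c) ^ 2 + 2 * (c - e) ^ 2) * Real.sin θ :=
      mul_le_mul_of_nonneg_right (by nlinarith [sq_nonneg ((d θ - c) - (c - e))]) hs.le
    have h4 : (2 * (c - e) ^ 2) * Real.sin θ ≤ 2 * (c - e) ^ 2 :=
      mul_le_of_le_one_right (by positivity) hs1
    linarith [h θ hθ]
  refine ⟨i1, i2 _, ?_⟩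
  set D := ⨍ y, d y.1 ∂volS3 with hD
  have i3 : Integrable (fun x : ℝ × ℝ × ℝ => d x.1 - D) volS3 := i1.sub (integrable_const D)
  have h0 : ∫ x : ℝ × ℝ × ℝ, (d x.1 - D) ∂volS3 = 0 :=
    integral_sub_average volS3 (fun x : ℝ × ℝ × ℝ => d x.1)
  -- The mean minimizes the quadratic deviation, so the average may be exchanged for the equatorial
  -- value that is available pointwise. The cross term integrates to zero.
  have h1 : ∫ x : ℝ × ℝ × ℝ, (d x.1 - D) ^ 2 ∂volS3 ≤ ∫ x : ℝ × ℝ × ℝ, (d x.1 - c) ^ 2 ∂volS3 := by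
    have h2 : ∫ x : ℝ × ℝ × ℝ, ((d x.1 - D) ^ 2 + 2 * (D - c) * (d x.1 - D)) ∂volS3 =
        ∫ x : ℝ × ℝ × ℝ, (d x.1 - D) ^ 2 ∂volS3 := by
      rw [integral_add (i2 D) (i3.const_mul _), integral_const_mul, h0, mul_zero, add_zero]
    rw [← h2]
    refine integral_mono ((i2 D).add (i3.const_mul _)) (i2 c) fun x => ?_
    show (d x.1 - D) ^ 2 + 2 * (D - c) * (d x.1 - D) ≤ (d x.1 - c) ^ 2
    nlinarith [sq_nonneg (D - c)]
  refine h1.trans ?_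
  rw [integral_volS3 (fun θ => (d θ - c) ^ 2)]
  have h3 : ∫ θ in Set.Ioo 0 Real.pi, (d θ - c) ^ 2 * Real.sin θ ≤
      ∫ θ in Set.Ioo 0 Real.pi, K := by
    refine setIntegral_mono_on (integrableOn_of_bound_sin (M := K)
      ((hd.sub continuousOn_const).pow 2) fun θ hθ => ?_) (by simp) measurableSet_Ioo h
    rw [abs_of_nonneg (sq_nonneg _)]
    exact h θ hθ
  rw [setIntegral_const, smul_eq_mul, Real.volume_real_Ioo_of_le hpi.le, sub_zero] at h3
  calc _ ≤ Real.pi ^ 2 * (Real.pi * K) := mul_le_mul_of_nonneg_left h3 (by positivity)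
    _ = _ := by ring

theorem cos_mem_Ioo {θ : ℝ} (hθ : θ ∈ Set.Ioo 0 Real.pi) : Real.cos θ ∈ Set.Ioo (-1 : ℝ) 1 := by
  have hs := Real.sin_pos_of_mem_Ioo hθ
  have := Real.sin_sq_add_cos_sq θ
  exact ⟨by nlinarith [Real.neg_one_le_cos θ], by nlinarith [Real.cos_le_one θ]⟩

theorem ord_zero_of_bound {l : Filter ℝ} (hl : IsPole l) {g : ℝ → ℝ} {M : ℝ}
    (h : ∀ θ ∈ Set.Ioo 0 Real.pi, ‖g θ‖ ≤ M) : Ord l 0 g :=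
  ord_zero_iff.2 (IsBigO.of_bound M (hl.eventually_mem.mono fun θ hθ => by simpa using h θ hθ))

/-- Properties of a weight that is a smooth positive function of `cos θ`. -/
theorem weight_properties {f ξ : ℝ → ℝ} (hf : ContDiffOn ℝ ∞ f (Set.Icc (-1) 1))
    (hξ : ∀ θ, ξ θ = f (Real.cos θ)) : ContDiffOn ℝ ∞ ξ (Set.Ioo 0 Real.pi) ∧
      (∀ l, IsPole l → Ord l 0 ξ) ∧ ∀ l, IsPole l → Ord l 0 (deriv ξ) := by
  have hξ' : ξ = fun θ => f (Real.cos θ) := funext hξ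
  have hmem : ∀ θ, Real.cos θ ∈ Set.Icc (-1 : ℝ) 1 := Real.cos_mem_Icc
  have hU : UniqueDiffOn ℝ (Set.Icc (-1 : ℝ) 1) := uniqueDiffOn_Icc (by norm_num)
  obtain ⟨M, hM⟩ := isCompact_Icc.exists_bound_of_continuousOn hf.continuousOn
  obtain ⟨M', hM'⟩ := isCompact_Icc.exists_bound_of_continuousOn
    (hf.continuousOn_derivWithin hU (by simp))
  refine ⟨?_, fun l hl => ord_zero_of_bound (M := M) hl fun θ _ => ?_, fun l hl =>
    ord_zero_of_bound (M := M') hl fun θ hθ => ?_⟩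
  · rw [hξ']
    exact hf.comp Real.contDiff_cos.contDiffOn fun θ _ => hmem θ
  · rw [hξ]; exact hM _ (hmem θ)
  · have hn : Set.Icc (-1 : ℝ) 1 ∈ 𝓝 (Real.cos θ) := Icc_mem_nhds (cos_mem_Ioo hθ).1 (cos_mem_Ioo hθ).2
    have hd : HasDerivAt f (derivWithin f (Set.Icc (-1) 1) (Real.cos θ)) (Real.cos θ) := by
      rw [derivWithin_of_mem_nhds hn]
      exact ((hf.contDiffAt hn).differentiableAt (by simp)).hasDerivAt
    have hc : HasDerivAt (fun θ => f (Real.cos θ)) _ θ := hd.comp θ (Real.hasDerivAt_cos θ)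
    rw [hξ', hc.deriv, norm_mul, norm_neg]
    exact (mul_le_of_le_one_right (norm_nonneg _) (Real.abs_sin_le_one θ)).trans (hM' _ (hmem θ))

end Conclusion

end

end MinSugra

theorem theorem6p1 (B : MinSugra.Horizon) (hB : B.Admissible)
    (Λ A : ℝ) (hΛ : 0 ≤ Λ) (hA : 0 < A)
    (f : ℝ → ℝ) (hf : ContDiffOn ℝ ∞ f (Set.Icc (-1) 1)) (hf_pos : ∀ x ∈ Set.Icc (-1 : ℝ) 1, 0 < f x)
    (ξ : ℝ → ℝ) (hξ : ∀ θ, ξ θ = f (Real.cos θ)) :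
    ∃ C : ℝ, 0 < C ∧ ∀ Ψ₀ Ψ : ℝ → MinSugra.Target,
      MinSugra.IsRenormalizedQuasiHarmonic B Λ A ξ Ψ₀ →
      ContDiffOn ℝ ∞ Ψ (Set.Ioo 0 Real.pi) →
      MinSugra.MapAsymptotics B Ψ →
      MinSugra.PotentialsAgree Ψ Ψ₀ →
      IntervalIntegrable (MinSugra.areaIntegrand B Λ A ξ Ψ) volume 0 Real.pi ∧
      IntervalIntegrable (MinSugra.areaIntegrand B Λ A ξ Ψ₀) volume 0 Real.pi ∧
      Integrable (MinSugra.mapDist B Ψ Ψ₀) MinSugra.volS3 ∧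
      Integrable (fun x => (MinSugra.mapDist B Ψ Ψ₀ x
        - ⨍ y, MinSugra.mapDist B Ψ Ψ₀ y ∂MinSugra.volS3) ^ 2) MinSugra.volS3 ∧
      C * ∫ x, (MinSugra.mapDist B Ψ Ψ₀ x
        - ⨍ y, MinSugra.mapDist B Ψ Ψ₀ y ∂MinSugra.volS3) ^ 2 ∂MinSugra.volS3
        ≤ MinSugra.areaFunctional B Λ A ξ Ψ - MinSugra.areaFunctional B Λ A ξ Ψ₀ ∧
      MinSugra.areaFunctional B Λ A ξ Ψ₀ ≤ MinSugra.areaFunctional B Λ A ξ Ψ := by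
  have hpi := Real.pi_pos
  have hp := hB.p_pos.ne'
  obtain ⟨x₀, hx₀, hmin⟩ := isCompact_Icc.exists_isMinOn (Set.nonempty_Icc.2 (by norm_num))
    hf.continuousOn
  obtain ⟨hξs, hξb, hξb'⟩ := MinSugra.weight_properties hf hξ
  have hm := hf_pos x₀ hx₀
  have hξm : ∀ θ ∈ Set.Ioo 0 Real.pi, f x₀ ≤ ξ θ := fun θ _ => by
    rw [hξ]; exact hmin (Real.cos_mem_Icc θ)
  have hξ0 : ∀ θ ∈ Set.Ioo 0 Real.pi, ξ θ ≠ 0 := fun θ hθ => (hm.trans_le (hξm θ hθ)).ne'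
  -- With m the minimum of the weight, the pointwise bound has constant 2π/m and integration over
  -- the sphere contributes π³.
  refine ⟨f x₀ / (2 * Real.pi ^ 4), by positivity, fun Ψ₀ Ψ hq hΨ hΨa hag => ?_⟩
  have hd : ∀ {g : ℝ → MinSugra.Target}, ContDiffOn ℝ ∞ g (Set.Ioo 0 Real.pi) →
      ∀ θ ∈ Set.Ioo 0 Real.pi, DifferentiableAt ℝ g θ :=
    fun hg θ hθ => (hg.contDiffAt (isOpen_Ioo.mem_nhds hθ)).differentiableAt (by simp)
  have ha₀ := hq.asymptotics.toMapAsymptotics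
  have i₁ := MinSugra.areaIntegrand_integrable (Λ := Λ) (A := A) hB hΨ hΨa hξs hξ0 hξb hξb'
  have i₀ := MinSugra.areaIntegrand_integrable (Λ := Λ) (A := A) hB hq.smooth ha₀ hξs hξ0 hξb hξb'
  have hbound := fun θ (hθ : θ ∈ Set.Ioo 0 Real.pi) => MinSugra.relDist_pointwise_bound hp hΛ hξs hm hξm
    hq.smooth hΨ hq.quasiHarmonic i₀ i₁
    (MinSugra.tendsto_momentum_poles hB (hd hq.smooth) (hd hΨ) hξb ha₀ hΨa hag) hθ
  set δ := MinSugra.areaFunctional B Λ A ξ Ψ - MinSugra.areaFunctional B Λ A ξ Ψ₀ with hδ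
  -- At the equator the left side of the pointwise bound vanishes, which is already the minimization
  -- statement.
  have hδ0 : 0 ≤ δ := by
    have := hbound (Real.pi / 2) ⟨by positivity, by linarith⟩
    rw [sub_self] at this
    simp only [ne_eq, OfNat.ofNat_ne_zero, not_false_eq_true, zero_pow, zero_mul, mul_zero] at this
    exact nonneg_of_mul_nonneg_right this (by positivity)
  have hdist : MinSugra.mapDist B Ψ Ψ₀ = fun x => MinSugra.relDist B (MinSugra.tilde Ψ₀ x.1) (MinSugra.tilde Ψ x.1) :=
    funext fun x => MinSugra.targetDist_eq hp _ _
  obtain ⟨j₁, j₂, j₃⟩ := MinSugra.variance_volS3_le (K := 2 * Real.pi * δ / f x₀)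
    (MinSugra.relDist_continuousOn (B := B) (MinSugra.tilde_contDiffOn hq.smooth) (MinSugra.tilde_contDiffOn hΨ))
    (fun θ hθ => by rw [le_div_iff₀ hm, mul_comm]; exact hbound θ hθ)
  rw [hdist]
  refine ⟨i₁, i₀, j₁, j₂, ?_, sub_nonneg.1 hδ0⟩
  calc _ ≤ f x₀ / (2 * Real.pi ^ 4) * (Real.pi ^ 3 * (2 * Real.pi * δ / f x₀)) :=
        mul_le_mul_of_nonneg_left j₃ (by positivity)
    _ = δ := by field_simp
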